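/- **Notation.** Functions are real- or complex-valued, $(x,y)\in\mathbb R^2$. For $\theta\in\mathbb R$, $J_x^\theta$ is the Fourier multiplier on $\mathcal S'(\mathbb R^2)$ with symbol $(1+\xi^2)^{\theta/2}$, where $(\xi,\mu)$ are the frequencies dual to $(x,y)$; $H^{s,0}$ is the space of $\phi\in L^2(\mathbb R^2)$ with $\|\phi\|_{H^{s,0}}=\|(1+\xi^2)^{s/2}\widehat\phi\|_{L^2}<\infty$. For $T>0$, $L^q_TL^r_{xy}=L^q((0,T);L^r(\mathbb R^2))$ and $L^\infty_TH^{s,0}=L^\infty((0,T);H^{s,0})$; a norm $\|J_x^\theta h\|_{L^q_TL^r_{xy}}$ is $+\infty$ if $J_x^\theta h$ is not a function in that space. Equations hold in the sense of distributions on $(0,T)\times\mathbb R^2$. **Proposition.** Let $s>2/3$. (i) For all $0<\varepsilon'<\varepsilon$ there is $C=C(s,\varepsilon,\varepsilon')$ such that for every $0<T<2$, every $u\in L^\infty_TH^{s,0}$ and every locally integrable $f$ on $(0,T)\times\mathbb R^2$ with $$(u_t+u_{xxx}+f_x)_x-u_{yy}=0 \qquad (*)$$ one has $$\|J_x^{s-\frac12-\varepsilon}u\|_{L^4_TL^4_{xy}}\le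 C\big(\|u\|_{L^\infty_TH^{s,0}}+\|J_x^{s-\varepsilon'}f\|_{L^4_TL^1_{xy}}\big).$$ (ii) For every $\varepsilon>0$ there is $q_0>2$ (depending on $s,\varepsilon$) such that for every $q\in(2,q_0)$ there is $C=C(s,\varepsilon,q)$ such that for all $T,u,f$ as in (i), with $(*)$, $$\|J_x^{s-\frac23-\varepsilon}u\|_{L^q_TL^\infty_{xy}}\le C\big(\|u\|_{L^\infty_TH^{s,0}}+\|J_x^{s}f\|_{L^q_TL^{4/3}_{xy}}\big).$$ (iii) For every $0<\varepsilon<s-\frac23$ there is $q_0>2$ (depending on $s,\varepsilon$) such that for every $q\in(2,q_0)$ there is $C=C(s,\varepsilon,q)$ such that for every $0<T<2$, every solution $u\in L^\infty_TH^{s,0}$ of the KP-I equation $(u_t+u_{xxx}+uu_x)_x-u_{yy}=0$, with $uu_x$ read as $\frac12(u^2)_x$, belongs to $L^q_TL^\infty_{xy}$ and satisfies $$\|J_x^{\varepsilon}u\|_{L^q_TL^\infty_{xy}}\le C\big(1+\|J_x^{s}u\|_{L^\infty_TL^2_{xy}}^2\big)\|J_x^{s}u\|_{L^\infty_TL^2_{xy}}.$$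 -/

import Mathlib

open MeasureTheory Set FourierTransform
open scoped SchwartzMap ENNReal NNReal ContDiff

namespace KP

noncomputable section

/-- The spatial plane `ℝ²`; the point `z` has coordinates `x = z 0` and `y = z 1`. Functions of time
and space are written `u : ℝ → Plane → ℂ`; real-valued functions are a special case. -/
abbrev Plane : Type := EuclideanSpace ℝ (Fin 2)

/-- Lebesgue measure on the space-time slab `(0, T) × ℝ²`. -/
def slabMeasure (T : ℝ) : Measure (ℝ × Plane) :=
  (volume.restrict (Ioo 0 T)).prod volume

/-- The mixed norm `‖g‖_{L^q_T L^r_{xy}}` over the time interval `(0, T)`. -/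
def mixedNorm (q r : ℝ≥0∞) (T : ℝ) (g : ℝ → Plane → ℂ) : ℝ≥0∞ :=
  eLpNorm (fun t => eLpNorm (g t) r volume) q (volume.restrict (Ioo 0 T))

/-- `g ∈ L^q_T L^r_{xy}`. -/
def MemMixed (q r : ℝ≥0∞) (T : ℝ) (g : ℝ → Plane → ℂ) : Prop :=
  AEStronglyMeasurable (Function.uncurry g) (slabMeasure T) ∧ mixedNorm q r T g < ⊤

/-- The symbol `(1 + ξ²)^{θ/2}` of `J_x^θ`. The Fourier transform of Mathlib has the phase
`e^{-2πi⟨z, ζ⟩}`, so the frequency variable dual to `x` is `ξ = 2π ζ₀`. -/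
def besselSymbol (θ : ℝ) (ζ : Plane) : ℝ :=
  (1 + (2 * Real.pi * ζ 0) ^ 2) ^ (θ / 2)

/-- The symbol is admissible for Mathlib's Fourier multipliers. -/
theorem besselSymbol_hasTemperateGrowth (θ : ℝ) :
    (fun ζ : Plane => (besselSymbol θ ζ : ℂ)).HasTemperateGrowth := by
  have h1 : (fun r : ℝ => (1 + ‖r‖ ^ 2) ^ (θ / 2)).HasTemperateGrowth :=
    Function.hasTemperateGrowth_one_add_norm_sq_rpow ℝ (θ / 2)
  have h2 : (fun ζ : Plane => 2 * Real.pi * ζ 0).HasTemperateGrowth :=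
    ((2 * Real.pi) • (EuclideanSpace.proj 0 : Plane →L[ℝ] ℝ)).hasTemperateGrowth
  have h3 := Complex.ofRealCLM.hasTemperateGrowth.comp (h1.comp h2)
  convert h3 using 2 with ζ
  simp [besselSymbol]

/-- The Bessel potential `J_x^θ` in the first variable, on tempered distributions of `ℝ²`. -/
def Jx (θ : ℝ) : 𝓢'(Plane, ℂ) →L[ℂ] 𝓢'(Plane, ℂ) :=
  TemperedDistribution.fourierMultiplierCLM ℂ (fun ζ : Plane => (besselSymbol θ ζ : ℂ))

/-- The tempered distribution `S` is given by integration against the function `h`. -/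
def Represents (S : 𝓢'(Plane, ℂ)) (h : Plane → ℂ) : Prop :=
  ∀ φ : 𝓢(Plane, ℂ), Integrable (fun z => h z * φ z) volume ∧ S φ = ∫ z, h z * φ z

/-- `J_x^θ h = g` on `(0, T) × ℝ²`: `g` is a measurable function and, for almost every `t`, the
tempered distribution `J_x^θ (h t)` is the function `g t`. -/
def IsJx (θ T : ℝ) (h g : ℝ → Plane → ℂ) : Prop :=
  AEStronglyMeasurable (Function.uncurry g) (slabMeasure T) ∧
    ∀ᵐ t ∂(volume.restrict (Ioo 0 T)),
      ∃ S : 𝓢'(Plane, ℂ), Represents S (h t) ∧ Represents (Jx θ S) (g t)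

/-- `‖J_x^θ h‖_{L^q_T L^r_{xy}}`, equal to `∞` when `J_x^θ h` is not a function. The function
`J_x^θ h` is unique up to null sets, so the infimum runs over one equivalence class. -/
def JxNorm (θ : ℝ) (q r : ℝ≥0∞) (T : ℝ) (h : ℝ → Plane → ℂ) : ℝ≥0∞ :=
  ⨅ (g : ℝ → Plane → ℂ) (_ : IsJx θ T h g), mixedNorm q r T g

/-- The norm `‖(1 + ξ²)^{s/2} ĥ‖_{L²}` of `H^{s,0}(ℝ²)`, equal to `∞` when `h` is not in `L²`. -/
def sobolevNorm (s : ℝ) (h : Plane → ℂ) : ℝ≥0∞ :=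
  ⨅ hh : MemLp h 2 volume,
    eLpNorm (fun ζ => (besselSymbol s ζ : ℂ) * (𝓕 (hh.toLp h) : Lp ℂ 2 (volume : Measure Plane)) ζ)
      2 volume

/-- `‖u‖_{L^∞_T H^{s,0}}`. -/
def linftySobolevNorm (s T : ℝ) (u : ℝ → Plane → ℂ) : ℝ≥0∞ :=
  eLpNorm (fun t => sobolevNorm s (u t)) ⊤ (volume.restrict (Ioo 0 T))

/-- `u ∈ L^∞_T H^{s,0}`. -/
def MemLinftySobolev (s T : ℝ) (u : ℝ → Plane → ℂ) : Prop :=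
  AEStronglyMeasurable (Function.uncurry u) (slabMeasure T) ∧ linftySobolevNorm s T u < ⊤

/-- Derivative in the direction `v` of a function on space-time. -/
def dirDeriv (v : ℝ × Plane) (φ : ℝ × Plane → ℂ) : ℝ × Plane → ℂ :=
  fun p => fderiv ℝ φ p v

/-- `∂_t`. -/
def dt : (ℝ × Plane → ℂ) → ℝ × Plane → ℂ := dirDeriv (1, 0)

/-- `∂_x`. -/
def dx : (ℝ × Plane → ℂ) → ℝ × Plane → ℂ := dirDeriv (0, EuclideanSpace.single 0 1)

/-- `∂_y`. -/
def dy : (ℝ × Plane → ℂ) → ℝ × Plane → ℂ := dirDeriv (0, EuclideanSpace.single 1 1)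

/-- `u` and `f` are locally integrable and `(u_t + u_xxx + f_x)_x - u_yy = 0` holds in the sense of
distributions on `(0, T) × ℝ²`. -/
def IsSolution (T : ℝ) (u f : ℝ → Plane → ℂ) : Prop :=
  LocallyIntegrableOn (Function.uncurry u) (Ioo 0 T ×ˢ univ) volume ∧
  LocallyIntegrableOn (Function.uncurry f) (Ioo 0 T ×ˢ univ) volume ∧
  ∀ φ : ℝ × Plane → ℂ, ContDiff ℝ ∞ φ → HasCompactSupport φ → tsupport φ ⊆ Ioo 0 T ×ˢ univ →
    ∫ p in Ioo 0 T ×ˢ univ,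
      (u p.1 p.2 * (dx (dt φ) p + dx (dx (dx (dx φ))) p - dy (dy φ) p)
        + f p.1 p.2 * dx (dx φ) p) = 0

/-- `u` solves the KP-I equation `(u_t + u_xxx + u u_x)_x - u_yy = 0` in the sense of distributions
on `(0, T) × ℝ²`, where `u u_x = (u² / 2)_x`. -/
def IsKPISolution (T : ℝ) (u : ℝ → Plane → ℂ) : Prop :=
  IsSolution T u (fun t z => u t z ^ 2 / 2)

end

end KP

namespace KP

/-! ### Oscillatory integrals with a cubic phase -/

/-! All estimates are made on one dyadic band |ξ| ~ 2^k of the x-frequency, with a small power of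
2^k left over for the summation.

Dispersion. The free evolution has symbol e^{itω}, ω = ξ³ + μ²/ξ. For fixed ξ the phase is quadratic
in μ, so integrating out μ gives a factor of size (|ξ|/|t|)^{1/2} and adds to the phase a term
linear in ξ, which is only a translation in x. What remains is a one-dimensional integral with cubic
phase, for which the second derivative test gives (2^k |t|)^{-1/2}. The kernel on a band is
therefore O(|t|^{-1}) without loss of derivatives. Interpolation with the trivial bound
2^{3k/2}|t|^{-1/2} turns this into 2^{3kν}|t|^{-1+ν}, which is integrable in time
(`band_dispersive`, `norm_fourier_prop_le`). A TT* argument through Schur's test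
(`lintegral_inner_rpow_le`) yields L^q_t L^∞ bounds for q equal to 2 or slightly larger. The sup
norm is a supremum over countably many L¹-normalised bumps; since the kernel bound is the same for
every pair of bumps, a measurable selection of the best bump at each time obeys the same estimate
(`lintegral_iSup_inner_rpow_le`).

Forcing. An L¹ forcing is handled by the dispersive bound itself and a singular convolution in time.
An L² forcing is handled by starting Duhamel's formula at a time t₀ within δ of t and averaging over
t₀: the free part pays δ^{-1/q}, the forcing gains δ^{1-1/q} (`exists_band_estimate`). For L^{4/3}
the forcing is cut at a height depending on t into an L¹ part gaining 2^{-k/3} and an L² part losing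
2^{k/3}; with δ = 2^{-4k/3} all contributions cost at most 2^{2k/3}, which is the 2/3 of (ii). For
(i), |V|⁴ ≤ |V|² sup|V|² combines the L^∞_t L² norm with the L²_t L^∞ bound for L¹ forcing; the
geometric mean of the two gives the exponent 1/2.

Nonlinear part. The product of two functions with frequencies below 2^{k-2} does not reach the band
k. Hence the band k sees v²/2 only through (v - L)(v + L)/2, where L is the part of v below 2^{k-2},
and the first factor is O(2^{-ks}) in L². This replaces a fractional Leibniz rule. With the L¹ bound
2^{-ks}U² one first controls the sum of the L⁴ norms of the pieces of u (`exists_nonlinear_four`);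
that bound makes the forcing O(2^{-ks}) in L^{4/3}, and the L^{4/3} estimate on bands gives (iii)
because s > 2/3 (`nonlinear_estimate`).

Duhamel's formula. The equation is only distributional and has to be divided by ξ. Against a test
function ψ supported away from ξ = 0, the numbers h_n(t) obtained by pairing u(t) with the Fourier
transform of ωⁿψ satisfy h_n' = i h_{n+1} + k_n weakly. On the support ω is bounded, so exponential
series solve this infinite system (`WeakSystem.duhamel`), and smooth cutoffs increasing to a band
carry the formula to the band (`IsSolution.bandDuhamel`). In this way only products of a function of
time and a function of space are ever used as test functions. -/

/-- The oscillating factor `e^{i(Xp + Yp³)}`. -/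
noncomputable def cubicPhase (X Y p : ℝ) : ℂ := Complex.exp (Complex.I * ((X * p + Y * p ^ 3 : ℝ) : ℂ))

theorem norm_cubicPhase (X Y p : ℝ) : ‖cubicPhase X Y p‖ = 1 := by
  rw [cubicPhase, mul_comm, Complex.norm_exp_ofReal_mul_I]

theorem continuous_cubicPhase (X Y : ℝ) : Continuous (cubicPhase X Y) := by
  unfold cubicPhase; fun_prop

theorem hasDerivAt_cubicPhase (X Y p : ℝ) :
    HasDerivAt (cubicPhase X Y)
      (Complex.I * ((X + 3 * Y * p ^ 2 : ℝ) : ℂ) * cubicPhase X Y p) p := by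
  have h1 : HasDerivAt (fun p : ℝ => X * p + Y * p ^ 3) (X + 3 * Y * p ^ 2) p := by
    refine HasDerivAt.congr_deriv
      (((hasDerivAt_id' p).const_mul X).fun_add ((hasDerivAt_pow 3 p).const_mul Y)) ?_
    norm_num; ring
  refine HasDerivAt.congr_deriv (h1.ofReal_comp.const_mul Complex.I).cexp ?_
  unfold cubicPhase; ring

theorem norm_integral_le_of_norm_cubicPhase {X Y a b : ℝ} (hab : a ≤ b) :
    ‖∫ p in a..b, cubicPhase X Y p‖ ≤ b - a := by
  have := intervalIntegral.norm_integral_le_of_norm_le_const (a := a) (b := b) (C := 1)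
    (f := cubicPhase X Y) (fun p _ => (norm_cubicPhase X Y p).le)
  rwa [one_mul, abs_of_nonneg (by linarith)] at this

/-- First derivative test: the phase has no stationary point in `[a, b]`. -/
theorem norm_integral_cubicPhase_le_of_deriv {X Y a b D : ℝ} (hY : 0 < Y) (ha : 0 ≤ a)
    (hab : a ≤ b) (hD : 0 < D)
    (h : (∀ p ∈ Icc a b, D ≤ X + 3 * Y * p ^ 2) ∨ (∀ p ∈ Icc a b, X + 3 * Y * p ^ 2 ≤ -D)) :
    ‖∫ p in a..b, cubicPhase X Y p‖ ≤ 4 / D := by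
  have habs : ∀ p ∈ Icc a b, D ≤ |X + 3 * Y * p ^ 2| := by
    intro p hp
    rcases h with h | h
    · exact (h p hp).trans (le_abs_self _)
    · have := h p hp
      exact le_trans (by linarith) (neg_le_abs _)
  have hne : ∀ p ∈ Icc a b, X + 3 * Y * p ^ 2 ≠ 0 := fun p hp h0 => by
    have := habs p hp; rw [h0, abs_zero] at this; linarith
  have hd : ∀ p ∈ Icc a b, HasDerivAt (fun p : ℝ => (X + 3 * Y * p ^ 2)⁻¹)
      (-(6 * Y * p) / (X + 3 * Y * p ^ 2) ^ 2) p := by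
    intro p hp
    have h1 : HasDerivAt (fun p : ℝ => X + 3 * Y * p ^ 2) (6 * Y * p) p := by
      refine HasDerivAt.congr_deriv (((hasDerivAt_pow 2 p).const_mul (3 * Y)).const_add X) ?_
      norm_num; ring
    exact h1.inv (hne p hp)
  have hcont : ContinuousOn (fun p : ℝ => -(6 * Y * p) / (X + 3 * Y * p ^ 2) ^ 2) (uIcc a b) := by
    rw [uIcc_of_le hab]
    exact ContinuousOn.div (by fun_prop) (by fun_prop) (fun p hp => pow_ne_zero _ (hne p hp))
  have hfun : ∫ p in a..b, (-(6 * Y * p) / (X + 3 * Y * p ^ 2) ^ 2)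
      = (X + 3 * Y * b ^ 2)⁻¹ - (X + 3 * Y * a ^ 2)⁻¹ := by
    refine intervalIntegral.integral_eq_sub_of_hasDerivAt (f := fun p : ℝ => (X + 3 * Y * p ^ 2)⁻¹)
      (fun p hp => hd p ?_) hcont.intervalIntegrable
    rwa [uIcc_of_le hab] at hp
  have hparts := intervalIntegral.integral_mul_deriv_eq_deriv_mul
    (u := fun p : ℝ => (((X + 3 * Y * p ^ 2)⁻¹ : ℝ) : ℂ))
    (u' := fun p : ℝ => ((-(6 * Y * p) / (X + 3 * Y * p ^ 2) ^ 2 : ℝ) : ℂ))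
    (v := fun p => -Complex.I * cubicPhase X Y p)
    (v' := fun p : ℝ => ((X + 3 * Y * p ^ 2 : ℝ) : ℂ) * cubicPhase X Y p) (a := a) (b := b)
    (fun p hp => (hd p (by rwa [uIcc_of_le hab] at hp)).ofReal_comp)
    (fun p _ => by
      refine HasDerivAt.congr_deriv ((hasDerivAt_cubicPhase X Y p).const_mul (-Complex.I)) ?_
      rw [← mul_assoc, ← mul_assoc, neg_mul, Complex.I_mul_I, neg_neg, one_mul])
    (by
      apply ContinuousOn.intervalIntegrable
      exact Complex.continuous_ofReal.comp_continuousOn hcont)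
    (by
      apply Continuous.intervalIntegrable
      have := continuous_cubicPhase X Y
      fun_prop)
  have hleft : ∫ p in a..b, cubicPhase X Y p = ∫ p in a..b, (((X + 3 * Y * p ^ 2)⁻¹ : ℝ) : ℂ) *
      (((X + 3 * Y * p ^ 2 : ℝ) : ℂ) * cubicPhase X Y p) := by
    refine intervalIntegral.integral_congr (fun p hp => ?_)
    rw [uIcc_of_le hab] at hp
    rw [← mul_assoc, ← Complex.ofReal_mul, inv_mul_cancel₀ (hne p hp), Complex.ofReal_one, one_mul]
  rw [hleft, hparts]
  have hbd : ∀ p ∈ Icc a b, |(X + 3 * Y * p ^ 2)⁻¹| ≤ 1 / D := fun p hp => by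
    rw [abs_inv, ← one_div]
    exact one_div_le_one_div_of_le hD (habs p hp)
  have hterm : ∀ p ∈ Icc a b, ‖(((X + 3 * Y * p ^ 2)⁻¹ : ℝ) : ℂ) *
      (-Complex.I * cubicPhase X Y p)‖ ≤ 1 / D := fun p hp => by
    rw [norm_mul, norm_mul, norm_cubicPhase, norm_neg, Complex.norm_I, Complex.norm_real]
    simpa using hbd p hp
  -- The derivative of 1/φ' has a constant sign because p ≥ 0 and Y > 0, so the integral of its
  -- absolute value is a difference of two endpoint values, each at most 1/D.
  have hInt : ‖∫ p in a..b, ((-(6 * Y * p) / (X + 3 * Y * p ^ 2) ^ 2 : ℝ) : ℂ) *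
      (-Complex.I * cubicPhase X Y p)‖ ≤ 2 / D := by
    have h1 : ‖∫ p in a..b, ((-(6 * Y * p) / (X + 3 * Y * p ^ 2) ^ 2 : ℝ) : ℂ) *
      (-Complex.I * cubicPhase X Y p)‖ ≤ ∫ p in a..b, -(-(6 * Y * p) / (X + 3 * Y * p ^ 2) ^ 2) := by
      refine intervalIntegral.norm_integral_le_of_norm_le hab (ae_of_all _ fun p hp => ?_)
        hcont.neg.intervalIntegrable
      rw [norm_mul, norm_mul, norm_cubicPhase, norm_neg, Complex.norm_I, Complex.norm_real,
        mul_one, mul_one, Real.norm_eq_abs, neg_div, abs_neg, neg_neg, abs_of_nonneg]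
      have : 0 ≤ p := ha.trans hp.1.le
      positivity
    rw [intervalIntegral.integral_neg, hfun] at h1
    have ha' := abs_le.1 (hbd a (left_mem_Icc.2 hab))
    have hb' := abs_le.1 (hbd b (right_mem_Icc.2 hab))
    refine h1.trans ?_
    have : 2 / D = 1 / D + 1 / D := by ring
    linarith
  calc _ ≤ 1 / D + 1 / D + 2 / D :=
        (norm_sub_le _ _).trans (add_le_add ((norm_sub_le _ _).trans
          (add_le_add (hterm b (right_mem_Icc.2 hab)) (hterm a (left_mem_Icc.2 hab)))) hInt)
    _ = 4 / D := by ring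

/-- The derivative of the phase increases on [a, b] with slope at least 6YA. If it has no zero
there, the endpoint nearest to one plays the role of the stationary point, so the caller needs no
case distinction. -/
theorem exists_stationary {X Y A a b : ℝ} (hY : 0 < Y) (hAa : A ≤ a) (hab : a ≤ b) :
    ∃ c ∈ Icc a b, (∀ p ∈ Icc a b, c < p → 6 * Y * A * (p - c) ≤ X + 3 * Y * p ^ 2) ∧
      (∀ p ∈ Icc a b, p < c → X + 3 * Y * p ^ 2 ≤ -(6 * Y * A * (c - p))) := by
  have key : ∀ p q : ℝ, A ≤ p → p ≤ q →
      X + 3 * Y * p ^ 2 + 6 * Y * A * (q - p) ≤ X + 3 * Y * q ^ 2 := by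
    intro p q hp hpq
    nlinarith [mul_nonneg hY.le (mul_nonneg (sub_nonneg.2 hpq) (sub_nonneg.2 hp)),
      mul_nonneg hY.le (mul_nonneg (sub_nonneg.2 hpq) (sub_nonneg.2 (hp.trans hpq)))]
  by_cases h1 : 0 ≤ X + 3 * Y * a ^ 2
  · refine ⟨a, left_mem_Icc.2 hab, fun p hp _ => ?_, fun p hp h => absurd hp.1 (not_le.2 h)⟩
    have := key a p hAa hp.1; linarith
  by_cases h2 : X + 3 * Y * b ^ 2 ≤ 0
  · refine ⟨b, right_mem_Icc.2 hab, fun p hp h => absurd hp.2 (not_le.2 h), fun p hp _ => ?_⟩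
    have := key p b (hAa.trans hp.1) hp.2; linarith
  obtain ⟨c, hc, hc0⟩ := intermediate_value_Icc hab
    (f := fun p : ℝ => X + 3 * Y * p ^ 2) (by fun_prop)
    (⟨(not_le.1 h1).le, (not_le.1 h2).le⟩ : (0 : ℝ) ∈ Icc _ _)
  simp only at hc0
  refine ⟨c, hc, fun p hp h => ?_, fun p hp h => ?_⟩
  · have := key c p (hAa.trans hc.1) h.le; linarith
  · have := key p c (hAa.trans hp.1) h.le; linarith

/-- Second derivative test for a cubic phase away from the origin. -/
theorem norm_integral_cubicPhase_le_of_pos {X Y A a b : ℝ} (hY : 0 < Y) (hA : 0 < A) (hAa : A ≤ a)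
    (hab : a ≤ b) : ‖∫ p in a..b, cubicPhase X Y p‖ ≤ 10 / √(Y * A) := by
  obtain ⟨c, hc, hr, hl⟩ := exists_stationary (X := X) hY hAa hab
  set S := √(Y * A) with hS
  have hSpos : 0 < S := Real.sqrt_pos.2 (by positivity)
  have hS2 : S * S = Y * A := Real.mul_self_sqrt (by positivity)
  -- This radius balances the two bounds: the trivial one gives 2h near c, and outside the
  -- derivative is at least 6YAh = 6S, of the order of 1/h.
  set h := 1 / S with hh
  have hpos : 0 < h := by positivity
  have hD : 6 * Y * A * h = 6 * S := by
    rw [hh, mul_assoc 6, ← hS2]; field_simp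
  set c₁ := max a (c - h)
  set c₂ := min b (c + h)
  have h1 : a ≤ c₁ := le_max_left _ _
  have h2 : c₂ ≤ b := min_le_left _ _
  have h12 : c₁ ≤ c₂ := max_le (le_min hab (by linarith [hc.1])) (le_min (by linarith [hc.2]) (by linarith))
  have hlen : c₂ - c₁ ≤ 2 * h := by
    have := min_le_right b (c + h)
    have := le_max_right a (c - h)
    linarith
  have hInt : ∀ x y, IntervalIntegrable (cubicPhase X Y) volume x y :=
    fun x y => (continuous_cubicPhase X Y).intervalIntegrable x y
  have e1 : ‖∫ p in a..c₁, cubicPhase X Y p‖ ≤ 4 / (6 * S) := by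
    by_cases hca : a < c - h
    · have hc1 : c₁ = c - h := max_eq_right hca.le
      refine norm_integral_cubicPhase_le_of_deriv hY (hA.le.trans hAa) h1 (by positivity) (Or.inr ?_)
      intro p hp
      rw [hc1] at hp
      have := hl p ⟨hp.1, by linarith [hp.2, hc.2]⟩ (by linarith [hp.2])
      have h3 : 6 * Y * A * h ≤ 6 * Y * A * (c - p) :=
        mul_le_mul_of_nonneg_left (by linarith [hp.2]) (by positivity)
      linarith
    · have hc1 : c₁ = a := max_eq_left (not_lt.1 hca)
      rw [hc1, intervalIntegral.integral_same, norm_zero]; positivity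
  have e3 : ‖∫ p in c₂..b, cubicPhase X Y p‖ ≤ 4 / (6 * S) := by
    by_cases hcb : c + h < b
    · have hc2 : c₂ = c + h := min_eq_right hcb.le
      refine norm_integral_cubicPhase_le_of_deriv hY ((hA.le.trans hAa).trans (h1.trans h12)) h2
        (by positivity) (Or.inl ?_)
      intro p hp
      rw [hc2] at hp
      have := hr p ⟨by linarith [hp.1, hc.1], hp.2⟩ (by linarith [hp.1])
      have h3 : 6 * Y * A * h ≤ 6 * Y * A * (p - c) :=
        mul_le_mul_of_nonneg_left (by linarith [hp.1]) (by positivity)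
      linarith
    · have hc2 : c₂ = b := min_eq_left (not_lt.1 hcb)
      rw [hc2, intervalIntegral.integral_same, norm_zero]; positivity
  have e2 : ‖∫ p in c₁..c₂, cubicPhase X Y p‖ ≤ 2 * h :=
    (norm_integral_le_of_norm_cubicPhase h12).trans hlen
  rw [← intervalIntegral.integral_add_adjacent_intervals (hInt a c₁) (hInt c₁ b),
    ← intervalIntegral.integral_add_adjacent_intervals (hInt c₁ c₂) (hInt c₂ b)]
  calc _ ≤ 4 / (6 * S) + (2 * h + 4 / (6 * S)) :=
        (norm_add_le _ _).trans (add_le_add e1 ((norm_add_le _ _).trans (add_le_add e2 e3)))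
    _ ≤ 10 / S := by
      rw [hh]
      have : 4 / (6 * S) = (2 / 3) * (1 / S) := by field_simp; norm_num
      rw [this]
      have : 10 / S = 10 * (1 / S) := by ring
      rw [this]
      have : 0 < 1 / S := hpos
      linarith

theorem conj_cubicPhase (X Y p : ℝ) :
    (starRingEnd ℂ) (cubicPhase X Y p) = cubicPhase (-X) (-Y) p := by
  rw [cubicPhase, ← Complex.exp_conj, map_mul, Complex.conj_I, Complex.conj_ofReal, cubicPhase]
  push_cast; ring_nf

/-- Complex conjugation flips the signs of X and Y, which reduces Y < 0 to Y > 0. -/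
theorem norm_integral_cubicPhase_le {X Y A a b : ℝ} (hY : Y ≠ 0) (hA : 0 < A) (hAa : A ≤ a)
    (hab : a ≤ b) : ‖∫ p in a..b, cubicPhase X Y p‖ ≤ 10 / √(|Y| * A) := by
  rcases lt_or_gt_of_ne hY with h | h
  · have := norm_integral_cubicPhase_le_of_pos (X := -X) (neg_pos.2 h) hA hAa hab
    rw [abs_of_neg h]
    rw [← Complex.norm_conj, ← intervalIntegral.intervalIntegral_conj]
    simpa only [conj_cubicPhase] using this
  · rw [abs_of_pos h]
    exact norm_integral_cubicPhase_le_of_pos h hA hAa hab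

/-- The second derivative test with a differentiable amplitude. -/
theorem norm_integral_amplitude_le {X Y A B M : ℝ} {α α' : ℝ → ℂ} (hY : Y ≠ 0) (hA : 0 < A)
    (hAB : A ≤ B) (hB : B ≤ 2 * A) (hα : ∀ p ∈ Icc A B, HasDerivAt α (α' p) p)
    (hα' : ContinuousOn α' (Icc A B)) (hM : ‖α B‖ ≤ M) (hM' : ∀ p ∈ Icc A B, ‖α' p‖ ≤ M / A) :
    ‖∫ p in A..B, α p * cubicPhase X Y p‖ ≤ 20 * M / √(|Y| * A) := by
  -- Integration by parts against the primitive F, which the second derivative test bounds uniformly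
  -- in its upper limit. The term with α' costs M/A over a length of at most A, the same as the
  -- boundary term.
  set F : ℝ → ℂ := fun x => ∫ p in A..x, cubicPhase X Y p
  have hF : ∀ x, HasDerivAt F (cubicPhase X Y x) x := fun x =>
    intervalIntegral.integral_hasDerivAt_right ((continuous_cubicPhase X Y).intervalIntegrable _ _)
      (continuous_cubicPhase X Y).stronglyMeasurable.stronglyMeasurableAtFilter
      (continuous_cubicPhase X Y).continuousAt
  have hFb : ∀ x ∈ Icc A B, ‖F x‖ ≤ 10 / √(|Y| * A) := fun x hx =>
    norm_integral_cubicPhase_le hY hA le_rfl hx.1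
  have hM0 : 0 ≤ M := (norm_nonneg _).trans hM
  rw [intervalIntegral.integral_mul_deriv_eq_deriv_mul (u := α) (u' := α') (v := F)
    (fun p hp => hα p (by rwa [uIcc_of_le hAB] at hp)) (fun p _ => hF p)
    (ContinuousOn.intervalIntegrable (by rwa [uIcc_of_le hAB]))
    ((continuous_cubicPhase X Y).intervalIntegrable _ _)]
  have hFA : F A = 0 := intervalIntegral.integral_same
  rw [hFA, mul_zero, sub_zero]
  have h1 : ‖α B * F B‖ ≤ M * (10 / √(|Y| * A)) := by
    rw [norm_mul]
    exact mul_le_mul hM (hFb B (right_mem_Icc.2 hAB)) (norm_nonneg _) hM0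
  have h2 : ‖∫ p in A..B, α' p * F p‖ ≤ (M / A * (10 / √(|Y| * A))) * |B - A| := by
    refine intervalIntegral.norm_integral_le_of_norm_le_const (fun p hp => ?_)
    rw [uIoc_of_le hAB] at hp
    have hp' : p ∈ Icc A B := ⟨hp.1.le, hp.2⟩
    rw [norm_mul]
    exact mul_le_mul (hM' p hp') (hFb p hp') (norm_nonneg _) (by positivity)
  have h3 : (M / A * (10 / √(|Y| * A))) * |B - A| ≤ M * (10 / √(|Y| * A)) := by
    rw [abs_of_nonneg (sub_nonneg.2 hAB)]
    calc (M / A * (10 / √(|Y| * A))) * (B - A) ≤ (M / A * (10 / √(|Y| * A))) * A :=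
          mul_le_mul_of_nonneg_left (by linarith) (by positivity)
      _ = M * (10 / √(|Y| * A)) := by rw [div_mul_eq_mul_div, div_mul_cancel₀ _ hA.ne']
  calc _ ≤ M * (10 / √(|Y| * A)) + M * (10 / √(|Y| * A)) :=
        (norm_sub_le _ _).trans (add_le_add h1 (h2.trans h3))
    _ = _ := by ring

/-! ### The dispersive estimate -/

theorem measurePreserving_coords :
    MeasurePreserving (fun ζ : Plane => (ζ 0, ζ 1)) volume (volume : Measure (ℝ × ℝ)) :=
  (volume_preserving_finTwoArrow ℝ).comp
    (EuclideanSpace.volume_preserving_symm_measurableEquiv_toLp (Fin 2))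

theorem measurableEmbedding_coords : MeasurableEmbedding (fun ζ : Plane => (ζ 0, ζ 1)) :=
  ((MeasurableEquiv.toLp 2 (Fin 2 → ℝ)).symm.trans MeasurableEquiv.finTwoArrow).measurableEmbedding

theorem measurable_coord (i : Fin 2) : Measurable (fun ζ : Plane => ζ i) :=
  (EuclideanSpace.proj i : Plane →L[ℝ] ℝ).measurable

theorem continuous_coord (i : Fin 2) : Continuous (fun ζ : Plane => ζ i) :=
  (EuclideanSpace.proj i : Plane →L[ℝ] ℝ).continuous

theorem integrable_coords {F : ℝ × ℝ → ℂ} :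
    Integrable (fun ζ : Plane => F (ζ 0, ζ 1)) ↔ Integrable F :=
  measurePreserving_coords.integrable_comp_emb measurableEmbedding_coords (g := F)

theorem integral_coords {F : ℝ × ℝ → ℂ} (hF : Integrable F) :
    ∫ ζ : Plane, F (ζ 0, ζ 1) = ∫ p, ∫ r, F (p, r) := by
  rw [measurePreserving_coords.integral_comp measurableEmbedding_coords F]
  exact integral_prod F hF

theorem inner_plane (v w : Plane) : inner ℝ v w = v 0 * w 0 + v 1 * w 1 := by
  rw [PiLp.inner_apply, Fin.sum_univ_two]
  simp [mul_comm]

/-! ### The dispersion relation and integration over the second frequency. -/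

/-- The dispersion relation `ξ³ + μ²/ξ` in the variables `ξ = 2πζ₀`, `μ = 2πζ₁`. -/
noncomputable def disp (ζ : Plane) : ℝ := (2 * Real.pi * ζ 0) ^ 3 + 2 * Real.pi * ζ 1 ^ 2 / ζ 0

theorem measurable_disp : Measurable disp := by
  have h0 := measurable_coord 0
  have h1 := measurable_coord 1
  unfold disp; fun_prop

/-- The symbol `e^{itω}` of the free evolution. -/
noncomputable def prop (t : ℝ) (ζ : Plane) : ℂ := Complex.exp (((t * disp ζ : ℝ) : ℂ) * Complex.I)

theorem norm_prop (t : ℝ) (ζ : Plane) : ‖prop t ζ‖ = 1 := Complex.norm_exp_ofReal_mul_I _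

theorem measurable_prop (t : ℝ) : Measurable (prop t) := by
  have := measurable_disp
  unfold prop; fun_prop

theorem prop_add (t t' : ℝ) (ζ : Plane) : prop (t + t') ζ = prop t ζ * prop t' ζ := by
  rw [prop, prop, prop, ← Complex.exp_add]; congr 1; push_cast; ring

/-- The phase and modulus factor produced by integrating out the second frequency. -/
noncomputable def gaussFactor (t p : ℝ) : ℂ := (Complex.I * p / (2 * t)) ^ ((1 / 2 : ℝ) : ℂ)

theorem norm_gaussFactor (t p : ℝ) : ‖gaussFactor t p‖ = (|p| / (2 * |t|)) ^ (1 / 2 : ℝ) := by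
  rw [gaussFactor, Complex.norm_cpow_real]
  congr 1
  simp

/-- The complex parameter of the regularised Gaussian. -/
noncomputable def gaussParam (σ t p : ℝ) : ℂ := σ - Complex.I * (2 * Real.pi * t / p : ℝ)

theorem gaussParam_re (σ t p : ℝ) : (gaussParam σ t p).re = σ := by simp [gaussParam]
theorem gaussParam_im (σ t p : ℝ) : (gaussParam σ t p).im = -(2 * Real.pi * t / p) := by
  simp [gaussParam]

theorem norm_gaussParam_ge (σ t p : ℝ) : 2 * Real.pi * |t| / |p| ≤ ‖gaussParam σ t p‖ := by
  have := Complex.abs_im_le_norm (gaussParam σ t p)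
  rw [gaussParam_im, abs_neg, abs_div, abs_mul, abs_of_pos (by positivity : 0 < 2 * Real.pi)] at this
  exact this

/-- The regularised inner integral. -/
noncomputable def gaussInner (σ t p y : ℝ) : ℂ :=
  (Real.pi / gaussParam σ t p) ^ ((1 / 2 : ℝ) : ℂ) *
    Complex.exp (-(2 * Real.pi * y : ℝ) ^ 2 / (4 * gaussParam σ t p))

theorem integral_gaussInner {σ : ℝ} (hσ : 0 < σ) (t p y : ℝ) :
    ∫ r : ℝ, Complex.exp (Complex.I * (2 * Real.pi * y : ℝ) * r) *
      Complex.exp (-gaussParam σ t p * r ^ 2) = gaussInner σ t p y := by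
  rw [fourierIntegral_gaussian (by rwa [gaussParam_re]), gaussInner]
  norm_num

/-- The exponent has nonpositive real part because the Gaussian parameter has real part σ ≥ 0, and
the modulus of the parameter is at least that of its imaginary part. The bound does not involve σ
and serves as the majorant as σ → 0. -/
theorem norm_gaussInner_le {σ : ℝ} (hσ : 0 ≤ σ) {t p : ℝ} (ht : t ≠ 0) (hp : p ≠ 0) (y : ℝ) :
    ‖gaussInner σ t p y‖ ≤ (|p| / (2 * |t|)) ^ (1 / 2 : ℝ) := by
  rw [gaussInner, norm_mul, Complex.norm_cpow_real, norm_div, Complex.norm_real, Real.norm_eq_abs,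
    abs_of_pos Real.pi_pos, Complex.norm_exp]
  have h1 : (-((2 * Real.pi * y : ℝ) : ℂ) ^ 2 / (4 * gaussParam σ t p)).re ≤ 0 := by
    have : -((2 * Real.pi * y : ℝ) : ℂ) ^ 2 / (4 * gaussParam σ t p)
      = ((-((2 * Real.pi * y) ^ 2 / 4) : ℝ) : ℂ) * (gaussParam σ t p)⁻¹ := by
      push_cast; rw [div_eq_mul_inv, mul_inv]; ring
    rw [this, Complex.re_ofReal_mul, Complex.inv_re, gaussParam_re, neg_mul]
    have := Complex.normSq_nonneg (gaussParam σ t p)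
    exact neg_nonpos.2 (by positivity)
  have h2 : Real.pi / ‖gaussParam σ t p‖ ≤ |p| / (2 * |t|) := by
    have h3 := norm_gaussParam_ge σ t p
    have hp' : 0 < |p| := abs_pos.2 hp
    have ht' : 0 < |t| := abs_pos.2 ht
    have h4 : 0 < 2 * Real.pi * |t| / |p| := by positivity
    calc Real.pi / ‖gaussParam σ t p‖ ≤ Real.pi / (2 * Real.pi * |t| / |p|) :=
          div_le_div_of_nonneg_left Real.pi_pos.le h4 h3
      _ = |p| / (2 * |t|) := by field_simp
  calc _ ≤ (|p| / (2 * |t|)) ^ (1 / 2 : ℝ) * 1 := by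
        refine mul_le_mul (Real.rpow_le_rpow (by positivity) h2 (by norm_num))
          (Real.exp_le_one_iff.2 h1) (Real.exp_pos _).le (by positivity)
    _ = _ := mul_one _

/-- At σ = 0 the base π/b equals ip/(2t), purely imaginary and nonzero, hence inside the domain of
continuity of the square root. The limiting exponent is linear in p: the y-variable merely shifts
the coefficient X of the cubic phase, which is why bounds uniform in X suffice later. -/
theorem tendsto_gaussInner {t p : ℝ} (ht : t ≠ 0) (hp : p ≠ 0) (y : ℝ) :
    Filter.Tendsto (fun n : ℕ => gaussInner (1 / ((n : ℝ) + 1)) t p y) Filter.atTop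
      (nhds (gaussFactor t p *
        Complex.exp (Complex.I * ((-(Real.pi * y ^ 2 / (2 * t)) * p : ℝ) : ℂ)))) := by
  have h0 : Filter.Tendsto (fun n : ℕ => gaussParam (1 / ((n : ℝ) + 1)) t p) Filter.atTop
      (nhds (gaussParam 0 t p)) := by
    have hc : Continuous (fun σ : ℝ => gaussParam σ t p) := by unfold gaussParam; fun_prop
    exact (hc.tendsto 0).comp tendsto_one_div_add_atTop_nhds_zero_nat
  have hne : gaussParam 0 t p ≠ 0 := by
    intro h
    have := congrArg Complex.im h
    rw [gaussParam_im] at this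
    simp [ht, hp, Real.pi_ne_zero] at this
  have hval : (Real.pi : ℂ) / gaussParam 0 t p = Complex.I * p / (2 * t) := by
    have hpC : (p : ℂ) ≠ 0 := by exact_mod_cast hp
    have htC : (t : ℂ) ≠ 0 := by exact_mod_cast ht
    have hpi : (Real.pi : ℂ) ≠ 0 := by exact_mod_cast Real.pi_ne_zero
    rw [div_eq_iff hne, gaussParam]
    push_cast
    field_simp
    linear_combination (2 * Real.pi * t : ℂ) * Complex.I_sq
  have hslit : (Real.pi : ℂ) / gaussParam 0 t p ∈ Complex.slitPlane := by
    rw [hval, Complex.mem_slitPlane_iff]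
    right
    have : Complex.I * p / (2 * t) = Complex.I * ((p / (2 * t) : ℝ) : ℂ) := by push_cast; ring
    rw [this, Complex.I_mul_im, Complex.ofReal_re]
    exact div_ne_zero hp (mul_ne_zero two_ne_zero ht)
  have h1 : Filter.Tendsto (fun n : ℕ => ((Real.pi : ℂ) / gaussParam (1 / ((n : ℝ) + 1)) t p) ^
      ((1 / 2 : ℝ) : ℂ)) Filter.atTop (nhds (gaussFactor t p)) := by
    rw [gaussFactor, ← hval]
    exact (continuousAt_cpow_const hslit).tendsto.comp (tendsto_const_nhds.div h0 hne)
  have h2 : Filter.Tendsto (fun n : ℕ => Complex.exp (-((2 * Real.pi * y : ℝ) : ℂ) ^ 2 /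
      (4 * gaussParam (1 / ((n : ℝ) + 1)) t p))) Filter.atTop
      (nhds (Complex.exp (-((2 * Real.pi * y : ℝ) : ℂ) ^ 2 / (4 * gaussParam 0 t p)))) := by
    refine (Complex.continuous_exp.tendsto _).comp (tendsto_const_nhds.div (h0.const_mul 4) ?_)
    exact mul_ne_zero (by norm_num) hne
  have h3 : -((2 * Real.pi * y : ℝ) : ℂ) ^ 2 / (4 * gaussParam 0 t p)
      = Complex.I * ((-(Real.pi * y ^ 2 / (2 * t)) * p : ℝ) : ℂ) := by
    have : -((2 * Real.pi * y : ℝ) : ℂ) ^ 2 / (4 * gaussParam 0 t p)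
      = -(Real.pi : ℂ) * y ^ 2 * (Real.pi / gaussParam 0 t p) := by
      field_simp; push_cast; ring
    rw [this, hval]; push_cast; ring
  rw [h3] at h2
  exact h1.mul h2

theorem prop_coords (t : ℝ) (ζ : Plane) : prop t ζ =
    Complex.exp (Complex.I * ((t * (2 * Real.pi * ζ 0) ^ 3 : ℝ) : ℂ)) *
      Complex.exp (Complex.I * (2 * Real.pi * t / ζ 0 : ℝ) * (ζ 1 : ℂ) ^ 2) := by
  rw [prop, disp, ← Complex.exp_add]; congr 1; push_cast; ring

/-- The kernel of the regularised evolution. -/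
theorem integral_regularised {a : ℝ → ℂ} (ha : Integrable a) {σ : ℝ} (hσ : 0 < σ) (t : ℝ)
    (z : Plane) :
    Integrable (fun ζ : Plane => a (ζ 0) * Complex.exp (-(σ * (ζ 1 : ℝ) ^ 2 : ℝ))) ∧
    ∫ ζ : Plane, Complex.exp ((2 * Real.pi * inner ℝ z ζ : ℝ) * Complex.I) *
      (a (ζ 0) * Complex.exp (-(σ * (ζ 1) ^ 2 : ℝ)) * prop t ζ) =
    ∫ p : ℝ, a p * Complex.exp (Complex.I * ((2 * Real.pi * z 0 * p + t * (2 * Real.pi * p) ^ 3 : ℝ) : ℂ))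
      * gaussInner σ t p (z 1) := by
  have hg : Integrable (fun r : ℝ => Complex.exp (-(σ * r ^ 2 : ℝ))) := by
    have := (integrable_exp_neg_mul_sq hσ).ofReal (𝕜 := ℂ)
    refine this.congr (ae_of_all _ fun r => ?_)
    simp
  have hprod : Integrable (fun q : ℝ × ℝ => a q.1 * Complex.exp (-(σ * q.2 ^ 2 : ℝ))) :=
    ha.mul_prod hg
  refine ⟨integrable_coords.2 hprod, ?_⟩
  -- A unimodular factor times the product of a and a Gaussian; the Gaussian is what makes Fubini
  -- legitimate.
  set F : ℝ × ℝ → ℂ := fun q => (Complex.exp (Complex.I *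
      ((2 * Real.pi * z 0 * q.1 + t * (2 * Real.pi * q.1) ^ 3 : ℝ) : ℂ)) *
      (Complex.exp (Complex.I * (2 * Real.pi * z 1 : ℝ) * q.2) *
        Complex.exp (Complex.I * (2 * Real.pi * t / q.1 : ℝ) * (q.2 : ℂ) ^ 2))) *
      (a q.1 * Complex.exp (-(σ * q.2 ^ 2 : ℝ))) with hF
  have hFint : Integrable F := by
    refine hprod.bdd_mul (c := 1) ?_ (ae_of_all _ fun q => ?_)
    · apply Measurable.aestronglyMeasurable
      fun_prop
    · rw [norm_mul, norm_mul, mul_comm Complex.I, Complex.norm_exp_ofReal_mul_I]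
      have e1 : Complex.I * ((2 * Real.pi * z 1 : ℝ) : ℂ) * q.2 =
        ((2 * Real.pi * z 1 * q.2 : ℝ) : ℂ) * Complex.I := by push_cast; ring
      have e2 : Complex.I * (2 * Real.pi * t / q.1 : ℝ) * (q.2 : ℂ) ^ 2 =
        ((2 * Real.pi * t / q.1 * q.2 ^ 2 : ℝ) : ℂ) * Complex.I := by push_cast; ring
      rw [e1, e2, Complex.norm_exp_ofReal_mul_I, Complex.norm_exp_ofReal_mul_I]
      norm_num
  have h1 : ∀ ζ : Plane, Complex.exp ((2 * Real.pi * inner ℝ z ζ : ℝ) * Complex.I) *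
      (a (ζ 0) * Complex.exp (-(σ * (ζ 1) ^ 2 : ℝ)) * prop t ζ) = F (ζ 0, ζ 1) := by
    intro ζ
    have e : Complex.exp ((2 * Real.pi * inner ℝ z ζ : ℝ) * Complex.I) =
      Complex.exp (Complex.I * (2 * Real.pi * z 0 * ζ 0 : ℝ)) *
        Complex.exp (Complex.I * (2 * Real.pi * z 1 : ℝ) * (ζ 1 : ℂ)) := by
      rw [inner_plane, ← Complex.exp_add]; congr 1; push_cast; ring
    have e' : Complex.exp (Complex.I *
      ((2 * Real.pi * z 0 * ζ 0 + t * (2 * Real.pi * ζ 0) ^ 3 : ℝ) : ℂ)) =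
      Complex.exp (Complex.I * (2 * Real.pi * z 0 * ζ 0 : ℝ)) *
        Complex.exp (Complex.I * ((t * (2 * Real.pi * ζ 0) ^ 3 : ℝ) : ℂ)) := by
      rw [← Complex.exp_add]; congr 1; push_cast; ring
    simp only [hF]
    rw [e, e', prop_coords]
    ring
  simp_rw [h1]
  rw [integral_coords hFint]
  congr 1; ext p
  rw [← integral_gaussInner hσ, ← integral_const_mul]
  congr 1; ext r
  simp only [hF]
  have : Complex.exp (-gaussParam σ t p * (r : ℂ) ^ 2) =
    Complex.exp (Complex.I * (2 * Real.pi * t / p : ℝ) * (r : ℂ) ^ 2) *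
      Complex.exp (-(σ * r ^ 2 : ℝ)) := by
    rw [← Complex.exp_add, gaussParam]; congr 1; push_cast; ring
  rw [this]; ring

/-- Dispersive estimate: a bound on the one-dimensional oscillatory integral is a bound on the
kernel of the evolution. -/
theorem norm_fourier_prop_le {a : ℝ → ℂ} {R M κ : ℝ} (ham : Measurable a) (haM : ∀ p, ‖a p‖ ≤ M)
    (haR : ∀ p, R < |p| → a p = 0) {t : ℝ} (ht : t ≠ 0)
    (hκ : ∀ X, ‖∫ p, a p * gaussFactor t p * cubicPhase X (8 * Real.pi ^ 3 * t) p‖ ≤ κ)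
    {Ψ : Plane → ℂ} (hΨ : Integrable Ψ) (hψ : Integrable (𝓕⁻ Ψ)) (z : Plane) :
    ‖𝓕 (fun ζ : Plane => a (ζ 0) * prop t ζ * 𝓕⁻ Ψ ζ) z‖ ≤ κ * ∫ w, ‖Ψ w‖ := by
  have hasupp : ∀ p, a p = (Icc (-R) R).indicator a p := fun p => by
    by_cases hp : p ∈ Icc (-R) R
    · rw [indicator_of_mem hp]
    · rw [indicator_of_notMem hp]
      exact haR p (not_le.1 fun h => hp (abs_le.1 h))
  have hM0 : 0 ≤ M := (norm_nonneg _).trans (haM 0)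
  have haint : Integrable a := by
    rw [show a = (Icc (-R) R).indicator a from funext hasupp, integrable_indicator_iff measurableSet_Icc]
    exact Measure.integrableOn_of_bounded (M := M) (by simp) ham.aestronglyMeasurable
      (ae_of_all _ haM)
  -- The integral over the second frequency converges only conditionally. It is damped by a Gaussian
  -- of parameter σ n; the limit is taken once on the kernel side and once on the Fourier side, and
  -- the two limits agree.
  set σ : ℕ → ℝ := fun n => 1 / ((n : ℝ) + 1) with hσdef
  have hσ : ∀ n, 0 < σ n := fun n => by simp only [hσdef]; positivity
  set L : ℝ := (R / (2 * |t|)) ^ (1 / 2 : ℝ) with hL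
  -- the regularised kernels
  set K : ℕ → Plane → ℂ := fun n v => ∫ p : ℝ, a p *
    Complex.exp (Complex.I * ((2 * Real.pi * v 0 * p + t * (2 * Real.pi * p) ^ 3 : ℝ) : ℂ))
      * gaussInner (σ n) t p (v 1) with hK
  set K' : Plane → ℂ := fun v => ∫ p, a p * gaussFactor t p *
    cubicPhase (2 * Real.pi * v 0 - Real.pi * v 1 ^ 2 / (2 * t)) (8 * Real.pi ^ 3 * t) p with hK'
  have hpt : ∀ (n : ℕ) (v : Plane) (p : ℝ), p ≠ 0 → ‖a p *
    Complex.exp (Complex.I * ((2 * Real.pi * v 0 * p + t * (2 * Real.pi * p) ^ 3 : ℝ) : ℂ))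
      * gaussInner (σ n) t p (v 1)‖ ≤ ‖a p‖ * L := by
    intro n v p hp
    rw [norm_mul, norm_mul, mul_comm Complex.I, Complex.norm_exp_ofReal_mul_I, mul_one]
    by_cases hpR : R < |p|
    · simp [haR p hpR]
    · refine mul_le_mul_of_nonneg_left ((norm_gaussInner_le (hσ n).le ht hp _).trans ?_)
        (norm_nonneg _)
      refine Real.rpow_le_rpow (by positivity) ?_ (by norm_num)
      exact div_le_div_of_nonneg_right (not_lt.1 hpR) (by positivity)
  have hne : ∀ᵐ p : ℝ, p ≠ 0 := by
    rw [ae_iff]; simp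
  have hmeas : ∀ n (v : Plane), Measurable (fun p : ℝ => a p *
    Complex.exp (Complex.I * ((2 * Real.pi * v 0 * p + t * (2 * Real.pi * p) ^ 3 : ℝ) : ℂ))
      * gaussInner (σ n) t p (v 1)) := by
    intro n v
    have : Measurable (fun p : ℝ => gaussInner (σ n) t p (v 1)) := by
      unfold gaussInner gaussParam; fun_prop
    fun_prop
  have hKlim : ∀ v, Filter.Tendsto (fun n => K n v) Filter.atTop (nhds (K' v)) := by
    intro v
    refine tendsto_integral_of_dominated_convergence (fun p => ‖a p‖ * L)
      (fun n => (hmeas n v).aestronglyMeasurable) (haint.norm.mul_const L)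
      (fun n => hne.mono fun p hp => hpt n v p hp) (hne.mono fun p hp => ?_)
    have := (tendsto_gaussInner ht hp (v 1)).const_mul (a p *
      Complex.exp (Complex.I * ((2 * Real.pi * v 0 * p + t * (2 * Real.pi * p) ^ 3 : ℝ) : ℂ)))
    convert this using 2
    rw [cubicPhase, mul_assoc (a p), mul_assoc (a p)]
    congr 1
    rw [mul_left_comm, ← Complex.exp_add]
    congr 2
    push_cast; ring
  have hKbd : ∀ n v, ‖K n v‖ ≤ (∫ p, ‖a p‖) * L := by
    intro n v
    rw [← integral_mul_const]
    exact norm_integral_le_of_norm_le (haint.norm.mul_const L) (hne.mono fun p hp => hpt n v p hp)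
  -- the regularised operators
  have hreg : ∀ n, ∫ ζ : Plane, Complex.exp ((-2 * Real.pi * inner ℝ ζ z : ℝ) * Complex.I) *
      (a (ζ 0) * Complex.exp (-(σ n * (ζ 1) ^ 2 : ℝ)) * prop t ζ * 𝓕⁻ Ψ ζ) =
      ∫ w, K n (w - z) * Ψ w := by
    intro n
    obtain ⟨hInt, -⟩ := integral_regularised haint (hσ n) t 0
    have h1 : ∀ ζ : Plane, Complex.exp ((-2 * Real.pi * inner ℝ ζ z : ℝ) * Complex.I) *
      (a (ζ 0) * Complex.exp (-(σ n * (ζ 1) ^ 2 : ℝ)) * prop t ζ * 𝓕⁻ Ψ ζ) =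
      ∫ w, Complex.exp ((2 * Real.pi * inner ℝ (w - z) ζ : ℝ) * Complex.I) *
        (a (ζ 0) * Complex.exp (-(σ n * (ζ 1) ^ 2 : ℝ)) * prop t ζ) * Ψ w := by
      intro ζ
      rw [Real.fourierInv_eq', ← integral_const_mul, ← integral_const_mul]
      congr 1; ext w
      rw [smul_eq_mul, inner_sub_left, real_inner_comm z ζ]
      have : Complex.exp ((2 * Real.pi * (inner ℝ w ζ - inner ℝ ζ z) : ℝ) * Complex.I) =
        Complex.exp ((-2 * Real.pi * inner ℝ ζ z : ℝ) * Complex.I) *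
        Complex.exp ((2 * Real.pi * inner ℝ w ζ : ℝ) * Complex.I) := by
        rw [← Complex.exp_add]; congr 1; push_cast; ring
      rw [real_inner_comm ζ z] at *
      rw [this]; ring
    simp_rw [h1]
    rw [integral_integral_swap]
    · congr 1; ext w
      rw [integral_mul_const, (integral_regularised haint (hσ n) t (w - z)).2]
    · have hprod := hInt.mul_prod hΨ
      refine (hprod.bdd_mul (c := 1) (f := fun q : Plane × Plane =>
        Complex.exp ((2 * Real.pi * inner ℝ (q.2 - z) q.1 : ℝ) * Complex.I) * prop t q.1) ?_
          (ae_of_all _ fun q => ?_)).congr (ae_of_all _ fun q => ?_)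
      · apply Measurable.aestronglyMeasurable
        have := measurable_prop t
        fun_prop
      · rw [norm_mul, norm_prop, Complex.norm_exp_ofReal_mul_I, one_mul]
      · simp only [Function.uncurry]; ring
  have hlim1 : Filter.Tendsto (fun n => ∫ w, K n (w - z) * Ψ w) Filter.atTop
      (nhds (∫ w, K' (w - z) * Ψ w)) := by
    refine tendsto_integral_of_dominated_convergence (fun w => (∫ p, ‖a p‖) * L * ‖Ψ w‖) ?_
      (hΨ.norm.const_mul _) (fun n => ae_of_all _ fun w => ?_) (ae_of_all _ fun w => ?_)
    · intro n
      refine AEStronglyMeasurable.mul ?_ hΨ.1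
      apply StronglyMeasurable.aestronglyMeasurable
      refine StronglyMeasurable.integral_prod_right (f := fun (w : Plane) (p : ℝ) => a p *
        Complex.exp (Complex.I * ((2 * Real.pi * (w - z) 0 * p + t * (2 * Real.pi * p) ^ 3 : ℝ) : ℂ))
        * gaussInner (σ n) t p ((w - z) 1)) ?_
      apply Measurable.stronglyMeasurable
      have h0 := measurable_coord 0
      have h1 := measurable_coord 1
      unfold Function.uncurry gaussInner gaussParam
      simp only [PiLp.sub_apply]
      fun_prop
    · rw [norm_mul]
      exact mul_le_mul_of_nonneg_right (hKbd n _) (norm_nonneg _)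
    · exact (hKlim _).mul_const _
  have hlim2 : Filter.Tendsto (fun n => ∫ w, K n (w - z) * Ψ w) Filter.atTop
      (nhds (𝓕 (fun ζ : Plane => a (ζ 0) * prop t ζ * 𝓕⁻ Ψ ζ) z)) := by
    simp_rw [← hreg]
    rw [Real.fourier_eq']
    have hm0 := measurable_coord 0
    have hm1 := measurable_coord 1
    have hmp := measurable_prop t
    refine tendsto_integral_of_dominated_convergence (fun ζ => M * ‖𝓕⁻ Ψ ζ‖) ?_
      (hψ.norm.const_mul _) (fun n => ae_of_all _ fun ζ => ?_) (ae_of_all _ fun ζ => ?_)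
    · intro n
      have : Measurable (fun ζ : Plane => Complex.exp ((-2 * Real.pi * inner ℝ ζ z : ℝ) * Complex.I)) := by
        fun_prop
      refine this.aestronglyMeasurable.mul (AEStronglyMeasurable.mul ?_ hψ.1)
      apply Measurable.aestronglyMeasurable
      fun_prop
    · rw [norm_mul, norm_mul, norm_mul, norm_mul, norm_prop, Complex.norm_exp_ofReal_mul_I, one_mul,
        mul_one]
      refine mul_le_mul_of_nonneg_right ?_ (norm_nonneg _)
      calc _ ≤ M * 1 := by
            refine mul_le_mul (haM _) ?_ (norm_nonneg _) hM0
            rw [Complex.norm_exp, Real.exp_le_one_iff]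
            have := (hσ n).le
            rw [← Complex.ofReal_neg, Complex.ofReal_re]
            nlinarith [sq_nonneg (ζ 1)]
        _ = M := mul_one M
    · simp only [smul_eq_mul]
      have : Filter.Tendsto (fun n => Complex.exp (-(σ n * (ζ 1) ^ 2 : ℝ))) Filter.atTop (nhds 1) := by
        have hc : Continuous (fun s : ℝ => Complex.exp (-(s * (ζ 1) ^ 2 : ℝ))) := by fun_prop
        have := (hc.tendsto 0).comp tendsto_one_div_add_atTop_nhds_zero_nat
        simpa [hσdef, Function.comp_def] using this
      have h2 := (((this.const_mul (a (ζ 0))).mul_const (prop t ζ)).mul_const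
        (𝓕⁻ Ψ ζ)).const_mul (Complex.exp ((-2 * Real.pi * inner ℝ ζ z : ℝ) * Complex.I))
      simpa using h2
  rw [tendsto_nhds_unique hlim2 hlim1, ← integral_const_mul]
  refine norm_integral_le_of_norm_le (hΨ.norm.const_mul κ) (ae_of_all _ fun w => ?_)
  rw [norm_mul]
  exact mul_le_mul_of_nonneg_right (hκ _) (norm_nonneg _)

/-! ### Dyadic bands in the first frequency -/

/-- The dyadic bands `|p| < 1` and `2^k ≤ |p| < 2^(k+1)`. -/
def band : ℕ → Set ℝ
  | 0 => {p | |p| < 1}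
  | k + 1 => {p | 2 ^ k ≤ |p| ∧ |p| < 2 ^ (k + 1)}

/-- The closed dyadic bands. -/
def closedBand : ℕ → Set ℝ
  | 0 => {p | |p| ≤ 1}
  | k + 1 => {p | 2 ^ k ≤ |p| ∧ |p| ≤ 2 ^ (k + 1)}

theorem band_subset_closedBand (k : ℕ) : band k ⊆ closedBand k := by
  cases k with
  | zero => exact fun p (hp : |p| < 1) => hp.le
  | succ k => exact fun p hp => ⟨hp.1, hp.2.le⟩

theorem measurableSet_band (k : ℕ) : MeasurableSet (band k) := by
  have h : Measurable (fun p : ℝ => |p|) := continuous_abs.measurable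
  cases k with
  | zero => exact measurableSet_lt h measurable_const
  | succ k => exact (measurableSet_le measurable_const h).inter (measurableSet_lt h measurable_const)

theorem abs_lt_of_mem_band {k : ℕ} {p : ℝ} (hp : p ∈ band k) : |p| < 2 ^ k := by
  cases k with
  | zero => simpa [band] using hp
  | succ k => exact hp.2

theorem abs_le_of_mem_closedBand {k : ℕ} {p : ℝ} (hp : p ∈ closedBand k) : |p| ≤ 2 ^ k := by
  cases k with
  | zero => simpa [closedBand] using hp
  | succ k => exact hp.2

/-- The band with index k + 1 starts at 2^k, half of 2^(k+1), and (2π)² ≥ 4 makes up for it; on the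
band 0 the summand 1 gives the lower bound. -/
theorem sq_mem_of_mem_closedBand {k : ℕ} {p : ℝ} (hp : p ∈ closedBand k) :
    (2 ^ k) ^ 2 ≤ 1 + (2 * Real.pi * p) ^ 2 ∧
      1 + (2 * Real.pi * p) ^ 2 ≤ (1 + 4 * Real.pi ^ 2) * (2 ^ k) ^ 2 := by
  have h2 := abs_le_of_mem_closedBand hp
  have hsq : p ^ 2 ≤ (2 ^ k) ^ 2 := by rw [← sq_abs p]; gcongr
  have h1 : (1 : ℝ) ≤ (2 ^ k) ^ 2 := one_le_pow₀ (one_le_pow₀ (by norm_num))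
  have hpi : 1 ≤ Real.pi ^ 2 := one_le_pow₀ (by linarith [Real.pi_gt_three])
  constructor
  · cases k with
    | zero => simp; positivity
    | succ k =>
      have h3 : ((2 : ℝ) ^ k) ^ 2 ≤ p ^ 2 := by rw [← sq_abs p]; gcongr; exact hp.1
      have : ((2 : ℝ) ^ (k + 1)) ^ 2 = 4 * (2 ^ k) ^ 2 := by ring
      rw [this]
      nlinarith [sq_nonneg p, mul_nonneg (sq_nonneg p) (sub_nonneg.2 hpi)]
  · nlinarith [mul_nonneg (sq_nonneg Real.pi) (sub_nonneg.2 hsq)]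

/-- The one-dimensional Bessel symbol. -/
noncomputable def bes (θ p : ℝ) : ℝ := (1 + (2 * Real.pi * p) ^ 2) ^ (θ / 2)

theorem besselSymbol_eq (θ : ℝ) (ζ : Plane) : besselSymbol θ ζ = bes θ (ζ 0) := rfl

theorem bes_pos (θ p : ℝ) : 0 < bes θ p := Real.rpow_pos_of_pos (by positivity) _

theorem continuous_bes (θ : ℝ) : Continuous (bes θ) := by
  unfold bes
  exact Continuous.rpow_const (by fun_prop) (fun p => Or.inl (by positivity))

theorem bes_add (θ θ' p : ℝ) : bes (θ + θ') p = bes θ p * bes θ' p := by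
  rw [bes, add_div, Real.rpow_add (by positivity)]; rfl

theorem bes_zero (p : ℝ) : bes 0 p = 1 := by simp [bes]

/-- The constant comparing the Bessel symbol with powers of `2` on dyadic bands. -/
noncomputable def besConst (θ : ℝ) : ℝ := (1 + 4 * Real.pi ^ 2) ^ (|θ| / 2)

theorem one_le_besConst (θ : ℝ) : 1 ≤ besConst θ :=
  Real.one_le_rpow (by nlinarith [sq_nonneg Real.pi]) (by positivity)

theorem bes_le {k : ℕ} {p : ℝ} (θ : ℝ) (hp : p ∈ closedBand k) :
    bes θ p ≤ besConst θ * (2 ^ k : ℝ) ^ θ := by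
  obtain ⟨h1, h2⟩ := sq_mem_of_mem_closedBand hp
  have hk : (0 : ℝ) < 2 ^ k := by positivity
  have hpow : (((2 : ℝ) ^ k) ^ 2) ^ (θ / 2) = ((2 : ℝ) ^ k) ^ θ := by
    rw [← Real.rpow_natCast _ 2, ← Real.rpow_mul hk.le]
    congr 1; push_cast; ring
  rcases le_or_gt 0 θ with h | h
  · calc bes θ p ≤ ((1 + 4 * Real.pi ^ 2) * (2 ^ k) ^ 2) ^ (θ / 2) :=
          Real.rpow_le_rpow (by positivity) h2 (by positivity)
      _ = _ := by
        rw [Real.mul_rpow (by positivity) (by positivity), hpow, besConst, abs_of_nonneg h]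
  · calc bes θ p ≤ ((2 ^ k) ^ 2) ^ (θ / 2) :=
          Real.rpow_le_rpow_of_nonpos (by positivity) h1 (by linarith)
      _ = 1 * ((2 : ℝ) ^ k) ^ θ := by rw [hpow, one_mul]
      _ ≤ _ := mul_le_mul_of_nonneg_right (one_le_besConst θ) (by positivity)

theorem hasDerivAt_bes (θ p : ℝ) : HasDerivAt (bes θ)
    (θ / 2 * bes θ p * (8 * Real.pi ^ 2 * p / (1 + (2 * Real.pi * p) ^ 2))) p := by
  have h1 : HasDerivAt (fun p : ℝ => 1 + (2 * Real.pi * p) ^ 2) (8 * Real.pi ^ 2 * p) p := by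
    refine HasDerivAt.congr_deriv ((((hasDerivAt_id' p).const_mul (2 * Real.pi)).fun_pow 2).const_add 1) ?_
    norm_num; ring
  refine HasDerivAt.congr_deriv (h1.rpow_const (p := θ / 2) (Or.inl (by positivity))) ?_
  rw [Real.rpow_sub_one (by positivity), bes]; ring

theorem abs_deriv_bes_le {θ p : ℝ} (hp : p ≠ 0) :
    |θ / 2 * bes θ p * (8 * Real.pi ^ 2 * p / (1 + (2 * Real.pi * p) ^ 2))| ≤
      |θ| * bes θ p / |p| := by
  have hp' : 0 < |p| := abs_pos.2 hp
  rw [abs_mul, abs_mul, abs_div, abs_div, abs_of_pos (bes_pos θ p), abs_mul,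
    abs_of_pos (by positivity : 0 < 1 + (2 * Real.pi * p) ^ 2),
    abs_of_pos (by positivity : 0 < 8 * Real.pi ^ 2), abs_two]
  have : 8 * Real.pi ^ 2 * |p| / (1 + (2 * Real.pi * p) ^ 2) ≤ 2 / |p| := by
    rw [div_le_div_iff₀ (by positivity) hp', mul_assoc _ |p|, abs_mul_abs_self]
    nlinarith
  calc |θ| / 2 * bes θ p * (8 * Real.pi ^ 2 * |p| / (1 + (2 * Real.pi * p) ^ 2))
      ≤ |θ| / 2 * bes θ p * (2 / |p|) :=
        mul_le_mul_of_nonneg_left this (mul_nonneg (by positivity) (bes_pos θ p).le)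
    _ = |θ| * bes θ p / |p| := by ring

/-- An amplitude on the closed band `k` which is bounded by `M` together with its scaled
derivative. -/
structure BandAmplitude (k : ℕ) (α : ℝ → ℂ) (M : ℝ) : Prop where
  contDiff : ContDiff ℝ 1 α
  norm_le : ∀ p ∈ closedBand k, ‖α p‖ ≤ M
  norm_deriv_le : ∀ p ∈ closedBand k, 1 ≤ |p| → ‖deriv α p‖ ≤ M / |p|

theorem bandAmplitude_one (k : ℕ) : BandAmplitude k (fun _ => 1) 1 where
  contDiff := contDiff_const
  norm_le := fun p _ => by simp
  norm_deriv_le := fun p _ _ => by simp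

/-- The amplitude of the forcing term. -/
theorem bandAmplitude_bes (k : ℕ) (β : ℝ) :
    BandAmplitude k (fun p => -(2 * Real.pi * Complex.I) * p * (bes β p : ℂ))
      (2 * Real.pi * (1 + |β|) * besConst β * (2 ^ k : ℝ) ^ (β + 1)) := by
  have hder : ∀ p : ℝ, HasDerivAt (fun p : ℝ => -(2 * Real.pi * Complex.I) * p * (bes β p : ℂ))
      (-(2 * Real.pi * Complex.I) * ((bes β p : ℂ) + p *
        ((β / 2 * bes β p * (8 * Real.pi ^ 2 * p / (1 + (2 * Real.pi * p) ^ 2)) : ℝ) : ℂ))) p := by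
    intro p
    have h1 := ((hasDerivAt_id' p).mul (hasDerivAt_bes β p)).ofReal_comp.const_mul
      (-(2 * Real.pi * Complex.I))
    refine (h1.congr_deriv ?_).congr_of_eventuallyEq (Filter.Eventually.of_forall fun q => ?_)
    · push_cast; ring
    · simp only [Pi.mul_apply]; push_cast; ring
  have hnorm : ‖-(2 * Real.pi * Complex.I)‖ = 2 * Real.pi := by
    simp [abs_of_pos Real.pi_pos]
  have hcd : ContDiff ℝ 1 (bes β) := by
    unfold bes
    exact ContDiff.rpow_const_of_ne (by fun_prop) (fun p => by positivity)
  have hC := one_le_besConst β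
  have hpow : ((2 : ℝ) ^ k) ^ (β + 1) = ((2 : ℝ) ^ k) ^ β * 2 ^ k := by
    rw [Real.rpow_add_one (by positivity)]
  have hkey : ∀ p ∈ closedBand k, bes β p * |p| ≤ besConst β * (2 ^ k : ℝ) ^ (β + 1) := fun p hp => by
    rw [hpow, ← mul_assoc]
    exact mul_le_mul (bes_le β hp) (abs_le_of_mem_closedBand hp) (abs_nonneg _) (by positivity)
  refine ⟨?_, fun p hp => ?_, fun p hp hp1 => ?_⟩
  · have : ContDiff ℝ 1 (fun p : ℝ => (bes β p : ℂ)) := Complex.ofRealCLM.contDiff.comp hcd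
    have h2 : ContDiff ℝ 1 (fun p : ℝ => (p : ℂ)) := Complex.ofRealCLM.contDiff
    fun_prop
  · rw [norm_mul, norm_mul, hnorm, Complex.norm_real, Complex.norm_real, Real.norm_eq_abs,
      Real.norm_eq_abs, abs_of_pos (bes_pos β p), mul_assoc, mul_comm |p|]
    have := hkey p hp
    have h1 : 0 ≤ besConst β * (2 ^ k : ℝ) ^ (β + 1) := by positivity
    calc 2 * Real.pi * (bes β p * |p|) ≤ 2 * Real.pi * (besConst β * (2 ^ k : ℝ) ^ (β + 1)) := by gcongr
      _ ≤ 2 * Real.pi * (besConst β * (2 ^ k : ℝ) ^ (β + 1)) * (1 + |β|) :=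
        le_mul_of_one_le_right (by positivity) (by linarith [abs_nonneg β])
      _ = _ := by ring
  · have hp0 : 0 < |p| := by linarith
    rw [(hder p).deriv, norm_mul, hnorm, le_div_iff₀ hp0]
    have h1 : ‖(bes β p : ℂ) + p *
        ((β / 2 * bes β p * (8 * Real.pi ^ 2 * p / (1 + (2 * Real.pi * p) ^ 2)) : ℝ) : ℂ)‖ ≤
        bes β p + |p| * (|β| * bes β p / |p|) := by
      refine (norm_add_le _ _).trans (add_le_add ?_ ?_)
      · rw [Complex.norm_real, Real.norm_eq_abs, abs_of_pos (bes_pos β p)]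
      · rw [norm_mul, Complex.norm_real, Complex.norm_real, Real.norm_eq_abs, Real.norm_eq_abs]
        exact mul_le_mul_of_nonneg_left (abs_deriv_bes_le (abs_pos.1 hp0)) (abs_nonneg _)
    rw [mul_div_cancel₀ _ hp0.ne'] at h1
    have := hkey p hp
    calc 2 * Real.pi * _ * |p| ≤ 2 * Real.pi * (bes β p + |β| * bes β p) * |p| := by gcongr
      _ = 2 * Real.pi * (1 + |β|) * (bes β p * |p|) := by ring
      _ ≤ 2 * Real.pi * (1 + |β|) * (besConst β * (2 ^ k : ℝ) ^ (β + 1)) := by gcongr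
      _ = _ := by ring

/-- Positive factors come out of the principal square root. With q = ±1 the sign of the frequency,
this turns both halves of a band into integrals over p > 0 with amplitude √p. -/
theorem gaussFactor_eq {t q p : ℝ} (ht : t ≠ 0) (hq : q ≠ 0) (hp : 0 < p) :
    gaussFactor t (p * q) = ((p ^ (1 / 2 : ℝ) : ℝ) : ℂ) * gaussFactor t q := by
  have hz : Complex.I * q / (2 * t) ≠ 0 :=
    div_ne_zero (mul_ne_zero Complex.I_ne_zero (by exact_mod_cast hq))
      (mul_ne_zero two_ne_zero (by exact_mod_cast ht))
  have h1 : Complex.I * ((p * q : ℝ) : ℂ) / (2 * t) = (p : ℂ) * (Complex.I * q / (2 * t)) := by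
    push_cast; ring
  rw [gaussFactor, gaussFactor, h1, Complex.cpow_def_of_ne_zero (mul_ne_zero (by exact_mod_cast hp.ne') hz),
    Complex.log_ofReal_mul hp hz, add_mul, Complex.exp_add, Complex.cpow_def_of_ne_zero hz,
    Complex.ofReal_cpow hp.le, Complex.cpow_def_of_ne_zero (by exact_mod_cast hp.ne'),
    Complex.ofReal_log hp.le]

theorem norm_gaussFactor_unit {t q : ℝ} (hq : |q| = 1) :
    ‖gaussFactor t q‖ = (1 / (2 * |t|)) ^ (1 / 2 : ℝ) := by
  rw [norm_gaussFactor, hq]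

theorem cubicPhase_mul_unit {X Y q p : ℝ} (hq : |q| = 1) :
    cubicPhase X Y (p * q) = cubicPhase (X * q) (Y * q) p := by
  have h2 : q ^ 2 = 1 := by rw [← sq_abs, hq, one_pow]
  rw [cubicPhase, cubicPhase]
  congr 3
  calc X * (p * q) + Y * (p * q) ^ 3 = X * q * p + Y * q * p ^ 3 * q ^ 2 := by ring
    _ = _ := by rw [h2]; ring

theorem mem_closedBand_mul_unit {j : ℕ} {q p : ℝ} (hq : |q| = 1)
    (hp : p ∈ Icc ((2 : ℝ) ^ j) (2 ^ (j + 1))) : p * q ∈ closedBand (j + 1) := by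
  have hp0 : 0 ≤ p := le_trans (by positivity) hp.1
  have : |p * q| = p := by rw [abs_mul, hq, mul_one, abs_of_nonneg hp0]
  exact ⟨by rw [this]; exact hp.1, by rw [this]; exact hp.2⟩

theorem integrand_half_eq {α : ℝ → ℂ} {X Y t q p : ℝ} (ht : t ≠ 0) (hq : |q| = 1) (hp : 0 < p) :
    α (p * q) * gaussFactor t (p * q) * cubicPhase X Y (p * q) =
      gaussFactor t q * (α (p * q) * ((√p : ℝ) : ℂ) * cubicPhase (X * q) (Y * q) p) := by
  have hq0 : q ≠ 0 := by rintro rfl; simp at hq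
  rw [gaussFactor_eq ht hq0 hp, cubicPhase_mul_unit hq, Real.sqrt_eq_rpow]; ring

/-- The amplitude α√p has size M√N, the second derivative test divides by √(|t|N), and the Gaussian
factor contributes |t|^{-1/2}. The powers of N cancel, so the bound M/|t| loses no derivatives. -/
theorem half_band_dispersive {j : ℕ} {α : ℝ → ℂ} {M X t q : ℝ} (hα : BandAmplitude (j + 1) α M)
    (ht : t ≠ 0) (hq : |q| = 1) :
    ‖∫ p in (2 : ℝ) ^ j..2 ^ (j + 1), α (p * q) * gaussFactor t (p * q) *
      cubicPhase X (8 * Real.pi ^ 3 * t) (p * q)‖ ≤ 40 * M / |t| := by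
  set N : ℝ := 2 ^ j with hN
  have hNpos : 0 < N := by positivity
  have hN2 : (2 : ℝ) ^ (j + 1) = 2 * N := by rw [hN]; ring
  have hNle : N ≤ 2 ^ (j + 1) := by rw [hN2]; linarith
  have hN1 : 1 ≤ N := one_le_pow₀ (by norm_num)
  have hq0 : q ≠ 0 := by rintro rfl; simp at hq
  have hM0 : 0 ≤ M := (norm_nonneg _).trans
    (hα.norm_le _ (mem_closedBand_mul_unit hq (left_mem_Icc.2 hNle)))
  have e1 : ∫ p in N..2 ^ (j + 1), α (p * q) * gaussFactor t (p * q) *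
      cubicPhase X (8 * Real.pi ^ 3 * t) (p * q) = gaussFactor t q * ∫ p in N..2 ^ (j + 1),
        α (p * q) * ((√p : ℝ) : ℂ) * cubicPhase (X * q) (8 * Real.pi ^ 3 * t * q) p := by
    rw [← intervalIntegral.integral_const_mul]
    refine intervalIntegral.integral_congr fun p hp => ?_
    rw [uIcc_of_le hNle] at hp
    exact integrand_half_eq ht hq (hNpos.trans_le hp.1)
  have hdiff : Differentiable ℝ α := hα.contDiff.differentiable (by norm_num)
  have hder : ∀ p ∈ Icc N (2 ^ (j + 1)), HasDerivAt (fun p : ℝ => α (p * q) * ((√p : ℝ) : ℂ))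
      (deriv α (p * q) * q * ((√p : ℝ) : ℂ) + α (p * q) * ((1 / (2 * √p) : ℝ) : ℂ)) p := by
    intro p hp
    have hp0 : p ≠ 0 := (hNpos.trans_le hp.1).ne'
    have h1 : HasDerivAt (fun p : ℝ => α (p * q)) (deriv α (p * q) * q) p := by
      have := (hdiff (p * q)).hasDerivAt.scomp p ((hasDerivAt_id' p).mul_const q)
      refine this.congr_deriv ?_
      simp [mul_comm]
    exact h1.mul (Real.hasDerivAt_sqrt hp0).ofReal_comp
  have hsq : √(2 * N) ≤ 2 * √N := by
    rw [Real.sqrt_mul (by norm_num)]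
    exact mul_le_mul_of_nonneg_right (Real.sqrt_le_iff.2 ⟨by norm_num, by norm_num⟩) (Real.sqrt_nonneg _)
  have hvdc := norm_integral_amplitude_le (X := X * q) (Y := 8 * Real.pi ^ 3 * t * q)
    (M := 3 * M * √N) (A := N) (B := 2 ^ (j + 1))
    (mul_ne_zero (mul_ne_zero (by positivity) ht) hq0) hNpos hNle hN2.le hder
    (by
      have := hα.contDiff.continuous_deriv (by norm_num)
      have := hα.contDiff.continuous
      refine ContinuousOn.add (by fun_prop) (ContinuousOn.mul (by fun_prop) ?_)
      refine Complex.continuous_ofReal.comp_continuousOn (ContinuousOn.div (by fun_prop)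
        (by fun_prop) fun p hp => ?_)
      exact mul_ne_zero two_ne_zero (Real.sqrt_pos.2 (hNpos.trans_le hp.1)).ne')
    (by
      rw [norm_mul, Complex.norm_real, Real.norm_eq_abs, abs_of_nonneg (Real.sqrt_nonneg _), hN2]
      have := hα.norm_le _ (mem_closedBand_mul_unit hq (right_mem_Icc.2 hNle))
      rw [hN2] at this
      calc _ ≤ M * (2 * √N) := mul_le_mul this hsq (Real.sqrt_nonneg _) hM0
        _ ≤ _ := by nlinarith [mul_nonneg hM0 (Real.sqrt_nonneg N)])
    (by
      intro p hp
      have hmem := mem_closedBand_mul_unit hq hp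
      have hpp : 0 < p := hNpos.trans_le hp.1
      have habs : |p * q| = p := by rw [abs_mul, hq, mul_one, abs_of_pos hpp]
      have h1 := hα.norm_le _ hmem
      have h2 := hα.norm_deriv_le _ hmem (by rw [habs]; linarith [hp.1])
      rw [habs] at h2
      have hsp : √p ≤ 2 * √N := le_trans (Real.sqrt_le_sqrt (hp.2.trans hN2.le)) hsq
      have hspN : √N ≤ √p := Real.sqrt_le_sqrt hp.1
      have hsN : 0 < √N := Real.sqrt_pos.2 hNpos
      have hNN : √N * √N = N := Real.mul_self_sqrt hNpos.le
      have t1 : ‖deriv α (p * q) * q * ((√p : ℝ) : ℂ)‖ ≤ 2 * (M * √N / N) := by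
        rw [norm_mul, norm_mul, Complex.norm_real, Complex.norm_real, Real.norm_eq_abs,
          Real.norm_eq_abs, hq, mul_one, abs_of_nonneg (Real.sqrt_nonneg _)]
        calc ‖deriv α (p * q)‖ * √p ≤ M / N * (2 * √N) := by
              refine mul_le_mul (h2.trans ?_) hsp (Real.sqrt_nonneg _) (by positivity)
              exact div_le_div_of_nonneg_left hM0 hNpos hp.1
          _ = _ := by ring
      have t2 : ‖α (p * q) * ((1 / (2 * √p) : ℝ) : ℂ)‖ ≤ M * √N / N := by
        rw [norm_mul, Complex.norm_real, Real.norm_eq_abs, abs_of_nonneg (by positivity)]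
        calc ‖α (p * q)‖ * (1 / (2 * √p)) ≤ M * (1 / √N) := by
              refine mul_le_mul h1 ?_ (by positivity) hM0
              exact one_div_le_one_div_of_le hsN (by linarith)
          _ = M * √N / N := by
            rw [mul_div_assoc]
            congr 1
            rw [div_eq_div_iff hsN.ne' hNpos.ne', one_mul, hNN]
      calc _ ≤ 2 * (M * √N / N) + M * √N / N := (norm_add_le _ _).trans (add_le_add t1 t2)
        _ = 3 * M * √N / N := by ring)
  rw [e1, norm_mul, norm_gaussFactor_unit hq]
  have ht0 : 0 < |t| := abs_pos.2 ht
  have hY : |8 * Real.pi ^ 3 * t * q| = 8 * Real.pi ^ 3 * |t| := by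
    rw [abs_mul, hq, mul_one, abs_mul, abs_of_pos (by positivity)]
  rw [hY] at hvdc
  have hden : 2 * (√|t| * √N) ≤ √(8 * Real.pi ^ 3 * |t| * N) := by
    have hpi : 1 ≤ Real.pi ^ 3 := one_le_pow₀ (by linarith [Real.pi_gt_three])
    rw [← Real.sqrt_mul ht0.le, show (2 : ℝ) = √4 by
      rw [show (4 : ℝ) = 2 ^ 2 by norm_num, Real.sqrt_sq (by norm_num)], ← Real.sqrt_mul (by norm_num)]
    refine Real.sqrt_le_sqrt ?_
    have : 0 < |t| * N := by positivity
    nlinarith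
  have hst : 0 < √|t| := Real.sqrt_pos.2 ht0
  have hsN : 0 < √N := Real.sqrt_pos.2 hNpos
  have hg : (1 / (2 * |t|)) ^ (1 / 2 : ℝ) ≤ 1 / √|t| := by
    rw [← Real.sqrt_eq_rpow, Real.sqrt_div (by norm_num), Real.sqrt_one]
    exact one_div_le_one_div_of_le hst (Real.sqrt_le_sqrt (by linarith))
  calc _ ≤ (1 / √|t|) * (20 * (3 * M * √N) / (2 * (√|t| * √N))) := by
        refine mul_le_mul hg (hvdc.trans ?_) (norm_nonneg _) (by positivity)
        exact div_le_div_of_nonneg_left (by positivity) (by positivity) hden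
    _ = 30 * M / (√|t| * √|t|) := by field_simp; ring
    _ = 30 * M / |t| := by rw [Real.mul_self_sqrt ht0.le]
    _ ≤ _ := by gcongr; norm_num

/-- Absolute values only: an interval of length N times an integrand of size M√(N/|t|). -/
theorem half_band_trivial {j : ℕ} {α : ℝ → ℂ} {M X Y t q : ℝ} (hα : BandAmplitude (j + 1) α M)
    (ht : t ≠ 0) (hq : |q| = 1) :
    ‖∫ p in (2 : ℝ) ^ j..2 ^ (j + 1), α (p * q) * gaussFactor t (p * q) *
      cubicPhase X Y (p * q)‖ ≤ 40 * M * ((2 : ℝ) ^ j) ^ (3 / 2 : ℝ) / √|t| := by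
  set N : ℝ := 2 ^ j with hN
  have hNpos : 0 < N := by positivity
  have hN2 : (2 : ℝ) ^ (j + 1) = 2 * N := by rw [hN]; ring
  have hNle : N ≤ 2 ^ (j + 1) := by rw [hN2]; linarith
  have ht0 : 0 < |t| := abs_pos.2 ht
  have hM0 : 0 ≤ M := (norm_nonneg _).trans
    (hα.norm_le _ (mem_closedBand_mul_unit hq (left_mem_Icc.2 hNle)))
  have h1 := intervalIntegral.norm_integral_le_of_norm_le_const (a := N) (b := 2 ^ (j + 1))
    (C := M * (√N / √|t|)) (f := fun p => α (p * q) * gaussFactor t (p * q) *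
      cubicPhase X Y (p * q)) (fun p hp => by
        rw [uIoc_of_le hNle] at hp
        have hpp : 0 < p := hNpos.trans hp.1
        have habs : |p * q| = p := by rw [abs_mul, hq, mul_one, abs_of_pos hpp]
        rw [norm_mul, norm_mul, norm_cubicPhase, mul_one, norm_gaussFactor, habs,
          ← Real.sqrt_eq_rpow, ← Real.sqrt_div hNpos.le]
        refine mul_le_mul (hα.norm_le _ (mem_closedBand_mul_unit hq ⟨hp.1.le, hp.2⟩))
          (Real.sqrt_le_sqrt ?_) (Real.sqrt_nonneg _) hM0
        rw [div_le_div_iff₀ (by positivity) ht0]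
        nlinarith [hp.2])
  refine h1.trans ?_
  rw [hN2, show 2 * N - N = N by ring, abs_of_pos hNpos]
  have : N ^ (3 / 2 : ℝ) = N * √N := by
    rw [Real.sqrt_eq_rpow, ← Real.rpow_one_add' hNpos.le (by norm_num)]; norm_num
  rw [this]
  calc M * (√N / √|t|) * N = 1 * (M * (N * √N) / √|t|) := by ring
    _ ≤ 40 * (M * (N * √N) / √|t|) := by gcongr; norm_num
    _ = _ := by ring

theorem integral_band_succ (j : ℕ) {F : ℝ → ℂ} (hF : Integrable ((band (j + 1)).indicator F)) :
    ∫ p, (band (j + 1)).indicator F p =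
      (∫ p in (2 : ℝ) ^ j..2 ^ (j + 1), F (p * -1)) + ∫ p in (2 : ℝ) ^ j..2 ^ (j + 1), F (p * 1) := by
  have hNle : (2 : ℝ) ^ j ≤ 2 ^ (j + 1) := pow_le_pow_right₀ (by norm_num) (by omega)
  have hpos : (0 : ℝ) < 2 ^ j := by positivity
  have key : ∀ q : ℝ, |q| = 1 → ∫ p in Ioi 0, (band (j + 1)).indicator F (p * q) =
      ∫ p in (2 : ℝ) ^ j..2 ^ (j + 1), F (p * q) := by
    intro q hq
    rw [intervalIntegral.integral_of_le hNle, ← integral_Ico_eq_integral_Ioc,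
      ← integral_indicator measurableSet_Ico, ← integral_indicator measurableSet_Ioi]
    congr 1; ext p
    by_cases hp : 0 < p
    · rw [indicator_of_mem (show p ∈ Ioi 0 from hp)]
      have habs : |p * q| = p := by rw [abs_mul, hq, mul_one, abs_of_pos hp]
      have hiff : p * q ∈ band (j + 1) ↔ p ∈ Ico ((2 : ℝ) ^ j) (2 ^ (j + 1)) := by
        show (_ ≤ |p * q| ∧ |p * q| < _) ↔ _
        rw [habs]; rfl
      by_cases hb : p ∈ Ico ((2 : ℝ) ^ j) (2 ^ (j + 1))
      · rw [indicator_of_mem hb, indicator_of_mem (hiff.2 hb)]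
      · rw [indicator_of_notMem hb, indicator_of_notMem (fun h => hb (hiff.1 h))]
    · rw [indicator_of_notMem (show p ∉ Ioi 0 from hp), indicator_of_notMem]
      exact fun h => hp (hpos.trans_le h.1)
  rw [← intervalIntegral.integral_Iic_add_Ioi (b := 0) hF.integrableOn hF.integrableOn,
    ← key (-1) (by simp), ← key 1 (by simp)]
  congr 1
  · have := integral_comp_neg_Ioi 0 ((band (j + 1)).indicator F)
    rw [neg_zero] at this
    rw [← this]; simp
  · simp

/-- Uniform dispersive bound for the kernel of a dyadic band. -/
theorem band_dispersive {k : ℕ} {α : ℝ → ℂ} {M ν X t : ℝ} (hα : BandAmplitude k α M)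
    (hν : 0 ≤ ν) (hν' : ν ≤ 1 / 2) (ht : t ≠ 0) (ht2 : |t| ≤ 2) :
    ‖∫ p, (band k).indicator α p * gaussFactor t p * cubicPhase X (8 * Real.pi ^ 3 * t) p‖ ≤
      80 * M * (2 ^ k : ℝ) ^ (3 * ν) * |t| ^ (-1 + ν) := by
  have ht0 : 0 < |t| := abs_pos.2 ht
  have hst : 0 < √|t| := Real.sqrt_pos.2 ht0
  have hsplit : ∀ p, (band k).indicator α p * gaussFactor t p * cubicPhase X (8 * Real.pi ^ 3 * t) p
      = (band k).indicator
        (fun p => α p * gaussFactor t p * cubicPhase X (8 * Real.pi ^ 3 * t) p) p := fun p => by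
    by_cases hp : p ∈ band k
    · rw [indicator_of_mem hp, indicator_of_mem hp]
    · rw [indicator_of_notMem hp, indicator_of_notMem hp, zero_mul, zero_mul]
  simp_rw [hsplit]
  set F : ℝ → ℂ := fun p => α p * gaussFactor t p * cubicPhase X (8 * Real.pi ^ 3 * t) p with hF
  have hM0 : 0 ≤ M := by
    refine (norm_nonneg _).trans (hα.norm_le (2 ^ k) ?_)
    cases k with
    | zero => simp [closedBand]
    | succ k =>
      refine ⟨?_, ?_⟩ <;> rw [abs_of_pos (by positivity)]
      exact pow_le_pow_right₀ (by norm_num) (by omega)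
  have hFb : ∀ p, ‖(band k).indicator F p‖ ≤
      (Icc (-(2 : ℝ) ^ k) (2 ^ k)).indicator (fun _ => M * √((2 : ℝ) ^ k / (2 * |t|))) p := by
    intro p
    by_cases hp : p ∈ band k
    · have h1 := (abs_lt_of_mem_band hp).le
      rw [indicator_of_mem hp, indicator_of_mem (show p ∈ Icc (-(2 : ℝ) ^ k) (2 ^ k) from abs_le.1 h1)]
      simp only [hF]
      rw [norm_mul, norm_mul, norm_cubicPhase, mul_one, norm_gaussFactor, ← Real.sqrt_eq_rpow]
      refine mul_le_mul (hα.norm_le p (band_subset_closedBand k hp)) (Real.sqrt_le_sqrt ?_)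
        (Real.sqrt_nonneg _) hM0
      gcongr
    · rw [indicator_of_notMem hp, norm_zero]
      exact indicator_nonneg (fun _ _ => by positivity) _
  have hbint : Integrable ((Icc (-(2 : ℝ) ^ k) (2 ^ k)).indicator
      (fun _ => M * √((2 : ℝ) ^ k / (2 * |t|)))) :=
    (integrable_indicator_iff measurableSet_Icc).2 (integrableOn_const (by simp))
  cases k with
  | zero =>
    -- On the band 0 the second derivative of the phase degenerates at p = 0, but the band has
    -- bounded length, so absolute values give |t|^{-1/2}; |t| ≤ 2 turns this into a multiple of
    -- |t|^{-1+ν}.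
    have h1 : ‖∫ p, (band 0).indicator F p‖ ≤ 2 * (M * √(1 / (2 * |t|))) := by
      refine (norm_integral_le_of_norm_le hbint (ae_of_all _ hFb)).trans ?_
      rw [integral_indicator measurableSet_Icc]
      simp; norm_num
    have h2 : √(1 / (2 * |t|)) ≤ 1 / √|t| := by
      rw [Real.sqrt_div (by norm_num), Real.sqrt_one]
      exact one_div_le_one_div_of_le hst (Real.sqrt_le_sqrt (by linarith))
    have h3 : 1 / √|t| ≤ 2 * |t| ^ (-1 + ν) := by
      have : 1 / √|t| = |t| ^ (1 / 2 - ν) * |t| ^ (-1 + ν) := by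
        rw [← Real.rpow_add ht0, Real.sqrt_eq_rpow, one_div, ← Real.rpow_neg ht0.le]
        congr 1; ring
      rw [this]
      refine mul_le_mul_of_nonneg_right ?_ (by positivity)
      calc |t| ^ (1 / 2 - ν) ≤ 2 ^ (1 / 2 - ν) := Real.rpow_le_rpow ht0.le ht2 (by linarith)
        _ ≤ 2 ^ (1 : ℝ) := Real.rpow_le_rpow_of_exponent_le (by norm_num) (by linarith)
        _ = 2 := Real.rpow_one 2
    have h4 : 0 ≤ |t| ^ (-1 + ν) := by positivity
    calc _ ≤ 2 * (M * (2 * |t| ^ (-1 + ν))) := h1.trans (by gcongr; exact h2.trans h3)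
      _ ≤ 80 * M * ((2 : ℝ) ^ 0) ^ (3 * ν) * |t| ^ (-1 + ν) := by
        rw [pow_zero, Real.one_rpow]
        nlinarith [mul_nonneg hM0 h4]
  | succ j =>
    have hFm : AEStronglyMeasurable ((band (j + 1)).indicator F) := by
      apply Measurable.aestronglyMeasurable
      refine Measurable.indicator ?_ (measurableSet_band _)
      have h1 := hα.contDiff.continuous.measurable
      have h2 := (continuous_cubicPhase X (8 * Real.pi ^ 3 * t)).measurable
      have h3 : Measurable (gaussFactor t) := by unfold gaussFactor; fun_prop
      fun_prop
    rw [integral_band_succ j (hbint.mono' hFm (ae_of_all _ hFb))]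
    set N : ℝ := 2 ^ j with hN
    have hNpos : 0 < N := by positivity
    -- From y ≤ A and y ≤ B follows y ≤ A^{1-2ν} B^{2ν}. With A = 1/|t| and B = N^{3/2}|t|^{-1/2}
    -- the exponent of |t| is -(1 - 2ν) - ν = -1 + ν and that of N is 3ν.
    set y : ℝ := min (1 / |t|) (N ^ (3 / 2 : ℝ) / √|t|) with hy
    have hy0 : 0 < y := lt_min (by positivity) (by positivity)
    have hboth : ∀ q : ℝ, |q| = 1 → ‖∫ p in N..2 ^ (j + 1), F (p * q)‖ ≤ 40 * M * y := by
      intro q hq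
      rw [hy, mul_min_of_nonneg _ _ (by positivity)]
      refine le_min ?_ ?_
      · have := half_band_dispersive (X := X) hα ht hq
        rwa [mul_one_div]
      · have := half_band_trivial (X := X) (Y := 8 * Real.pi ^ 3 * t) hα ht hq
        rwa [mul_div_assoc] at this
    have hyle : y ≤ (2 ^ (j + 1) : ℝ) ^ (3 * ν) * |t| ^ (-1 + ν) := by
      calc y = y ^ (1 - 2 * ν) * y ^ (2 * ν) := by
            rw [← Real.rpow_add hy0]; ring_nf; rw [Real.rpow_one]
        _ ≤ (1 / |t|) ^ (1 - 2 * ν) * (N ^ (3 / 2 : ℝ) / √|t|) ^ (2 * ν) := by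
            refine mul_le_mul (Real.rpow_le_rpow hy0.le (min_le_left _ _) (by linarith))
              (Real.rpow_le_rpow hy0.le (min_le_right _ _) (by linarith)) (by positivity)
              (by positivity)
        _ = N ^ (3 * ν) * |t| ^ (-1 + ν) := by
            rw [Real.div_rpow (by positivity) hst.le, ← Real.rpow_mul hNpos.le, Real.sqrt_eq_rpow,
              ← Real.rpow_mul ht0.le, one_div, Real.inv_rpow ht0.le, ← Real.rpow_neg ht0.le,
              div_eq_mul_inv, ← Real.rpow_neg ht0.le, mul_left_comm, ← Real.rpow_add ht0]
            congr 2 <;> ring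
        _ ≤ _ := by
            refine mul_le_mul_of_nonneg_right (Real.rpow_le_rpow hNpos.le ?_ (by linarith))
              (by positivity)
            rw [hN]; exact pow_le_pow_right₀ (by norm_num) (by omega)
    calc _ ≤ 40 * M * y + 40 * M * y := (norm_add_le _ _).trans
          (add_le_add (hboth (-1) (by simp)) (hboth 1 (by simp)))
      _ = 80 * M * y := by ring
      _ ≤ 80 * M * ((2 ^ (j + 1) : ℝ) ^ (3 * ν) * |t| ^ (-1 + ν)) := by gcongr
      _ = _ := by ring

/-- Dispersive estimate on a dyadic band. -/
theorem norm_fourier_band_le {k : ℕ} {α : ℝ → ℂ} {M ν t : ℝ} (hα : BandAmplitude k α M)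
    (hν : 0 ≤ ν) (hν' : ν ≤ 1 / 2) (ht : t ≠ 0) (ht2 : |t| ≤ 2)
    {Ψ : Plane → ℂ} (hΨ : Integrable Ψ) (hψ : Integrable (𝓕⁻ Ψ)) (z : Plane) :
    ‖𝓕 (fun ζ : Plane => (band k).indicator α (ζ 0) * prop t ζ * 𝓕⁻ Ψ ζ) z‖ ≤
      80 * M * (2 ^ k : ℝ) ^ (3 * ν) * |t| ^ (-1 + ν) * ∫ w, ‖Ψ w‖ := by
  refine norm_fourier_prop_le (R := 2 ^ k) (M := M)
    (hα.contDiff.continuous.measurable.indicator (measurableSet_band k)) (fun p => ?_)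
    (fun p hp => indicator_of_notMem (fun h => (abs_lt_of_mem_band h).not_gt hp) _) ht
    (fun X => band_dispersive hα hν hν' ht ht2) hΨ hψ z
  by_cases hp : p ∈ band k
  · rw [indicator_of_mem hp]
    exact hα.norm_le p (band_subset_closedBand k hp)
  · rw [indicator_of_notMem hp, norm_zero]
    refine (norm_nonneg _).trans (hα.norm_le (2 ^ k) ?_)
    cases k with
    | zero => simp [closedBand]
    | succ k =>
      refine ⟨?_, ?_⟩ <;> rw [abs_of_pos (by positivity)]
      exact pow_le_pow_right₀ (by norm_num) (by omega)

/-! ### The `TT*` argument -/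

section TTstar

variable {Ω H : Type*} [MeasurableSpace Ω] [NormedAddCommGroup H] [InnerProductSpace ℂ H]

theorem enorm_inner_le (x y : H) : ‖inner ℂ x y‖ₑ ≤ ‖x‖ₑ * ‖y‖ₑ := by
  rw [← ofReal_norm, ← ofReal_norm, ← ofReal_norm, ← ENNReal.ofReal_mul (norm_nonneg _)]
  exact ENNReal.ofReal_le_ofReal (norm_inner_le_norm x y)

/-- Schur's test in TT* form. With c = ⟨e, φ⟩ and w = ∫ c e, the integral S of |c|² is ⟨φ, w⟩, hence
S ≤ ‖w‖‖φ‖, while ‖w‖² is bounded by a quadratic form in |c| whose kernel has row integrals at most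
B. The factor 2 is that of ab ≤ a² + b². The bound R does not enter the constant: it makes w exist
and S finite, so that S can be cancelled. -/
theorem lintegral_inner_sq_le [CompleteSpace H] {μ : Measure Ω} [IsFiniteMeasure μ] {e : Ω → H}
    (he : StronglyMeasurable e) {R : ℝ} (hR : ∀ t, ‖e t‖ ≤ R) {B : ℝ≥0∞}
    (hκ : ∀ t, ∫⁻ t', ‖inner ℂ (e t) (e t')‖ₑ ∂μ ≤ B) (φ : H) :
    ∫⁻ t, ‖inner ℂ (e t) φ‖ₑ ^ 2 ∂μ ≤ 2 * B * ‖φ‖ₑ ^ 2 := by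
  set c : Ω → ℂ := fun t => inner ℂ (e t) φ with hc
  have hcm : StronglyMeasurable c := he.inner stronglyMeasurable_const
  have hcb : ∀ t, ‖c t‖ ≤ R * ‖φ‖ := fun t =>
    (norm_inner_le_norm _ _).trans (mul_le_mul_of_nonneg_right (hR t) (norm_nonneg _))
  have hce : Integrable (fun t => c t • e t) μ := by
    refine Integrable.of_bound (hcm.smul he).aestronglyMeasurable (R * ‖φ‖ * R) (ae_of_all _ fun t => ?_)
    rw [norm_smul]
    exact mul_le_mul (hcb t) (hR t) (norm_nonneg _) ((norm_nonneg _).trans (hcb t))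
  set w : H := ∫ t, c t • e t ∂μ with hw
  set S : ℝ≥0∞ := ∫⁻ t, ‖c t‖ₑ ^ 2 ∂μ with hS
  have hSfin : S ≠ ⊤ := by
    refine ne_top_of_le_ne_top (b := ∫⁻ _, (ENNReal.ofReal (R * ‖φ‖)) ^ 2 ∂μ) ?_ ?_
    · rw [lintegral_const]
      exact ENNReal.mul_ne_top (by simp) (measure_ne_top _ _)
    · refine lintegral_mono fun t => ?_
      gcongr
      rw [← ofReal_norm]
      exact ENNReal.ofReal_le_ofReal (hcb t)
  -- pairing with `φ`
  have h1 : S ≤ ‖w‖ₑ * ‖φ‖ₑ := by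
    have e1 : inner ℂ φ w = ∫ t, ((‖c t‖ ^ 2 : ℝ) : ℂ) ∂μ := by
      rw [hw, ← integral_inner hce]
      congr 1; ext t
      rw [inner_smul_right, ← inner_conj_symm φ (e t)]
      show c t * (starRingEnd ℂ) (c t) = _
      rw [Complex.mul_conj, Complex.normSq_eq_norm_sq]
    have e2 : ‖inner ℂ φ w‖ₑ = S := by
      rw [e1, integral_complex_ofReal, ← ofReal_norm, Complex.norm_real, Real.norm_of_nonneg
        (integral_nonneg fun t => by positivity), ofReal_integral_eq_lintegral_ofReal]
      · refine lintegral_congr fun t => ?_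
        rw [ENNReal.ofReal_pow (norm_nonneg _), ofReal_norm]
      · refine Integrable.of_bound (hcm.norm.pow 2).aestronglyMeasurable ((R * ‖φ‖) ^ 2)
          (ae_of_all _ fun t => ?_)
        rw [Real.norm_of_nonneg (by positivity)]
        exact pow_le_pow_left₀ (norm_nonneg _) (hcb t) 2
      · exact ae_of_all _ fun t => by positivity
    rw [← e2, mul_comm]
    exact enorm_inner_le φ w
  -- the norm of `w`
  have hkm : Measurable (fun p : Ω × Ω => ‖inner ℂ (e p.1) (e p.2)‖ₑ) :=
    ((he.comp_measurable measurable_fst).inner (he.comp_measurable measurable_snd)).enorm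
  have hcm' : Measurable (fun t => ‖c t‖ₑ) := hcm.enorm
  have h2 : ‖w‖ₑ ^ 2 ≤ ∫⁻ t, ∫⁻ t', ‖c t‖ₑ * ‖c t'‖ₑ * ‖inner ℂ (e t) (e t')‖ₑ ∂μ ∂μ := by
    have e1 : ‖w‖ₑ ^ 2 = ‖inner ℂ w w‖ₑ := by
      rw [inner_self_eq_norm_sq_to_K, enorm_pow, ← ofReal_norm w, ← ofReal_norm, RCLike.norm_ofReal,
        abs_norm]
    rw [e1]
    nth_rewrite 2 [hw]
    rw [← integral_inner hce]
    refine (enorm_integral_le_lintegral_enorm _).trans (lintegral_mono fun t => ?_)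
    rw [inner_smul_right, enorm_mul, ← inner_conj_symm, RCLike.enorm_conj, hw, ← integral_inner hce]
    calc ‖c t‖ₑ * ‖∫ t', inner ℂ (e t) (c t' • e t') ∂μ‖ₑ
        ≤ ‖c t‖ₑ * ∫⁻ t', ‖c t'‖ₑ * ‖inner ℂ (e t) (e t')‖ₑ ∂μ := by
          gcongr
          refine (enorm_integral_le_lintegral_enorm _).trans (lintegral_mono fun t' => ?_)
          rw [inner_smul_right, enorm_mul]
      _ = _ := by
          rw [← lintegral_const_mul _ (by fun_prop)]
          simp_rw [mul_assoc]
  have h3 : ∫⁻ t, ∫⁻ t', ‖c t‖ₑ * ‖c t'‖ₑ * ‖inner ℂ (e t) (e t')‖ₑ ∂μ ∂μ ≤ 2 * B * S := by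
    have hA : ∫⁻ t, ∫⁻ t', ‖c t‖ₑ ^ 2 * ‖inner ℂ (e t) (e t')‖ₑ ∂μ ∂μ ≤ B * S := by
      rw [hS, ← lintegral_const_mul _ (by fun_prop)]
      refine lintegral_mono fun t => ?_
      rw [lintegral_const_mul _ (by fun_prop), mul_comm]
      gcongr
      exact hκ t
    have hA' : ∫⁻ t, ∫⁻ t', ‖c t'‖ₑ ^ 2 * ‖inner ℂ (e t) (e t')‖ₑ ∂μ ∂μ ≤ B * S := by
      rw [lintegral_lintegral_swap]
      · refine le_trans (lintegral_mono fun t => lintegral_mono fun t' => ?_) hA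
        rw [← inner_conj_symm, RCLike.enorm_conj]
      · exact (((hcm'.comp measurable_snd).pow_const 2).mul hkm).aemeasurable
    have hpt : ∀ a b k : ℝ≥0∞, a * b * k ≤ a ^ 2 * k + b ^ 2 * k := by
      intro a b k
      rw [← add_mul]
      gcongr
      rcases le_total a b with h | h
      · calc a * b ≤ b * b := by gcongr
          _ = b ^ 2 := (sq b).symm
          _ ≤ _ := le_add_self
      · calc a * b ≤ a * a := by gcongr
          _ = a ^ 2 := (sq a).symm
          _ ≤ _ := le_self_add
    calc _ ≤ ∫⁻ t, ∫⁻ t', (‖c t‖ₑ ^ 2 * ‖inner ℂ (e t) (e t')‖ₑ +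
            ‖c t'‖ₑ ^ 2 * ‖inner ℂ (e t) (e t')‖ₑ) ∂μ ∂μ :=
          lintegral_mono fun t => lintegral_mono fun t' => hpt _ _ _
      _ = (∫⁻ t, ∫⁻ t', ‖c t‖ₑ ^ 2 * ‖inner ℂ (e t) (e t')‖ₑ ∂μ ∂μ) +
            ∫⁻ t, ∫⁻ t', ‖c t'‖ₑ ^ 2 * ‖inner ℂ (e t) (e t')‖ₑ ∂μ ∂μ := by
          rw [← lintegral_add_left]
          · refine lintegral_congr fun t => ?_
            rw [lintegral_add_left (by fun_prop)]
          · exact Measurable.lintegral_prod_right'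
              (f := fun p : Ω × Ω => ‖c p.1‖ₑ ^ 2 * ‖inner ℂ (e p.1) (e p.2)‖ₑ)
              (((hcm'.comp measurable_fst).pow_const 2).mul hkm)
      _ ≤ B * S + B * S := by gcongr
      _ = 2 * B * S := by ring
  by_cases hS0 : S = 0
  · rw [hS0]; exact zero_le
  have h4 : S * S ≤ (2 * B * ‖φ‖ₑ ^ 2) * S := by
    calc S * S ≤ (‖w‖ₑ * ‖φ‖ₑ) * (‖w‖ₑ * ‖φ‖ₑ) := mul_le_mul' h1 h1
      _ = ‖w‖ₑ ^ 2 * ‖φ‖ₑ ^ 2 := by ring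
      _ ≤ (2 * B * S) * ‖φ‖ₑ ^ 2 := by gcongr; exact h2.trans h3
      _ = _ := by ring
  exact (ENNReal.mul_le_mul_iff_left hS0 hSfin).1 h4

/-- The `L^q` version, for the measure with density `|⟨e, φ⟩|^{q-2}`. -/
theorem lintegral_inner_rpow_le [CompleteSpace H] {μ : Measure Ω} [IsFiniteMeasure μ] {e : Ω → H}
    (he : StronglyMeasurable e) {R : ℝ} (hR : ∀ t, ‖e t‖ ≤ R) {B : ℝ≥0∞} {q : ℝ} (hq : 2 ≤ q)
    (hκ : ∀ t, ∫⁻ t', ‖inner ℂ (e t) (e t')‖ₑ ^ (q / 2) ∂μ ≤ B) (φ : H) :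
    ∫⁻ t, ‖inner ℂ (e t) φ‖ₑ ^ q ∂μ ≤ 2 ^ (q / 2) * B * ‖φ‖ₑ ^ q := by
  rcases hq.eq_or_lt with rfl | hq
  · have := lintegral_inner_sq_le (μ := μ) he hR (B := B) (fun t => by simpa using hκ t) φ
    simpa using this
  have hq0 : 0 < q := by linarith
  set m : Ω → ℝ≥0∞ := fun t => ‖inner ℂ (e t) φ‖ₑ with hm
  have hmm : Measurable m := (he.inner stronglyMeasurable_const).enorm
  have hmb : ∀ t, m t ≤ ENNReal.ofReal R * ‖φ‖ₑ := fun t => by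
    refine (enorm_inner_le _ _).trans ?_
    gcongr
    rw [← ofReal_norm]
    exact ENNReal.ofReal_le_ofReal (hR t)
  have hbfin : ENNReal.ofReal R * ‖φ‖ₑ ≠ ⊤ := ENNReal.mul_ne_top (by simp) (by simp)
  have hpowfin : ∀ r : ℝ, 0 ≤ r → ∫⁻ t, m t ^ r ∂μ ≠ ⊤ := by
    intro r hr
    refine ne_top_of_le_ne_top (b := ∫⁻ _, (ENNReal.ofReal R * ‖φ‖ₑ) ^ r ∂μ) ?_ ?_
    · rw [lintegral_const]
      exact ENNReal.mul_ne_top (ENNReal.rpow_ne_top_of_nonneg hr hbfin) (measure_ne_top _ _)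
    · exact lintegral_mono fun t => ENNReal.rpow_le_rpow (hmb t) hr
  set S : ℝ≥0∞ := ∫⁻ t, m t ^ q ∂μ with hS
  have hSfin : S ≠ ⊤ := hpowfin q hq0.le
  -- The L² integral of m against ν is its L^q integral S against μ. The row integrals against ν are
  -- controlled by Hölder with exponents q/2 and q/(q-2), which produces S^{(q-2)/q}; this power is
  -- then cancelled against the left side.
  set ν : Measure Ω := μ.withDensity (fun t => m t ^ (q - 2)) with hν
  have : IsFiniteMeasure ν := isFiniteMeasure_withDensity (hpowfin (q - 2) (by linarith))
  have hdens : Measurable (fun t => m t ^ (q - 2)) := hmm.pow_const _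
  have hkm : ∀ t, Measurable (fun t' => ‖inner ℂ (e t) (e t')‖ₑ) := fun t =>
    (stronglyMeasurable_const.inner he).enorm
  have hholder : ∀ t, ∫⁻ t', ‖inner ℂ (e t) (e t')‖ₑ ∂ν ≤ B ^ (2 / q) * S ^ ((q - 2) / q) := by
    intro t
    rw [hν, lintegral_withDensity_eq_lintegral_mul _ hdens (hkm t)]
    have hpq : (q / 2).HolderConjugate (q / (q - 2)) := by
      rw [Real.holderConjugate_iff]
      refine ⟨by linarith, ?_⟩
      field_simp
      ring
    have h1 := ENNReal.lintegral_mul_le_Lp_mul_Lq μ hpq (hkm t).aemeasurable hdens.aemeasurable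
    refine le_trans (le_of_eq ?_) (h1.trans (mul_le_mul' ?_ ?_))
    · refine lintegral_congr fun t' => ?_
      simp only [Pi.mul_apply]; rw [mul_comm]
    · rw [one_div_div]
      exact ENNReal.rpow_le_rpow (hκ t) (by positivity)
    · rw [one_div_div, hS]
      refine ENNReal.rpow_le_rpow (lintegral_mono fun t' => ?_) (div_nonneg (by linarith) hq0.le)
      rw [← ENNReal.rpow_mul, mul_div_cancel₀]
      linarith
  have hmain := lintegral_inner_sq_le (μ := ν) he hR hholder φ
  have hleft : ∫⁻ t, ‖inner ℂ (e t) φ‖ₑ ^ 2 ∂ν = S := by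
    rw [hν, lintegral_withDensity_eq_lintegral_mul _ hdens (hmm.pow_const 2)]
    refine lintegral_congr fun t => ?_
    simp only [Pi.mul_apply]
    rw [← ENNReal.rpow_natCast, ← ENNReal.rpow_add_of_nonneg _ _ (by linarith) (by norm_num)]
    norm_num
  rw [hleft] at hmain
  by_cases hS0 : S = 0
  · rw [hS0]; exact zero_le
  have hSp : S = S ^ (2 / q) * S ^ ((q - 2) / q) := by
    rw [← ENNReal.rpow_add _ _ hS0 hSfin, ← add_div, add_sub_cancel, div_self hq0.ne', ENNReal.rpow_one]
  have hcancel : S ^ (2 / q) ≤ 2 * B ^ (2 / q) * ‖φ‖ₑ ^ 2 := by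
    refine (ENNReal.mul_le_mul_iff_left (c := S ^ ((q - 2) / q)) ?_ ?_).1 ?_
    · exact (ENNReal.rpow_pos (pos_iff_ne_zero.2 hS0) hSfin).ne'
    · exact ENNReal.rpow_ne_top_of_nonneg (div_nonneg (by linarith) hq0.le) hSfin
    · rw [← hSp]
      refine hmain.trans (le_of_eq ?_)
      ring
  calc S = (S ^ (2 / q)) ^ (q / 2) := by
        rw [← ENNReal.rpow_mul, div_mul_div_cancel₀ hq0.ne', div_self (by norm_num), ENNReal.rpow_one]
    _ ≤ (2 * B ^ (2 / q) * ‖φ‖ₑ ^ 2) ^ (q / 2) := ENNReal.rpow_le_rpow hcancel (by positivity)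
    _ = _ := by
        rw [ENNReal.mul_rpow_of_nonneg _ _ (by positivity), ENNReal.mul_rpow_of_nonneg _ _ (by positivity),
          ← ENNReal.rpow_mul, div_mul_div_cancel₀ hq0.ne', div_self (by norm_num), ENNReal.rpow_one,
          ← ENNReal.rpow_natCast, ← ENNReal.rpow_mul]
        congr 2
        push_cast; ring

/-- A measurable selection maximising `|⟨e j t, φ⟩|` over `j ≤ n`. -/
theorem exists_maximising_selection {e : ℕ → Ω → H} (he : ∀ j, StronglyMeasurable (e j))
    {R : ℕ → ℝ} (hR : ∀ j t, ‖e j t‖ ≤ R j) (φ : H) (n : ℕ) :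
    ∃ f : Ω → H, StronglyMeasurable f ∧ (∃ C, ∀ t, ‖f t‖ ≤ C) ∧ (∀ t, ∃ j, f t = e j t) ∧
      ∀ t, ∀ j ≤ n, ‖inner ℂ (e j t) φ‖ₑ ≤ ‖inner ℂ (f t) φ‖ₑ := by
  classical
  induction n with
  | zero =>
    refine ⟨e 0, he 0, ⟨R 0, hR 0⟩, fun t => ⟨0, rfl⟩, fun t j hj => ?_⟩
    rw [Nat.le_zero.1 hj]
  | succ n ih =>
    obtain ⟨f, hf, ⟨C, hC⟩, hfj, hmax⟩ := ih
    set A : Set Ω := {t | ‖inner ℂ (f t) φ‖ₑ < ‖inner ℂ (e (n + 1) t) φ‖ₑ} with hA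
    have hAm : MeasurableSet A := measurableSet_lt (hf.inner stronglyMeasurable_const).enorm
      ((he (n + 1)).inner stronglyMeasurable_const).enorm
    refine ⟨A.piecewise (e (n + 1)) f, (he (n + 1)).piecewise hAm hf, ⟨max C (R (n + 1)), fun t => ?_⟩,
      fun t => ?_, fun t j hj => ?_⟩
    · by_cases ht : t ∈ A
      · rw [piecewise_eq_of_mem _ _ _ ht]; exact (hR _ t).trans (le_max_right _ _)
      · rw [piecewise_eq_of_notMem _ _ _ ht]; exact (hC t).trans (le_max_left _ _)
    · by_cases ht : t ∈ A
      · exact ⟨n + 1, piecewise_eq_of_mem _ _ _ ht⟩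
      · rw [piecewise_eq_of_notMem _ _ _ ht]; exact hfj t
    · by_cases ht : t ∈ A
      · rw [piecewise_eq_of_mem _ _ _ ht]
        rcases Nat.le_succ_iff.1 hj with h | h
        · exact (hmax t j h).trans (le_of_lt ht)
        · rw [h]
      · rw [piecewise_eq_of_notMem _ _ _ ht]
        rcases Nat.le_succ_iff.1 hj with h | h
        · exact hmax t j h
        · rw [h]; exact not_lt.1 ht

/-- Maximal `TT*` estimate for a countable family. -/
theorem lintegral_iSup_inner_rpow_le [CompleteSpace H] {μ : Measure Ω} [IsFiniteMeasure μ] {e : ℕ → Ω → H}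
    (he : ∀ j, StronglyMeasurable (e j)) {R : ℕ → ℝ} (hR : ∀ j t, ‖e j t‖ ≤ R j)
    {κ : Ω → Ω → ℝ≥0∞} {B : ℝ≥0∞} {q : ℝ} (hq : 2 ≤ q)
    (hκ : ∀ i j t t', ‖inner ℂ (e i t) (e j t')‖ₑ ≤ κ t t')
    (hB : ∀ t, ∫⁻ t', κ t t' ^ (q / 2) ∂μ ≤ B) (φ : H) :
    ∫⁻ t, (⨆ j, ‖inner ℂ (e j t) φ‖ₑ) ^ q ∂μ ≤ 2 ^ (q / 2) * B * ‖φ‖ₑ ^ q := by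
  have hmono : ∀ t, Monotone (fun n : ℕ => ⨆ j ≤ n, ‖inner ℂ (e j t) φ‖ₑ) := fun t a b hab =>
    biSup_mono fun j hj => hj.trans hab
  have hq0 : 0 < q := by linarith
  have hsup : ∀ t, (⨆ j, ‖inner ℂ (e j t) φ‖ₑ) ^ q =
      ⨆ n : ℕ, (⨆ j ≤ n, ‖inner ℂ (e j t) φ‖ₑ) ^ q := by
    intro t
    have h1 : (⨆ j, ‖inner ℂ (e j t) φ‖ₑ) = ⨆ n : ℕ, ⨆ j ≤ n, ‖inner ℂ (e j t) φ‖ₑ := by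
      refine le_antisymm (iSup_le fun j => ?_) (iSup_le fun n => iSup₂_le fun j _ =>
        le_iSup (fun j => ‖inner ℂ (e j t) φ‖ₑ) j)
      exact le_iSup_of_le j (le_iSup₂_of_le j le_rfl le_rfl)
    rw [h1]
    exact (ENNReal.orderIsoRpow q hq0).map_iSup _
  simp_rw [hsup]
  have hmeas : ∀ j, Measurable (fun t => ‖inner ℂ (e j t) φ‖ₑ) := fun j =>
    ((he j).inner stronglyMeasurable_const).enorm
  rw [lintegral_iSup]
  · refine iSup_le fun n => ?_
    -- The majorant κ is common to all pairs of indices, so the selected vectors satisfy the L^q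
    -- estimate with the same B, independently of n and of C.
    obtain ⟨f, hf, ⟨C, hC⟩, hfj, hmax⟩ := exists_maximising_selection he hR φ n
    refine le_trans (lintegral_mono fun t => ENNReal.rpow_le_rpow
      (iSup₂_le fun j hj => hmax t j hj) hq0.le) (lintegral_inner_rpow_le hf hC hq (fun t => ?_) φ)
    refine le_trans (lintegral_mono fun t' => ENNReal.rpow_le_rpow ?_ (by positivity)) (hB t)
    obtain ⟨i, hi⟩ := hfj t
    obtain ⟨j, hj⟩ := hfj t'
    rw [hi, hj]; exact hκ i j t t'
  · intro n
    exact (Measurable.iSup fun j => Measurable.iSup fun _ => hmeas j).pow_const q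
  · exact fun a b hab t => ENNReal.rpow_le_rpow (hmono t hab) hq0.le

end TTstar

/-! ### Weak derivatives in one variable -/

/-- Test functions on the interval `(0, T)`. -/
structure IsTest (T : ℝ) (η : ℝ → ℝ) : Prop where
  contDiff : ContDiff ℝ ∞ η
  hasCompactSupport : HasCompactSupport η
  tsupport_subset : tsupport η ⊆ Ioo 0 T

theorem IsTest.eq_zero {T : ℝ} {η : ℝ → ℝ} (hη : IsTest T η) {t : ℝ} (ht : t ∉ Ioo 0 T) : η t = 0 :=
  image_eq_zero_of_notMem_tsupport fun h => ht (hη.tsupport_subset h)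

theorem IsTest.deriv_eq_zero {T : ℝ} {η : ℝ → ℝ} (hη : IsTest T η) {t : ℝ} (ht : t ∉ Ioo 0 T) :
    deriv η t = 0 := by
  have : t ∉ tsupport (deriv η) := fun h => ht (hη.tsupport_subset (tsupport_deriv_subset h))
  exact image_eq_zero_of_notMem_tsupport this

theorem IsTest.continuous_deriv {T : ℝ} {η : ℝ → ℝ} (hη : IsTest T η) : Continuous (deriv η) :=
  hη.contDiff.continuous_deriv (by norm_num)

theorem IsTest.exists_bound {T : ℝ} {η : ℝ → ℝ} (hη : IsTest T η) :
    ∃ A, ∀ t, ‖η t‖ ≤ A ∧ ‖deriv η t‖ ≤ A := by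
  obtain ⟨A, hA⟩ := hη.contDiff.continuous.bounded_above_of_compact_support hη.hasCompactSupport
  obtain ⟨A', hA'⟩ := hη.continuous_deriv.bounded_above_of_compact_support hη.hasCompactSupport.deriv
  exact ⟨max A A', fun t => ⟨(hA t).trans (le_max_left _ _), (hA' t).trans (le_max_right _ _)⟩⟩

theorem IsTest.mul_pow {T : ℝ} {η : ℝ → ℝ} (hη : IsTest T η) (n : ℕ) :
    IsTest T (fun t => η t * t ^ n) where
  contDiff := hη.contDiff.mul (contDiff_id.pow n)
  hasCompactSupport := hη.hasCompactSupport.mul_right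
  tsupport_subset := (tsupport_mul_subset_left).trans hη.tsupport_subset

/-- A primitive of a test function with vanishing integral is a test function. -/
theorem exists_primitive {T : ℝ} {g : ℝ → ℝ} (hg : IsTest T g) (h0 : ∫ t, g t = 0) :
    ∃ η, IsTest T η ∧ deriv η = g := by
  have hcont := hg.contDiff.continuous
  have hder : ∀ t, HasDerivAt (fun t => ∫ τ in (0 : ℝ)..t, g τ) (g t) t := fun t =>
    intervalIntegral.integral_hasDerivAt_right (hcont.intervalIntegrable _ _)
      hcont.stronglyMeasurable.stronglyMeasurableAtFilter hcont.continuousAt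
  have hd : deriv (fun t => ∫ τ in (0 : ℝ)..t, g τ) = g := funext fun t => (hder t).deriv
  have hInt : Integrable g := hcont.integrable_of_hasCompactSupport hg.hasCompactSupport
  refine ⟨fun t => ∫ τ in (0 : ℝ)..t, g τ, ?_, hd⟩
  obtain ⟨a, b, ha, hb, hab⟩ : ∃ a b : ℝ, 0 < a ∧ b < T ∧ tsupport g ⊆ Icc a b := by
    rcases (tsupport g).eq_empty_or_nonempty with he | hne
    · exact ⟨1, T - 1, one_pos, by linarith, by simp [he]⟩
    · obtain ⟨a, ha⟩ := hg.hasCompactSupport.isCompact.exists_isLeast hne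
      obtain ⟨b, hb⟩ := hg.hasCompactSupport.isCompact.exists_isGreatest hne
      exact ⟨a, b, (hg.tsupport_subset ha.1).1, (hg.tsupport_subset hb.1).2,
        fun t ht => ⟨ha.2 ht, hb.2 ht⟩⟩
  have hz : ∀ t, t ∉ Icc a b → g t = 0 := fun t ht =>
    image_eq_zero_of_notMem_tsupport fun h => ht (hab h)
  have hsupp : tsupport (fun t => ∫ τ in (0 : ℝ)..t, g τ) ⊆ Icc a b := by
    refine closure_minimal (fun t ht => ?_) isClosed_Icc
    by_contra hcon
    refine ht ?_
    rcases lt_or_ge t a with h | h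
    · refine (intervalIntegral.integral_congr (g := fun _ => 0) fun τ hτ => hz τ ?_).trans (by simp)
      intro hτ'
      have : τ ≤ max 0 t := hτ.2
      have : max 0 t < a := max_lt ha h
      linarith [hτ'.1]
    · have hbt : b < t := by
        by_contra hbt
        exact hcon ⟨h, not_lt.1 hbt⟩
      have e1 : ∫ τ in (0 : ℝ)..t, g τ = ∫ τ, g τ := by
        rw [intervalIntegral.integral_of_le (by linarith), ← integral_indicator measurableSet_Ioc]
        congr 1; ext τ
        by_cases hτ : τ ∈ Ioc 0 t
        · rw [indicator_of_mem hτ]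
        · rw [indicator_of_notMem hτ, hz τ]
          exact fun hτ' => hτ ⟨by linarith [hτ'.1], by linarith [hτ'.2]⟩
      show ∫ τ in (0 : ℝ)..t, g τ = 0
      rw [e1, h0]
  refine ⟨?_, ?_, ?_⟩
  · rw [contDiff_infty_iff_deriv, hd]
    exact ⟨fun t => (hder t).differentiableAt, hg.contDiff⟩
  · exact HasCompactSupport.of_support_subset_isCompact isCompact_Icc (subset_closure.trans hsupp)
  · exact fun t ht => ⟨lt_of_lt_of_le ha (hsupp ht).1, lt_of_le_of_lt (hsupp ht).2 hb⟩

theorem exists_test_integral_one {T : ℝ} (hT : 0 < T) : ∃ ρ, IsTest T ρ ∧ ∫ t, ρ t = 1 := by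
  let f : ContDiffBump (T / 2) := ⟨T / 8, T / 4, by positivity, by linarith⟩
  refine ⟨f.normed volume, ⟨f.contDiff_normed, f.hasCompactSupport_normed, ?_⟩, f.integral_normed⟩
  rw [f.tsupport_normed_eq, Real.closedBall_eq_Icc]
  exact fun t ht => ⟨by have := ht.1; simp only [f] at this; linarith,
    by have := ht.2; simp only [f] at this; linarith⟩

theorem integrableOn_test_smul {T : ℝ} {f : ℝ → ℂ} (hf : IntegrableOn f (Ioo 0 T)) {η : ℝ → ℝ}
    (hc : Continuous η) (hb : ∃ A, ∀ t, ‖η t‖ ≤ A) : IntegrableOn (fun t => (η t : ℂ) * f t) (Ioo 0 T) := by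
  obtain ⟨A, hA⟩ := hb
  exact hf.bdd_mul (c := A) (Complex.continuous_ofReal.comp hc).aestronglyMeasurable
    (ae_of_all _ fun t => by simpa using hA t)

/-- Fubini on the triangle τ < t, together with the fact that η' integrates to -η(τ) over (τ, ∞). -/
theorem integral_deriv_mul_primitive {T : ℝ} {k : ℝ → ℂ} (hk : IntegrableOn k (Ioo 0 T))
    {η : ℝ → ℝ} (hη : IsTest T η) :
    ∫ t in Ioo 0 T, ((deriv η t : ℝ) : ℂ) * ∫ τ in (0 : ℝ)..t, k τ = -∫ t in Ioo 0 T, (η t : ℂ) * k t := by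
  have hk' : Integrable ((Ioo 0 T).indicator k) := (integrable_indicator_iff measurableSet_Ioo).2 hk
  have hη' : Integrable (fun t => ((deriv η t : ℝ) : ℂ)) :=
    (hη.continuous_deriv.integrable_of_hasCompactSupport hη.hasCompactSupport.deriv).ofReal
  set F : ℝ → ℝ → ℂ := fun t τ => (Ioi τ).indicator (fun _ => 1) t *
    (((deriv η t : ℝ) : ℂ) * (Ioo 0 T).indicator k τ) with hF
  have hFint : Integrable (Function.uncurry F) (volume.prod volume) := by
    refine (hη'.mul_prod hk').bdd_mul (c := 1)
      (f := fun p : ℝ × ℝ => (Ioi p.2).indicator (fun _ => (1 : ℂ)) p.1) ?_ (ae_of_all _ fun p => ?_)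
    · have : (fun p : ℝ × ℝ => (Ioi p.2).indicator (fun _ => (1 : ℂ)) p.1) =
          {p : ℝ × ℝ | p.2 < p.1}.indicator (fun _ => 1) := by
        ext p; rfl
      rw [this]
      exact (measurable_const.indicator
        (measurableSet_lt measurable_snd measurable_fst)).aestronglyMeasurable
    · by_cases h : p.1 ∈ Ioi p.2
      · rw [indicator_of_mem h]; simp
      · rw [indicator_of_notMem h]; simp
  have e1 : ∫ t in Ioo 0 T, ((deriv η t : ℝ) : ℂ) * ∫ τ in (0 : ℝ)..t, k τ = ∫ t, ∫ τ, F t τ := by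
    rw [← integral_indicator measurableSet_Ioo]
    congr 1; ext t
    by_cases ht : t ∈ Ioo 0 T
    · rw [indicator_of_mem ht, intervalIntegral.integral_of_le ht.1.le, integral_Ioc_eq_integral_Ioo,
        ← integral_indicator measurableSet_Ioo, ← integral_const_mul]
      congr 1; ext τ
      simp only [hF]
      by_cases h1 : τ < t
      · rw [indicator_of_mem (show t ∈ Ioi τ from h1), one_mul]
        by_cases h0 : 0 < τ
        · rw [indicator_of_mem (show τ ∈ Ioo 0 t from ⟨h0, h1⟩),
            indicator_of_mem (show τ ∈ Ioo 0 T from ⟨h0, h1.trans ht.2⟩)]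
        · rw [indicator_of_notMem (fun h => h0 h.1), indicator_of_notMem (fun h => h0 h.1)]
      · rw [indicator_of_notMem (show t ∉ Ioi τ from h1), zero_mul,
          indicator_of_notMem (fun h => h1 h.2), mul_zero]
    · rw [indicator_of_notMem ht]
      simp [hF, hη.deriv_eq_zero ht]
  have e2 : ∫ t, ∫ τ, F t τ = ∫ τ, ∫ t, F t τ := integral_integral_swap hFint
  have e3 : ∀ τ, ∫ t, F t τ = -((η τ : ℂ) * (Ioo 0 T).indicator k τ) := by
    intro τ
    have h1 : ∀ t, F t τ = (Ioi τ).indicator (fun t => ((deriv η t : ℝ) : ℂ)) t * (Ioo 0 T).indicator k τ := by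
      intro t
      simp only [hF]
      by_cases h : t ∈ Ioi τ
      · rw [indicator_of_mem h, indicator_of_mem h, one_mul]
      · rw [indicator_of_notMem h, indicator_of_notMem h, zero_mul, zero_mul]
    simp_rw [h1]
    rw [integral_mul_const, integral_indicator measurableSet_Ioi, integral_complex_ofReal,
      hη.hasCompactSupport.integral_Ioi_deriv_eq (hη.contDiff.of_le (by norm_num))]
    push_cast; ring
  rw [e1, e2]
  simp_rw [e3]
  rw [integral_neg, ← integral_indicator measurableSet_Ioo]
  congr 2; ext τ
  by_cases h : τ ∈ Ioo 0 T
  · rw [indicator_of_mem h, indicator_of_mem h]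
  · rw [indicator_of_notMem h, indicator_of_notMem h, mul_zero]

/-- Du Bois-Reymond: a function with an integrable weak derivative is a primitive of it. -/
theorem exists_eq_add_integral_of_weak {T : ℝ} (hT : 0 < T) {h k : ℝ → ℂ}
    (hh : IntegrableOn h (Ioo 0 T)) (hk : IntegrableOn k (Ioo 0 T))
    (hweak : ∀ η, IsTest T η →
      ∫ t in Ioo 0 T, (((deriv η t : ℝ) : ℂ) * h t + (η t : ℂ) * k t) = 0) :
    ∃ c : ℂ, ∀ᵐ t ∂volume.restrict (Ioo 0 T), h t = c + ∫ τ in (0 : ℝ)..t, k τ := by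
  set K : ℝ → ℂ := fun t => ∫ τ in (0 : ℝ)..t, k τ with hK
  have hkii : IntervalIntegrable k volume 0 T := by
    rw [intervalIntegrable_iff_integrableOn_Ioo_of_le hT.le]; exact hk
  have hKc : ContinuousOn K (Icc 0 T) := by
    have := intervalIntegral.continuousOn_primitive_interval (f := k) (μ := volume) (a := 0) (b := T)
      (by rw [uIcc_of_le hT.le, integrableOn_Icc_iff_integrableOn_Ioo]; exact hk)
    rwa [uIcc_of_le hT.le] at this
  have hKint : IntegrableOn K (Ioo 0 T) := (hKc.integrableOn_Icc).mono_set Ioo_subset_Icc_self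
  set F : ℝ → ℂ := fun t => h t - K t with hFdef
  have hFint : IntegrableOn F (Ioo 0 T) := hh.sub hKint
  have hF0 : ∀ η, IsTest T η → ∫ t in Ioo 0 T, ((deriv η t : ℝ) : ℂ) * F t = 0 := by
    intro η hη
    obtain ⟨A, hA⟩ := hη.exists_bound
    have i1 := integrableOn_test_smul hh hη.continuous_deriv ⟨A, fun t => (hA t).2⟩
    have i2 := integrableOn_test_smul hk hη.contDiff.continuous ⟨A, fun t => (hA t).1⟩
    have i3 := integrableOn_test_smul hKint hη.continuous_deriv ⟨A, fun t => (hA t).2⟩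
    have h1 := hweak η hη
    rw [integral_add i1 i2] at h1
    have h2 := integral_deriv_mul_primitive hk hη
    simp_rw [hFdef, mul_sub]
    rw [integral_sub i1 i3, h2, sub_neg_eq_add, h1]
  obtain ⟨ρ, hρ, hρ1⟩ := exists_test_integral_one hT
  set c : ℂ := ∫ t in Ioo 0 T, (ρ t : ℂ) * F t with hc
  refine ⟨c, ?_⟩
  have hcint : IntegrableOn (fun t => F t - c) (Ioo 0 T) := hFint.sub (integrableOn_const (by simp))
  have key := isOpen_Ioo.ae_eq_zero_of_integral_contDiff_smul_eq_zero (μ := volume)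
    (hcint.locallyIntegrableOn) (fun g hg1 hg2 hg3 => ?_)
  · rw [ae_restrict_iff' measurableSet_Ioo]
    filter_upwards [key] with t ht hmem
    have := ht hmem
    simp only [hFdef] at this
    linear_combination this
  · have hg : IsTest T g := ⟨hg1, hg2, hg3⟩
    set I : ℝ := ∫ t, g t with hI
    have hgint : Integrable g := hg1.continuous.integrable_of_hasCompactSupport hg2
    have hρint : Integrable ρ := hρ.contDiff.continuous.integrable_of_hasCompactSupport hρ.hasCompactSupport
    -- Subtracting a multiple of ρ makes the integral vanish, so the difference is the derivative of
    -- a test function; the subtracted multiple is what produces the constant c.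
    have hG : IsTest T (fun t => g t - I * ρ t) := by
      refine ⟨hg1.sub (contDiff_const.mul hρ.contDiff), ?_, ?_⟩
      · exact hg2.sub (hρ.hasCompactSupport.mul_left)
      · refine (tsupport_sub _ _).trans (union_subset hg3 ?_)
        exact (tsupport_mul_subset_right).trans hρ.tsupport_subset
    obtain ⟨η, hη, hηd⟩ := exists_primitive hG (by
      rw [integral_sub hgint (hρint.const_mul I), integral_const_mul, hρ1, mul_one, sub_self])
    have h0 := hF0 η hη
    obtain ⟨A, hA⟩ := hg.exists_bound
    obtain ⟨A', hA'⟩ := hρ.exists_bound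
    have i1 := integrableOn_test_smul hFint hg1.continuous ⟨A, fun t => (hA t).1⟩
    have i2 := integrableOn_test_smul hFint hρ.contDiff.continuous ⟨A', fun t => (hA' t).1⟩
    rw [hηd] at h0
    have h1 : ∫ t in Ioo 0 T, (g t : ℂ) * F t = I * c := by
      have : ∀ t, (((g t - I * ρ t : ℝ)) : ℂ) * F t = (g t : ℂ) * F t - I * ((ρ t : ℂ) * F t) := by
        intro t; push_cast; ring
      simp_rw [this] at h0
      rw [integral_sub i1 (i2.const_mul _), integral_const_mul] at h0
      linear_combination h0
    have h2 : ∫ t in Ioo 0 T, (g t : ℂ) * c = I * c := by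
      rw [integral_mul_const]
      congr 1
      rw [integral_complex_ofReal, hI]
      congr 1
      exact setIntegral_eq_integral_of_forall_compl_eq_zero fun t ht => hg.eq_zero ht
    have h3 : ∫ t, g t • (F t - c) = ∫ t in Ioo 0 T, g t • (F t - c) :=
      (setIntegral_eq_integral_of_forall_compl_eq_zero fun t ht => by rw [hg.eq_zero ht, zero_smul]).symm
    rw [h3]
    have h4 : ∀ t, g t • (F t - c) = (g t : ℂ) * F t - (g t : ℂ) * c := fun t => by
      rw [Complex.real_smul]; ring
    simp_rw [h4]
    rw [integral_sub i1, h1, h2, sub_self]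
    exact integrableOn_test_smul (integrableOn_const (by simp)) hg1.continuous ⟨A, fun t => (hA t).1⟩

/-! ### A Duhamel formula for infinite systems -/

/-- The exponential series `∑ aⁿ xₙ / n!`. -/
noncomputable def expSum (a : ℂ) (x : ℕ → ℂ) : ℂ := ∑' n : ℕ, a ^ n / (n.factorial : ℂ) * x n

theorem norm_expSum_term_le {a : ℂ} {x : ℕ → ℂ} {A C : ℝ} (hx : ∀ n, ‖x n‖ ≤ C ^ n * A) (n : ℕ) :
    ‖a ^ n / (n.factorial : ℂ) * x n‖ ≤ (‖a‖ * C) ^ n / n.factorial * A := by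
  rw [norm_mul, norm_div, norm_pow, Complex.norm_natCast, mul_pow]
  calc ‖a‖ ^ n / n.factorial * ‖x n‖ ≤ ‖a‖ ^ n / n.factorial * (C ^ n * A) := by
        gcongr; exact hx n
    _ = _ := by ring

theorem summable_expBound (a A C : ℝ) : Summable (fun n : ℕ => (a * C) ^ n / n.factorial * A) :=
  (Real.summable_pow_div_factorial (a * C)).mul_right A

theorem tsum_expBound (a A C : ℝ) : ∑' n : ℕ, (a * C) ^ n / n.factorial * A = Real.exp (a * C) * A := by
  rw [tsum_mul_right, Real.exp_eq_exp_ℝ, NormedSpace.exp_eq_tsum_div]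

theorem summable_expSum {a : ℂ} {x : ℕ → ℂ} {A C : ℝ} (hx : ∀ n, ‖x n‖ ≤ C ^ n * A) :
    Summable (fun n : ℕ => a ^ n / (n.factorial : ℂ) * x n) :=
  Summable.of_norm_bounded (summable_expBound ‖a‖ A C) (norm_expSum_term_le hx)

theorem norm_expSum_le {a : ℂ} {x : ℕ → ℂ} {A C : ℝ} (hx : ∀ n, ‖x n‖ ≤ C ^ n * A) :
    ‖expSum a x‖ ≤ Real.exp (‖a‖ * C) * A := by
  rw [← tsum_expBound]
  exact tsum_of_norm_bounded (summable_expBound ‖a‖ A C).hasSum (norm_expSum_term_le hx)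

theorem norm_expSum_shift_le {a : ℂ} {x : ℕ → ℂ} {A C : ℝ} (hx : ∀ n, ‖x n‖ ≤ C ^ n * A) (m : ℕ) :
    ‖expSum a (fun n => x (n + m))‖ ≤ C ^ m * (Real.exp (‖a‖ * C) * A) := by
  have := norm_expSum_le (a := a) (x := fun n => x (n + m)) (A := C ^ m * A) (C := C)
    (fun n => by rw [← mul_assoc, ← pow_add]; exact hx _)
  linarith

/-- The identity e^a e^b = e^{a+b} for the shift on sequences: the double series converges
absolutely by the geometric bound and is resummed along antidiagonals with the binomial theorem. -/
theorem expSum_expSum {a b : ℂ} {x : ℕ → ℂ} {A C : ℝ} (hC : 0 ≤ C) (hx : ∀ n, ‖x n‖ ≤ C ^ n * A) :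
    expSum a (fun m => expSum b (fun n => x (n + m))) = expSum (a + b) x := by
  set f : ℕ × ℕ → ℂ := fun p => a ^ p.1 / (p.1.factorial : ℂ) *
    (b ^ p.2 / (p.2.factorial : ℂ) * x (p.2 + p.1)) with hf
  have hA : 0 ≤ A := by have := (norm_nonneg _).trans (hx 0); simpa using this
  have hs : Summable f := by
    have h1 : Summable (fun p : ℕ × ℕ => ((‖a‖ * C) ^ p.1 / (p.1.factorial : ℝ)) *
        ((‖b‖ * C) ^ p.2 / p.2.factorial * A)) :=
      (Real.summable_pow_div_factorial (‖a‖ * C)).mul_of_nonneg (summable_expBound ‖b‖ A C)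
        (fun n => by simp only [Pi.zero_apply]; positivity)
        (fun n => by simp only [Pi.zero_apply]; positivity)
    refine Summable.of_norm_bounded h1 fun p => ?_
    simp only [hf]
    rw [norm_mul, norm_mul, norm_div, norm_div, norm_pow, norm_pow, Complex.norm_natCast,
      Complex.norm_natCast, mul_pow, mul_pow]
    calc _ ≤ ‖a‖ ^ p.1 / p.1.factorial * (‖b‖ ^ p.2 / p.2.factorial * (C ^ (p.2 + p.1) * A)) := by
          gcongr; exact hx _
      _ = _ := by rw [pow_add]; ring
  have hfib : ∀ m, Summable (fun n => f (m, n)) := fun m => hs.comp_injective (Prod.mk_right_injective m)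
  have e1 : expSum a (fun m => expSum b (fun n => x (n + m))) = ∑' p, f p := by
    rw [hs.tsum_prod' hfib]
    refine tsum_congr fun m => ?_
    simp only [hf, expSum, tsum_mul_left]
  rw [e1, ← Finset.HasAntidiagonal.sigmaAntidiagonalEquivProd.tsum_eq f]
  have hs' : Summable (fun c => f (Finset.HasAntidiagonal.sigmaAntidiagonalEquivProd c)) :=
    Finset.HasAntidiagonal.sigmaAntidiagonalEquivProd.summable_iff.2 hs
  rw [hs'.tsum_sigma' (fun n => (hasSum_fintype _).summable)]
  refine tsum_congr fun n => ?_
  rw [tsum_fintype, (Commute.all a b).add_pow', Finset.sum_div, Finset.sum_mul,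
    ← Finset.sum_coe_sort (Finset.HasAntidiagonal.antidiagonal n)]
  refine Finset.sum_congr rfl fun p _ => ?_
  have hp : p.1.1 + p.1.2 = n := Finset.HasAntidiagonal.mem_antidiagonal.1 p.2
  have hn : (n.factorial : ℂ) = (n.choose p.1.1 : ℂ) * p.1.1.factorial * p.1.2.factorial := by
    have := Nat.choose_mul_factorial_mul_factorial (n := n) (k := p.1.1) (by omega)
    rw [show n - p.1.1 = p.1.2 by omega] at this
    exact_mod_cast this.symm
  have h1 : (p.1.1.factorial : ℂ) ≠ 0 := by exact_mod_cast p.1.1.factorial_ne_zero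
  have h2 : (p.1.2.factorial : ℂ) ≠ 0 := by exact_mod_cast p.1.2.factorial_ne_zero
  have h3 : (n.choose p.1.1 : ℂ) ≠ 0 := by
    exact_mod_cast (Nat.choose_pos (show p.1.1 ≤ n by omega)).ne'
  simp only [hf, Finset.HasAntidiagonal.sigmaAntidiagonalEquivProd_apply]
  rw [show p.1.2 + p.1.1 = n by omega, hn, nsmul_eq_mul]
  field_simp

/-- Weak solutions of `hₙ' = i hₙ₊₁ + kₙ` on `(0, T)`. -/
structure WeakSystem (T C : ℝ) (h k : ℕ → ℝ → ℂ) (α β : ℝ → ℝ) : Prop where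
  nonneg : 0 ≤ C
  meas_h : ∀ n, AEStronglyMeasurable (h n) (volume.restrict (Ioo 0 T))
  meas_k : ∀ n, AEStronglyMeasurable (k n) (volume.restrict (Ioo 0 T))
  int_α : IntegrableOn α (Ioo 0 T)
  int_β : IntegrableOn β (Ioo 0 T)
  bound_h : ∀ᵐ t ∂volume.restrict (Ioo 0 T), ∀ n, ‖h n t‖ ≤ C ^ n * α t
  bound_k : ∀ᵐ t ∂volume.restrict (Ioo 0 T), ∀ n, ‖k n t‖ ≤ C ^ n * β t
  weak : ∀ η, IsTest T η → ∀ n, ∫ t in Ioo 0 T, (((deriv η t : ℝ) : ℂ) * h n t +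
    (η t : ℂ) * (Complex.I * h (n + 1) t + k n t)) = 0

variable {T C : ℝ} {h k : ℕ → ℝ → ℂ} {α β : ℝ → ℝ}

theorem WeakSystem.shift (hs : WeakSystem T C h k α β) (m : ℕ) :
    WeakSystem T C (fun n => h (n + m)) (fun n => k (n + m)) (fun t => C ^ m * α t)
      (fun t => C ^ m * β t) where
  nonneg := hs.nonneg
  meas_h := fun n => hs.meas_h _
  meas_k := fun n => hs.meas_k _
  int_α := hs.int_α.const_mul _
  int_β := hs.int_β.const_mul _
  bound_h := hs.bound_h.mono fun t ht n => by rw [← mul_assoc, ← pow_add]; exact ht _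
  bound_k := hs.bound_k.mono fun t ht n => by rw [← mul_assoc, ← pow_add]; exact ht _
  weak := fun η hη n => by
    have := hs.weak η hη (n + m)
    rwa [show n + m + 1 = n + 1 + m by ring] at this

theorem WeakSystem.integrable_h (hs : WeakSystem T C h k α β) (n : ℕ) : IntegrableOn (h n) (Ioo 0 T) :=
  (hs.int_α.const_mul (C ^ n)).mono' (hs.meas_h n) (hs.bound_h.mono fun _ ht => ht n)

theorem WeakSystem.integrable_k (hs : WeakSystem T C h k α β) (n : ℕ) : IntegrableOn (k n) (Ioo 0 T) :=
  (hs.int_β.const_mul (C ^ n)).mono' (hs.meas_k n) (hs.bound_k.mono fun _ ht => ht n)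

/-- The coefficients `(-i)ⁿ/n!`. -/
noncomputable def sysCoeff (n : ℕ) : ℂ := (-Complex.I) ^ n / (n.factorial : ℂ)

theorem sysCoeff_succ (n : ℕ) : sysCoeff (n + 1) * ((n + 1 : ℕ) : ℂ) = -Complex.I * sysCoeff n := by
  have h1 : ((n + 1 : ℕ) : ℂ) ≠ 0 := by exact_mod_cast n.succ_ne_zero
  have h2 : (n.factorial : ℂ) ≠ 0 := by exact_mod_cast n.factorial_ne_zero
  rw [sysCoeff, sysCoeff, Nat.factorial_succ, Nat.cast_mul, pow_succ]
  field_simp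

/-- The n-th equation is tested with η(t)tⁿ and weighted by (-i)ⁿ/n!. The term in which tⁿ is
differentiated cancels the coupling term of the preceding equation, so everything telescopes except
the coupling term of the last one. -/
theorem WeakSystem.partial_sum (hs : WeakSystem T C h k α β) {η : ℝ → ℝ} (hη : IsTest T η) (L : ℕ) :
    ∫ t in Ioo 0 T, (((deriv η t : ℝ) : ℂ) * (∑ n ∈ Finset.range (L + 1), sysCoeff n * (t : ℂ) ^ n * h n t) +
      (η t : ℂ) * (∑ n ∈ Finset.range (L + 1), sysCoeff n * (t : ℂ) ^ n * k n t) +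
      Complex.I * ((η t : ℂ) * (sysCoeff L * (t : ℂ) ^ L * h (L + 1) t))) = 0 := by
  have hInt : ∀ n : ℕ, IntegrableOn (fun t => (((deriv (fun r => η r * r ^ n) t : ℝ) : ℂ) * h n t +
      ((η t * t ^ n : ℝ) : ℂ) * (Complex.I * h (n + 1) t + k n t))) (Ioo 0 T) := fun n => by
    obtain ⟨A, hA⟩ := (hη.mul_pow n).exists_bound
    exact (integrableOn_test_smul (hs.integrable_h n) (hη.mul_pow n).continuous_deriv
      ⟨A, fun t => (hA t).2⟩).add (integrableOn_test_smul
        (((hs.integrable_h (n + 1)).const_mul _).add (hs.integrable_k n))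
        (hη.mul_pow n).contDiff.continuous ⟨A, fun t => (hA t).1⟩)
  have key : ∀ t, (((deriv η t : ℝ) : ℂ) * (∑ n ∈ Finset.range (L + 1), sysCoeff n * (t : ℂ) ^ n * h n t) +
      (η t : ℂ) * (∑ n ∈ Finset.range (L + 1), sysCoeff n * (t : ℂ) ^ n * k n t) +
      Complex.I * ((η t : ℂ) * (sysCoeff L * (t : ℂ) ^ L * h (L + 1) t))) =
      ∑ n ∈ Finset.range (L + 1), sysCoeff n * (((deriv (fun r => η r * r ^ n) t : ℝ) : ℂ) * h n t +
      ((η t * t ^ n : ℝ) : ℂ) * (Complex.I * h (n + 1) t + k n t)) := by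
    intro t
    have hd : ∀ n : ℕ, deriv (fun r => η r * r ^ n) t = deriv η t * t ^ n + η t * (n * t ^ (n - 1)) := by
      intro n
      have h1 : HasDerivAt η (deriv η t) t :=
        (hη.contDiff.differentiable (by simp) t).hasDerivAt
      exact (h1.mul (hasDerivAt_pow n t)).deriv
    clear hInt
    simp only [hd]
    induction L with
    | zero => simp [sysCoeff]; ring
    | succ L ih =>
      rw [Finset.sum_range_succ _ (L + 1), Finset.sum_range_succ _ (L + 1),
        Finset.sum_range_succ _ (L + 1), ← ih]
      have h2 := sysCoeff_succ L
      simp only [Nat.add_sub_cancel]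
      push_cast at h2 ⊢
      linear_combination (- (η t : ℂ) * (t:ℂ) ^ L * h (L + 1) t) * h2
  simp only [key]
  rw [integral_finsetSum _ (fun n _ => (hInt n).const_mul _)]
  refine Finset.sum_eq_zero fun n _ => ?_
  rw [integral_const_mul]
  have := hs.weak _ (hη.mul_pow n) n
  rw [this, mul_zero]

theorem norm_partial_expSum_le {a : ℂ} {x : ℕ → ℂ} {A C : ℝ} (hC : 0 ≤ C)
    (hx : ∀ n, ‖x n‖ ≤ C ^ n * A) (L : ℕ) :
    ‖∑ n ∈ Finset.range L, a ^ n / (n.factorial : ℂ) * x n‖ ≤ Real.exp (‖a‖ * C) * A := by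
  have hA : 0 ≤ A := by have := (norm_nonneg _).trans (hx 0); simpa using this
  rw [← tsum_expBound]
  refine (norm_sum_le _ _).trans ((Finset.sum_le_sum fun n _ => norm_expSum_term_le hx n).trans ?_)
  exact (summable_expBound ‖a‖ A C).sum_le_tsum _ fun n _ => by positivity

theorem expSum_zero (x : ℕ → ℂ) : expSum 0 x = x 0 := by
  rw [expSum, tsum_eq_single 0]
  · simp
  · intro n hn; simp [hn]

theorem aestronglyMeasurable_expSum {μ : Measure ℝ} {x : ℕ → ℝ → ℂ} {A : ℝ → ℝ} {a : ℝ → ℂ}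
    (ha : Continuous a) (hm : ∀ n, AEStronglyMeasurable (x n) μ)
    (hx : ∀ᵐ t ∂μ, ∀ n, ‖x n t‖ ≤ C ^ n * A t) :
    AEStronglyMeasurable (fun t => expSum (a t) (fun n => x n t)) μ := by
  refine aestronglyMeasurable_of_tendsto_ae Filter.atTop
    (f := fun (L : ℕ) t => ∑ n ∈ Finset.range L, a t ^ n / (n.factorial : ℂ) * x n t) (fun L => ?_) ?_
  · refine Finset.aestronglyMeasurable_fun_sum _ fun n _ => ?_
    exact ((ha.pow n).div_const _).aestronglyMeasurable.mul (hm n)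
  · filter_upwards [hx] with t ht
    exact (summable_expSum ht).hasSum.tendsto_sum_nat

/-- Limit of the telescoped identities. The leftover term is a general term of a convergent
exponential series and tends to zero, and the integrands are dominated uniformly by multiples of α
and β. -/
theorem WeakSystem.weak_expSum (hs : WeakSystem T C h k α β) {η : ℝ → ℝ} (hη : IsTest T η) :
    ∫ t in Ioo 0 T, (((deriv η t : ℝ) : ℂ) * expSum (-Complex.I * t) (fun n => h n t) +
      (η t : ℂ) * expSum (-Complex.I * t) (fun n => k n t)) = 0 := by
  obtain ⟨A, hA⟩ := hη.exists_bound
  have hA0 : 0 ≤ A := (norm_nonneg _).trans (hA 0).1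
  have hC := hs.nonneg
  have ht_mem : ∀ᵐ t ∂volume.restrict (Ioo 0 T), t ∈ Ioo 0 T := ae_restrict_mem measurableSet_Ioo
  have hcoef : ∀ (t : ℝ) (n : ℕ), sysCoeff n * (t : ℂ) ^ n = (-Complex.I * t) ^ n / (n.factorial : ℂ) := by
    intro t n; rw [sysCoeff, mul_pow]; ring
  have hnorm : ∀ t : ℝ, t ∈ Ioo 0 T → ‖-Complex.I * (t : ℂ)‖ * C ≤ T * C := by
    intro t ht
    have : ‖-Complex.I * (t : ℂ)‖ = t := by simp [abs_of_pos ht.1]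
    rw [this]; exact mul_le_mul_of_nonneg_right ht.2.le hC
  refine tendsto_nhds_unique (tendsto_integral_of_dominated_convergence
    (F := fun (L : ℕ) t => (((deriv η t : ℝ) : ℂ) *
      (∑ n ∈ Finset.range (L + 1), sysCoeff n * (t : ℂ) ^ n * h n t) +
      (η t : ℂ) * (∑ n ∈ Finset.range (L + 1), sysCoeff n * (t : ℂ) ^ n * k n t) +
      Complex.I * ((η t : ℂ) * (sysCoeff L * (t : ℂ) ^ L * h (L + 1) t))))
    (fun t => A * (Real.exp (T * C) * α t) + A * (Real.exp (T * C) * β t) +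
      A * (Real.exp (T * C) * (C * α t))) ?_ ?_ ?_ ?_) ?_
  · intro L
    have m1 : AEStronglyMeasurable (fun t : ℝ => ((deriv η t : ℝ) : ℂ)) (volume.restrict (Ioo 0 T)) :=
      (Complex.continuous_ofReal.comp hη.continuous_deriv).aestronglyMeasurable
    have m2 : AEStronglyMeasurable (fun t : ℝ => (η t : ℂ)) (volume.restrict (Ioo 0 T)) :=
      (Complex.continuous_ofReal.comp hη.contDiff.continuous).aestronglyMeasurable
    have m3 : ∀ n, AEStronglyMeasurable (fun t : ℝ => sysCoeff n * (t : ℂ) ^ n)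
        (volume.restrict (Ioo 0 T)) := fun n =>
      (continuous_const.mul (Complex.continuous_ofReal.pow n)).aestronglyMeasurable
    refine AEStronglyMeasurable.add (AEStronglyMeasurable.add (m1.mul ?_) (m2.mul ?_)) ?_
    · exact Finset.aestronglyMeasurable_fun_sum _ fun n _ => (m3 n).mul (hs.meas_h n)
    · exact Finset.aestronglyMeasurable_fun_sum _ fun n _ => (m3 n).mul (hs.meas_k n)
    · exact (m2.mul ((m3 L).mul (hs.meas_h _))).const_mul _
  · exact ((((hs.int_α.const_mul _).const_mul _).add ((hs.int_β.const_mul _).const_mul _)).add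
      (((hs.int_α.const_mul _).const_mul _).const_mul _))
  · intro L
    filter_upwards [ht_mem, hs.bound_h, hs.bound_k] with t ht hh hk
    have hα : 0 ≤ α t := by have := (norm_nonneg _).trans (hh 0); simpa using this
    have hβ : 0 ≤ β t := by have := (norm_nonneg _).trans (hk 0); simpa using this
    simp only [hcoef]
    refine (norm_add_le _ _).trans (add_le_add ((norm_add_le _ _).trans (add_le_add ?_ ?_)) ?_)
    · rw [norm_mul, Complex.norm_real]
      refine mul_le_mul (hA t).2 ((norm_partial_expSum_le hC hh _).trans ?_) (norm_nonneg _) hA0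
      gcongr ?_ * _; exact Real.exp_le_exp.2 (hnorm t ht)
    · rw [norm_mul, Complex.norm_real]
      refine mul_le_mul (hA t).1 ((norm_partial_expSum_le hC hk _).trans ?_) (norm_nonneg _) hA0
      gcongr ?_ * _; exact Real.exp_le_exp.2 (hnorm t ht)
    · rw [norm_mul, Complex.norm_I, one_mul, norm_mul, Complex.norm_real]
      refine mul_le_mul (hA t).1 ?_ (norm_nonneg _) hA0
      have h1 : ∀ n, ‖h (n + 1) t‖ ≤ C ^ n * (C * α t) := fun n => by
        have := hh (n + 1); rwa [pow_succ, mul_assoc] at this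
      refine (norm_expSum_term_le h1 L).trans ?_
      gcongr
      exact (Real.pow_div_factorial_le_exp _ (by positivity) L).trans (Real.exp_le_exp.2 (hnorm t ht))
  · filter_upwards [hs.bound_h, hs.bound_k] with t hh hk
    simp only [hcoef]
    have l1 := (summable_expSum (a := -Complex.I * t) hh).hasSum.tendsto_sum_nat
    have l2 := (summable_expSum (a := -Complex.I * t) hk).hasSum.tendsto_sum_nat
    have h1 : ∀ n, ‖h (n + 1) t‖ ≤ C ^ n * (C * α t) := fun n => by
      have := hh (n + 1); rwa [pow_succ, mul_assoc] at this
    have l3 := (summable_expSum (a := -Complex.I * t) h1).tendsto_atTop_zero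
    have := (((l1.comp (Filter.tendsto_add_atTop_nat 1)).const_mul ((deriv η t : ℝ) : ℂ)).add
      ((l2.comp (Filter.tendsto_add_atTop_nat 1)).const_mul (η t : ℂ))).add
      ((l3.const_mul (η t : ℂ)).const_mul Complex.I)
    simpa [expSum, Function.comp_def] using this
  · simp only [hs.partial_sum hη]
    exact tendsto_const_nhds

theorem WeakSystem.exists_primitive (hT : 0 < T) (hs : WeakSystem T C h k α β) :
    ∃ c, ∀ᵐ t : ℝ ∂volume.restrict (Ioo 0 T), expSum (-Complex.I * t) (fun n => h n t) =
      c + ∫ τ : ℝ in 0..t, expSum (-Complex.I * τ) (fun n => k n τ) := by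
  have ht_mem : ∀ᵐ t ∂volume.restrict (Ioo 0 T), t ∈ Ioo 0 T := ae_restrict_mem measurableSet_Ioo
  have hca : Continuous (fun t : ℝ => -Complex.I * (t : ℂ)) :=
    continuous_const.mul Complex.continuous_ofReal
  have hC := hs.nonneg
  have hnorm : ∀ t : ℝ, t ∈ Ioo 0 T → ‖-Complex.I * (t : ℂ)‖ * C ≤ T * C := by
    intro t ht
    have : ‖-Complex.I * (t : ℂ)‖ = t := by simp [abs_of_pos ht.1]
    rw [this]; exact mul_le_mul_of_nonneg_right ht.2.le hC
  refine exists_eq_add_integral_of_weak hT ?_ ?_ fun η hη => hs.weak_expSum hη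
  · refine (hs.int_α.const_mul (Real.exp (T * C))).mono'
      (aestronglyMeasurable_expSum hca hs.meas_h hs.bound_h) ?_
    filter_upwards [ht_mem, hs.bound_h] with t ht hh
    have hα : 0 ≤ α t := by have := (norm_nonneg _).trans (hh 0); simpa using this
    refine (norm_expSum_le hh).trans ?_
    gcongr ?_ * _; exact Real.exp_le_exp.2 (hnorm t ht)
  · refine (hs.int_β.const_mul (Real.exp (T * C))).mono'
      (aestronglyMeasurable_expSum hca hs.meas_k hs.bound_k) ?_
    filter_upwards [ht_mem, hs.bound_k] with t ht hh
    have hα : 0 ≤ β t := by have := (norm_nonneg _).trans (hh 0); simpa using this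
    refine (norm_expSum_le hh).trans ?_
    gcongr ?_ * _; exact Real.exp_le_exp.2 (hnorm t ht)

/-- The series with parameter -it removes the coupling and leaves a plain primitive, for the system
and for each of its shifts by m. Summing these identities against (it)^m/m! multiplies by the
inverse exponential: the left side collapses to h₀(t), the other terms acquire the parameters t - t₀
and t - τ. The set S collects the times at which the countably many almost-everywhere identities and
the bounds on h hold. -/
theorem WeakSystem.duhamel (hT : 0 < T) (hs : WeakSystem T C h k α β) :
    ∃ S : Set ℝ, (∀ᵐ t ∂volume.restrict (Ioo 0 T), t ∈ S) ∧ S ⊆ Ioo 0 T ∧ ∀ t₀ ∈ S, ∀ t ∈ S,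
      h 0 t = expSum (Complex.I * ((t - t₀ : ℝ) : ℂ)) (fun n => h n t₀) +
        ∫ τ : ℝ in t₀..t, expSum (Complex.I * ((t - τ : ℝ) : ℂ)) (fun n => k n τ) := by
  have ht_mem : ∀ᵐ t ∂volume.restrict (Ioo 0 T), t ∈ Ioo 0 T := ae_restrict_mem measurableSet_Ioo
  have hca : Continuous (fun t : ℝ => -Complex.I * (t : ℂ)) :=
    continuous_const.mul Complex.continuous_ofReal
  have hC := hs.nonneg
  choose c hc using fun m => (hs.shift m).exists_primitive hT
  have hnorm : ∀ t : ℝ, t ∈ Ioo 0 T → ‖-Complex.I * (t : ℂ)‖ * C ≤ T * C := by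
    intro t ht
    have : ‖-Complex.I * (t : ℂ)‖ = t := by simp [abs_of_pos ht.1]
    rw [this]; exact mul_le_mul_of_nonneg_right ht.2.le hC
  have hκm : ∀ m, AEStronglyMeasurable (fun t : ℝ => expSum (-Complex.I * t) (fun n => k (n + m) t))
      (volume.restrict (Ioo 0 T)) := fun m =>
    aestronglyMeasurable_expSum hca (hs.shift m).meas_k (hs.shift m).bound_k
  have hκb : ∀ᵐ t : ℝ ∂volume.restrict (Ioo 0 T), ∀ m,
      ‖expSum (-Complex.I * t) (fun n => k (n + m) t)‖ ≤ C ^ m * (Real.exp (T * C) * β t) := by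
    filter_upwards [ht_mem, hs.bound_k] with t ht hh m
    have hβ : 0 ≤ β t := by have := (norm_nonneg _).trans (hh 0); simpa using this
    refine (norm_expSum_shift_le hh m).trans ?_
    gcongr _ * (?_ * _); exact Real.exp_le_exp.2 (hnorm t ht)
  have hκi : ∀ m, IntegrableOn (fun t : ℝ => expSum (-Complex.I * t) (fun n => k (n + m) t)) (Ioo 0 T) :=
    fun m => ((hs.int_β.const_mul _).const_mul _).mono' (hκm m) (hκb.mono fun t ht => ht m)
  have hii : ∀ {a b : ℝ} {f : ℝ → ℂ}, IntegrableOn f (Ioo 0 T) → a ∈ Icc 0 T → b ∈ Icc 0 T →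
      IntervalIntegrable f volume a b := by
    intro a b f hf ha hb
    rw [intervalIntegrable_iff]
    refine ((integrableOn_Icc_iff_integrableOn_Ioo (by finiteness) (by finiteness)).2 hf).mono_set ?_
    exact uIoc_subset_uIcc.trans (uIcc_subset_Icc ha hb)
  refine ⟨{t | t ∈ Ioo 0 T ∧ (∀ n, ‖h n t‖ ≤ C ^ n * α t) ∧
    ∀ m, expSum (-Complex.I * t) (fun n => h (n + m) t) =
      c m + ∫ τ : ℝ in 0..t, expSum (-Complex.I * τ) (fun n => k (n + m) τ)}, ?_, fun t ht => ht.1, ?_⟩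
  · filter_upwards [ht_mem, hs.bound_h, ae_all_iff.2 hc] with t h1 h2 h3
    exact ⟨h1, h2, h3⟩
  rintro t₀ ⟨ht₀, hb₀, hy₀⟩ t ⟨ht, hb, hy⟩
  have h0 : (0:ℝ) ∈ Icc 0 T := ⟨le_rfl, ht.1.le.trans ht.2.le⟩
  have ht₀' := Ioo_subset_Icc_self ht₀
  have ht' := Ioo_subset_Icc_self ht
  have hdiff : ∀ m, expSum (-Complex.I * t) (fun n => h (n + m) t) =
      expSum (-Complex.I * t₀) (fun n => h (n + m) t₀) +
        ∫ τ : ℝ in t₀..t, expSum (-Complex.I * τ) (fun n => k (n + m) τ) := by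
    intro m
    rw [hy m, hy₀ m, add_assoc, intervalIntegral.integral_add_adjacent_intervals
      (hii (hκi m) h0 ht₀') (hii (hκi m) ht₀' ht')]
  have hsub : uIoc t₀ t ⊆ Ioo 0 T := by
    intro τ hτ
    rcases mem_uIoc.1 hτ with h | h
    · exact ⟨ht₀.1.trans h.1, h.2.trans_lt ht.2⟩
    · exact ⟨ht.1.trans h.1, h.2.trans_lt ht₀.2⟩
  have hae : ∀ {p : ℝ → Prop}, (∀ᵐ τ ∂volume.restrict (Ioo 0 T), p τ) →
      ∀ᵐ τ ∂volume, τ ∈ uIoc t₀ t → p τ := fun hp => by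
    filter_upwards [(ae_restrict_iff' measurableSet_Ioo).1 hp] with τ h1 h2 using h1 (hsub h2)
  set a : ℂ := Complex.I * (t : ℂ) with ha
  -- Interchange of the sum over m with the time integral; the majorants sum to a constant multiple
  -- of β, which is integrable.
  have hsum := intervalIntegral.hasSum_integral_of_dominated_convergence (μ := volume) (a := t₀)
    (b := t) (F := fun (m : ℕ) τ => a ^ m / (m.factorial : ℂ) *
      expSum (-Complex.I * τ) (fun n => k (n + m) τ))
    (f := fun τ => expSum (Complex.I * ((t - τ : ℝ) : ℂ)) (fun n => k n τ))
    (fun m τ => (‖a‖ * C) ^ m / m.factorial * (Real.exp (T * C) * β τ))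
    (fun m => ((hκm m).mono_measure (Measure.restrict_mono_set _ hsub)).const_mul _)
    (fun m => hae (hκb.mono fun τ hτ => norm_expSum_term_le hτ m))
    (Filter.Eventually.of_forall fun τ _ => summable_expBound _ _ _)
    (by
      simp only [tsum_expBound]
      rw [intervalIntegrable_iff]
      exact (((hs.int_β.mono_set hsub).const_mul _).const_mul _))
    (hae (by
      filter_upwards [hs.bound_k, hκb] with τ h1 h2
      have h3 := expSum_expSum (a := a) (b := -Complex.I * τ) hC h1
      have h4 : a + -Complex.I * τ = Complex.I * ((t - τ : ℝ) : ℂ) := by rw [ha]; push_cast; ring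
      rw [h4] at h3
      rw [← h3]
      exact (summable_expSum h2).hasSum))
  have hx : ∀ n, ‖(fun m => expSum (-Complex.I * t₀) (fun n => h (n + m) t₀)) n‖ ≤
      C ^ n * (Real.exp (‖-Complex.I * (t₀ : ℂ)‖ * C) * α t₀) := norm_expSum_shift_le hb₀
  have e1 := expSum_expSum (a := a) (b := -Complex.I * t) hC hb
  have e2 := expSum_expSum (a := a) (b := -Complex.I * t₀) hC hb₀
  rw [show a + -Complex.I * t = 0 by rw [ha]; ring, expSum_zero] at e1
  rw [show a + -Complex.I * t₀ = Complex.I * ((t - t₀ : ℝ) : ℂ) by rw [ha]; push_cast; ring] at e2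
  have h5 := (summable_expSum (a := a) hx).hasSum.add hsum
  rw [← e1, ← e2, expSum]
  refine HasSum.tsum_eq ?_
  convert h5 using 2 with m
  · rw [hdiff m, intervalIntegral.integral_const_mul]
    ring
  · rfl

end KP

namespace KP

/-! ### Fourier pairings -/

theorem fourier_const_mul (c : ℂ) (χ : Plane → ℂ) (z : Plane) :
    𝓕 (fun ζ => c * χ ζ) z = c * 𝓕 χ z := by
  simp only [Real.fourier_eq', smul_eq_mul]
  rw [← integral_const_mul]
  exact integral_congr_ae (ae_of_all _ fun ζ => by ring)

theorem integrable_fourier_integrand {χ : Plane → ℂ} (hχ : Integrable χ) (z : Plane) :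
    Integrable (fun v => Complex.exp ((↑(-2 * Real.pi * inner ℝ v z) * Complex.I)) • χ v) := by
  have := (Real.fourierIntegral_convergent_iff (μ := volume) (f := χ) z).2 hχ
  simpa [Circle.smul_def, Real.fourierChar_apply] using this

theorem fourier_sub {χ₁ χ₂ : Plane → ℂ} (h₁ : Integrable χ₁) (h₂ : Integrable χ₂) (z : Plane) :
    𝓕 (fun ζ => χ₁ ζ - χ₂ ζ) z = 𝓕 χ₁ z - 𝓕 χ₂ z := by
  simp only [Real.fourier_eq', smul_sub]
  exact integral_sub (integrable_fourier_integrand h₁ z) (integrable_fourier_integrand h₂ z)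

theorem norm_fourier_le (χ : Plane → ℂ) (z : Plane) : ‖𝓕 χ z‖ ≤ ∫ ζ, ‖χ ζ‖ :=
  VectorFourier.norm_fourierIntegral_le_integral_norm _ _ _ _ _

theorem continuous_fourier {χ : Plane → ℂ} (h : Integrable χ) : Continuous (𝓕 χ) :=
  VectorFourier.fourierIntegral_continuous Real.continuous_fourierChar
    continuous_inner h

theorem integral_fourier_mul {f g : Plane → ℂ} (hf : Integrable f) (hg : Integrable g) :
    ∫ z, 𝓕 f z * g z = ∫ ζ, f ζ * 𝓕 g ζ := by
  have := VectorFourier.integral_fourierIntegral_smul_eq_flip (μ := volume) (ν := volume)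
    (L := innerₗ Plane) Real.continuous_fourierChar continuous_inner hf hg
  rw [flip_innerₗ] at this
  exact this

/-- The L² transform and the integral transform define the same tempered distribution, and locally
integrable functions are determined by their integrals against smooth compactly supported functions.
-/
theorem fourier_toLp_ae {χ : Plane → ℂ} (h₁ : Integrable χ) (h₂ : MemLp χ 2 volume) :
    (𝓕 (h₂.toLp χ) : Lp ℂ 2 (volume : Measure Plane)) =ᵐ[volume] 𝓕 χ := by
  refine ae_eq_of_integral_contDiff_smul_eq ?_ (continuous_fourier h₁).locallyIntegrable ?_
  · exact (Lp.memLp _).locallyIntegrable (by norm_num)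
  intro g hg hc
  have hg' : ContDiff ℝ ∞ (fun z => (g z : ℂ)) := Complex.ofRealCLM.contDiff.comp hg
  have hc' : HasCompactSupport (fun z => (g z : ℂ)) := hc.comp_left (g := fun r : ℝ => (r : ℂ)) rfl
  set φ : 𝓢(Plane, ℂ) := hc'.toSchwartzMap hg' with hφ
  have e0 : ∀ z, φ z = (g z : ℂ) := fun z => rfl
  have h := congrArg (fun S : 𝓢'(Plane, ℂ) => S φ)
    (Lp.fourier_toTemperedDistribution_eq (h₂.toLp χ))
  simp only [TemperedDistribution.fourier_apply, Lp.toTemperedDistribution_apply] at h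
  have e1 : ∫ z, g z • (𝓕 (h₂.toLp χ) : Lp ℂ 2 (volume : Measure Plane)) z =
      ∫ z, φ z • (𝓕 (h₂.toLp χ) : Lp ℂ 2 (volume : Measure Plane)) z :=
    integral_congr_ae (ae_of_all _ fun z => by simp [e0])
  rw [e1, ← h]
  have e2 : ∫ z, (𝓕 φ) z • (h₂.toLp χ) z = ∫ z, 𝓕 (φ : Plane → ℂ) z * χ z := by
    refine integral_congr_ae ?_
    filter_upwards [h₂.coeFn_toLp] with z hz
    rw [hz, smul_eq_mul, SchwartzMap.fourier_coe]
  rw [e2, integral_fourier_mul φ.integrable h₁]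
  exact integral_congr_ae (ae_of_all _ fun z => by simp [e0])

theorem memLp_fourier {χ : Plane → ℂ} (h₁ : Integrable χ) (h₂ : MemLp χ 2 volume) :
    MemLp (𝓕 χ) 2 volume :=
  (Lp.memLp _).ae_eq (fourier_toLp_ae h₁ h₂)

theorem eLpNorm_fourier {χ : Plane → ℂ} (h₁ : Integrable χ) (h₂ : MemLp χ 2 volume) :
    eLpNorm (𝓕 χ) 2 volume = eLpNorm χ 2 volume := by
  rw [← eLpNorm_congr_ae (fourier_toLp_ae h₁ h₂), ← Lp.enorm_def, ← Lp.enorm_toLp h₂,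
    ← ofReal_norm, ← ofReal_norm, Lp.norm_fourier_eq]

/-- Both sides are continuous in w for the L² norm, and for Schwartz w the identity is the classical
multiplication formula. -/
theorem integral_Lp_fourier_mul (w : Lp ℂ 2 (volume : Measure Plane)) {χ : Plane → ℂ}
    (h₁ : Integrable χ) (h₂ : MemLp χ 2 volume) :
    ∫ z, w z * 𝓕 χ z = ∫ ζ, (𝓕 w : Lp ℂ 2 (volume : Measure Plane)) ζ * χ ζ := by
  have hcont : ∀ {g : Plane → ℂ} (hg : MemLp g 2 volume),
      Continuous (fun w : Lp ℂ 2 (volume : Measure Plane) => ∫ z, w z * g z) := by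
    intro g hg
    have hg' : MemLp (fun z => (starRingEnd ℂ) (g z)) 2 volume := hg.star
    have : (fun w : Lp ℂ 2 (volume : Measure Plane) => ∫ z, w z * g z) =
        fun w => inner ℂ (hg'.toLp _) w := by
      funext w
      rw [L2.inner_def]
      refine integral_congr_ae ?_
      filter_upwards [hg'.coeFn_toLp] with z hz
      rw [hz, RCLike.inner_apply, starRingEnd_self_apply]
    rw [this]
    exact continuous_const.inner continuous_id
  refine DenseRange.induction_on (p := fun w : Lp ℂ 2 (volume : Measure Plane) =>
    ∫ z, w z * 𝓕 χ z = ∫ ζ, (𝓕 w : Lp ℂ 2 (volume : Measure Plane)) ζ * χ ζ)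
    (SchwartzMap.denseRange_toLpCLM (p := 2) ENNReal.ofNat_ne_top) w ?_ ?_
  · exact isClosed_eq (hcont (memLp_fourier h₁ h₂))
      ((hcont h₂).comp (ContinuousFourier.continuous_fourier))
  · intro φ
    have e1 : ∫ z, (SchwartzMap.toLpCLM ℝ ℂ 2 volume φ) z * 𝓕 χ z = ∫ z, φ z * 𝓕 χ z := by
      refine integral_congr_ae ?_
      filter_upwards [φ.coeFn_toLp 2 volume] with z hz
      rw [SchwartzMap.toLpCLM_apply, hz]
    have e2 : ∫ z, (𝓕 (SchwartzMap.toLpCLM ℝ ℂ 2 volume φ) : Lp ℂ 2 (volume : Measure Plane)) z * χ z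
        = ∫ z, 𝓕 (φ : Plane → ℂ) z * χ z := by
      refine integral_congr_ae ?_
      rw [SchwartzMap.toLpCLM_apply, SchwartzMap.toLp_fourier_eq]
      filter_upwards [(𝓕 φ).coeFn_toLp 2 volume] with z hz
      rw [hz, SchwartzMap.fourier_coe]
    rw [e1, e2, integral_fourier_mul φ.integrable h₁]

/-! ### Pairings with Fourier transforms of functions in L¹ ∩ L². -/

/-- The pairing `∫ v 𝓕χ`. -/
noncomputable def pair (v χ : Plane → ℂ) : ℂ := ∫ z, v z * 𝓕 χ z

/-- The norm of `L¹ ∩ L²`. -/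
noncomputable def nrm (χ : Plane → ℂ) : ℝ := (∫ ζ, ‖χ ζ‖) + (eLpNorm χ 2 volume).toReal

theorem nrm_nonneg (χ : Plane → ℂ) : 0 ≤ nrm χ :=
  add_nonneg (integral_nonneg fun _ => norm_nonneg _) ENNReal.toReal_nonneg

/-- Membership in `L¹ ∩ L²`. -/
structure Mem12 (χ : Plane → ℂ) : Prop where
  int : Integrable χ
  l2 : MemLp χ 2 volume

theorem Mem12.sub {χ₁ χ₂ : Plane → ℂ} (h₁ : Mem12 χ₁) (h₂ : Mem12 χ₂) :
    Mem12 (fun ζ => χ₁ ζ - χ₂ ζ) := ⟨h₁.int.sub h₂.int, h₁.l2.sub h₂.l2⟩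

theorem Mem12.mono {G χ : Plane → ℂ} (hG : Mem12 G) (hm : AEStronglyMeasurable χ volume) {c : ℝ}
    (h : ∀ᵐ ζ, ‖χ ζ‖ ≤ c * ‖G ζ‖) : Mem12 χ :=
  ⟨(hG.int.norm.const_mul c).mono' hm h, hG.l2.of_le_mul hm h⟩

theorem nrm_le_of_norm_le {G χ : Plane → ℂ} (hG : Mem12 G) (hm : AEStronglyMeasurable χ volume) {c : ℝ}
    (hc : 0 ≤ c) (h : ∀ᵐ ζ, ‖χ ζ‖ ≤ c * ‖G ζ‖) : nrm χ ≤ c * nrm G := by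
  have hχ := hG.mono hm h
  rw [nrm, nrm, mul_add]
  refine add_le_add ?_ ?_
  · rw [← integral_const_mul]
    exact integral_mono_ae hχ.int.norm (hG.int.norm.const_mul c) h
  · have h1 := eLpNorm_le_mul_eLpNorm_of_ae_le_mul h 2
    have h2 := ENNReal.toReal_mono (ENNReal.mul_ne_top ENNReal.ofReal_ne_top hG.l2.eLpNorm_ne_top) h1
    rwa [ENNReal.toReal_mul, ENNReal.toReal_ofReal hc] at h2

/-- Dominated convergence in `L¹ ∩ L²`. -/
theorem tendsto_nrm_zero {F : ℕ → Plane → ℂ} {G : Plane → ℂ} (hG : Mem12 G)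
    (hm : ∀ n, AEStronglyMeasurable (F n) volume) (hb : ∀ n, ∀ᵐ ζ, ‖F n ζ‖ ≤ ‖G ζ‖)
    (hl : ∀ᵐ ζ, Filter.Tendsto (fun n => F n ζ) Filter.atTop (nhds 0)) :
    Filter.Tendsto (fun n => nrm (F n)) Filter.atTop (nhds 0) := by
  have h1 : Filter.Tendsto (fun n => ∫ ζ, ‖F n ζ‖) Filter.atTop (nhds (∫ _ : Plane, (0:ℝ))) := by
    refine tendsto_integral_of_dominated_convergence (fun ζ => ‖G ζ‖) (fun n => (hm n).norm)
      hG.int.norm (fun n => (hb n).mono fun ζ h => by simpa using h) ?_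
    filter_upwards [hl] with ζ h
    simpa using h.norm
  have h2 : Filter.Tendsto (fun n => eLpNorm (F n) 2 volume) Filter.atTop (nhds 0) := by
    have h3 : Filter.Tendsto (fun n => ∫⁻ ζ, ‖F n ζ‖ₑ ^ (2:ℝ)) Filter.atTop
        (nhds (∫⁻ _ : Plane, 0)) := by
      refine tendsto_lintegral_of_dominated_convergence' (fun ζ => ‖G ζ‖ₑ ^ (2:ℝ))
        (fun n => (hm n).enorm.pow_const _) (fun n => (hb n).mono fun ζ h => ?_) ?_ ?_
      · exact ENNReal.rpow_le_rpow (enorm_le_iff_norm_le.2 h) (by norm_num)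
      · have := lintegral_rpow_enorm_lt_top_of_eLpNorm_lt_top (p := 2) (by norm_num) (by norm_num)
          hG.l2.2
        simpa using this.ne
      · filter_upwards [hl] with ζ h
        have := (ENNReal.continuous_rpow_const (y := 2)).tendsto _ |>.comp h.enorm
        simpa [Function.comp_def] using this
    have h4 : ∀ n, eLpNorm (F n) 2 volume = (∫⁻ ζ, ‖F n ζ‖ₑ ^ (2:ℝ)) ^ (1 / 2 : ℝ) := by
      intro n
      rw [eLpNorm_eq_lintegral_rpow_enorm_toReal (by norm_num) (by norm_num)]
      simp
    simp only [h4]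
    have := (ENNReal.continuous_rpow_const (y := 1 / 2)).tendsto _ |>.comp h3
    simpa [Function.comp_def] using this
  have h5 := (ENNReal.tendsto_toReal ENNReal.zero_ne_top).comp h2
  simpa [nrm, Function.comp_def] using h1.add h5

/-- `v` pairs with Fourier transforms of functions in `L¹ ∩ L²`, with constant `A`. -/
structure Pairable (v : Plane → ℂ) (A : ℝ) : Prop where
  int : ∀ χ, Mem12 χ → Integrable (fun z => v z * 𝓕 χ z)
  bound : ∀ χ, Mem12 χ → ‖pair v χ‖ ≤ A * nrm χ

theorem Pairable.sub {v χ₁ χ₂ : Plane → ℂ} {A : ℝ} (hv : Pairable v A) (h₁ : Mem12 χ₁)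
    (h₂ : Mem12 χ₂) : pair v (fun ζ => χ₁ ζ - χ₂ ζ) = pair v χ₁ - pair v χ₂ := by
  simp only [pair]
  rw [← integral_sub (hv.int _ h₁) (hv.int _ h₂)]
  exact integral_congr_ae (ae_of_all _ fun z => by simp only [fourier_sub h₁.int h₂.int]; ring)

theorem pair_const_mul (v χ : Plane → ℂ) (c : ℂ) : pair v (fun ζ => c * χ ζ) = c * pair v χ := by
  simp only [pair]
  rw [← integral_const_mul]
  exact integral_congr_ae (ae_of_all _ fun z => by simp only [fourier_const_mul]; ring)

theorem Pairable.tendsto {v χ : Plane → ℂ} {A : ℝ} (hv : Pairable v A) {F : ℕ → Plane → ℂ}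
    (hF : ∀ n, Mem12 (F n)) (hχ : Mem12 χ)
    (h : Filter.Tendsto (fun n => nrm (fun ζ => F n ζ - χ ζ)) Filter.atTop (nhds 0)) :
    Filter.Tendsto (fun n => pair v (F n)) Filter.atTop (nhds (pair v χ)) := by
  rw [tendsto_iff_norm_sub_tendsto_zero]
  refine squeeze_zero (fun n => norm_nonneg _) (fun n => ?_) (by simpa using h.const_mul A)
  rw [← hv.sub (hF n) hχ]
  exact hv.bound _ ((hF n).sub hχ)

/-- For χ in L¹ ∩ L² the transform is bounded and square integrable. A single class of test
functions therefore serves u in L², forcings in L¹, and forcings in L^{4/3}, which lies in L¹ + L².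
-/
theorem pairable_of_integrable {v : Plane → ℂ} (hv : Integrable v) : Pairable v (∫ z, ‖v z‖) where
  int := fun χ hχ => hv.mul_bdd (c := ∫ ζ, ‖χ ζ‖) (continuous_fourier hχ.int).aestronglyMeasurable
    (ae_of_all _ fun z => norm_fourier_le χ z)
  bound := fun χ hχ => by
    have h0 : ‖pair v χ‖ ≤ ∫ z, ‖v z‖ * ∫ ζ, ‖χ ζ‖ := by
      refine norm_integral_le_of_norm_le (hv.norm.mul_const _) (ae_of_all _ fun z => ?_)
      rw [norm_mul]
      exact mul_le_mul_of_nonneg_left (norm_fourier_le χ z) (norm_nonneg _)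
    rw [integral_mul_const] at h0
    refine h0.trans (mul_le_mul_of_nonneg_left ?_ (integral_nonneg fun _ => norm_nonneg _))
    exact le_add_of_nonneg_right ENNReal.toReal_nonneg

theorem pairable_of_memLp {v : Plane → ℂ} (hv : MemLp v 2 volume) :
    Pairable v (eLpNorm v 2 volume).toReal where
  int := fun χ hχ => hv.integrable_mul (memLp_fourier hχ.int hχ.l2)
  bound := fun χ hχ => by
    have h1 : ‖pair v χ‖ₑ ≤ eLpNorm v 2 volume * eLpNorm χ 2 volume := by
      rw [← eLpNorm_fourier hχ.int hχ.l2]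
      refine (enorm_integral_le_lintegral_enorm _).trans ?_
      have := eLpNorm_smul_le_mul_eLpNorm (p := 2) (q := 2) (r := 1)
        (memLp_fourier hχ.int hχ.l2).1 hv.1
      rw [eLpNorm_one_eq_lintegral_enorm] at this
      simpa using this
    have h2 := ENNReal.toReal_mono (ENNReal.mul_ne_top hv.eLpNorm_ne_top hχ.l2.eLpNorm_ne_top) h1
    rw [toReal_enorm, ENNReal.toReal_mul] at h2
    refine h2.trans (mul_le_mul_of_nonneg_left ?_ ENNReal.toReal_nonneg)
    exact le_add_of_nonneg_left (integral_nonneg fun _ => norm_nonneg _)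

theorem Pairable.mono {v : Plane → ℂ} {A B : ℝ} (h : Pairable v A) (hAB : A ≤ B) : Pairable v B where
  int := h.int
  bound := fun χ hχ => (h.bound χ hχ).trans (mul_le_mul_of_nonneg_right hAB (nrm_nonneg χ))

theorem pair_add {v w χ : Plane → ℂ} {A B : ℝ} (hv : Pairable v A) (hw : Pairable w B) (hχ : Mem12 χ) :
    pair (fun z => v z + w z) χ = pair v χ + pair w χ := by
  simp only [pair, add_mul]
  exact integral_add (hv.int χ hχ) (hw.int χ hχ)

theorem Pairable.add {v w : Plane → ℂ} {A B : ℝ} (hv : Pairable v A) (hw : Pairable w B) :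
    Pairable (fun z => v z + w z) (A + B) where
  int := fun χ hχ => by
    simp only [add_mul]
    exact (hv.int χ hχ).add (hw.int χ hχ)
  bound := fun χ hχ => by
    rw [pair_add hv hw hχ, add_mul]
    exact (norm_add_le _ _).trans (add_le_add (hv.bound χ hχ) (hw.bound χ hχ))

/-! ### Compactly supported functions are dense in the Schwartz space -/

/-- A fixed smooth cutoff, equal to `1` on the unit ball. -/
noncomputable def cutoffBump : ContDiffBump (0 : Plane) := ⟨1, 2, one_pos, one_lt_two⟩

/-- The rescaled cutoff `z ↦ θ(z / (n + 1))`. -/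
noncomputable def cutoff (n : ℕ) (z : Plane) : ℂ := (cutoffBump (((n + 1 : ℝ)⁻¹) • z) : ℂ)

theorem contDiff_cutoff (n : ℕ) : ContDiff ℝ ∞ (cutoff n) :=
  Complex.ofRealCLM.contDiff.comp (cutoffBump.contDiff.comp (contDiff_const_smul _))

theorem hasCompactSupport_cutoff (n : ℕ) : HasCompactSupport (cutoff n) := by
  have h : HasCompactSupport (fun z : Plane => cutoffBump (((n + 1 : ℝ)⁻¹) • z)) :=
    cutoffBump.hasCompactSupport.comp_smul (by positivity)
  exact h.comp_left (g := fun r : ℝ => (r : ℂ)) rfl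

/-- Every derivative gains a factor 1/(n+1) by scaling. For i = 0 there is no such gain, but the
difference from 1 vanishes for ‖z‖ ≤ n + 1, so it is at most ‖z‖/(n+1); this is the origin of the
weight 1 + ‖z‖. -/
theorem exists_iteratedFDeriv_cutoff_le (i : ℕ) : ∃ M : ℝ, 0 ≤ M ∧ ∀ (n : ℕ) (z : Plane),
    ‖iteratedFDeriv ℝ i (fun z => cutoff n z - 1) z‖ ≤ M * (1 + ‖z‖) / (n + 1) := by
  set β : Plane → ℂ := fun w => (cutoffBump w : ℂ) - 1 with hβ
  have hθ : ContDiff ℝ ∞ (fun w => (cutoffBump w : ℂ)) :=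
    Complex.ofRealCLM.contDiff.comp cutoffBump.contDiff
  have hβc : ContDiff ℝ ∞ β := hθ.sub contDiff_const
  have hcs : HasCompactSupport (fun w => (cutoffBump w : ℂ)) :=
    cutoffBump.hasCompactSupport.comp_left (g := fun r : ℝ => (r : ℂ)) rfl
  have hscale : ∀ (n : ℕ) (z : Plane), ‖iteratedFDeriv ℝ i (fun z => cutoff n z - 1) z‖ ≤
      ‖iteratedFDeriv ℝ i β (((n + 1 : ℝ)⁻¹) • z)‖ * ((n + 1 : ℝ)⁻¹) ^ i := by
    intro n z
    set g : Plane →L[ℝ] Plane := ((n + 1 : ℝ)⁻¹) • ContinuousLinearMap.id ℝ Plane with hg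
    have h1 : (fun z => cutoff n z - 1) = β ∘ g := by
      funext z; simp [cutoff, hβ, hg]
    rw [h1, g.iteratedFDeriv_comp_right (n := ∞) hβc z (by exact_mod_cast le_top)]
    refine (ContinuousMultilinearMap.norm_compContinuousLinearMap_le _ _).trans ?_
    have h2 : ‖g‖ ≤ ((n + 1 : ℝ)⁻¹) := by
      refine g.opNorm_le_bound (by positivity) fun v => ?_
      rw [hg, smul_apply, norm_smul, Real.norm_of_nonneg (by positivity)]
      simp
    rw [Finset.prod_const, Finset.card_univ, Fintype.card_fin]
    have h3 : g z = ((n + 1 : ℝ)⁻¹) • z := by simp [hg]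
    rw [h3]
    gcongr
  rcases Nat.eq_zero_or_pos i with rfl | hi
  · refine ⟨1, zero_le_one, fun n z => (hscale n z).trans ?_⟩
    rw [pow_zero, mul_one, norm_iteratedFDeriv_zero, one_mul]
    set w := ((n + 1 : ℝ)⁻¹) • z with hw
    have hn : ‖w‖ = ‖z‖ / (n + 1) := by
      rw [hw, norm_smul, Real.norm_of_nonneg (by positivity)]; ring
    have hb : ‖β w‖ ≤ ‖w‖ := by
      by_cases h1 : ‖w‖ ≤ 1
      · have : cutoffBump w = 1 := cutoffBump.one_of_mem_closedBall (by simpa [cutoffBump] using h1)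
        simp [hβ, this]
      · have h2 := cutoffBump.nonneg (x := w)
        have h3 := cutoffBump.le_one (x := w)
        have : β w = ((cutoffBump w - 1 : ℝ) : ℂ) := by simp [hβ]
        rw [this, Complex.norm_real, Real.norm_eq_abs, abs_le]
        constructor <;> linarith
    refine hb.trans ?_
    rw [hn]
    gcongr; linarith
  · set Φ : 𝓢(Plane, ℂ) := hcs.toSchwartzMap hθ with hΦ
    refine ⟨SchwartzMap.seminorm ℝ 0 i Φ, apply_nonneg _ _, fun n z => (hscale n z).trans ?_⟩
    set w := ((n + 1 : ℝ)⁻¹) • z with hw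
    have h1 : iteratedFDeriv ℝ i β w = iteratedFDeriv ℝ i Φ w := by
      have h2 : β = (Φ : Plane → ℂ) + fun _ => (-1 : ℂ) := by funext w; simp [hβ, hΦ, sub_eq_add_neg]
      rw [h2, iteratedFDeriv_add_apply (Φ.smooth _).contDiffAt contDiff_const.contDiffAt,
        iteratedFDeriv_const_of_ne hi.ne']
      simp
    have h3 := Φ.le_seminorm ℝ 0 i w
    rw [pow_zero, one_mul] at h3
    rw [h1]
    have h4 : ((n + 1 : ℝ)⁻¹) ^ i ≤ (n + 1 : ℝ)⁻¹ := by
      have := pow_le_pow_of_le_one (a := (n + 1 : ℝ)⁻¹) (by positivity)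
        (inv_le_one_of_one_le₀ (by linarith [Nat.cast_nonneg (α := ℝ) n])) hi
      simpa using this
    calc _ ≤ SchwartzMap.seminorm ℝ 0 i Φ * (n + 1 : ℝ)⁻¹ := by gcongr
      _ ≤ SchwartzMap.seminorm ℝ 0 i Φ * (1 + ‖z‖) * (n + 1 : ℝ)⁻¹ := by
        gcongr
        exact le_mul_of_one_le_right (apply_nonneg _ _) (by linarith [norm_nonneg z])
      _ = _ := by ring

/-- Multiplication of a Schwartz function by the cutoff. -/
noncomputable def cutoffMul (n : ℕ) (Φ : 𝓢(Plane, ℂ)) : 𝓢(Plane, ℂ) :=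
  HasCompactSupport.toSchwartzMap (f := fun z => cutoff n z * Φ z) (hasCompactSupport_cutoff n).mul_right
    ((contDiff_cutoff n).mul (Φ.smooth _))

theorem hasCompactSupport_cutoffMul (n : ℕ) (Φ : 𝓢(Plane, ℂ)) : HasCompactSupport (cutoffMul n Φ) :=
  (hasCompactSupport_cutoff n).mul_right

/-- The weak equation admits only compactly supported test functions, whereas those localised in
frequency are not compactly supported; this density bridges the gap. By Leibniz, the weight 1 + ‖z‖
costs one more power of ‖z‖, that is, a seminorm of order k + 1, and the whole is O(1/n). -/
theorem tendsto_cutoffMul (Φ : 𝓢(Plane, ℂ)) :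
    Filter.Tendsto (fun n => cutoffMul n Φ) Filter.atTop (nhds Φ) := by
  rw [(schwartz_withSeminorms ℝ Plane ℂ).tendsto_nhds _ Φ]
  rintro ⟨k, m⟩ ε hε
  choose M hM0 hM using exists_iteratedFDeriv_cutoff_le
  set S : ℕ → ℝ := fun i => SchwartzMap.seminorm ℝ k (m - i) Φ + SchwartzMap.seminorm ℝ (k + 1) (m - i) Φ
  have hS : ∀ i, 0 ≤ S i := fun i => add_nonneg (apply_nonneg _ _) (apply_nonneg _ _)
  set B : ℝ := ∑ i ∈ Finset.range (m + 1), (m.choose i : ℝ) * (M i * S i) with hB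
  have hB0 : 0 ≤ B := Finset.sum_nonneg fun i _ =>
    mul_nonneg (Nat.cast_nonneg _) (mul_nonneg (hM0 i) (hS i))
  have hbound : ∀ n : ℕ, SchwartzMap.seminorm ℝ k m (cutoffMul n Φ - Φ) ≤ B / (n + 1) := by
    intro n
    refine SchwartzMap.seminorm_le_bound ℝ k m _ (by positivity) fun z => ?_
    have h1 : ((cutoffMul n Φ - Φ : 𝓢(Plane, ℂ)) : Plane → ℂ) = fun y => (cutoff n y - 1) * Φ y := by
      funext y
      simp [cutoffMul, sub_mul]
    rw [h1]
    have h2 := norm_iteratedFDeriv_mul_le (𝕜 := ℝ) (n := m) (N := ∞)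
      ((contDiff_cutoff n).sub (contDiff_const (c := (1:ℂ)))) (Φ.smooth _) z (by exact_mod_cast le_top)
    refine (mul_le_mul_of_nonneg_left h2 (by positivity)).trans ?_
    rw [Finset.mul_sum, hB, Finset.sum_div]
    refine Finset.sum_le_sum fun i _ => ?_
    have h3 := hM i n z
    have h4 := Φ.le_seminorm ℝ k (m - i) z
    have h5 := Φ.le_seminorm ℝ (k + 1) (m - i) z
    calc ‖z‖ ^ k * ((m.choose i : ℝ) * ‖iteratedFDeriv ℝ i (fun y => cutoff n y - 1) z‖ *
          ‖iteratedFDeriv ℝ (m - i) Φ z‖)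
        ≤ ‖z‖ ^ k * ((m.choose i : ℝ) * (M i * (1 + ‖z‖) / (n + 1)) *
          ‖iteratedFDeriv ℝ (m - i) Φ z‖) := by gcongr
      _ = (m.choose i : ℝ) * (M i * (‖z‖ ^ k * ‖iteratedFDeriv ℝ (m - i) Φ z‖ +
          ‖z‖ ^ (k + 1) * ‖iteratedFDeriv ℝ (m - i) Φ z‖)) / (n + 1) := by ring
      _ ≤ _ := by
        have := hM0 i
        gcongr
        exact add_le_add h4 h5
  have hlim : Filter.Tendsto (fun n : ℕ => B / ((n : ℝ) + 1)) Filter.atTop (nhds 0) := by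
    have := (tendsto_const_div_atTop_nhds_zero_nat B).comp (Filter.tendsto_add_atTop_nat 1)
    simpa [Function.comp_def] using this
  filter_upwards [hlim.eventually (gt_mem_nhds hε)] with n hn
  exact (hbound n).trans_lt hn

open LineDeriv

/-! ### The weak formulation tested with Fourier transforms of Schwartz functions -/

theorem hasTemperateGrowth_symbol (i : Fin 2) :
    (fun ζ : Plane => -(2 * (Real.pi : ℂ) * Complex.I) * (ζ i : ℂ)).HasTemperateGrowth := by
  have h : (fun ζ : Plane => ((ζ i : ℝ) : ℂ)).HasTemperateGrowth :=
    (Complex.ofRealCLM.comp (EuclideanSpace.proj i : Plane →L[ℝ] ℝ)).hasTemperateGrowth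
  exact (Function.HasTemperateGrowth.const _).mul h

/-- Multiplication by `-2πi ζᵢ`, the Fourier side of `∂ᵢ`. -/
noncomputable def symbolMul (i : Fin 2) : 𝓢(Plane, ℂ) →L[ℂ] 𝓢(Plane, ℂ) :=
  SchwartzMap.smulLeftCLM ℂ (fun ζ : Plane => -(2 * (Real.pi : ℂ) * Complex.I) * (ζ i : ℂ))

theorem symbolMul_apply (i : Fin 2) (χ : 𝓢(Plane, ℂ)) (ζ : Plane) :
    symbolMul i χ ζ = -(2 * (Real.pi : ℂ) * Complex.I) * (ζ i : ℂ) * χ ζ := by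
  rw [symbolMul, SchwartzMap.smulLeftCLM_apply_apply (hasTemperateGrowth_symbol i), smul_eq_mul]

/-- Multiplication by the Bessel symbol. -/
noncomputable def besselMul (θ : ℝ) : 𝓢(Plane, ℂ) →L[ℂ] 𝓢(Plane, ℂ) :=
  SchwartzMap.smulLeftCLM ℂ (fun ζ : Plane => (besselSymbol θ ζ : ℂ))

theorem besselMul_apply (θ : ℝ) (χ : 𝓢(Plane, ℂ)) (ζ : Plane) :
    besselMul θ χ ζ = (besselSymbol θ ζ : ℂ) * χ ζ := by
  rw [besselMul, SchwartzMap.smulLeftCLM_apply_apply (besselSymbol_hasTemperateGrowth θ), smul_eq_mul]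

theorem lineDeriv_fourier (i : Fin 2) (χ : 𝓢(Plane, ℂ)) :
    ∂_{(EuclideanSpace.single i 1 : Plane)} (𝓕 χ) = 𝓕 (symbolMul i χ) := by
  rw [SchwartzMap.lineDerivOp_fourier_eq]
  congr 1
  ext ζ
  have h : (fun ζ : Plane => inner ℝ ζ (EuclideanSpace.single i 1 : Plane)).HasTemperateGrowth :=
    ((innerSL ℝ).flip (EuclideanSpace.single i 1 : Plane)).hasTemperateGrowth
  rw [symbolMul_apply, smul_apply, SchwartzMap.smulLeftCLM_apply_apply h]
  simp [EuclideanSpace.inner_single_right]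
  ring

theorem Jx_apply_fourier (θ : ℝ) (S : 𝓢'(Plane, ℂ)) (χ : 𝓢(Plane, ℂ)) :
    Jx θ S (𝓕 χ) = S (𝓕 (besselMul θ χ)) := by
  rw [Jx, TemperedDistribution.fourierMultiplierCLM_apply_apply, fourierInv_fourier_eq, besselMul]

theorem bessel_neg_mul (θ : ℝ) (χ : 𝓢(Plane, ℂ)) : besselMul θ (besselMul (-θ) χ) = χ := by
  ext ζ
  rw [besselMul_apply, besselMul_apply, besselSymbol_eq, besselSymbol_eq, ← mul_assoc,
    ← Complex.ofReal_mul, ← bes_add, add_neg_cancel, bes_zero]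
  simp

theorem Represents.fourier_eq_pair {S : 𝓢'(Plane, ℂ)} {g : Plane → ℂ} (h : Represents S g)
    (χ : 𝓢(Plane, ℂ)) : S (𝓕 χ) = pair g χ := (h (𝓕 χ)).2

/-- This is how J_x^θ f replaces f: the distribution f is never estimated, it enters only through
the function g = J_x^θ f and the inverse symbol on the test side. -/
theorem apply_fourier_eq_pair {θ : ℝ} {S : 𝓢'(Plane, ℂ)} {g : Plane → ℂ}
    (h : Represents (Jx θ S) g) (χ : 𝓢(Plane, ℂ)) : S (𝓕 χ) = pair g (besselMul (-θ) χ) := by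
  rw [← h.fourier_eq_pair, Jx_apply_fourier, bessel_neg_mul]

theorem mem12_schwartz (χ : 𝓢(Plane, ℂ)) : Mem12 χ := ⟨χ.integrable, χ.memLp 2⟩

theorem tendsto_nrm_schwartz {F : ℕ → 𝓢(Plane, ℂ)} {χ : 𝓢(Plane, ℂ)}
    (h : Filter.Tendsto F Filter.atTop (nhds χ)) :
    Filter.Tendsto (fun n => nrm (fun ζ => F n ζ - χ ζ)) Filter.atTop (nhds 0) := by
  have e : ∀ φ : 𝓢(Plane, ℂ), nrm φ = ‖SchwartzMap.toLpCLM ℂ ℂ 1 volume φ‖ +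
      ‖SchwartzMap.toLpCLM ℂ ℂ 2 volume φ‖ := by
    intro φ
    rw [SchwartzMap.toLpCLM_apply, SchwartzMap.toLpCLM_apply, SchwartzMap.norm_toLp,
      SchwartzMap.norm_toLp, nrm, eLpNorm_one_eq_lintegral_enorm, integral_norm_eq_lintegral_enorm
        φ.integrable.aestronglyMeasurable]
  have hc : Continuous (fun φ : 𝓢(Plane, ℂ) => nrm φ) := by
    simp only [e]
    exact (SchwartzMap.toLpCLM ℂ ℂ 1 volume).continuous.norm.add
      (SchwartzMap.toLpCLM ℂ ℂ 2 volume).continuous.norm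
  have h1 : Filter.Tendsto (fun n => F n - χ) Filter.atTop (nhds 0) := by
    simpa using h.sub_const χ
  have h2 := (hc.tendsto 0).comp h1
  have h3 : nrm ((0 : 𝓢(Plane, ℂ)) : Plane → ℂ) = 0 := by rw [e, map_zero, map_zero, norm_zero, norm_zero, add_zero]
  rw [h3] at h2
  exact h2

theorem aestronglyMeasurable_pair {T : ℝ} {v : ℝ → Plane → ℂ}
    (hv : AEStronglyMeasurable (Function.uncurry v) (slabMeasure T)) {χ : Plane → ℂ}
    (hχ : Integrable χ) : AEStronglyMeasurable (fun t => pair (v t) χ) (volume.restrict (Ioo 0 T)) := by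
  have h : AEStronglyMeasurable (fun p : ℝ × Plane => Function.uncurry v p * 𝓕 χ p.2) (slabMeasure T) :=
    hv.mul ((continuous_fourier hχ).comp continuous_snd).aestronglyMeasurable
  exact AEStronglyMeasurable.integral_prod_right' h

/-- A function of time and space which pairs, with an integrable constant. -/
structure TimePairable (T : ℝ) (v : ℝ → Plane → ℂ) (A : ℝ → ℝ) : Prop where
  meas : AEStronglyMeasurable (Function.uncurry v) (slabMeasure T)
  int : IntegrableOn A (Ioo 0 T)
  pairable : ∀ᵐ t ∂volume.restrict (Ioo 0 T), Pairable (v t) (A t)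

theorem TimePairable.integrable {T : ℝ} {v : ℝ → Plane → ℂ} {A : ℝ → ℝ} (h : TimePairable T v A)
    {χ : Plane → ℂ} (hχ : Mem12 χ) : IntegrableOn (fun t => pair (v t) χ) (Ioo 0 T) :=
  (h.int.mul_const (nrm χ)).mono' (aestronglyMeasurable_pair h.meas hχ.int)
    (h.pairable.mono fun _ ht => ht.bound χ hχ)

theorem TimePairable.tendsto {T : ℝ} {v : ℝ → Plane → ℂ} {A : ℝ → ℝ} (h : TimePairable T v A)
    {c : ℝ → ℝ} (hc : Continuous c) (hcb : ∃ M, ∀ t, ‖c t‖ ≤ M) {F : ℕ → Plane → ℂ} {χ : Plane → ℂ}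
    (hF : ∀ n, Mem12 (F n)) (hχ : Mem12 χ)
    (hl : Filter.Tendsto (fun n => nrm (fun ζ => F n ζ - χ ζ)) Filter.atTop (nhds 0)) :
    Filter.Tendsto (fun n => ∫ t in Ioo 0 T, (c t : ℂ) * pair (v t) (F n)) Filter.atTop
      (nhds (∫ t in Ioo 0 T, (c t : ℂ) * pair (v t) χ)) := by
  obtain ⟨B, hB⟩ := hl.bddAbove_range
  have i1 : ∀ {χ}, Mem12 χ → IntegrableOn (fun t => (c t : ℂ) * pair (v t) χ) (Ioo 0 T) := fun hχ =>
    integrableOn_test_smul (h.integrable hχ) hc hcb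
  obtain ⟨M, hM⟩ := hcb
  have hM0 : 0 ≤ M := (norm_nonneg _).trans (hM 0)
  rw [tendsto_iff_norm_sub_tendsto_zero]
  refine squeeze_zero (fun n => norm_nonneg _) (fun n => ?_)
    (by simpa using hl.const_mul (M * ∫ t in Ioo 0 T, A t))
  rw [← integral_sub (i1 (hF n)) (i1 hχ)]
  refine (norm_integral_le_of_norm_le
    (g := fun t => M * (A t * nrm (fun ζ => F n ζ - χ ζ))) ((h.int.mul_const _).const_mul _) ?_).trans
    (le_of_eq ?_)
  · filter_upwards [h.pairable] with t ht
    rw [← mul_sub, ← ht.sub (hF n) hχ, norm_mul, Complex.norm_real]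
    exact mul_le_mul (hM t) (ht.bound _ ((hF n).sub hχ)) (norm_nonneg _) hM0
  · rw [integral_const_mul, integral_mul_const]; ring

theorem dirDeriv_time_tensor {η : ℝ → ℝ} (hη : ContDiff ℝ ∞ η) (Φ : 𝓢(Plane, ℂ)) :
    dt (fun p => (η p.1 : ℂ) * Φ p.2) = fun p => ((deriv η p.1 : ℝ) : ℂ) * Φ p.2 := by
  funext p
  have h1 : HasDerivAt η (deriv η p.1) p.1 := (hη.differentiable (by simp) p.1).hasDerivAt
  have h2 : HasFDerivAt (fun p : ℝ × Plane => (η p.1 : ℂ))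
      ((Complex.ofRealCLM.comp (ContinuousLinearMap.toSpanSingleton ℝ (deriv η p.1))).comp
        (ContinuousLinearMap.fst ℝ ℝ Plane)) p :=
    (Complex.ofRealCLM.hasFDerivAt.comp p.1 h1.hasFDerivAt).comp p hasFDerivAt_fst
  have h3 : HasFDerivAt (fun p : ℝ × Plane => Φ p.2)
      ((fderiv ℝ Φ p.2).comp (ContinuousLinearMap.snd ℝ ℝ Plane)) p :=
    (Φ.differentiableAt.hasFDerivAt).comp p hasFDerivAt_snd
  rw [dt, dirDeriv, show fderiv ℝ (fun p : ℝ × Plane => (η p.1 : ℂ) * Φ p.2) p = _ from (h2.mul h3).fderiv]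
  simp
  ring

theorem dirDeriv_space_tensor {η : ℝ → ℝ} (hη : ContDiff ℝ ∞ η) (Φ : 𝓢(Plane, ℂ)) (v : Plane) :
    dirDeriv (0, v) (fun p => (η p.1 : ℂ) * Φ p.2) = fun p => (η p.1 : ℂ) * (∂_{v} Φ) p.2 := by
  funext p
  have h1 : HasDerivAt η (deriv η p.1) p.1 := (hη.differentiable (by simp) p.1).hasDerivAt
  have h2 : HasFDerivAt (fun p : ℝ × Plane => (η p.1 : ℂ))
      ((Complex.ofRealCLM.comp (ContinuousLinearMap.toSpanSingleton ℝ (deriv η p.1))).comp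
        (ContinuousLinearMap.fst ℝ ℝ Plane)) p :=
    (Complex.ofRealCLM.hasFDerivAt.comp p.1 h1.hasFDerivAt).comp p hasFDerivAt_fst
  have h3 : HasFDerivAt (fun p : ℝ × Plane => Φ p.2)
      ((fderiv ℝ Φ p.2).comp (ContinuousLinearMap.snd ℝ ℝ Plane)) p :=
    (Φ.differentiableAt.hasFDerivAt).comp p hasFDerivAt_snd
  rw [dirDeriv, show fderiv ℝ (fun p : ℝ × Plane => (η p.1 : ℂ) * Φ p.2) p = _ from (h2.mul h3).fderiv,
    SchwartzMap.lineDerivOp_apply_eq_fderiv]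
  simp

theorem restrict_slab (T : ℝ) :
    (volume : Measure (ℝ × Plane)).restrict (Ioo 0 T ×ˢ univ) = slabMeasure T := by
  rw [slabMeasure, Measure.volume_eq_prod, ← Measure.prod_restrict, Measure.restrict_univ]

theorem integrable_mul_tensor {T : ℝ} {F : ℝ × Plane → ℂ}
    (hF : LocallyIntegrableOn F (Ioo 0 T ×ˢ univ) volume) {a : ℝ → ℝ} (ha : Continuous a)
    {K : Set ℝ} (hK : IsCompact K) (hKT : K ⊆ Ioo 0 T) (haK : ∀ t ∉ K, a t = 0) {Ψ : Plane → ℂ}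
    (hΨ : Continuous Ψ) (hΨc : HasCompactSupport Ψ) :
    Integrable (fun p : ℝ × Plane => F p * ((a p.1 : ℂ) * Ψ p.2)) (slabMeasure T) := by
  have hc : Continuous (fun p : ℝ × Plane => (a p.1 : ℂ) * Ψ p.2) := by fun_prop
  have hcomp : IsCompact (K ×ˢ tsupport Ψ) := hK.prod hΨc
  have hsub : K ×ˢ tsupport Ψ ⊆ Ioo 0 T ×ˢ univ := prod_mono hKT (subset_univ _)
  have h1 : IntegrableOn F (K ×ˢ tsupport Ψ) volume := hF.integrableOn_compact_subset hsub hcomp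
  have h2 : IntegrableOn (fun p => F p * ((a p.1 : ℂ) * Ψ p.2)) (K ×ˢ tsupport Ψ) volume :=
    h1.mul_continuousOn hc.continuousOn hcomp
  have h3 : Function.support (fun p : ℝ × Plane => F p * ((a p.1 : ℂ) * Ψ p.2)) ⊆ K ×ˢ tsupport Ψ := by
    intro p hp
    simp only [Function.mem_support, ne_eq, mul_eq_zero, not_or] at hp
    refine ⟨?_, subset_tsupport _ hp.2.2⟩
    by_contra hnot
    exact hp.2.1 (by simp [haK _ hnot])
  rw [← restrict_slab]
  exact ((integrableOn_iff_integrable_of_support_subset h3).1 h2).integrableOn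

theorem hasCompactSupport_lineDeriv {Φ : 𝓢(Plane, ℂ)} (h : HasCompactSupport Φ) (v : Plane) :
    HasCompactSupport (∂_{v} Φ : 𝓢(Plane, ℂ)) := by
  have : ((∂_{v} Φ : 𝓢(Plane, ℂ)) : Plane → ℂ) = fun z => fderiv ℝ Φ z v := by
    funext z; rw [SchwartzMap.lineDerivOp_apply_eq_fderiv]
  rw [this]
  exact h.fderiv_apply ℝ v

/-- The definition is tested with η(t)Φ(z), whose support is compact in the slab; local
integrability then justifies Fubini for each term separately. -/
theorem IsSolution.weak_compact {T : ℝ} {u f : ℝ → Plane → ℂ} (h : IsSolution T u f)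
    {η : ℝ → ℝ} (hη : IsTest T η) {Φ : 𝓢(Plane, ℂ)} (hΦ : HasCompactSupport Φ) :
    (∫ t in Ioo 0 T, ((deriv η t : ℝ) : ℂ) * ∫ z, u t z * (∂_{(EuclideanSpace.single 0 1 : Plane)} Φ) z) +
    (∫ t in Ioo 0 T, (η t : ℂ) * ∫ z, u t z * (∂_{(EuclideanSpace.single 0 1 : Plane)}
      (∂_{(EuclideanSpace.single 0 1 : Plane)} (∂_{(EuclideanSpace.single 0 1 : Plane)}
      (∂_{(EuclideanSpace.single 0 1 : Plane)} Φ)))) z) -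
    (∫ t in Ioo 0 T, (η t : ℂ) * ∫ z, u t z * (∂_{(EuclideanSpace.single 1 1 : Plane)}
      (∂_{(EuclideanSpace.single 1 1 : Plane)} Φ)) z) +
    (∫ t in Ioo 0 T, (η t : ℂ) * ∫ z, f t z * (∂_{(EuclideanSpace.single 0 1 : Plane)}
      (∂_{(EuclideanSpace.single 0 1 : Plane)} Φ)) z) = 0 := by
  obtain ⟨hu, hf, hw⟩ := h
  have hd : ContDiff ℝ ∞ (deriv η) := (contDiff_infty_iff_deriv.1 hη.contDiff).2
  have hK : ∀ t ∉ tsupport η, η t = 0 := fun t ht => image_eq_zero_of_notMem_tsupport ht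
  have hK' : ∀ t ∉ tsupport η, deriv η t = 0 := fun t ht => by
    have h1 : t ∉ tsupport (deriv η) := fun h1 => ht (tsupport_deriv_subset h1)
    exact image_eq_zero_of_notMem_tsupport h1
  have hfub : ∀ {F : ℝ → Plane → ℂ}, LocallyIntegrableOn (Function.uncurry F) (Ioo 0 T ×ˢ univ) volume →
      ∀ {a : ℝ → ℝ}, Continuous a → (∀ t ∉ tsupport η, a t = 0) → ∀ {Ψ : 𝓢(Plane, ℂ)},
      HasCompactSupport Ψ → Integrable (fun p : ℝ × Plane => F p.1 p.2 * ((a p.1 : ℂ) * Ψ p.2)) (slabMeasure T) ∧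
      ∫ p, F p.1 p.2 * ((a p.1 : ℂ) * Ψ p.2) ∂(slabMeasure T) =
        ∫ t in Ioo 0 T, (a t : ℂ) * ∫ z, F t z * Ψ z := by
    intro F hF a ha haK Ψ hΨ
    have h1 := integrable_mul_tensor hF ha hη.hasCompactSupport hη.tsupport_subset haK Ψ.continuous hΨ
    refine ⟨h1, (integral_prod _ h1).trans ?_⟩
    refine integral_congr_ae (ae_of_all _ fun t => ?_)
    simp only [Function.uncurry]
    rw [← integral_const_mul]
    exact integral_congr_ae (ae_of_all _ fun z => by ring)
  set X : Plane := EuclideanSpace.single 0 1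
  set Y : Plane := EuclideanSpace.single 1 1
  have c1 := hasCompactSupport_lineDeriv hΦ X
  have c2 := hasCompactSupport_lineDeriv c1 X
  have c4 := hasCompactSupport_lineDeriv (hasCompactSupport_lineDeriv c2 X) X
  have d2 := hasCompactSupport_lineDeriv (hasCompactSupport_lineDeriv hΦ Y) Y
  obtain ⟨i1, e1⟩ := hfub hu hη.continuous_deriv hK' c1
  obtain ⟨i2, e2⟩ := hfub hu hη.contDiff.continuous hK c4
  obtain ⟨i3, e3⟩ := hfub hu hη.contDiff.continuous hK d2
  obtain ⟨i4, e4⟩ := hfub hf hη.contDiff.continuous hK c2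
  rw [← e1, ← e2, ← e3, ← e4, ← integral_add' i1 i2, ← integral_sub' (i1.add i2) i3,
    ← integral_add' ((i1.add i2).sub i3) i4]
  have hsm : ContDiff ℝ ∞ (fun p : ℝ × Plane => (η p.1 : ℂ) * Φ p.2) :=
    (Complex.ofRealCLM.contDiff.comp (hη.contDiff.comp contDiff_fst)).mul ((Φ.smooth _).comp contDiff_snd)
  have hts : Function.support (fun p : ℝ × Plane => (η p.1 : ℂ) * Φ p.2) ⊆ tsupport η ×ˢ tsupport Φ := by
    intro p hp
    simp only [Function.mem_support, ne_eq, mul_eq_zero, not_or] at hp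
    exact ⟨subset_tsupport _ (by simpa using hp.1), subset_tsupport _ hp.2⟩
  have hcp : IsCompact (tsupport η ×ˢ tsupport Φ) := hη.hasCompactSupport.prod hΦ
  have := hw _ hsm (HasCompactSupport.of_support_subset_isCompact hcp hts)
    ((closure_minimal hts hcp.isClosed).trans (prod_mono hη.tsupport_subset (subset_univ _)))
  rw [restrict_slab] at this
  rw [← this]
  refine integral_congr_ae (ae_of_all _ fun p => ?_)
  simp only [Pi.add_apply, Pi.sub_apply, dirDeriv_time_tensor hη.contDiff, dx, dy, dirDeriv_space_tensor hη.contDiff,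
    dirDeriv_space_tensor hd]
  ring

/-- Derivatives of 𝓕χ are transforms of symbol multiples of χ. The compact-support restriction is
removed by cutting off 𝓕χ: the modified χ converge in the Schwartz topology, hence in L¹ ∩ L² after
any continuous operator, and the pairings are continuous for that norm. -/
theorem IsSolution.weak_fourier {T : ℝ} {u f g : ℝ → Plane → ℂ} {θ : ℝ} {A B : ℝ → ℝ}
    (h : IsSolution T u f) (hu : TimePairable T u A) (hg : TimePairable T g B)
    (hfg : ∀ᵐ t ∂volume.restrict (Ioo 0 T),
      ∃ S : 𝓢'(Plane, ℂ), Represents S (f t) ∧ Represents (Jx θ S) (g t))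
    {η : ℝ → ℝ} (hη : IsTest T η) (χ : 𝓢(Plane, ℂ)) :
    (∫ t in Ioo 0 T, ((deriv η t : ℝ) : ℂ) * pair (u t) (symbolMul 0 χ)) +
    (∫ t in Ioo 0 T, (η t : ℂ) * pair (u t)
      (symbolMul 0 (symbolMul 0 (symbolMul 0 (symbolMul 0 χ))))) -
    (∫ t in Ioo 0 T, (η t : ℂ) * pair (u t) (symbolMul 1 (symbolMul 1 χ))) +
    (∫ t in Ioo 0 T, (η t : ℂ) * pair (g t) (besselMul (-θ) (symbolMul 0 (symbolMul 0 χ)))) = 0 := by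
  set F : ℕ → 𝓢(Plane, ℂ) := fun n => 𝓕⁻ (cutoffMul n (𝓕 χ)) with hF
  have hFl : Filter.Tendsto F Filter.atTop (nhds χ) := by
    have h1 := (FourierTransform.fourierInvCLM ℂ 𝓢(Plane, ℂ)).continuous.tendsto (𝓕 χ)
    have h2 := h1.comp (tendsto_cutoffMul (𝓕 χ))
    simpa [Function.comp_def, hF] using h2
  have hlim : ∀ {v : ℝ → Plane → ℂ} {A : ℝ → ℝ}, TimePairable T v A → ∀ {c : ℝ → ℝ}, Continuous c →
      (∃ M, ∀ t, ‖c t‖ ≤ M) → ∀ L : 𝓢(Plane, ℂ) →L[ℂ] 𝓢(Plane, ℂ),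
      Filter.Tendsto (fun n => ∫ t in Ioo 0 T, (c t : ℂ) * pair (v t) (L (F n))) Filter.atTop
      (nhds (∫ t in Ioo 0 T, (c t : ℂ) * pair (v t) (L χ))) := fun hv c hc hcb L =>
    hv.tendsto hc hcb (fun n => mem12_schwartz _) (mem12_schwartz _)
      (tendsto_nrm_schwartz ((L.continuous.tendsto χ).comp hFl))
  obtain ⟨M, hM⟩ := hη.exists_bound
  have b1 : ∃ M, ∀ t, ‖η t‖ ≤ M := ⟨M, fun t => (hM t).1⟩
  have b2 : ∃ M, ∀ t, ‖deriv η t‖ ≤ M := ⟨M, fun t => (hM t).2⟩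
  have l1 := hlim hu hη.continuous_deriv b2 (symbolMul 0)
  have l2 := hlim hu hη.contDiff.continuous b1
    (symbolMul 0 ∘L symbolMul 0 ∘L symbolMul 0 ∘L symbolMul 0)
  have l3 := hlim hu hη.contDiff.continuous b1 (symbolMul 1 ∘L symbolMul 1)
  have l4 := hlim hg hη.contDiff.continuous b1 (besselMul (-θ) ∘L symbolMul 0 ∘L symbolMul 0)
  refine tendsto_nhds_unique (((l1.add l2).sub l3).add l4) ?_
  refine tendsto_const_nhds.congr fun n => ?_
  have hΦ : 𝓕 (F n) = cutoffMul n (𝓕 χ) := by rw [hF]; exact fourier_fourierInv_eq _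
  have hw := h.weak_compact hη (Φ := 𝓕 (F n)) (by rw [hΦ]; exact hasCompactSupport_cutoffMul n _)
  simp only [lineDeriv_fourier] at hw
  rw [← hw]
  congr 1
  refine integral_congr_ae ?_
  filter_upwards [hfg] with t ⟨S, hS, hJ⟩
  congr 1
  rw [← (hS (𝓕 (symbolMul 0 (symbolMul 0 (F n))))).2, apply_fourier_eq_pair hJ]
  rfl

end KP

namespace KP

/-! ### Duhamel's formula -/

/-- Smooth compactly supported functions vanishing near `{ζ₀ = 0}`. -/
structure AwayTest (ψ : Plane → ℂ) : Prop where
  contDiff : ContDiff ℝ ∞ ψ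
  hasCompactSupport : HasCompactSupport ψ
  ne_zero : ∀ ζ ∈ tsupport ψ, ζ 0 ≠ 0

theorem AwayTest.mul {ψ : Plane → ℂ} (h : AwayTest ψ) {m : Plane → ℂ}
    (hm : ∀ ζ : Plane, ζ 0 ≠ 0 → ContDiffAt ℝ ∞ m ζ) : AwayTest (fun ζ => m ζ * ψ ζ) where
  contDiff := by
    rw [contDiff_iff_contDiffAt]
    intro ζ
    by_cases hζ : ζ ∈ tsupport ψ
    · exact (hm ζ (h.ne_zero ζ hζ)).mul h.contDiff.contDiffAt
    · have : (fun ζ => m ζ * ψ ζ) =ᶠ[nhds ζ] fun _ => 0 := by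
        filter_upwards [notMem_tsupport_iff_eventuallyEq.1 hζ] with ξ hξ
        simp [hξ]
      exact contDiffAt_const.congr_of_eventuallyEq this
  hasCompactSupport := h.hasCompactSupport.mul_left
  ne_zero := fun ζ hζ => h.ne_zero ζ (tsupport_mul_subset_right hζ)

theorem contDiff_coord (i : Fin 2) : ContDiff ℝ ∞ (fun ζ : Plane => ζ i) :=
  (EuclideanSpace.proj i : Plane →L[ℝ] ℝ).contDiff

theorem contDiffAt_disp {ζ : Plane} (h : ζ 0 ≠ 0) : ContDiffAt ℝ ∞ disp ζ := by
  have h0 := (contDiff_coord 0).contDiffAt (x := ζ)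
  have h1 := (contDiff_coord 1).contDiffAt (x := ζ)
  unfold disp
  exact ((contDiffAt_const.mul h0).pow 3).add ((contDiffAt_const.mul (h1.pow 2)).div h0 h)

theorem contDiffAt_dispPow {ζ : Plane} (h : ζ 0 ≠ 0) (n : ℕ) :
    ContDiffAt ℝ ∞ (fun ζ : Plane => (disp ζ : ℂ) ^ n) ζ :=
  ((Complex.ofRealCLM.contDiff.contDiffAt).comp ζ (contDiffAt_disp h)).pow n

theorem AwayTest.exists_disp_le {ψ : Plane → ℂ} (h : AwayTest ψ) :
    ∃ C, 0 ≤ C ∧ ∀ ζ, ψ ζ ≠ 0 → |disp ζ| ≤ C := by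
  have hc : ContinuousOn disp (tsupport ψ) := fun ζ hζ =>
    (contDiffAt_disp (h.ne_zero ζ hζ)).continuousAt.continuousWithinAt
  obtain ⟨C, hC⟩ := h.hasCompactSupport.exists_bound_of_continuousOn hc
  refine ⟨max C 0, le_max_right _ _, fun ζ hζ => ?_⟩
  exact (hC ζ (subset_tsupport _ hζ)).trans (le_max_left _ _)

/-- An `AwayTest` as a Schwartz function. -/
noncomputable def AwayTest.toSchwartz {ψ : Plane → ℂ} (h : AwayTest ψ) : 𝓢(Plane, ℂ) :=
  h.hasCompactSupport.toSchwartzMap h.contDiff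

theorem AwayTest.toSchwartz_apply {ψ : Plane → ℂ} (h : AwayTest ψ) (ζ : Plane) :
    h.toSchwartz ζ = ψ ζ := rfl

theorem AwayTest.mem12 {ψ : Plane → ℂ} (h : AwayTest ψ) : Mem12 ψ := mem12_schwartz h.toSchwartz

theorem AwayTest.dispPow {ψ : Plane → ℂ} (h : AwayTest ψ) (n : ℕ) :
    AwayTest (fun ζ => (disp ζ : ℂ) ^ n * ψ ζ) := h.mul fun _ hζ => contDiffAt_dispPow hζ n

theorem Pairable.sum {v : Plane → ℂ} {A : ℝ} (hv : Pairable v A) {F : ℕ → Plane → ℂ}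
    (hF : ∀ n, Mem12 (F n)) (L : ℕ) :
    pair v (fun ζ => ∑ n ∈ Finset.range L, F n ζ) = ∑ n ∈ Finset.range L, pair v (F n) := by
  simp only [pair]
  rw [← integral_finsetSum _ fun n _ => hv.int _ (hF n)]
  refine integral_congr_ae (ae_of_all _ fun z => ?_)
  simp only [← Finset.mul_sum]
  congr 1
  simp only [Real.fourier_eq', Finset.smul_sum]
  exact integral_finsetSum _ fun n _ => integrable_fourier_integrand (hF n).int z

/-- On the support of ψ the dispersion relation is bounded by C, so the partial sums of the
exponential converge to e^{isω}ψ in L¹ ∩ L² by dominated convergence, and the pairing passes to the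
limit. -/
theorem expSum_pair {v ψ : Plane → ℂ} {A C : ℝ} (hv : Pairable v A) (hψ : Mem12 ψ)
    (hC : 0 ≤ C) (hd : ∀ ζ, ψ ζ ≠ 0 → |disp ζ| ≤ C) (s : ℝ) :
    expSum (Complex.I * (s : ℂ)) (fun n => pair v (fun ζ => (disp ζ : ℂ) ^ n * ψ ζ)) =
      pair v (fun ζ => prop s ζ * ψ ζ) := by
  have hm : ∀ n, AEStronglyMeasurable (fun ζ : Plane => (disp ζ : ℂ) ^ n * ψ ζ) volume := fun n =>
    ((Complex.measurable_ofReal.comp measurable_disp).pow_const n).aestronglyMeasurable.mul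
      hψ.int.aestronglyMeasurable
  have hb : ∀ n ζ, ‖(disp ζ : ℂ) ^ n * ψ ζ‖ ≤ C ^ n * ‖ψ ζ‖ := by
    intro n ζ
    by_cases h : ψ ζ = 0
    · simp [h]
    · rw [norm_mul, norm_pow, Complex.norm_real, Real.norm_eq_abs]
      gcongr; exact hd ζ h
  have h12 : ∀ n, Mem12 (fun ζ => (disp ζ : ℂ) ^ n * ψ ζ) := fun n =>
    hψ.mono (hm n) (ae_of_all _ (hb n))
  have hbd : ∀ n, ‖pair v (fun ζ => (disp ζ : ℂ) ^ n * ψ ζ)‖ ≤ C ^ n * (|A| * nrm ψ) := by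
    intro n
    calc _ ≤ A * nrm (fun ζ => (disp ζ : ℂ) ^ n * ψ ζ) := hv.bound _ (h12 n)
      _ ≤ |A| * nrm (fun ζ => (disp ζ : ℂ) ^ n * ψ ζ) :=
        mul_le_mul_of_nonneg_right (le_abs_self A) (nrm_nonneg _)
      _ ≤ |A| * (C ^ n * nrm ψ) := mul_le_mul_of_nonneg_left
        (nrm_le_of_norm_le hψ (hm n) (by positivity) (ae_of_all _ (hb n))) (abs_nonneg A)
      _ = _ := by ring
  have hprop : Mem12 (fun ζ => prop s ζ * ψ ζ) :=
    hψ.mono (c := 1) ((measurable_prop s).aestronglyMeasurable.mul hψ.int.aestronglyMeasurable)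
      (ae_of_all _ fun ζ => by rw [norm_mul, norm_prop])
  set F : ℕ → Plane → ℂ := fun L ζ => ∑ n ∈ Finset.range L,
    (Complex.I * (s : ℂ)) ^ n / (n.factorial : ℂ) * ((disp ζ : ℂ) ^ n * ψ ζ) with hF
  have hFm : ∀ n, Mem12 (fun ζ => (Complex.I * (s : ℂ)) ^ n / (n.factorial : ℂ) * ((disp ζ : ℂ) ^ n * ψ ζ)) :=
    fun n => (h12 n).mono (c := ‖(Complex.I * (s : ℂ)) ^ n / (n.factorial : ℂ)‖)
      ((hm n).const_mul _) (ae_of_all _ fun ζ => by rw [norm_mul])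
  have hxb : ∀ ζ n, ‖(disp ζ : ℂ) ^ n * ψ ζ‖ ≤ C ^ n * ‖ψ ζ‖ := fun ζ n => hb n ζ
  set R : ℝ := Real.exp (‖Complex.I * (s : ℂ)‖ * C) with hR
  have hFb : ∀ L ζ, ‖F L ζ‖ ≤ R * ‖ψ ζ‖ := fun L ζ => norm_partial_expSum_le hC (hxb ζ) L
  have hFmeas : ∀ L, AEStronglyMeasurable (F L) volume := fun L =>
    Finset.aestronglyMeasurable_fun_sum _ fun n _ => (hm n).const_mul _
  have hF12 : ∀ L, Mem12 (F L) := fun L => hψ.mono (hFmeas L) (ae_of_all _ (hFb L))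
  have hlim : ∀ ζ, Filter.Tendsto (fun L => F L ζ) Filter.atTop (nhds (prop s ζ * ψ ζ)) := by
    intro ζ
    have h1 := (summable_expSum (a := Complex.I * (s : ℂ)) (hxb ζ)).hasSum.tendsto_sum_nat
    have h2 : ∑' n : ℕ, (Complex.I * (s : ℂ)) ^ n / (n.factorial : ℂ) * ((disp ζ : ℂ) ^ n * ψ ζ) =
        prop s ζ * ψ ζ := by
      have h3 : ∀ n : ℕ, (Complex.I * (s : ℂ)) ^ n / (n.factorial : ℂ) * ((disp ζ : ℂ) ^ n * ψ ζ) =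
          (((s * disp ζ : ℝ) : ℂ) * Complex.I) ^ n / (n.factorial : ℂ) * ψ ζ := by
        intro n; push_cast; simp only [mul_pow]; ring
      simp only [h3]
      rw [tsum_mul_right, prop, Complex.exp_eq_exp_ℂ, NormedSpace.exp_eq_tsum_div]
    rwa [h2] at h1
  have hnrm : Filter.Tendsto (fun L => nrm (fun ζ => F L ζ - prop s ζ * ψ ζ)) Filter.atTop (nhds 0) := by
    have hG : Mem12 (fun ζ => ((R + 1 : ℝ) : ℂ) * ψ ζ) :=
      hψ.mono (c := ‖((R + 1 : ℝ) : ℂ)‖) (hψ.int.aestronglyMeasurable.const_mul _)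
        (ae_of_all _ fun ζ => by rw [norm_mul])
    refine tendsto_nrm_zero hG (fun L => (hFmeas L).sub hprop.int.aestronglyMeasurable)
      (fun L => ae_of_all _ fun ζ => ?_) (ae_of_all _ fun ζ => ?_)
    · rw [norm_mul, Complex.norm_real, Real.norm_of_nonneg (by positivity), add_mul, one_mul]
      refine (norm_sub_le _ _).trans (add_le_add (hFb L ζ) ?_)
      rw [norm_mul, norm_prop, one_mul]
    · simpa using (hlim ζ).sub_const (prop s ζ * ψ ζ)
  have h1 := hv.tendsto hF12 hprop hnrm
  refine tendsto_nhds_unique ((summable_expSum hbd).hasSum.tendsto_sum_nat) (h1.congr fun L => ?_)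
  rw [hF, hv.sum hFm]
  exact Finset.sum_congr rfl fun n _ => pair_const_mul _ _ _

/-- The multiplier `-2πi p b_β(p)`. -/
noncomputable def forceSymbol (β : ℝ) (p : ℝ) : ℂ := -(2 * (Real.pi : ℂ) * Complex.I) * p * (bes β p : ℂ)

theorem contDiff_bes_plane (β : ℝ) : ContDiff ℝ ∞ (fun ζ : Plane => (bes β (ζ 0) : ℂ)) :=
  (besselSymbol_hasTemperateGrowth β).1

theorem contDiff_forceSymbol (β : ℝ) : ContDiff ℝ ∞ (fun ζ : Plane => forceSymbol β (ζ 0)) :=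
  (contDiff_const.mul (Complex.ofRealCLM.contDiff.comp (contDiff_coord 0))).mul (contDiff_bes_plane β)

/-- On the Fourier side and after division by -iξ, the operators ∂ₓ⁴ - ∂_y² become (-iξ)³ + μ²/(-iξ)
= iω, which raises the index n by one, and the forcing gets the symbol -iξ. Support away from ξ = 0
keeps all test functions smooth. -/
theorem IsSolution.weakSystem {T : ℝ} {u f g : ℝ → Plane → ℂ} {θ : ℝ} {A B : ℝ → ℝ}
    (h : IsSolution T u f) (hu : TimePairable T u A) (hg : TimePairable T g B)
    (hfg : ∀ᵐ t ∂volume.restrict (Ioo 0 T),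
      ∃ S : 𝓢'(Plane, ℂ), Represents S (f t) ∧ Represents (Jx θ S) (g t))
    {ψ : Plane → ℂ} (hψ : AwayTest ψ) {C : ℝ} (hC : 0 ≤ C) (hd : ∀ ζ, ψ ζ ≠ 0 → |disp ζ| ≤ C) :
    WeakSystem T C (fun n t => pair (u t) (fun ζ => (disp ζ : ℂ) ^ n * ψ ζ))
      (fun n t => pair (g t) (fun ζ => (disp ζ : ℂ) ^ n * (forceSymbol (-θ) (ζ 0) * ψ ζ)))
      (fun t => A t * nrm ψ) (fun t => B t * nrm (fun ζ => forceSymbol (-θ) (ζ 0) * ψ ζ)) := by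
  have hmψ : AwayTest (fun ζ => forceSymbol (-θ) (ζ 0) * ψ ζ) :=
    hψ.mul fun ζ _ => (contDiff_forceSymbol (-θ)).contDiffAt
  have hnn : ∀ {v : Plane → ℂ} {a : ℝ}, Pairable v a → ∀ {φ : Plane → ℂ}, AwayTest φ →
      (∀ ζ, φ ζ ≠ 0 → |disp ζ| ≤ C) → ∀ n,
      ‖pair v (fun ζ => (disp ζ : ℂ) ^ n * φ ζ)‖ ≤ C ^ n * (a * nrm φ) := by
    intro v a hv φ hφ hdφ n
    have hb : ∀ ζ, ‖(disp ζ : ℂ) ^ n * φ ζ‖ ≤ C ^ n * ‖φ ζ‖ := by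
      intro ζ
      by_cases h : φ ζ = 0
      · simp [h]
      · rw [norm_mul, norm_pow, Complex.norm_real, Real.norm_eq_abs]
        gcongr; exact hdφ ζ h
    have h1 := hv.bound _ (hφ.dispPow n).mem12
    have h2 := nrm_le_of_norm_le hφ.mem12 (hφ.dispPow n).mem12.int.aestronglyMeasurable
      (pow_nonneg hC n) (ae_of_all _ hb)
    -- A negative pairing constant is possible only if the norm of φ vanishes, and then both sides
    -- are zero.
    by_cases ha : 0 ≤ a
    · refine h1.trans ((mul_le_mul_of_nonneg_left h2 ha).trans (le_of_eq ?_)); ring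
    · have h3 : nrm φ = 0 := by
        have := (norm_nonneg _).trans (hv.bound φ hφ.mem12)
        nlinarith [nrm_nonneg φ]
      rw [h3] at h2 ⊢
      have h4 : nrm (fun ζ => (disp ζ : ℂ) ^ n * φ ζ) = 0 := le_antisymm (by simpa using h2) (nrm_nonneg _)
      rw [h4] at h1
      simpa using h1
  refine ⟨hC, fun n => aestronglyMeasurable_pair hu.meas (hψ.dispPow n).mem12.int,
    fun n => aestronglyMeasurable_pair hg.meas (hmψ.dispPow n).mem12.int,
    hu.int.mul_const _, hg.int.mul_const _,
    hu.pairable.mono fun t ht n => hnn ht hψ hd n,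
    hg.pairable.mono fun t ht n => hnn ht hmψ (fun ζ hζ => hd ζ fun h0 => hζ (by simp [h0])) n, ?_⟩
  intro η hη n
  -- The equation carries one x-derivative too many; testing with ωⁿψ divided by the symbol of ∂ₓ
  -- removes it.
  have hdiv : AwayTest (fun ζ => (-(2 * (Real.pi : ℂ) * Complex.I) * (ζ 0 : ℂ))⁻¹ *
      ((disp ζ : ℂ) ^ n * ψ ζ)) := by
    refine (hψ.dispPow n).mul fun ζ hζ => ContDiffAt.inv ?_ ?_
    · exact contDiffAt_const.mul (Complex.ofRealCLM.contDiff.comp (contDiff_coord 0)).contDiffAt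
    · have : (ζ 0 : ℂ) ≠ 0 := by exact_mod_cast hζ
      have h2 : (Real.pi : ℂ) ≠ 0 := by exact_mod_cast Real.pi_ne_zero
      simp [this, h2]
  set χ := hdiv.toSchwartz with hχ
  have hcase : ∀ ζ : Plane, ζ 0 = 0 → ψ ζ = 0 := fun ζ hζ => by
    by_contra h0; exact hψ.ne_zero ζ (subset_tsupport _ h0) hζ
  have hpi : (Real.pi : ℂ) ≠ 0 := by exact_mod_cast Real.pi_ne_zero
  have e1 : (symbolMul 0 χ : Plane → ℂ) = fun ζ => (disp ζ : ℂ) ^ n * ψ ζ := by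
    funext ζ
    rw [symbolMul_apply, hχ, hdiv.toSchwartz_apply]
    by_cases h0 : ζ 0 = 0
    · simp [hcase ζ h0]
    · have h1 : (ζ 0 : ℂ) ≠ 0 := by exact_mod_cast h0
      rw [mul_inv_cancel_left₀]
      simp [h1, hpi]
  have e2 : (fun ζ => symbolMul 0 (symbolMul 0 (symbolMul 0 (symbolMul 0 χ))) ζ -
      symbolMul 1 (symbolMul 1 χ) ζ) = fun ζ => Complex.I * ((disp ζ : ℂ) ^ (n + 1) * ψ ζ) := by
    funext ζ
    simp only [symbolMul_apply, hχ, hdiv.toSchwartz_apply]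
    by_cases h0 : ζ 0 = 0
    · simp [hcase ζ h0]
    · have h1 : (ζ 0 : ℂ) ≠ 0 := by exact_mod_cast h0
      rw [pow_succ]
      generalize (disp ζ : ℂ) ^ n = D
      rw [disp]
      push_cast
      field_simp
      ring_nf
      simp only [Complex.I_sq]
      ring
  have e3 : (besselMul (-θ) (symbolMul 0 (symbolMul 0 χ)) : Plane → ℂ) =
      fun ζ => (disp ζ : ℂ) ^ n * (forceSymbol (-θ) (ζ 0) * ψ ζ) := by
    funext ζ
    rw [besselMul_apply, symbolMul_apply, besselSymbol_eq, e1, forceSymbol]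
    ring
  have hw := h.weak_fourier hu hg hfg hη χ
  obtain ⟨M, hM⟩ := hη.exists_bound
  have b1 : ∃ M, ∀ t, ‖η t‖ ≤ M := ⟨M, fun t => (hM t).1⟩
  have b2 : ∃ M, ∀ t, ‖deriv η t‖ ≤ M := ⟨M, fun t => (hM t).2⟩
  have i1 := integrableOn_test_smul (hu.integrable (mem12_schwartz (symbolMul 0 χ))) hη.continuous_deriv b2
  have i2 := integrableOn_test_smul (hu.integrable (mem12_schwartz
    (symbolMul 0 (symbolMul 0 (symbolMul 0 (symbolMul 0 χ)))))) hη.contDiff.continuous b1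
  have i3 := integrableOn_test_smul (hu.integrable (mem12_schwartz (symbolMul 1 (symbolMul 1 χ))))
    hη.contDiff.continuous b1
  have i4 := integrableOn_test_smul (hg.integrable (mem12_schwartz
    (besselMul (-θ) (symbolMul 0 (symbolMul 0 χ))))) hη.contDiff.continuous b1
  rw [← integral_add' i1 i2, ← integral_sub' (i1.add i2) i3, ← integral_add' ((i1.add i2).sub i3) i4] at hw
  rw [← hw]
  refine integral_congr_ae ?_
  filter_upwards [hu.pairable] with t ht
  have h1 := ht.sub (mem12_schwartz (symbolMul 0 (symbolMul 0 (symbolMul 0 (symbolMul 0 χ)))))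
    (mem12_schwartz (symbolMul 1 (symbolMul 1 χ)))
  rw [e2, pair_const_mul] at h1
  simp only [Pi.add_apply, Pi.sub_apply]
  rw [h1, e1, e3]
  ring

/-- The Duhamel formula of the infinite system, with both exponential series summed to genuine
propagators. -/
theorem IsSolution.duhamel_away {T : ℝ} (hT : 0 < T) {u f g : ℝ → Plane → ℂ} {θ : ℝ} {A B : ℝ → ℝ}
    (h : IsSolution T u f) (hu : TimePairable T u A) (hg : TimePairable T g B)
    (hfg : ∀ᵐ t ∂volume.restrict (Ioo 0 T),
      ∃ S : 𝓢'(Plane, ℂ), Represents S (f t) ∧ Represents (Jx θ S) (g t))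
    {ψ : Plane → ℂ} (hψ : AwayTest ψ) :
    ∃ S : Set ℝ, (∀ᵐ t ∂volume.restrict (Ioo 0 T), t ∈ S) ∧ S ⊆ Ioo 0 T ∧ ∀ t₀ ∈ S, ∀ t ∈ S,
      pair (u t) ψ = pair (u t₀) (fun ζ => prop (t - t₀) ζ * ψ ζ) +
        ∫ τ in t₀..t, pair (g τ) (fun ζ => prop (t - τ) ζ * (forceSymbol (-θ) (ζ 0) * ψ ζ)) := by
  obtain ⟨C, hC, hd⟩ := hψ.exists_disp_le
  have hmψ : AwayTest (fun ζ => forceSymbol (-θ) (ζ 0) * ψ ζ) :=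
    hψ.mul fun ζ _ => (contDiff_forceSymbol (-θ)).contDiffAt
  obtain ⟨S, hS, hST, hSD⟩ := (h.weakSystem hu hg hfg hψ hC hd).duhamel hT
  refine ⟨S ∩ {t | Pairable (u t) (A t)}, by filter_upwards [hS, hu.pairable] with t h1 h2 using ⟨h1, h2⟩,
    fun t ht => hST ht.1, ?_⟩
  rintro t₀ ⟨ht₀, hp₀⟩ t ⟨ht, hp⟩
  have h1 := hSD t₀ ht₀ t ht
  rw [expSum_pair hp₀ hψ.mem12 hC hd] at h1
  simp only [pow_zero, one_mul] at h1
  rw [h1]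
  congr 1
  have hsub : uIoc t₀ t ⊆ Ioo 0 T := by
    have ha := hST ht₀
    have hb := hST ht
    intro τ hτ
    rcases mem_uIoc.1 hτ with h | h
    · exact ⟨ha.1.trans h.1, h.2.trans_lt hb.2⟩
    · exact ⟨hb.1.trans h.1, h.2.trans_lt ha.2⟩
  refine intervalIntegral.integral_congr_ae ?_
  filter_upwards [(ae_restrict_iff' measurableSet_Ioo).1 hg.pairable] with τ h2 h3
  exact expSum_pair (h2 (hsub h3)) hmψ.mem12 hC (fun ζ hζ => hd ζ fun h0 => hζ (by simp [h0])) _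

/-! ### Duhamel's formula on a dyadic band -/

/-- The lower end of the squared band. -/
def bandLow : ℕ → ℝ
  | 0 => 0
  | k + 1 => 4 ^ k

theorem bandLow_nonneg (k : ℕ) : 0 ≤ bandLow k := by
  cases k <;> simp [bandLow]

/-- A polynomial, positive exactly in the interior of the band `k` minus the origin. -/
def bandGap (k : ℕ) (p : ℝ) : ℝ := (p ^ 2 - bandLow k) * (4 ^ k - p ^ 2)

theorem bandLow_le (k : ℕ) : bandLow k ≤ 4 ^ k := by
  cases k with
  | zero => simp [bandLow]
  | succ k => simp only [bandLow]; exact pow_le_pow_right₀ (by norm_num) (by omega)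

theorem sq_of_bandGap_pos {k : ℕ} {p : ℝ} (h : 0 < bandGap k p) : bandLow k < p ^ 2 ∧ p ^ 2 < 4 ^ k := by
  have h1 := bandLow_le k
  rcases pos_and_pos_or_neg_and_neg_of_mul_pos h with h2 | h2
  · exact ⟨by linarith [h2.1], by linarith [h2.2]⟩
  · linarith [h2.1, h2.2]

theorem four_pow_eq (k : ℕ) : (4 : ℝ) ^ k = (2 ^ k) ^ 2 := by
  rw [← pow_mul, mul_comm, pow_mul]; norm_num

theorem mem_band_of_bandGap_pos {k : ℕ} {p : ℝ} (h : 0 < bandGap k p) : p ∈ band k := by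
  obtain ⟨h1, h2⟩ := sq_of_bandGap_pos h
  rw [four_pow_eq, sq_lt_sq, abs_of_pos (a := (2 : ℝ) ^ k) (by positivity)] at h2
  cases k with
  | zero => simpa [band] using h2
  | succ k =>
    simp only [bandLow, four_pow_eq] at h1
    rw [sq_lt_sq, abs_of_pos (a := (2 : ℝ) ^ k) (by positivity)] at h1
    exact ⟨h1.le, h2⟩

theorem bandGap_pos_of_mem {k : ℕ} {p : ℝ} (h : p ∈ band k) (hp : p ^ 2 ≠ bandLow k) :
    0 < bandGap k p := by
  have h2 : p ^ 2 < 4 ^ k := by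
    rw [four_pow_eq, sq_lt_sq, abs_of_pos (a := (2 : ℝ) ^ k) (by positivity)]
    exact abs_lt_of_mem_band h
  have h1 : bandLow k ≤ p ^ 2 := by
    cases k with
    | zero => simp only [bandLow]; positivity
    | succ k =>
      simp only [bandLow, four_pow_eq]
      rw [sq_le_sq, abs_of_pos (a := (2 : ℝ) ^ k) (by positivity)]
      exact h.1
  exact mul_pos (sub_pos.2 (lt_of_le_of_ne h1 hp.symm)) (sub_pos.2 h2)

/-- Smooth cutoffs increasing to the indicator of the band. -/
noncomputable def bandCut (k n : ℕ) (ζ : Plane) : ℝ :=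
  Real.smoothTransition (n * bandGap k (ζ 0) - 1) * Real.smoothTransition (n - ζ 1 ^ 2)

theorem bandCut_nonneg (k n : ℕ) (ζ : Plane) : 0 ≤ bandCut k n ζ :=
  mul_nonneg (Real.smoothTransition.nonneg _) (Real.smoothTransition.nonneg _)

theorem bandCut_le_one (k n : ℕ) (ζ : Plane) : bandCut k n ζ ≤ 1 :=
  mul_le_one₀ (Real.smoothTransition.le_one _) (Real.smoothTransition.nonneg _)
    (Real.smoothTransition.le_one _)

theorem contDiff_bandCut (k n : ℕ) : ContDiff ℝ ∞ (fun ζ => (bandCut k n ζ : ℂ)) := by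
  have h0 := contDiff_coord 0
  have h1 := contDiff_coord 1
  refine Complex.ofRealCLM.contDiff.comp (ContDiff.mul (Real.smoothTransition.contDiff.comp ?_)
    (Real.smoothTransition.contDiff.comp ?_))
  · unfold bandGap
    exact (contDiff_const.mul (((h0.pow 2).sub contDiff_const).mul (contDiff_const.sub (h0.pow 2)))).sub
      contDiff_const
  · exact contDiff_const.sub (h1.pow 2)

theorem of_bandCut_ne_zero {k n : ℕ} {ζ : Plane} (h : bandCut k n ζ ≠ 0) :
    1 ≤ n * bandGap k (ζ 0) ∧ ζ 1 ^ 2 ≤ n := by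
  rw [bandCut, mul_ne_zero_iff] at h
  constructor
  · by_contra hc
    exact h.1 (Real.smoothTransition.zero_of_nonpos (by linarith))
  · by_contra hc
    exact h.2 (Real.smoothTransition.zero_of_nonpos (by linarith))

theorem bandGap_pos_of_one_le {k n : ℕ} {p : ℝ} (h : 1 ≤ n * bandGap k p) : 0 < bandGap k p := by
  by_contra hc
  have : (n : ℝ) * bandGap k p ≤ 0 := mul_nonpos_of_nonneg_of_nonpos (Nat.cast_nonneg n) (not_lt.1 hc)
  linarith

/-- The shift by -1 in the first factor confines the support to {n · bandGap ≥ 1}, a closed set on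
which ζ₀ is bounded and nonzero; the second factor bounds ζ₁. -/
theorem awayTest_bandCut (k n : ℕ) : AwayTest (fun ζ => (bandCut k n ζ : ℂ)) := by
  set K : Set Plane := {ζ | 1 ≤ n * bandGap k (ζ 0) ∧ ζ 1 ^ 2 ≤ n} with hK
  have h0 := continuous_coord 0
  have h1 := continuous_coord 1
  have hcl : IsClosed K := by
    have h2 : Continuous (fun ζ : Plane => (n : ℝ) * bandGap k (ζ 0)) := by unfold bandGap; fun_prop
    exact (isClosed_le continuous_const h2).inter (isClosed_le (h1.pow 2) continuous_const)
  have hsub : tsupport (fun ζ => (bandCut k n ζ : ℂ)) ⊆ K := by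
    refine closure_minimal (fun ζ hζ => of_bandCut_ne_zero (k := k) ?_) hcl
    simpa using hζ
  have hcp : IsCompact K := by
    refine Metric.isCompact_of_isClosed_isBounded hcl
      ((Metric.isBounded_closedBall (x := (0 : Plane)) (r := Real.sqrt (4 ^ k + n))).subset fun ζ hζ => ?_)
    rw [mem_closedBall_zero_iff, EuclideanSpace.norm_eq, Fin.sum_univ_two]
    refine Real.sqrt_le_sqrt ?_
    rw [Real.norm_eq_abs, Real.norm_eq_abs, sq_abs, sq_abs]
    exact add_le_add (sq_of_bandGap_pos (bandGap_pos_of_one_le hζ.1)).2.le hζ.2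
  refine ⟨contDiff_bandCut k n, hcp.of_isClosed_subset (isClosed_tsupport _) hsub, fun ζ hζ h2 => ?_⟩
  have h3 := (sq_of_bandGap_pos (bandGap_pos_of_one_le (hsub hζ).1)).1
  have h4 : ζ 0 ^ 2 = 0 := by rw [h2]; norm_num
  rw [h4] at h3
  exact absurd h3 (not_lt.2 (bandLow_nonneg k))

theorem ae_coord_ne (i : Fin 2) (c : ℝ) : ∀ᵐ ζ : Plane, ζ i ≠ c := by
  have h1 : ∀ᵐ x : ℝ × ℝ, x.1 ≠ c ∧ x.2 ≠ c := by
    have hc : ∀ᵐ x : ℝ, x ≠ c := by simp [ae_iff]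
    rw [Measure.volume_eq_prod]
    have ha := Measure.quasiMeasurePreserving_fst (μ := (volume : Measure ℝ)) (ν := (volume : Measure ℝ)) |>.ae hc
    have hb := Measure.quasiMeasurePreserving_snd (μ := (volume : Measure ℝ)) (ν := (volume : Measure ℝ)) |>.ae hc
    exact ha.and hb
  have h2 := measurePreserving_coords.quasiMeasurePreserving.ae h1
  filter_upwards [h2] with ζ hζ
  fin_cases i
  · exact hζ.1
  · exact hζ.2

/-- Convergence can fail only where ζ₀² equals the lower edge of the squared band: there `bandGap`
vanishes although the half-open band may contain the point. These lines are null sets. -/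
theorem tendsto_bandCut (k : ℕ) : ∀ᵐ ζ : Plane, Filter.Tendsto (fun n : ℕ => (bandCut k n ζ : ℂ))
    Filter.atTop (nhds ((band k).indicator (fun _ => (1 : ℂ)) (ζ 0))) := by
  filter_upwards [ae_coord_ne 0 (Real.sqrt (bandLow k)), ae_coord_ne 0 (-Real.sqrt (bandLow k))] with ζ h1 h2
  have hne : ζ 0 ^ 2 ≠ bandLow k := by
    intro h
    rw [← Real.sq_sqrt (bandLow_nonneg k)] at h
    rcases sq_eq_sq_iff_eq_or_eq_neg.1 h with h | h
    · exact h1 h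
    · exact h2 h
  by_cases hb : ζ 0 ∈ band k
  · have hg := bandGap_pos_of_mem hb hne
    rw [indicator_of_mem hb]
    refine tendsto_const_nhds.congr' ?_
    obtain ⟨N, hN⟩ := exists_nat_ge (max (2 / bandGap k (ζ 0)) (1 + ζ 1 ^ 2))
    filter_upwards [Filter.eventually_ge_atTop N] with n hn
    have hn' : (N : ℝ) ≤ n := by exact_mod_cast hn
    have a1 : 2 / bandGap k (ζ 0) ≤ n := (le_max_left _ _).trans (hN.trans hn')
    have a2 : 1 + ζ 1 ^ 2 ≤ n := (le_max_right _ _).trans (hN.trans hn')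
    rw [div_le_iff₀ hg] at a1
    rw [bandCut, Real.smoothTransition.one_of_one_le (by linarith),
      Real.smoothTransition.one_of_one_le (by linarith)]
    simp
  · rw [indicator_of_notMem hb]
    refine tendsto_const_nhds.congr fun n => ?_
    by_contra hc
    have h3 : bandCut k n ζ ≠ 0 := fun h => hc (by simp [h])
    exact hb (mem_band_of_bandGap_pos (bandGap_pos_of_one_le (of_bandCut_ne_zero h3).1))

/-- The frequency-localised test function `1_k(p) α(p) e^{itω} 𝓕⁻Ψ`. -/
noncomputable def bandTest (k : ℕ) (α : ℝ → ℂ) (t : ℝ) (Ψ : 𝓢(Plane, ℂ)) (ζ : Plane) : ℂ :=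
  (band k).indicator α (ζ 0) * prop t ζ * 𝓕⁻ (Ψ : Plane → ℂ) ζ

theorem prop_zero (ζ : Plane) : prop 0 ζ = 1 := by simp [prop]

theorem forceSymbol_mul_bes (θ β p : ℝ) : forceSymbol β p * (bes θ p : ℂ) = forceSymbol (θ + β) p := by
  rw [forceSymbol, forceSymbol, bes_add]; push_cast; ring

theorem exists_bound_on_band {α : ℝ → ℂ} (hα : Continuous α) (k : ℕ) :
    ∃ M, 0 ≤ M ∧ ∀ p ∈ band k, ‖α p‖ ≤ M := by
  obtain ⟨M, hM⟩ := (isCompact_Icc (a := -(2 : ℝ) ^ k) (b := 2 ^ k)).exists_bound_of_continuousOn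
    hα.continuousOn
  refine ⟨max M 0, le_max_right _ _, fun p hp => (hM p ?_).trans (le_max_left _ _)⟩
  have := abs_lt.1 (abs_lt_of_mem_band hp)
  exact ⟨this.1.le, this.2.le⟩

theorem mem12_fourierInv (Ψ : 𝓢(Plane, ℂ)) : Mem12 (𝓕⁻ (Ψ : Plane → ℂ)) := by
  rw [← SchwartzMap.fourierInv_coe]; exact mem12_schwartz _

theorem measurable_bandTest {α : ℝ → ℂ} (hα : Continuous α) (k : ℕ) (t : ℝ) (Ψ : 𝓢(Plane, ℂ)) :
    Measurable (bandTest k α t Ψ) := by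
  have h1 : Measurable ((band k).indicator α) := hα.measurable.indicator (measurableSet_band k)
  have h2 : Measurable (𝓕⁻ (Ψ : Plane → ℂ)) := by
    rw [← SchwartzMap.fourierInv_coe]; exact (𝓕⁻ Ψ).continuous.measurable
  exact ((h1.comp (measurable_coord 0)).mul (measurable_prop t)).mul h2

theorem norm_indicator_band_le {α : ℝ → ℂ} {k : ℕ} {M : ℝ} (hM0 : 0 ≤ M) (hM : ∀ p ∈ band k, ‖α p‖ ≤ M)
    (p : ℝ) : ‖(band k).indicator α p‖ ≤ M := by
  by_cases h : p ∈ band k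
  · rw [indicator_of_mem h]; exact hM p h
  · rw [indicator_of_notMem h, norm_zero]; exact hM0

theorem norm_bandTest_le {α : ℝ → ℂ} {k : ℕ} {M : ℝ} (hM0 : 0 ≤ M) (hM : ∀ p ∈ band k, ‖α p‖ ≤ M)
    (t : ℝ) (Ψ : 𝓢(Plane, ℂ)) (ζ : Plane) :
    ‖bandTest k α t Ψ ζ‖ ≤ M * ‖𝓕⁻ (Ψ : Plane → ℂ) ζ‖ := by
  rw [bandTest, norm_mul, norm_mul, norm_prop, mul_one]
  exact mul_le_mul_of_nonneg_right (norm_indicator_band_le hM0 hM _) (norm_nonneg _)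

theorem mem12_bandTest {α : ℝ → ℂ} (hα : Continuous α) (k : ℕ) (t : ℝ) (Ψ : 𝓢(Plane, ℂ)) :
    Mem12 (bandTest k α t Ψ) := by
  obtain ⟨M, hM0, hM⟩ := exists_bound_on_band hα k
  exact (mem12_fourierInv Ψ).mono (measurable_bandTest hα k t Ψ).aestronglyMeasurable
    (ae_of_all _ (norm_bandTest_le hM0 hM t Ψ))

theorem continuous_ofReal_bes (θ : ℝ) : Continuous (fun p => (bes θ p : ℂ)) :=
  Complex.continuous_ofReal.comp (continuous_bes θ)

theorem continuous_forceSymbol (β : ℝ) : Continuous (forceSymbol β) :=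
  (continuous_const.mul Complex.continuous_ofReal).mul (continuous_ofReal_bes β)

/-- The kernels `𝓕(e^{isω} χ)` are jointly continuous in time and space. -/
theorem continuous_fourier_prop {χ : Plane → ℂ} (hχ : Integrable χ) :
    Continuous (fun p : ℝ × Plane => 𝓕 (fun ζ => prop p.1 ζ * χ ζ) p.2) := by
  simp only [Real.fourier_eq']
  refine continuous_of_dominated (bound := fun ζ => ‖χ ζ‖) (fun p => ?_) (fun p => ae_of_all _ fun ζ => ?_)
    hχ.norm (ae_of_all _ fun ζ => ?_)
  · have h1 : AEStronglyMeasurable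
        (fun v : Plane => Complex.exp (↑(-2 * Real.pi * inner ℝ v p.2) * Complex.I)) volume :=
      Continuous.aestronglyMeasurable (by fun_prop)
    exact h1.mul ((measurable_prop p.1).aestronglyMeasurable.mul hχ.aestronglyMeasurable)
  · rw [norm_smul, norm_mul, norm_prop, one_mul, Complex.norm_exp_ofReal_mul_I, one_mul]
  · simp only [prop]
    fun_prop

theorem stronglyMeasurable_pair_prop {v : ℝ → Plane → ℂ} (hv : StronglyMeasurable (Function.uncurry v))
    {χ : Plane → ℂ} (hχ : Integrable χ) :
    StronglyMeasurable (fun q : ℝ × ℝ => pair (v q.2) (fun ζ => prop (q.1 - q.2) ζ * χ ζ)) := by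
  have h1 : StronglyMeasurable (fun p : (ℝ × ℝ) × Plane => Function.uncurry v (p.1.2, p.2) *
      𝓕 (fun ζ => prop (p.1.1 - p.1.2) ζ * χ ζ) p.2) := by
    refine StronglyMeasurable.mul (hv.comp_measurable (by fun_prop)) ?_
    have h2 := continuous_fourier_prop hχ
    exact (h2.comp (g := fun p : ℝ × Plane => 𝓕 (fun ζ => prop p.1 ζ * χ ζ) p.2)
      (f := fun p : (ℝ × ℝ) × Plane => (p.1.1 - p.1.2, p.2)) (by fun_prop)).stronglyMeasurable
  exact h1.integral_prod_right'

theorem bandTest_eq_prop_mul (k : ℕ) (α : ℝ → ℂ) (t : ℝ) (Ψ : 𝓢(Plane, ℂ)) :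
    bandTest k α t Ψ = fun ζ => prop t ζ * bandTest k α 0 Ψ ζ := by
  funext ζ
  rw [bandTest, bandTest, prop_zero]; ring

theorem stronglyMeasurable_pair_bandTest {v : ℝ → Plane → ℂ}
    (hv : StronglyMeasurable (Function.uncurry v)) {α : ℝ → ℂ} (hα : Continuous α) (k : ℕ)
    (Ψ : 𝓢(Plane, ℂ)) :
    StronglyMeasurable (fun q : ℝ × ℝ => pair (v q.2) (bandTest k α (q.1 - q.2) Ψ)) := by
  have h := stronglyMeasurable_pair_prop hv (mem12_bandTest hα k 0 Ψ).int
  have e : (fun q : ℝ × ℝ => pair (v q.2) (bandTest k α (q.1 - q.2) Ψ)) =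
      fun q : ℝ × ℝ => pair (v q.2) (fun ζ => prop (q.1 - q.2) ζ * bandTest k α 0 Ψ ζ) := by
    funext q; rw [← bandTest_eq_prop_mul]
  rw [e]; exact h

/-- Duhamel's formula tested with a band-localised function. -/
def BandDuhamel (T : ℝ) (u g : ℝ → Plane → ℂ) (k : ℕ) (θ β : ℝ) (Ψ : 𝓢(Plane, ℂ)) : Prop :=
  ∃ S : Set ℝ, (∀ᵐ t ∂volume.restrict (Ioo 0 T), t ∈ S) ∧ S ⊆ Ioo 0 T ∧ ∀ t₀ ∈ S, ∀ t ∈ S,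
    pair (u t) (bandTest k (fun p => (bes θ p : ℂ)) 0 Ψ) =
      pair (u t₀) (bandTest k (fun p => (bes θ p : ℂ)) (t - t₀) Ψ) +
      ∫ τ in t₀..t, pair (g τ) (bandTest k (forceSymbol β) (t - τ) Ψ)

/-- The formula holds for the smooth cutoffs of the band. These converge to the sharp band in L¹ ∩
L² with norms bounded uniformly in n and in the propagation time, so the pairings converge, and in
the time integral |B| times a constant dominates. The exceptional sets of the countably many cutoffs
are discarded together. The order left on the forcing is θ - θ' since g already carries J_x^{θ'}. -/
theorem IsSolution.bandDuhamel {T : ℝ} (hT : 0 < T) {u f g : ℝ → Plane → ℂ} {θ' : ℝ} {A B : ℝ → ℝ}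
    (h : IsSolution T u f) (hu : TimePairable T u A) (hg : TimePairable T g B)
    (hgm : StronglyMeasurable (Function.uncurry g))
    (hfg : ∀ᵐ t ∂volume.restrict (Ioo 0 T),
      ∃ S : 𝓢'(Plane, ℂ), Represents S (f t) ∧ Represents (Jx θ' S) (g t))
    (k : ℕ) (θ : ℝ) (Ψ : 𝓢(Plane, ℂ)) : BandDuhamel T u g k θ (θ - θ') Ψ := by
  set φ : Plane → ℂ := fun ζ => (bes θ (ζ 0) : ℂ) * 𝓕⁻ (Ψ : Plane → ℂ) ζ with hφ
  have hφc : ContDiff ℝ ∞ φ := by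
    refine (contDiff_bes_plane θ).mul ?_
    rw [← SchwartzMap.fourierInv_coe]; exact (𝓕⁻ Ψ).smooth _
  set ψ : ℕ → Plane → ℂ := fun n ζ => φ ζ * (bandCut k n ζ : ℂ) with hψ
  have hA : ∀ n, AwayTest (ψ n) := fun n => (awayTest_bandCut k n).mul fun ζ _ => hφc.contDiffAt
  choose S hS hST hSD using fun n => h.duhamel_away hT hu hg hfg (hA n)
  -- convergence of the cutoffs after multiplication by a bounded symbol
  have hconv : ∀ (α : ℝ → ℂ), Continuous α → ∃ N, ∀ (F : ℕ → Plane → ℂ) (s : ℝ),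
      (∀ n ζ, F n ζ = prop s ζ * (α (ζ 0) * (bandCut k n ζ : ℂ) * 𝓕⁻ (Ψ : Plane → ℂ) ζ)) →
      (∀ n, AEStronglyMeasurable (F n) volume) →
      (∀ n, Mem12 (F n)) ∧
      (Filter.Tendsto (fun n => nrm (fun ζ => F n ζ - bandTest k α s Ψ ζ)) Filter.atTop (nhds 0)) ∧
      ∀ n, nrm (F n) ≤ N := by
    intro α hα
    obtain ⟨M, hM0, hM⟩ := exists_bound_on_band hα k
    refine ⟨M * nrm (𝓕⁻ (Ψ : Plane → ℂ)), fun F s hF hFm => ?_⟩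
    have hb1 : ∀ n ζ, ‖F n ζ‖ ≤ M * ‖𝓕⁻ (Ψ : Plane → ℂ) ζ‖ := by
      intro n ζ
      rw [hF, norm_mul, norm_prop, one_mul, norm_mul]
      refine mul_le_mul_of_nonneg_right ?_ (norm_nonneg _)
      rw [norm_mul, Complex.norm_real, Real.norm_of_nonneg (bandCut_nonneg _ _ _)]
      by_cases hz : bandCut k n ζ = 0
      · rw [hz, mul_zero]; exact hM0
      · have hmem := mem_band_of_bandGap_pos (bandGap_pos_of_one_le (of_bandCut_ne_zero hz).1)
        calc _ ≤ M * 1 := mul_le_mul (hM _ hmem) (bandCut_le_one _ _ _) (bandCut_nonneg _ _ _) hM0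
          _ = M := mul_one M
    have h12 : ∀ n, Mem12 (F n) := fun n => (mem12_fourierInv Ψ).mono (hFm n) (ae_of_all _ (hb1 n))
    refine ⟨h12, ?_, fun n =>
      nrm_le_of_norm_le (mem12_fourierInv Ψ) (hFm n) hM0 (ae_of_all _ (hb1 n))⟩
    have hG : Mem12 (fun ζ => ((2 * M : ℝ) : ℂ) * 𝓕⁻ (Ψ : Plane → ℂ) ζ) :=
      (mem12_fourierInv Ψ).mono (c := ‖((2 * M : ℝ) : ℂ)‖)
        ((mem12_fourierInv Ψ).int.aestronglyMeasurable.const_mul _) (ae_of_all _ fun ζ => by rw [norm_mul])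
    refine tendsto_nrm_zero hG (fun n => (hFm n).sub (measurable_bandTest hα k s Ψ).aestronglyMeasurable)
      (fun n => ae_of_all _ fun ζ => ?_) ?_
    · rw [norm_mul, Complex.norm_real, Real.norm_of_nonneg (by positivity), two_mul, add_mul]
      exact (norm_sub_le _ _).trans (add_le_add (hb1 n ζ) (norm_bandTest_le hM0 hM s Ψ ζ))
    · filter_upwards [tendsto_bandCut k] with ζ hζ
      have h1 : Filter.Tendsto (fun n => F n ζ) Filter.atTop (nhds (bandTest k α s Ψ ζ)) := by
        simp only [hF]
        have h2 := ((hζ.const_mul (α (ζ 0))).mul_const (𝓕⁻ (Ψ : Plane → ℂ) ζ)).const_mul (prop s ζ)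
        convert h2 using 2
        rw [bandTest]
        by_cases hb : ζ 0 ∈ band k
        · rw [indicator_of_mem hb, indicator_of_mem hb]; ring
        · rw [indicator_of_notMem hb, indicator_of_notMem hb]; ring
      simpa using h1.sub_const (bandTest k α s Ψ ζ)
  have hψm : ∀ n, AEStronglyMeasurable (ψ n) volume := fun n => (hA n).mem12.int.aestronglyMeasurable
  have hφm : ∀ n s, AEStronglyMeasurable (fun ζ => prop s ζ * ψ n ζ) volume := fun n s =>
    (measurable_prop s).aestronglyMeasurable.mul (hψm n)
  have hf12 : ∀ n, AwayTest (fun ζ => forceSymbol (-θ') (ζ 0) * ψ n ζ) := fun n =>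
    (hA n).mul fun ζ _ => (contDiff_forceSymbol (-θ')).contDiffAt
  obtain ⟨N₁, hN₁⟩ := hconv _ (continuous_ofReal_bes θ)
  obtain ⟨N₂, hN₂⟩ := hconv _ (continuous_forceSymbol (θ - θ'))
  have cu := fun s => hN₁ (fun n ζ => prop s ζ * ψ n ζ) s (fun n ζ => by simp only [hψ, hφ]; ring)
    (fun n => hφm n s)
  have cg := fun s => hN₂ (fun n ζ => prop s ζ * (forceSymbol (-θ') (ζ 0) * ψ n ζ)) s
    (fun n ζ => by
      rw [sub_eq_add_neg, ← forceSymbol_mul_bes]; simp only [hψ, hφ]; ring)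
    (fun n => (measurable_prop s).aestronglyMeasurable.mul (hf12 n).mem12.int.aestronglyMeasurable)
  refine ⟨(⋂ n, S n) ∩ {t | Pairable (u t) (A t)}, ?_, fun t ht => hST 0 (mem_iInter.1 ht.1 0), ?_⟩
  · filter_upwards [ae_all_iff.2 hS, hu.pairable] with t h1 h2 using ⟨mem_iInter.2 h1, h2⟩
  rintro t₀ ⟨ht₀, hp₀⟩ t ⟨ht, hp⟩
  rw [mem_iInter] at ht₀ ht
  have l1 : Filter.Tendsto (fun n => pair (u t) (ψ n)) Filter.atTop
      (nhds (pair (u t) (bandTest k (fun p => (bes θ p : ℂ)) 0 Ψ))) := by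
    have := hp.tendsto (cu 0).1 (mem12_bandTest (continuous_ofReal_bes θ) k 0 Ψ) (cu 0).2.1
    simpa only [prop_zero, one_mul] using this
  have l2 := hp₀.tendsto (cu (t - t₀)).1 (mem12_bandTest (continuous_ofReal_bes θ) k (t - t₀) Ψ)
    (cu (t - t₀)).2.1
  have hsub : uIoc t₀ t ⊆ Ioo 0 T := by
    have ha := hST 0 (ht₀ 0)
    have hb := hST 0 (ht 0)
    intro τ hτ
    rcases mem_uIoc.1 hτ with h | h
    · exact ⟨ha.1.trans h.1, h.2.trans_lt hb.2⟩
    · exact ⟨hb.1.trans h.1, h.2.trans_lt ha.2⟩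
  have hpg : ∀ᵐ τ, τ ∈ uIoc t₀ t → Pairable (g τ) (B τ) := by
    filter_upwards [(ae_restrict_iff' measurableSet_Ioo).1 hg.pairable] with τ h2 h3 using h2 (hsub h3)
  have l3 : Filter.Tendsto (fun n => ∫ τ in t₀..t, pair (g τ)
      (fun ζ => prop (t - τ) ζ * (forceSymbol (-θ') (ζ 0) * ψ n ζ))) Filter.atTop
      (nhds (∫ τ in t₀..t, pair (g τ) (bandTest k (forceSymbol (θ - θ')) (t - τ) Ψ))) := by
    refine intervalIntegral.tendsto_integral_filter_of_dominated_convergence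
      (fun τ => |B τ| * N₂) (Filter.Eventually.of_forall fun n => ?_)
      (Filter.Eventually.of_forall fun n => ?_) ?_ ?_
    · have := stronglyMeasurable_pair_prop hgm (hf12 n).mem12.int
      exact (this.comp_measurable (measurable_prodMk_left (x := t))).aestronglyMeasurable
    · filter_upwards [hpg] with τ h1 h2
      refine ((h1 h2).bound _ ((cg (t - τ)).1 n)).trans ?_
      exact mul_le_mul (le_abs_self _) ((cg (t - τ)).2.2 n) (nrm_nonneg _) (abs_nonneg _)
    · rw [intervalIntegrable_iff]
      exact ((hg.int.mono_set hsub).abs).mul_const _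
    · filter_upwards [hpg] with τ h1 h2
      exact (h1 h2).tendsto (cg (t - τ)).1
        (mem12_bandTest (continuous_forceSymbol _) k (t - τ) Ψ) (cg (t - τ)).2.1
  exact tendsto_nhds_unique l1 ((l2.add l3).congr fun n => (hSD n t₀ (ht₀ n) t (ht n)).symm)

/-! ### Maximal Strichartz estimates on a band -/

/-- The truncated singular weight. -/
noncomputable def singWeight (a s : ℝ) : ℝ := (Ioo (0:ℝ) 1).indicator (fun r => r ^ (-a)) |s|

theorem integrable_singWeight {a : ℝ} (ha : a < 1) : Integrable (singWeight a) := by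
  have h1 : IntegrableOn (fun r : ℝ => r ^ (-a)) (Ioo 0 1) := by
    have := (intervalIntegral.intervalIntegrable_rpow' (a := 0) (b := 1) (r := -a) (by linarith)).1
    exact this.mono_set Ioo_subset_Ioc_self
  have h2 : Integrable ((Ioo (0:ℝ) 1).indicator (fun r => r ^ (-a))) :=
    h1.integrable_indicator measurableSet_Ioo
  have h3 : singWeight a = fun s => (Ioo (0:ℝ) 1).indicator (fun r => r ^ (-a)) s +
      (Ioo (0:ℝ) 1).indicator (fun r => r ^ (-a)) (-s) := by
    funext s
    rw [singWeight]
    rcases le_or_gt 0 s with h | h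
    · rw [abs_of_nonneg h, indicator_of_notMem (a := -s) (fun h' => by linarith [h'.1]), add_zero]
    · rw [abs_of_neg h, indicator_of_notMem (a := s) (fun h' => by linarith [h'.1]), zero_add]
  rw [h3]
  exact h2.add h2.comp_neg

/-- A bound for `∫ |t - s|^{-a} ds` over intervals of length at most `2`. -/
noncomputable def singConst (a : ℝ) : ℝ≥0∞ := (∫⁻ s, ENNReal.ofReal (singWeight a s)) + 2

theorem singConst_ne_top {a : ℝ} (ha : a < 1) : singConst a ≠ ⊤ := by
  have := (integrable_singWeight ha).lintegral_lt_top
  rw [singConst]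
  exact ENNReal.add_ne_top.2 ⟨this.ne, ENNReal.ofNat_ne_top⟩

theorem rpow_neg_le_singWeight {a s : ℝ} (ha : 0 ≤ a) (hs : s ≠ 0) : |s| ^ (-a) ≤ singWeight a s + 1 := by
  have h0 : 0 < |s| := abs_pos.2 hs
  by_cases h : |s| < 1
  · rw [singWeight, indicator_of_mem (show |s| ∈ Ioo (0:ℝ) 1 from ⟨h0, h⟩)]
    linarith
  · rw [singWeight, indicator_of_notMem (fun h' => h h'.2), zero_add]
    exact Real.rpow_le_one_of_one_le_of_nonpos (not_lt.1 h) (by linarith)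

/-- The singular part is at most its integral over the whole line, and the rest is at most 1 on an
interval shorter than 2; hence a constant free of t and T. -/
theorem lintegral_sing_le {a T : ℝ} (ha : 0 ≤ a) (hT : T < 2) (t : ℝ) :
    ∫⁻ s in Ioo 0 T, ENNReal.ofReal (|t - s| ^ (-a)) ≤ singConst a := by
  have hne : ∀ᵐ s ∂volume.restrict (Ioo 0 T), s ≠ t :=
    ae_restrict_of_ae (by simp [ae_iff])
  calc ∫⁻ s in Ioo 0 T, ENNReal.ofReal (|t - s| ^ (-a))
      ≤ ∫⁻ s in Ioo 0 T, (ENNReal.ofReal (singWeight a (t - s)) + 1) := by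
        refine lintegral_mono_ae ?_
        filter_upwards [hne] with s hs
        refine (ENNReal.ofReal_le_ofReal (rpow_neg_le_singWeight ha (sub_ne_zero.2 hs.symm))).trans ?_
        exact ENNReal.ofReal_add_le.trans (by simp)
    _ = (∫⁻ s in Ioo 0 T, ENNReal.ofReal (singWeight a (t - s))) + volume (Ioo 0 T) := by
        rw [lintegral_add_right _ measurable_const]; simp
    _ ≤ (∫⁻ s, ENNReal.ofReal (singWeight a (t - s))) + 2 := by
        gcongr
        · exact Measure.restrict_le_self
        · rw [Real.volume_Ioo, sub_zero]
          exact (ENNReal.ofReal_le_ofReal hT.le).trans (by simp)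
    _ = singConst a := by
        rw [lintegral_sub_left_eq_self (μ := volume) (fun s => ENNReal.ofReal (singWeight a s)) t, singConst]

/-- A countable family of real test functions, bounded in `L¹`. -/
structure TestFamily (ρ : ℕ → 𝓢(Plane, ℂ)) : Prop where
  real : ∀ j z, (starRingEnd ℂ) (ρ j z) = ρ j z
  norm_le : ∀ j, ∫ z, ‖ρ j z‖ ≤ 1

/-- The reason for real test functions: the conjugate in the L² inner product then produces a
Fourier transform, which can be moved to the other factor. -/
theorem conj_fourierInv {Ψ : 𝓢(Plane, ℂ)} (h : ∀ z, (starRingEnd ℂ) (Ψ z) = Ψ z) (ζ : Plane) :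
    (starRingEnd ℂ) (𝓕⁻ (Ψ : Plane → ℂ) ζ) = 𝓕 (Ψ : Plane → ℂ) ζ := by
  rw [Real.fourierInv_eq', Real.fourier_eq', ← integral_conj]
  refine integral_congr_ae (ae_of_all _ fun z => ?_)
  simp only [smul_eq_mul, map_mul, h, ← Complex.exp_conj, Complex.conj_ofReal, Complex.conj_I]
  congr 2
  push_cast
  ring

theorem continuous_prop_left (ζ : Plane) : Continuous (fun t => prop t ζ) := by
  unfold prop; fun_prop

/-- The conjugate of `bandTest` as an element of `L²`. -/
noncomputable def bandVec (k : ℕ) (Ψ : 𝓢(Plane, ℂ)) (t : ℝ) : Lp ℂ 2 (volume : Measure Plane) :=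
  ((mem12_bandTest (α := fun _ => 1) continuous_const k t Ψ).l2.star).toLp

theorem bandVec_coe (k : ℕ) (Ψ : 𝓢(Plane, ℂ)) (t : ℝ) :
    bandVec k Ψ t =ᵐ[volume] fun ζ => (starRingEnd ℂ) (bandTest k (fun _ => 1) t Ψ ζ) :=
  MemLp.coeFn_toLp _

theorem continuous_bandVec (k : ℕ) (Ψ : 𝓢(Plane, ℂ)) : Continuous (bandVec k Ψ) := by
  rw [continuous_iff_seqContinuous]
  intro x t hx
  rw [tendsto_iff_norm_sub_tendsto_zero]
  have hb : ∀ s ζ, ‖bandTest k (fun _ => 1) s Ψ ζ‖ ≤ 1 * ‖𝓕⁻ (Ψ : Plane → ℂ) ζ‖ :=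
    norm_bandTest_le zero_le_one (fun p _ => by simp) (k := k) (Ψ := Ψ)
  have hm : ∀ s, AEStronglyMeasurable (bandTest k (fun _ => 1) s Ψ) volume := fun s =>
    (measurable_bandTest continuous_const k s Ψ).aestronglyMeasurable
  have hlim : Filter.Tendsto (fun n => nrm (fun ζ => bandTest k (fun _ => 1) (x n) Ψ ζ -
      bandTest k (fun _ => 1) t Ψ ζ)) Filter.atTop (nhds 0) := by
    have hG : Mem12 (fun ζ => (2 : ℂ) * 𝓕⁻ (Ψ : Plane → ℂ) ζ) :=
      (mem12_fourierInv Ψ).mono (c := ‖(2 : ℂ)‖)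
        ((mem12_fourierInv Ψ).int.aestronglyMeasurable.const_mul _) (ae_of_all _ fun ζ => by rw [norm_mul])
    refine tendsto_nrm_zero hG (fun n => (hm _).sub (hm _)) (fun n => ae_of_all _ fun ζ => ?_)
      (ae_of_all _ fun ζ => ?_)
    · refine (norm_sub_le _ _).trans ((add_le_add (hb _ ζ) (hb _ ζ)).trans (le_of_eq ?_))
      rw [norm_mul, Complex.norm_ofNat]; ring
    · have h1 := ((continuous_prop_left ζ).tendsto t).comp hx
      have h2 := ((h1.const_mul ((band k).indicator (fun _ => (1:ℂ)) (ζ 0))).mul_const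
        (𝓕⁻ (Ψ : Plane → ℂ) ζ)).sub_const (bandTest k (fun _ => 1) t Ψ ζ)
      simpa [bandTest, Function.comp_def] using h2
  refine squeeze_zero (fun n => norm_nonneg _) (fun n => ?_) hlim
  rw [Lp.norm_def, nrm]
  refine le_add_of_nonneg_of_le (integral_nonneg fun _ => norm_nonneg _) (le_of_eq ?_)
  congr 1
  refine eLpNorm_congr_norm_ae ?_
  filter_upwards [Lp.coeFn_sub (bandVec k Ψ (x n)) (bandVec k Ψ t), bandVec_coe k Ψ (x n),
    bandVec_coe k Ψ t] with ζ h1 h2 h3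
  rw [Function.comp_apply, h1, Pi.sub_apply, h2, h3, ← map_sub, RCLike.norm_conj]

theorem inner_bandVec (k : ℕ) (Ψ : 𝓢(Plane, ℂ)) (t : ℝ) (φ : Lp ℂ 2 (volume : Measure Plane)) :
    inner ℂ (bandVec k Ψ t) φ = ∫ ζ, φ ζ * bandTest k (fun _ => 1) t Ψ ζ := by
  rw [L2.inner_def]
  refine integral_congr_ae ?_
  filter_upwards [bandVec_coe k Ψ t] with ζ h
  rw [h, RCLike.inner_apply, starRingEnd_self_apply]

theorem norm_bandVec_le (k : ℕ) (Ψ : 𝓢(Plane, ℂ)) (t : ℝ) :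
    ‖bandVec k Ψ t‖ ≤ nrm (𝓕⁻ (Ψ : Plane → ℂ)) := by
  rw [Lp.norm_def, nrm]
  refine le_add_of_nonneg_of_le (integral_nonneg fun _ => norm_nonneg _) ?_
  refine ENNReal.toReal_mono (mem12_fourierInv Ψ).l2.eLpNorm_ne_top (eLpNorm_mono_ae ?_)
  filter_upwards [bandVec_coe k Ψ t] with ζ h
  rw [h, RCLike.norm_conj]
  simpa using norm_bandTest_le zero_le_one (fun p _ => by simp) (k := k) (Ψ := Ψ) (α := fun _ => 1) t ζ

/-- The two propagators combine to e^{i(t-t')ω}. Moving the Fourier transform off ρ j exhibits the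
inner product as ρ j integrated against the band kernel applied to ρ i; both have L¹ norm at most 1,
so only the dispersive bound remains. -/
theorem norm_inner_bandVec_le {ρ : ℕ → 𝓢(Plane, ℂ)} (hρ : TestFamily ρ) (k : ℕ) {ν : ℝ} (hν : 0 ≤ ν)
    (hν' : ν ≤ 1 / 2) (i j : ℕ) {t t' : ℝ} (ht : t ≠ t') (ht2 : |t - t'| ≤ 2) :
    ‖inner ℂ (bandVec k (ρ i) t) (bandVec k (ρ j) t')‖ ≤
      80 * (2 ^ k : ℝ) ^ (3 * ν) * |t - t'| ^ (-1 + ν) := by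
  have h12 := mem12_bandTest (α := fun _ => 1) continuous_const k (t - t') (ρ i)
  have e : inner ℂ (bandVec k (ρ i) t) (bandVec k (ρ j) t') =
      ∫ z, 𝓕 (bandTest k (fun _ => 1) (t - t') (ρ i)) z * ρ j z := by
    rw [inner_bandVec, integral_fourier_mul h12.int (ρ j).integrable]
    refine integral_congr_ae ?_
    filter_upwards [bandVec_coe k (ρ j) t'] with ζ h
    have h1 : prop t ζ * (starRingEnd ℂ) (prop t' ζ) = prop (t - t') ζ := by
      have h2 := prop_add (t - t') t' ζ
      rw [sub_add_cancel] at h2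
      rw [h2, mul_assoc, Complex.mul_conj, Complex.normSq_eq_norm_sq, norm_prop]
      simp
    have h3 : (starRingEnd ℂ) ((band k).indicator (fun _ => (1:ℂ)) (ζ 0)) *
        (band k).indicator (fun _ => (1:ℂ)) (ζ 0) = (band k).indicator (fun _ => (1:ℂ)) (ζ 0) := by
      by_cases hb : ζ 0 ∈ band k
      · simp [indicator_of_mem hb]
      · simp [indicator_of_notMem hb]
    rw [h, bandTest, bandTest, bandTest, map_mul, map_mul, conj_fourierInv (hρ.real j), ← h1]
    linear_combination (𝓕 (ρ j : Plane → ℂ) ζ * prop t ζ * (starRingEnd ℂ) (prop t' ζ) *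
      𝓕⁻ (ρ i : Plane → ℂ) ζ) * h3
  have hK : ∀ z, ‖𝓕 (bandTest k (fun _ => 1) (t - t') (ρ i)) z‖ ≤
      80 * (2 ^ k : ℝ) ^ (3 * ν) * |t - t'| ^ (-1 + ν) := by
    intro z
    have h1 := norm_fourier_band_le (bandAmplitude_one k) hν hν' (sub_ne_zero.2 ht) ht2
      (Ψ := ρ i) (ρ i).integrable (mem12_fourierInv (ρ i)).int z
    refine h1.trans ?_
    have h2 := mul_le_mul_of_nonneg_left (hρ.norm_le i)
      (show 0 ≤ 80 * 1 * (2 ^ k : ℝ) ^ (3 * ν) * |t - t'| ^ (-1 + ν) by positivity)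
    linarith
  rw [e]
  have h0 : 0 ≤ 80 * (2 ^ k : ℝ) ^ (3 * ν) * |t - t'| ^ (-1 + ν) := by positivity
  calc _ ≤ ∫ z, 80 * (2 ^ k : ℝ) ^ (3 * ν) * |t - t'| ^ (-1 + ν) * ‖ρ j z‖ := by
        refine norm_integral_le_of_norm_le ((ρ j).integrable.norm.const_mul _) (ae_of_all _ fun z => ?_)
        rw [norm_mul]
        exact mul_le_mul_of_nonneg_right (hK z) (norm_nonneg _)
    _ ≤ _ := by
        rw [integral_const_mul]
        exact (mul_le_mul_of_nonneg_left (hρ.norm_le j) h0).trans (le_of_eq (mul_one _))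

/-- The constant in the maximal Strichartz estimate. -/
noncomputable def strichartzConst (q ν : ℝ) : ℝ≥0∞ :=
  2 ^ (q / 2) * (ENNReal.ofReal (80 ^ (q / 2)) * singConst ((1 - ν) * (q / 2)))

theorem strichartzConst_ne_top {q ν : ℝ} (hq : (1 - ν) * (q / 2) < 1) (hq2 : 2 ≤ q) :
    strichartzConst q ν ≠ ⊤ := by
  refine ENNReal.mul_ne_top (ENNReal.rpow_ne_top_of_nonneg (by linarith) (by norm_num))
    (ENNReal.mul_ne_top ENNReal.ofReal_ne_top (singConst_ne_top hq))

theorem lintegral_iSup_bandTest_le {ρ : ℕ → 𝓢(Plane, ℂ)} (hρ : TestFamily ρ) (k : ℕ) {ν q T : ℝ}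
    (hν : 0 ≤ ν) (hν' : ν ≤ 1 / 2) (hq2 : 2 ≤ q) (hT : T < 2)
    {V : Plane → ℂ} (hV : MemLp V 2 volume) :
    ∫⁻ t in Ioo 0 T, (⨆ j, ‖∫ ζ, V ζ * bandTest k (fun _ => 1) t (ρ j) ζ‖ₑ) ^ q ≤
      strichartzConst q ν * ENNReal.ofReal ((2 ^ k : ℝ) ^ (3 * ν * (q / 2))) * eLpNorm V 2 volume ^ q := by
  set e : ℕ → ℝ → Lp ℂ 2 (volume : Measure Plane) := fun j =>
    (Ioo 0 T).indicator (bandVec k (ρ j)) with he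
  set a : ℝ := (1 - ν) * (q / 2) with ha
  have ha0 : 0 ≤ a := mul_nonneg (by linarith) (by linarith)
  set D : ℝ := 80 * (2 ^ k : ℝ) ^ (3 * ν) with hD
  have hD0 : 0 ≤ D := by positivity
  have key := lintegral_iSup_inner_rpow_le (H := Lp ℂ 2 (volume : Measure Plane))
    (μ := volume.restrict (Ioo 0 T)) (e := e) (R := fun j => nrm (𝓕⁻ (ρ j : Plane → ℂ))) (q := q)
    -- The dispersive bound says nothing on the diagonal; the value ⊤ is harmless because for each t
    -- it concerns a single t'.
    (κ := fun t t' => if t = t' then ⊤ else ENNReal.ofReal (D * |t - t'| ^ (-1 + ν)))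
    (B := ENNReal.ofReal (D ^ (q / 2)) * singConst a)
    (fun j => (continuous_bandVec k (ρ j)).stronglyMeasurable.indicator measurableSet_Ioo)
    (fun j t => by
      rw [he]
      by_cases h : t ∈ Ioo 0 T
      · simp only [indicator_of_mem h]; exact norm_bandVec_le k (ρ j) t
      · simp only [indicator_of_notMem h, norm_zero]; exact nrm_nonneg _)
    hq2
    (fun i j t t' => by
      by_cases hne : t = t'
      · simp [hne]
      simp only [if_neg hne, he]
      by_cases h : t ∈ Ioo 0 T
      · by_cases h' : t' ∈ Ioo 0 T
        · rw [indicator_of_mem h, indicator_of_mem h', ← ofReal_norm]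
          refine ENNReal.ofReal_le_ofReal (norm_inner_bandVec_le hρ k hν hν' i j hne ?_)
          rw [abs_le]
          constructor <;> linarith [h.1, h.2, h'.1, h'.2]
        · rw [indicator_of_notMem h', inner_zero_right, enorm_zero]; exact zero_le
      · rw [indicator_of_notMem h, inner_zero_left, enorm_zero]; exact zero_le)
    (fun t => by
      have hne : ∀ᵐ s ∂volume.restrict (Ioo 0 T), s ≠ t := ae_restrict_of_ae (by simp [ae_iff])
      calc _ = ∫⁻ s in Ioo 0 T, ENNReal.ofReal (D ^ (q / 2)) * ENNReal.ofReal (|t - s| ^ (-a)) := by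
            refine lintegral_congr_ae ?_
            filter_upwards [hne] with s hs
            rw [if_neg hs.symm, ENNReal.ofReal_rpow_of_nonneg (by positivity) (by linarith),
              ← ENNReal.ofReal_mul (by positivity), Real.mul_rpow hD0 (by positivity),
              ← Real.rpow_mul (abs_nonneg _)]
            congr 4
            rw [ha]; ring
        _ ≤ _ := by
            rw [lintegral_const_mul' _ _ ENNReal.ofReal_ne_top]
            gcongr
            exact lintegral_sing_le ha0 hT t)
    (hV.toLp V)
  have e1 : ∫⁻ t in Ioo 0 T, (⨆ j, ‖∫ ζ, V ζ * bandTest k (fun _ => 1) t (ρ j) ζ‖ₑ) ^ q =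
      ∫⁻ t in Ioo 0 T, (⨆ j, ‖inner ℂ (e j t) (hV.toLp V)‖ₑ) ^ q := by
    refine setLIntegral_congr_fun measurableSet_Ioo fun t ht => ?_
    have h1 : ∀ j, ∫ ζ, V ζ * bandTest k (fun _ => 1) t (ρ j) ζ = inner ℂ (e j t) (hV.toLp V) := by
      intro j
      simp only [he]
      rw [indicator_of_mem ht, inner_bandVec]
      refine integral_congr_ae ?_
      filter_upwards [hV.coeFn_toLp] with ζ h
      rw [h]
    simp only [h1]
  rw [e1]
  refine key.trans (le_of_eq ?_)
  rw [Lp.enorm_toLp, strichartzConst, hD, Real.mul_rpow (by norm_num) (by positivity),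
    ENNReal.ofReal_mul (by positivity), ← Real.rpow_mul (by positivity)]
  ring

/-- The Fourier transform in `L²`, on functions. -/
noncomputable def fourierL2 {v : Plane → ℂ} (hv : MemLp v 2 volume) : Plane → ℂ :=
  (𝓕 (hv.toLp v) : Lp ℂ 2 (volume : Measure Plane))

theorem memLp_fourierL2 {v : Plane → ℂ} (hv : MemLp v 2 volume) : MemLp (fourierL2 hv) 2 volume :=
  Lp.memLp _

theorem pair_eq_fourierL2 {v : Plane → ℂ} (hv : MemLp v 2 volume) {χ : Plane → ℂ} (hχ : Mem12 χ) :
    pair v χ = ∫ ζ, fourierL2 hv ζ * χ ζ := by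
  rw [fourierL2, ← integral_Lp_fourier_mul _ hχ.int hχ.l2, pair]
  refine integral_congr_ae ?_
  filter_upwards [hv.coeFn_toLp] with z h
  rw [h]

/-- By the group property the amplitude and e^{-iτω} can be moved onto the transform of v, where the
unimodular factor leaves the L² norm unchanged; the constant is therefore uniform in τ. -/
theorem lintegral_iSup_pair_le {ρ : ℕ → 𝓢(Plane, ℂ)} (hρ : TestFamily ρ) (k : ℕ) {ν q T : ℝ}
    (hν : 0 ≤ ν) (hν' : ν ≤ 1 / 2) (hq2 : 2 ≤ q) (hT : T < 2) {α : ℝ → ℂ} (hα : Continuous α)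
    {v : Plane → ℂ} (hv : MemLp v 2 volume) (τ : ℝ) :
    ∫⁻ t in Ioo 0 T, (⨆ j, ‖pair v (bandTest k α (t - τ) (ρ j))‖ₑ) ^ q ≤
      strichartzConst q ν * ENNReal.ofReal ((2 ^ k : ℝ) ^ (3 * ν * (q / 2))) *
        eLpNorm (fun ζ => (band k).indicator α (ζ 0) * fourierL2 hv ζ) 2 volume ^ q := by
  obtain ⟨M, hM0, hM⟩ := exists_bound_on_band hα k
  have hind : Measurable (fun ζ : Plane => (band k).indicator α (ζ 0)) :=
    (hα.measurable.indicator (measurableSet_band k)).comp (measurable_coord 0)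
  set V : Plane → ℂ := fun ζ => prop (-τ) ζ * ((band k).indicator α (ζ 0) * fourierL2 hv ζ) with hVd
  have hVm : AEStronglyMeasurable V volume := (measurable_prop _).aestronglyMeasurable.mul
    (hind.aestronglyMeasurable.mul (memLp_fourierL2 hv).1)
  have hV : MemLp V 2 volume := by
    refine (memLp_fourierL2 hv).of_le_mul (c := M) hVm (ae_of_all _ fun ζ => ?_)
    rw [hVd, norm_mul, norm_prop, one_mul, norm_mul]
    exact mul_le_mul_of_nonneg_right (norm_indicator_band_le hM0 hM _) (norm_nonneg _)
  have hVn : eLpNorm V 2 volume =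
      eLpNorm (fun ζ => (band k).indicator α (ζ 0) * fourierL2 hv ζ) 2 volume :=
    eLpNorm_congr_norm_ae (ae_of_all _ fun ζ => by rw [hVd, norm_mul, norm_prop, one_mul])
  rw [← hVn]
  refine le_trans (le_of_eq ?_) (lintegral_iSup_bandTest_le hρ k hν hν' hq2 hT hV)
  refine lintegral_congr fun t => ?_
  congr 2
  funext j
  rw [pair_eq_fourierL2 hv (mem12_bandTest hα k _ _)]
  congr 2
  funext ζ
  rw [hVd, bandTest, bandTest, sub_eq_add_neg, prop_add]
  by_cases hb : ζ 0 ∈ band k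
  · simp only [indicator_of_mem hb]; ring
  · simp only [indicator_of_notMem hb]; ring

/-! ### The estimate on one band -/

/-- Hölder with respect to the measure w dμ. It serves as Young's inequality in time, as Hölder on
short windows, and as the weighting of dyadic sums. -/
theorem rpow_lintegral_mul_le {X : Type*} [MeasurableSpace X] {μ : Measure X} {q : ℝ} (hq : 1 < q)
    {w f : X → ℝ≥0∞} (hw : AEMeasurable w μ) (hf : AEMeasurable f μ) :
    (∫⁻ x, w x * f x ∂μ) ^ q ≤ (∫⁻ x, w x ∂μ) ^ (q - 1) * ∫⁻ x, w x * f x ^ q ∂μ := by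
  have hq0 : 0 < q := by linarith
  set p : ℝ := q / (q - 1) with hp
  have hpq : p.HolderConjugate q := (Real.HolderConjugate.conjExponent hq).symm
  have hp0 : 0 < p := hpq.pos
  have hsum : 1 / p + 1 / q = 1 := by simpa using hpq.inv_add_inv_eq_one
  have h1 := ENNReal.lintegral_mul_le_Lp_mul_Lq μ hpq (hw.pow_const (1 / p))
    ((hw.pow_const (1 / q)).mul hf)
  have e1 : ∀ x, ((fun x => w x ^ (1 / p)) * ((fun x => w x ^ (1 / q)) * f)) x = w x * f x := by
    intro x
    simp only [Pi.mul_apply]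
    rw [← mul_assoc, ← ENNReal.rpow_add_of_nonneg _ _ (by positivity) (by positivity), hsum,
      ENNReal.rpow_one]
  have e2 : ∀ x, (w x ^ (1 / p)) ^ p = w x := fun x => by
    rw [← ENNReal.rpow_mul, one_div_mul_cancel hp0.ne', ENNReal.rpow_one]
  have e3 : ∀ x, (((fun x => w x ^ (1 / q)) * f) x) ^ q = w x * f x ^ q := fun x => by
    simp only [Pi.mul_apply]
    rw [ENNReal.mul_rpow_of_nonneg _ _ hq0.le, ← ENNReal.rpow_mul, one_div_mul_cancel hq0.ne',
      ENNReal.rpow_one]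
  simp only [e1, e2, e3] at h1
  calc (∫⁻ x, w x * f x ∂μ) ^ q ≤ ((∫⁻ x, w x ∂μ) ^ (1 / p) * (∫⁻ x, w x * f x ^ q ∂μ) ^ (1 / q)) ^ q :=
        ENNReal.rpow_le_rpow h1 hq0.le
    _ = _ := by
        rw [ENNReal.mul_rpow_of_nonneg _ _ hq0.le, ← ENNReal.rpow_mul, ← ENNReal.rpow_mul,
          one_div_mul_cancel hq0.ne', ENNReal.rpow_one]
        congr 2
        rw [hp]
        field_simp

theorem rpow_add_le {q : ℝ} (hq : 1 ≤ q) (a b : ℝ≥0∞) : (a + b) ^ q ≤ 2 ^ (q - 1) * (a ^ q + b ^ q) :=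
  ENNReal.rpow_add_le_mul_rpow_add_rpow a b hq

/-- The size of `2^k` as an extended number. -/
noncomputable def dyad (k : ℕ) : ℝ≥0∞ := 2 ^ k

theorem ofReal_two_pow_rpow (k : ℕ) (x : ℝ) : ENNReal.ofReal ((2 ^ k : ℝ) ^ x) = dyad k ^ x := by
  rw [← ENNReal.ofReal_rpow_of_pos (by positivity), dyad, ENNReal.ofReal_pow (by norm_num)]
  simp

theorem one_le_dyad (k : ℕ) : 1 ≤ dyad k := one_le_pow₀ (by norm_num)

theorem dyad_ne_top (k : ℕ) : dyad k ≠ ⊤ := ENNReal.pow_ne_top (by norm_num)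

theorem dyad_ne_zero (k : ℕ) : dyad k ≠ 0 := (zero_lt_one.trans_le (one_le_dyad k)).ne'

theorem norm_forceSymbol (β p : ℝ) : ‖forceSymbol β p‖ = 2 * Real.pi * |p| * bes β p := by
  rw [forceSymbol, norm_mul, norm_mul, norm_neg, norm_mul, norm_mul, Complex.norm_real, Complex.norm_real,
    Complex.norm_I, Complex.norm_real, Real.norm_of_nonneg Real.pi_pos.le,
    Real.norm_of_nonneg (bes_pos β p).le, Real.norm_eq_abs]
  simp

theorem norm_forceSymbol_le {β p : ℝ} {k : ℕ} (hp : p ∈ band k) :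
    ‖forceSymbol β p‖ ≤ 2 * Real.pi * besConst β * (2 ^ k : ℝ) ^ (β + 1) := by
  rw [norm_forceSymbol, Real.rpow_add (by positivity), Real.rpow_one]
  have h1 := (abs_lt_of_mem_band hp).le
  have h2 := bes_le (θ := β) (band_subset_closedBand k hp)
  have h3 := (bes_pos β p).le
  have h4 := one_le_besConst β
  calc 2 * Real.pi * |p| * bes β p ≤ 2 * Real.pi * 2 ^ k * (besConst β * (2 ^ k : ℝ) ^ β) := by gcongr
    _ = _ := by ring

theorem eLpNorm_fourierL2 {v : Plane → ℂ} (hv : MemLp v 2 volume) :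
    eLpNorm (fourierL2 hv) 2 volume = eLpNorm v 2 volume := by
  rw [fourierL2, ← Lp.enorm_def, ← Lp.enorm_toLp hv, ← ofReal_norm, ← ofReal_norm, Lp.norm_fourier_eq]

/-- Bounds on the band for the free part. -/
theorem eLpNorm_band_bes_le {v : Plane → ℂ} (hv : MemLp v 2 volume) (k : ℕ) (θ s : ℝ) :
    eLpNorm (fun ζ => (band k).indicator (fun p => (bes θ p : ℂ)) (ζ 0) * fourierL2 hv ζ) 2 volume ≤
      ENNReal.ofReal (besConst (θ - s)) * dyad k ^ (θ - s) *
        eLpNorm (fun ζ => (besselSymbol s ζ : ℂ) * fourierL2 hv ζ) 2 volume := by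
  rw [← ofReal_two_pow_rpow, ← ENNReal.ofReal_mul (by linarith [one_le_besConst (θ - s)])]
  refine eLpNorm_le_mul_eLpNorm_of_ae_le_mul (ae_of_all _ fun ζ => ?_) 2
  have h0 := one_le_besConst (θ - s)
  by_cases h : ζ 0 ∈ band k
  · rw [indicator_of_mem h, norm_mul, norm_mul, Complex.norm_real, Complex.norm_real, besselSymbol_eq,
      Real.norm_of_nonneg (bes_pos _ _).le, Real.norm_of_nonneg (bes_pos _ _).le]
    have h1 : bes θ (ζ 0) = bes (θ - s) (ζ 0) * bes s (ζ 0) := by rw [← bes_add, sub_add_cancel]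
    have h2 := bes_le (θ := θ - s) (band_subset_closedBand k h)
    have h3 := (bes_pos s (ζ 0)).le
    rw [h1, mul_assoc]
    exact mul_le_mul_of_nonneg_right h2 (by positivity)
  · rw [indicator_of_notMem h, zero_mul, norm_zero]; positivity

theorem eLpNorm_band_force_le {v : Plane → ℂ} (hv : MemLp v 2 volume) (k : ℕ) (β : ℝ) :
    eLpNorm (fun ζ => (band k).indicator (forceSymbol β) (ζ 0) * fourierL2 hv ζ) 2 volume ≤
      ENNReal.ofReal (2 * Real.pi * besConst β) * dyad k ^ (β + 1) * eLpNorm v 2 volume := by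
  have h0 := one_le_besConst β
  rw [← ofReal_two_pow_rpow, ← ENNReal.ofReal_mul (by positivity), ← eLpNorm_fourierL2 hv]
  refine eLpNorm_le_mul_eLpNorm_of_ae_le_mul (ae_of_all _ fun ζ => ?_) 2
  rw [norm_mul]
  exact mul_le_mul_of_nonneg_right
    (norm_indicator_band_le (by positivity) (fun p hp => norm_forceSymbol_le hp) _) (norm_nonneg _)

theorem enorm_pair_band_force_le {ρ : ℕ → 𝓢(Plane, ℂ)} (hρ : TestFamily ρ) (k : ℕ) {ν β : ℝ}
    (hν : 0 ≤ ν) (hν' : ν ≤ 1 / 2) {s : ℝ} (hs : s ≠ 0) (hs2 : |s| ≤ 2) (v : Plane → ℂ) (j : ℕ) :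
    ‖pair v (bandTest k (forceSymbol β) s (ρ j))‖ₑ ≤
      ENNReal.ofReal (80 * (2 * Real.pi * (1 + |β|) * besConst β)) * dyad k ^ (β + 1) * dyad k ^ (3 * ν) *
        (ENNReal.ofReal (|s| ^ (-(1 - ν))) * eLpNorm v 1 volume) := by
  have h0 := one_le_besConst β
  have hK : ∀ z, ‖𝓕 (bandTest k (forceSymbol β) s (ρ j)) z‖ₑ ≤
      ENNReal.ofReal (80 * (2 * Real.pi * (1 + |β|) * besConst β)) * dyad k ^ (β + 1) * dyad k ^ (3 * ν) *
        ENNReal.ofReal (|s| ^ (-(1 - ν))) := by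
    intro z
    have h1 := norm_fourier_band_le (bandAmplitude_bes k β) hν hν' hs hs2
      (Ψ := ρ j) (ρ j).integrable (mem12_fourierInv (ρ j)).int z
    rw [← ofReal_two_pow_rpow, ← ofReal_two_pow_rpow, ← ENNReal.ofReal_mul (by positivity),
      ← ENNReal.ofReal_mul (by positivity), ← ENNReal.ofReal_mul (by positivity), ← ofReal_norm]
    refine ENNReal.ofReal_le_ofReal (h1.trans ?_)
    have h2 := mul_le_mul_of_nonneg_left (hρ.norm_le j)
      (show 0 ≤ 80 * (2 * Real.pi * (1 + |β|) * besConst β * (2 ^ k : ℝ) ^ (β + 1)) *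
        (2 ^ k : ℝ) ^ (3 * ν) * |s| ^ (-1 + ν) by positivity)
    refine h2.trans (le_of_eq ?_)
    rw [show -(1 - ν) = -1 + ν by ring]
    ring
  calc _ ≤ ∫⁻ z, ‖v z * 𝓕 (bandTest k (forceSymbol β) s (ρ j)) z‖ₑ := enorm_integral_le_lintegral_enorm _
    _ ≤ ∫⁻ z, (ENNReal.ofReal (80 * (2 * Real.pi * (1 + |β|) * besConst β)) * dyad k ^ (β + 1) *
        dyad k ^ (3 * ν) * ENNReal.ofReal (|s| ^ (-(1 - ν)))) * ‖v z‖ₑ := by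
        refine lintegral_mono fun z => ?_
        rw [enorm_mul, mul_comm]
        gcongr
        exact hK z
    _ = _ := by
        rw [lintegral_const_mul', eLpNorm_one_eq_lintegral_enorm, mul_assoc]
        have h3 : ∀ x : ℝ, dyad k ^ x ≠ ⊤ := fun x =>
          ENNReal.rpow_ne_top_of_ne_zero (dyad_ne_zero k) (dyad_ne_top k)
        exact ENNReal.mul_ne_top (ENNReal.mul_ne_top (ENNReal.mul_ne_top ENNReal.ofReal_ne_top (h3 _))
          (h3 _)) ENNReal.ofReal_ne_top

theorem dyad_rpow_ne_top (k : ℕ) (x : ℝ) : dyad k ^ x ≠ ⊤ :=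
  ENNReal.rpow_ne_top_of_ne_zero (dyad_ne_zero k) (dyad_ne_top k)

/-- The maximal function of the pairings with `1_k α e^{i(t-τ)ω} 𝓕⁻ρⱼ`. -/
noncomputable def bandMax (k : ℕ) (α : ℝ → ℂ) (ρ : ℕ → 𝓢(Plane, ℂ)) (v : ℝ → Plane → ℂ) (t τ : ℝ) : ℝ≥0∞ :=
  ⨆ j, ‖pair (v τ) (bandTest k α (t - τ) (ρ j))‖ₑ

theorem measurable_bandMax {v : ℝ → Plane → ℂ} (hv : StronglyMeasurable (Function.uncurry v))
    {α : ℝ → ℂ} (hα : Continuous α) (k : ℕ) (ρ : ℕ → 𝓢(Plane, ℂ)) :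
    Measurable (Function.uncurry (bandMax k α ρ v)) :=
  Measurable.iSup fun j => (stronglyMeasurable_pair_bandTest hv hα k (ρ j)).measurable.enorm

/-- After Tonelli the inner integral over t, for a frozen datum at time τ, is the homogeneous
maximal estimate. -/
theorem lintegral_bandMax_l2_le {ρ : ℕ → 𝓢(Plane, ℂ)} (hρ : TestFamily ρ) (k : ℕ) {ν q T : ℝ}
    (hν : 0 ≤ ν) (hν' : ν ≤ 1 / 2) (hq2 : 2 ≤ q) (hq : (1 - ν) * (q / 2) < 1) (hT : T < 2) {α : ℝ → ℂ}
    (hα : Continuous α) {v : ℝ → Plane → ℂ} (hvm : StronglyMeasurable (Function.uncurry v)) {D : ℝ → ℝ≥0∞}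
    (hv : ∀ᵐ τ ∂volume.restrict (Ioo 0 T), ∃ h : MemLp (v τ) 2 volume,
      eLpNorm (fun ζ => (band k).indicator α (ζ 0) * fourierL2 h ζ) 2 volume ≤ D τ) :
    ∫⁻ t in Ioo 0 T, ∫⁻ τ in Ioo 0 T, bandMax k α ρ v t τ ^ q ≤
      strichartzConst q ν * dyad k ^ (3 * ν * (q / 2)) * ∫⁻ τ in Ioo 0 T, D τ ^ q := by
  have hK : ∀ᵐ τ ∂volume.restrict (Ioo 0 T), ∫⁻ t in Ioo 0 T, bandMax k α ρ v t τ ^ q ≤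
      strichartzConst q ν * dyad k ^ (3 * ν * (q / 2)) * D τ ^ q := by
    filter_upwards [hv] with τ ⟨h, hD⟩
    refine (lintegral_iSup_pair_le hρ k hν hν' hq2 hT hα h τ).trans ?_
    rw [ofReal_two_pow_rpow]
    gcongr
  rw [lintegral_lintegral_swap ((measurable_bandMax hvm hα k ρ).pow_const q).aemeasurable]
  refine (lintegral_mono_ae hK).trans ?_
  rw [lintegral_const_mul' _ _ (ENNReal.mul_ne_top (strichartzConst_ne_top hq hq2) (dyad_rpow_ne_top _ _))]

/-- For L¹ data the dispersive bound applies for each pair t, τ, so the maximal function is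
dominated by the convolution of a with |t-τ|^{-1+ν}. Hölder with this weight and Tonelli bound it on
L^q. Taking absolute values inside the integral makes the restriction to times between t₀ and t free
of charge. -/
theorem lintegral_bandMax_l1_le {ρ : ℕ → 𝓢(Plane, ℂ)} (hρ : TestFamily ρ) (k : ℕ) {ν q T β : ℝ}
    (hν : 0 < ν) (hν' : ν ≤ 1 / 2) (hq2 : 2 ≤ q) (hT : T < 2)
    {v : ℝ → Plane → ℂ} {a : ℝ → ℝ≥0∞} (ham : Measurable a)
    (hv : ∀ᵐ τ ∂volume.restrict (Ioo 0 T), eLpNorm (v τ) 1 volume ≤ a τ) :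
    ∫⁻ t in Ioo 0 T, (∫⁻ τ in Ioo 0 T, bandMax k (forceSymbol β) ρ v t τ) ^ q ≤
      (ENNReal.ofReal (80 * (2 * Real.pi * (1 + |β|) * besConst β)) * dyad k ^ (β + 1) * dyad k ^ (3 * ν)) ^ q
        * (singConst (1 - ν) ^ q * ∫⁻ τ in Ioo 0 T, a τ ^ q) := by
  set E : ℝ≥0∞ := ENNReal.ofReal (80 * (2 * Real.pi * (1 + |β|) * besConst β)) * dyad k ^ (β + 1) *
    dyad k ^ (3 * ν) with hE
  have hEt : E ≠ ⊤ := ENNReal.mul_ne_top (ENNReal.mul_ne_top ENNReal.ofReal_ne_top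
    (dyad_rpow_ne_top _ _)) (dyad_rpow_ne_top _ _)
  set w : ℝ → ℝ → ℝ≥0∞ := fun t τ => ENNReal.ofReal (|t - τ| ^ (-(1 - ν))) with hw
  have hwm : Measurable (Function.uncurry w) := by
    simp only [hw, Function.uncurry_def]; fun_prop
  have hq0 : 0 ≤ q := by linarith
  have h1 : ∀ t ∈ Ioo 0 T, (∫⁻ τ in Ioo 0 T, bandMax k (forceSymbol β) ρ v t τ) ^ q ≤
      E ^ q * (singConst (1 - ν) ^ (q - 1) * ∫⁻ τ in Ioo 0 T, w t τ * a τ ^ q) := by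
    intro t ht
    have hne : ∀ᵐ τ ∂volume.restrict (Ioo 0 T), τ ≠ t := ae_restrict_of_ae (by simp [ae_iff])
    have h2 : ∫⁻ τ in Ioo 0 T, bandMax k (forceSymbol β) ρ v t τ ≤ E * ∫⁻ τ in Ioo 0 T, w t τ * a τ := by
      rw [← lintegral_const_mul' _ _ hEt]
      refine lintegral_mono_ae ?_
      filter_upwards [hne, hv, ae_restrict_mem measurableSet_Ioo] with τ h3 h4 h5
      refine iSup_le fun j => ?_
      refine (enorm_pair_band_force_le hρ k hν.le hν' (sub_ne_zero.2 h3.symm) ?_ (v τ) j).trans ?_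
      · rw [abs_le]; constructor <;> linarith [ht.1, ht.2, h5.1, h5.2]
      · gcongr
    calc _ ≤ (E * ∫⁻ τ in Ioo 0 T, w t τ * a τ) ^ q := ENNReal.rpow_le_rpow h2 hq0
      _ = E ^ q * (∫⁻ τ in Ioo 0 T, w t τ * a τ) ^ q := ENNReal.mul_rpow_of_nonneg _ _ hq0
      _ ≤ E ^ q * ((∫⁻ τ in Ioo 0 T, w t τ) ^ (q - 1) * ∫⁻ τ in Ioo 0 T, w t τ * a τ ^ q) := by
          gcongr
          exact rpow_lintegral_mul_le (by linarith) hwm.of_uncurry_left.aemeasurable ham.aemeasurable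
      _ ≤ _ := by
          have h6 := ENNReal.rpow_le_rpow (lintegral_sing_le (a := 1 - ν) (by linarith) hT t)
            (show 0 ≤ q - 1 by linarith)
          exact mul_le_mul_right (mul_le_mul_left h6 _) _
  have hsc : singConst (1 - ν) ≠ ⊤ := singConst_ne_top (by linarith)
  calc _ ≤ ∫⁻ t in Ioo 0 T, E ^ q * (singConst (1 - ν) ^ (q - 1) *
        ∫⁻ τ in Ioo 0 T, w t τ * a τ ^ q) := setLIntegral_mono' measurableSet_Ioo h1
    _ = E ^ q * (singConst (1 - ν) ^ (q - 1) *
        ∫⁻ t in Ioo 0 T, ∫⁻ τ in Ioo 0 T, w t τ * a τ ^ q) := by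
        rw [lintegral_const_mul' _ _ (ENNReal.rpow_ne_top_of_nonneg hq0 hEt),
          lintegral_const_mul' _ _ (ENNReal.rpow_ne_top_of_nonneg (by linarith) hsc)]
    _ = E ^ q * (singConst (1 - ν) ^ (q - 1) *
        ∫⁻ τ in Ioo 0 T, ∫⁻ t in Ioo 0 T, w t τ * a τ ^ q) := by
        rw [lintegral_lintegral_swap]
        exact (hwm.mul ((ham.pow_const q).comp measurable_snd)).aemeasurable
    _ ≤ E ^ q * (singConst (1 - ν) ^ (q - 1) *
        ∫⁻ τ in Ioo 0 T, singConst (1 - ν) * a τ ^ q) := by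
        gcongr with τ
        rw [lintegral_mul_const _ hwm.of_uncurry_right]
        gcongr
        have := lintegral_sing_le (a := 1 - ν) (by linarith) hT τ
        simpa only [hw, abs_sub_comm] using this
    _ = _ := by
        rw [lintegral_const_mul' _ _ hsc, ← mul_assoc (singConst (1 - ν) ^ (q - 1))]
        congr 2
        nth_rw 2 [← ENNReal.rpow_one (singConst (1 - ν))]
        rw [← ENNReal.rpow_add_of_nonneg _ _ (by linarith) (by norm_num), sub_add_cancel]

/-- On one side of t the window keeps a length of at least min(δ, T/2). The lower bound is made
proportional to T so that it cancels the length of (0, T) in the free part and the final constants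
do not depend on T. -/
theorem volume_window_le {t δ T : ℝ} (hδ : 0 < δ) (hδ1 : δ ≤ 1) (ht : t ∈ Ioo 0 T) (hT : T < 2) :
    ENNReal.ofReal (δ * T / 2) ≤ volume (Ioo 0 T ∩ Ioo (t - δ) (t + δ)) := by
  have hT0 : 0 < T := ht.1.trans ht.2
  rw [Ioo_inter_Ioo, Real.volume_Ioo]
  refine ENNReal.ofReal_le_ofReal ?_
  have h1 : δ * T ≤ δ * 2 := by gcongr
  have h2 : δ * T ≤ 1 * T := by gcongr
  have h3 := ht.1
  have h4 := ht.2
  rcases max_cases 0 (t - δ) with h | h <;> rcases min_cases T (t + δ) with h' | h' <;>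
    rw [h.1, h'.1] <;> nlinarith [h.2, h'.2]

theorem volume_window_le' (t δ T : ℝ) :
    volume (Ioo 0 T ∩ Ioo (t - δ) (t + δ)) ≤ ENNReal.ofReal (2 * δ) := by
  refine (measure_mono inter_subset_right).trans ?_
  rw [Real.volume_Ioo]
  exact ENNReal.ofReal_le_ofReal (by linarith)

/-- Because t₀ is within δ of t, the L² forcing is integrated only over the window, which is the
source of its gain. For the L¹ forcing nothing is gained there and the whole interval is kept. -/
theorem bandMax_le_of_duhamel {ρ : ℕ → 𝓢(Plane, ℂ)} {k : ℕ} {δ T θ β : ℝ}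
    {u g₁ g₂ : ℝ → Plane → ℂ} (hm : StronglyMeasurable (Function.uncurry g₁))
    (h₁ : ∀ᵐ t ∂volume.restrict (Ioo 0 T), ∃ A, Pairable (g₁ t) A)
    (h₂ : ∀ᵐ t ∂volume.restrict (Ioo 0 T), ∃ A, Pairable (g₂ t) A)
    (hD : ∀ j, BandDuhamel T u (fun τ z => g₁ τ z + g₂ τ z) k θ β (ρ j)) :
    ∀ᵐ t ∂volume.restrict (Ioo 0 T),
      ∀ᵐ t₀ ∂volume.restrict (Ioo 0 T ∩ Ioo (t - δ) (t + δ)),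
      bandMax k (fun p => (bes θ p : ℂ)) ρ (fun _ => u t) 0 0 ≤
        bandMax k (fun p => (bes θ p : ℂ)) ρ u t t₀ +
        ((∫⁻ τ in Ioo 0 T, bandMax k (forceSymbol β) ρ g₁ t τ) +
        ∫⁻ τ in Ioo 0 T ∩ Ioo (t - δ) (t + δ), bandMax k (forceSymbol β) ρ g₂ t τ) := by
  choose S hS hST hSD using hD
  have hS' := ae_all_iff.2 hS
  filter_upwards [hS'] with t ht
  filter_upwards [ae_restrict_of_ae_restrict_of_subset inter_subset_left hS',
    ae_restrict_mem (measurableSet_Ioo.inter measurableSet_Ioo)] with t₀ ht₀ hmem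
  refine iSup_le fun j => ?_
  rw [sub_zero, hSD j t₀ (ht₀ j) t (ht j)]
  refine (enorm_add_le _ _).trans (add_le_add (le_iSup (fun j => ‖pair (u t₀)
    (bandTest k (fun p => (bes θ p : ℂ)) (t - t₀) (ρ j))‖ₑ) j) ?_)
  have htT := hST j (ht j)
  have hsub : uIoc t₀ t ⊆ Ioo 0 T ∩ Ioo (t - δ) (t + δ) := by
    obtain ⟨⟨a1, a2⟩, a3, a4⟩ := hmem
    intro τ hτ
    rcases mem_uIoc.1 hτ with h | h
    · exact ⟨⟨a1.trans h.1, h.2.trans_lt htT.2⟩, by linarith [h.1], by linarith [h.2]⟩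
    · exact ⟨⟨htT.1.trans h.1, h.2.trans_lt a2⟩, by linarith [h.1], by linarith [h.2]⟩
  have hle : ‖∫ τ in t₀..t, pair (fun z => g₁ τ z + g₂ τ z) (bandTest k (forceSymbol β) (t - τ) (ρ j))‖ₑ ≤
      ∫⁻ τ in uIoc t₀ t, ‖pair (fun z => g₁ τ z + g₂ τ z) (bandTest k (forceSymbol β) (t - τ) (ρ j))‖ₑ := by
    rw [← ofReal_norm, intervalIntegral.norm_intervalIntegral_eq, ofReal_norm]
    exact enorm_integral_le_lintegral_enorm _
  refine hle.trans ?_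
  have hp₁ := ae_restrict_of_ae_restrict_of_subset (hsub.trans inter_subset_left) h₁
  have hp₂ := ae_restrict_of_ae_restrict_of_subset (hsub.trans inter_subset_left) h₂
  have hm₁ : AEMeasurable (fun τ => ‖pair (g₁ τ) (bandTest k (forceSymbol β) (t - τ) (ρ j))‖ₑ)
      (volume.restrict (uIoc t₀ t)) :=
    ((stronglyMeasurable_pair_bandTest hm (continuous_forceSymbol β) k (ρ j)).comp_measurable
      (measurable_prodMk_left (x := t))).measurable.enorm.aemeasurable
  calc _ ≤ ∫⁻ τ in uIoc t₀ t, (‖pair (g₁ τ) (bandTest k (forceSymbol β) (t - τ) (ρ j))‖ₑ +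
        ‖pair (g₂ τ) (bandTest k (forceSymbol β) (t - τ) (ρ j))‖ₑ) := by
        refine lintegral_mono_ae ?_
        filter_upwards [hp₁, hp₂] with τ ⟨_, b1⟩ ⟨_, b2⟩
        rw [pair_add b1 b2 (mem12_bandTest (continuous_forceSymbol β) k (t - τ) (ρ j))]
        exact enorm_add_le _ _
    _ = (∫⁻ τ in uIoc t₀ t, ‖pair (g₁ τ) (bandTest k (forceSymbol β) (t - τ) (ρ j))‖ₑ) +
        ∫⁻ τ in uIoc t₀ t, ‖pair (g₂ τ) (bandTest k (forceSymbol β) (t - τ) (ρ j))‖ₑ :=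
        lintegral_add_left' hm₁ _
    _ ≤ _ := by
        refine add_le_add ?_ ?_
        · exact (lintegral_mono_set (hsub.trans inter_subset_left)).trans
            (lintegral_mono fun τ => le_iSup (fun j => ‖pair (g₁ τ)
              (bandTest k (forceSymbol β) (t - τ) (ρ j))‖ₑ) j)
        · exact (lintegral_mono_set hsub).trans
            (lintegral_mono fun τ => le_iSup (fun j => ‖pair (g₂ τ)
              (bandTest k (forceSymbol β) (t - τ) (ρ j))‖ₑ) j)

/-- The data of a linear problem on a band: Duhamel's formula with a forcing split into an `L¹` part
and an `L²` part. -/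
structure BandProblem (T : ℝ) (k : ℕ) (θ β s : ℝ) (ρ : ℕ → 𝓢(Plane, ℂ)) (u g₁ g₂ : ℝ → Plane → ℂ)
    (U : ℝ≥0∞) (a₁ a₂ : ℝ → ℝ≥0∞) : Prop where
  meas_u : StronglyMeasurable (Function.uncurry u)
  meas_g₁ : StronglyMeasurable (Function.uncurry g₁)
  meas_g₂ : StronglyMeasurable (Function.uncurry g₂)
  meas_a₁ : Measurable a₁
  meas_a₂ : Measurable a₂
  bound_u : ∀ᵐ t ∂volume.restrict (Ioo 0 T), ∃ h : MemLp (u t) 2 volume,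
    eLpNorm (fun ζ => (besselSymbol s ζ : ℂ) * fourierL2 h ζ) 2 volume ≤ U
  bound_g₁ : ∀ᵐ t ∂volume.restrict (Ioo 0 T), Integrable (g₁ t) ∧ eLpNorm (g₁ t) 1 volume ≤ a₁ t
  bound_g₂ : ∀ᵐ t ∂volume.restrict (Ioo 0 T), MemLp (g₂ t) 2 volume ∧ eLpNorm (g₂ t) 2 volume ≤ a₂ t
  duhamel : ∀ j, BandDuhamel T u (fun τ z => g₁ τ z + g₂ τ z) k θ β (ρ j)

/-- The estimate on one band. -/
theorem exists_band_estimate (θ β s : ℝ) {ν q : ℝ} (hν : 0 < ν) (hν' : ν ≤ 1 / 2) (hq2 : 2 ≤ q)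
    (hq : (1 - ν) * (q / 2) < 1) : ∃ C : ℝ≥0∞, C ≠ ⊤ ∧ ∀ (ρ : ℕ → 𝓢(Plane, ℂ)), TestFamily ρ →
      ∀ (k : ℕ) (δ T : ℝ), 0 < δ → δ ≤ 1 → 0 < T → T < 2 → ∀ (u g₁ g₂ : ℝ → Plane → ℂ) (U : ℝ≥0∞)
        (a₁ a₂ : ℝ → ℝ≥0∞), BandProblem T k θ β s ρ u g₁ g₂ U a₁ a₂ →
      ∫⁻ t in Ioo 0 T, bandMax k (fun p => (bes θ p : ℂ)) ρ (fun _ => u t) 0 0 ^ q ≤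
        C * (dyad k ^ (3 * ν)) ^ q * ((ENNReal.ofReal δ)⁻¹ * (dyad k ^ (θ - s) * U) ^ q +
          (dyad k ^ (β + 1)) ^ q * (∫⁻ t in Ioo 0 T, a₁ t ^ q) +
          ENNReal.ofReal δ ^ (q - 1) * ((dyad k ^ (β + 1)) ^ q * ∫⁻ t in Ioo 0 T, a₂ t ^ q)) := by
  have hq0 : 0 ≤ q := by linarith
  set P : ℝ≥0∞ := 2 ^ (q - 1) with hP
  have hPt : P ≠ ⊤ := ENNReal.rpow_ne_top_of_nonneg (by linarith) (by norm_num)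
  set K : ℝ≥0∞ := strichartzConst q ν with hK
  have hKt : K ≠ ⊤ := strichartzConst_ne_top hq hq2
  set Ku : ℝ≥0∞ := ENNReal.ofReal (besConst (θ - s))
  set Kf : ℝ≥0∞ := ENNReal.ofReal (2 * Real.pi * besConst β)
  set Ks : ℝ≥0∞ := ENNReal.ofReal (80 * (2 * Real.pi * (1 + |β|) * besConst β))
  have hrt : ∀ r : ℝ, ENNReal.ofReal r ^ q ≠ ⊤ := fun r =>
    ENNReal.rpow_ne_top_of_nonneg hq0 ENNReal.ofReal_ne_top
  have hst : singConst (1 - ν) ^ q ≠ ⊤ :=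
    ENNReal.rpow_ne_top_of_nonneg hq0 (singConst_ne_top (by linarith))
  -- One constant each for the free part, the L¹ forcing and the L² forcing. Each splitting of a
  -- q-th power costs P; the 2 in C₁ comes from the window length, and the last P in C₃ from
  -- (2δ)^{q-1}.
  set C₁ : ℝ≥0∞ := P * 2 * (K * Ku ^ q)
  set C₂ : ℝ≥0∞ := P * P * (Ks ^ q * singConst (1 - ν) ^ q)
  set C₃ : ℝ≥0∞ := P * P * (P * (K * Kf ^ q))
  refine ⟨C₁ + C₂ + C₃, ENNReal.add_ne_top.2 ⟨ENNReal.add_ne_top.2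
    ⟨ENNReal.mul_ne_top (ENNReal.mul_ne_top hPt (by norm_num)) (ENNReal.mul_ne_top hKt (hrt _)),
      ENNReal.mul_ne_top (ENNReal.mul_ne_top hPt hPt) (ENNReal.mul_ne_top (hrt _) hst)⟩,
    ENNReal.mul_ne_top (ENNReal.mul_ne_top hPt hPt) (ENNReal.mul_ne_top hPt
      (ENNReal.mul_ne_top hKt (hrt _)))⟩, ?_⟩
  intro ρ hρ k δ T hδ hδ1 hT0 hT u g₁ g₂ U a₁ a₂ h
  have hbc := continuous_ofReal_bes θ
  have hfc := continuous_forceSymbol β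
  set H : ℝ → ℝ≥0∞ := fun t => bandMax k (fun p => (bes θ p : ℂ)) ρ (fun _ => u t) 0 0 with hH
  set a : ℝ → ℝ → ℝ≥0∞ := bandMax k (fun p => (bes θ p : ℂ)) ρ u with ha
  set c : ℝ → ℝ → ℝ≥0∞ := bandMax k (forceSymbol β) ρ g₁ with hc
  set d : ℝ → ℝ → ℝ≥0∞ := bandMax k (forceSymbol β) ρ g₂ with hd
  have ham : Measurable (Function.uncurry a) := measurable_bandMax h.meas_u hbc k ρ
  have hcm : Measurable (Function.uncurry c) := measurable_bandMax h.meas_g₁ hfc k ρ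
  have hdm : Measurable (Function.uncurry d) := measurable_bandMax h.meas_g₂ hfc k ρ
  set F₁ : ℝ → ℝ≥0∞ := fun t => ∫⁻ τ in Ioo 0 T, c t τ with hF₁
  set F₂ : ℝ → ℝ≥0∞ := fun t => ∫⁻ τ in Ioo 0 T ∩ Ioo (t - δ) (t + δ), d t τ with hF₂
  have hF₁m : Measurable F₁ := hcm.lintegral_prod_right'
  have hIa : Measurable (fun t => ∫⁻ τ in Ioo 0 T, a t τ ^ q) :=
    (ham.pow_const q).lintegral_prod_right'
  have hId : Measurable (fun t => ∫⁻ τ in Ioo 0 T, d t τ ^ q) :=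
    (hdm.pow_const q).lintegral_prod_right'
  set W : ℝ≥0∞ := ENNReal.ofReal (δ * T / 2) with hW
  have hW0 : W ≠ 0 := by
    rw [hW, ne_eq, ENNReal.ofReal_eq_zero, not_le]; positivity
  -- pointwise bound by averaging
  have hpt : ∀ᵐ t ∂volume.restrict (Ioo 0 T), H t ^ q ≤ W⁻¹ * (P * ∫⁻ τ in Ioo 0 T, a t τ ^ q) +
      P * (P * (F₁ t ^ q + F₂ t ^ q)) := by
    have hdu := bandMax_le_of_duhamel (δ := δ) h.meas_g₁
      (h.bound_g₁.mono fun t ht => ⟨_, pairable_of_integrable ht.1⟩)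
      (h.bound_g₂.mono fun t ht => ⟨_, pairable_of_memLp ht.1⟩) h.duhamel
    filter_upwards [hdu, ae_restrict_mem measurableSet_Ioo] with t ht htT
    -- The left side does not depend on t₀, so integrating over the window replaces the value at one
    -- t₀ by the average of the free evolution.
    have h1 : ∀ᵐ t₀ ∂volume.restrict (Ioo 0 T ∩ Ioo (t - δ) (t + δ)),
        H t ^ q - P * (F₁ t + F₂ t) ^ q ≤ P * a t t₀ ^ q := by
      filter_upwards [ht] with t₀ h2
      rw [tsub_le_iff_right, ← mul_add]
      exact (ENNReal.rpow_le_rpow h2 hq0).trans (rpow_add_le (by linarith) _ _)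
    have h3 : (H t ^ q - P * (F₁ t + F₂ t) ^ q) * W ≤ P * ∫⁻ τ in Ioo 0 T, a t τ ^ q := by
      calc _ ≤ (H t ^ q - P * (F₁ t + F₂ t) ^ q) * volume (Ioo 0 T ∩ Ioo (t - δ) (t + δ)) := by
            gcongr; exact volume_window_le hδ hδ1 htT hT
        _ = ∫⁻ _ in Ioo 0 T ∩ Ioo (t - δ) (t + δ), (H t ^ q - P * (F₁ t + F₂ t) ^ q) := by
            rw [setLIntegral_const]
        _ ≤ ∫⁻ τ in Ioo 0 T ∩ Ioo (t - δ) (t + δ), P * a t τ ^ q := lintegral_mono_ae h1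
        _ ≤ ∫⁻ τ in Ioo 0 T, P * a t τ ^ q := lintegral_mono_set inter_subset_left
        _ = _ := lintegral_const_mul' _ _ hPt
    calc H t ^ q ≤ (H t ^ q - P * (F₁ t + F₂ t) ^ q) + P * (F₁ t + F₂ t) ^ q := le_tsub_add
      _ ≤ _ := by
        refine add_le_add ?_ ?_
        · rw [mul_comm W⁻¹, ← div_eq_mul_inv]
          exact (ENNReal.le_div_iff_mul_le (Or.inl hW0) (Or.inl ENNReal.ofReal_ne_top)).2 h3
        · gcongr
          exact rpow_add_le (by linarith) _ _
  have hI₁ : ∫⁻ t in Ioo 0 T, ∫⁻ τ in Ioo 0 T, a t τ ^ q ≤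
      K * dyad k ^ (3 * ν * (q / 2)) * ((Ku * dyad k ^ (θ - s) * U) ^ q * ENNReal.ofReal T) := by
    refine (lintegral_bandMax_l2_le hρ k hν.le hν' hq2 hq hT hbc h.meas_u
      (D := fun _ => Ku * dyad k ^ (θ - s) * U) ?_).trans (le_of_eq ?_)
    · filter_upwards [h.bound_u] with t ⟨ht, hU⟩
      exact ⟨ht, (eLpNorm_band_bes_le ht k θ s).trans (by gcongr)⟩
    · rw [setLIntegral_const, Real.volume_Ioo, sub_zero]
  have hI₂ := lintegral_bandMax_l1_le (β := β) hρ k hν hν' hq2 hT h.meas_a₁ (h.bound_g₁.mono fun t ht => ht.2)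
  have hI₃ : ∫⁻ t in Ioo 0 T, F₂ t ^ q ≤ ENNReal.ofReal (2 * δ) ^ (q - 1) *
      (K * dyad k ^ (3 * ν * (q / 2)) * ∫⁻ τ in Ioo 0 T, (Kf * dyad k ^ (β + 1) * a₂ τ) ^ q) := by
    have h1 : ∀ t, F₂ t ^ q ≤ ENNReal.ofReal (2 * δ) ^ (q - 1) * ∫⁻ τ in Ioo 0 T, d t τ ^ q := by
      intro t
      have h2 := rpow_lintegral_mul_le (μ := volume.restrict (Ioo 0 T ∩ Ioo (t - δ) (t + δ))) (q := q)
        (by linarith) (w := fun _ => 1) (f := d t) aemeasurable_const hdm.of_uncurry_left.aemeasurable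
      simp only [one_mul, lintegral_one, Measure.restrict_apply_univ] at h2
      refine h2.trans (mul_le_mul' (ENNReal.rpow_le_rpow (volume_window_le' t δ T) (by linarith))
        (lintegral_mono_set inter_subset_left))
    refine (lintegral_mono h1).trans ?_
    rw [lintegral_const_mul _ hId]
    gcongr
    refine lintegral_bandMax_l2_le hρ k hν.le hν' hq2 hq hT hfc h.meas_g₂ ?_
    filter_upwards [h.bound_g₂] with t ⟨ht, hU⟩
    exact ⟨ht, (eLpNorm_band_force_le ht k β).trans (by gcongr)⟩
  set X : ℝ≥0∞ := (dyad k ^ (3 * ν)) ^ q with hX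
  -- TT* loses only half of the power that the L¹ part loses; enlarging it gives all terms the same
  -- prefactor.
  have hXle : dyad k ^ (3 * ν * (q / 2)) ≤ X := by
    rw [hX, ← ENNReal.rpow_mul]
    exact ENNReal.rpow_le_rpow_of_exponent_le (one_le_dyad k) (by nlinarith)
  have hWT : W⁻¹ * ENNReal.ofReal T = 2 * (ENNReal.ofReal δ)⁻¹ := by
    rw [hW, ← ENNReal.ofReal_inv_of_pos (by positivity), ← ENNReal.ofReal_mul (by positivity),
      ← ENNReal.ofReal_inv_of_pos hδ, show (2 : ℝ≥0∞) = ENNReal.ofReal 2 by simp,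
      ← ENNReal.ofReal_mul (by norm_num)]
    congr 1
    field_simp
  have hδ2 : ENNReal.ofReal (2 * δ) ^ (q - 1) = P * ENNReal.ofReal δ ^ (q - 1) := by
    rw [ENNReal.ofReal_mul (by norm_num), ENNReal.mul_rpow_of_nonneg _ _ (by linarith), hP]; simp
  have hf₃ : ∫⁻ τ in Ioo 0 T, (Kf * dyad k ^ (β + 1) * a₂ τ) ^ q =
      Kf ^ q * ((dyad k ^ (β + 1)) ^ q * ∫⁻ τ in Ioo 0 T, a₂ τ ^ q) := by
    simp only [ENNReal.mul_rpow_of_nonneg _ _ hq0]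
    rw [lintegral_const_mul _ (h.meas_a₂.pow_const q), mul_assoc]
  calc ∫⁻ t in Ioo 0 T, H t ^ q
      ≤ ∫⁻ t in Ioo 0 T, (W⁻¹ * (P * ∫⁻ τ in Ioo 0 T, a t τ ^ q) + P * (P * (F₁ t ^ q + F₂ t ^ q))) :=
        lintegral_mono_ae hpt
    _ = W⁻¹ * (P * ∫⁻ t in Ioo 0 T, ∫⁻ τ in Ioo 0 T, a t τ ^ q) +
        P * (P * ((∫⁻ t in Ioo 0 T, F₁ t ^ q) + ∫⁻ t in Ioo 0 T, F₂ t ^ q)) := by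
        rw [lintegral_add_left ((hIa.const_mul P).const_mul _), lintegral_const_mul _ (hIa.const_mul P),
          lintegral_const_mul _ hIa, lintegral_const_mul' _ _ hPt, lintegral_const_mul' _ _ hPt,
          lintegral_add_left (hF₁m.pow_const q)]
    _ ≤ W⁻¹ * (P * (K * X * ((Ku * dyad k ^ (θ - s) * U) ^ q * ENNReal.ofReal T))) +
        P * (P * ((Ks * dyad k ^ (β + 1) * dyad k ^ (3 * ν)) ^ q *
          (singConst (1 - ν) ^ q * ∫⁻ τ in Ioo 0 T, a₁ τ ^ q) +
          ENNReal.ofReal (2 * δ) ^ (q - 1) *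
          (K * X * ∫⁻ τ in Ioo 0 T, (Kf * dyad k ^ (β + 1) * a₂ τ) ^ q))) := by
        refine add_le_add (mul_le_mul_right (mul_le_mul_right (hI₁.trans ?_) _) _)
          (mul_le_mul_right (mul_le_mul_right (add_le_add hI₂ (hI₃.trans ?_)) _) _)
        · gcongr
        · gcongr
    _ = C₁ * X * ((ENNReal.ofReal δ)⁻¹ * (dyad k ^ (θ - s) * U) ^ q) +
        C₂ * X * ((dyad k ^ (β + 1)) ^ q * ∫⁻ t in Ioo 0 T, a₁ t ^ q) +
        C₃ * X * (ENNReal.ofReal δ ^ (q - 1) * ((dyad k ^ (β + 1)) ^ q * ∫⁻ t in Ioo 0 T, a₂ t ^ q)) := by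
        have e1 : W⁻¹ * (P * (K * X * ((Ku * dyad k ^ (θ - s) * U) ^ q * ENNReal.ofReal T))) =
            (W⁻¹ * ENNReal.ofReal T) * (P * (K * X * (Ku ^ q * (dyad k ^ (θ - s) * U) ^ q))) := by
          rw [mul_assoc Ku, ENNReal.mul_rpow_of_nonneg Ku _ hq0]; ring
        rw [e1, hWT, hδ2, hf₃, ENNReal.mul_rpow_of_nonneg (Ks * dyad k ^ (β + 1)) _ hq0,
          ENNReal.mul_rpow_of_nonneg Ks _ hq0, ← hX]
        simp only [C₁, C₂, C₃]
        ring
    _ ≤ _ := by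
        have l1 : C₁ ≤ C₁ + C₂ + C₃ := le_self_add.trans le_self_add
        have l2 : C₂ ≤ C₁ + C₂ + C₃ := le_add_self.trans le_self_add
        have l3 : C₃ ≤ C₁ + C₂ + C₃ := le_add_self
        rw [mul_add, mul_add]
        gcongr

/-! ### Bump functions and reconstruction of functions from pairings -/

/-- Bump functions shrinking to the origin. -/
noncomputable def shrinkBump (n : ℕ) : ContDiffBump (0 : Plane) where
  rIn := 1 / ((n : ℝ) + 1)
  rOut := 2 / ((n : ℝ) + 1)
  rIn_pos := by positivity
  rIn_lt_rOut := by gcongr; norm_num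

/-- The normalised bump of index `n` around `c`. -/
noncomputable def bumpFun (n : ℕ) (c z : Plane) : ℝ := (shrinkBump n).normed volume (c - z)

theorem continuous_bumpFun (n : ℕ) : Continuous (fun p : Plane × Plane => bumpFun n p.1 p.2) :=
  (shrinkBump n).continuous_normed.comp (continuous_fst.sub continuous_snd)

theorem hasCompactSupport_bumpFun (n : ℕ) (c : Plane) : HasCompactSupport (bumpFun n c) :=
  (shrinkBump n).hasCompactSupport_normed.comp_homeomorph (Homeomorph.subLeft c)

theorem contDiff_bumpFun (n : ℕ) (c : Plane) : ContDiff ℝ ∞ (bumpFun n c) :=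
  (shrinkBump n).contDiff_normed.comp (contDiff_const.sub contDiff_id)

theorem integral_norm_bumpFun (n : ℕ) (c : Plane) : ∫ z, ‖(bumpFun n c z : ℂ)‖ = 1 := by
  have h : ∀ z, ‖(bumpFun n c z : ℂ)‖ = (shrinkBump n).normed volume (c - z) := fun z => by
    rw [Complex.norm_real, Real.norm_of_nonneg]
    · rfl
    · exact (shrinkBump n).nonneg_normed _
  simp only [h]
  rw [integral_sub_left_eq_self (fun z => (shrinkBump n).normed volume z) volume c]
  exact (shrinkBump n).integral_normed

/-- The normalised bump as a Schwartz function. -/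
noncomputable def bumpS (n : ℕ) (c : Plane) : 𝓢(Plane, ℂ) :=
  HasCompactSupport.toSchwartzMap (f := fun z => (bumpFun n c z : ℂ))
    ((hasCompactSupport_bumpFun n c).comp_left (g := fun r : ℝ => (r : ℂ)) rfl)
    (Complex.ofRealCLM.contDiff.comp (contDiff_bumpFun n c))

theorem bumpS_apply (n : ℕ) (c z : Plane) : bumpS n c z = (bumpFun n c z : ℂ) := rfl

/-- The countable family of bumps with centres in a dense sequence. -/
noncomputable def bumpFamily (j : ℕ) : 𝓢(Plane, ℂ) :=
  bumpS j.unpair.1 (TopologicalSpace.denseSeq Plane j.unpair.2)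

theorem testFamily_bumpFamily : TestFamily bumpFamily where
  real := fun j z => by rw [bumpFamily, bumpS_apply, Complex.conj_ofReal]
  norm_le := fun j => by
    simp only [bumpFamily, bumpS_apply]
    exact (integral_norm_bumpFun _ _).le

theorem integral_mul_bumpS (v : Plane → ℂ) (n : ℕ) (c : Plane) :
    ∫ z, v z * bumpS n c z =
      MeasureTheory.convolution ((shrinkBump n).normed volume) v (ContinuousLinearMap.lsmul ℝ ℝ) volume c := by
  rw [MeasureTheory.convolution_lsmul_swap]
  refine integral_congr_ae (ae_of_all _ fun z => ?_)
  simp only [bumpS_apply, bumpFun, Complex.real_smul, mul_comm]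

theorem tendsto_integral_mul_bumpS {v : Plane → ℂ} (hv : LocallyIntegrable v volume) :
    ∀ᵐ c, Filter.Tendsto (fun n => ∫ z, v z * bumpS n c z) Filter.atTop (nhds (v c)) := by
  simp only [integral_mul_bumpS]
  refine ContDiffBump.ae_convolution_tendsto_right_of_locallyIntegrable (K := 2) ?_ ?_ hv
  · have := tendsto_one_div_add_atTop_nhds_zero_nat (𝕜 := ℝ)
    have h2 := this.const_mul 2
    simpa [shrinkBump, div_eq_mul_inv] using h2
  · exact Filter.Eventually.of_forall fun n => by simp [shrinkBump, div_eq_mul_inv]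

theorem continuous_integral_mul_bumpS {v : Plane → ℂ} (hv : LocallyIntegrable v volume) (n : ℕ) :
    Continuous (fun c => ∫ z, v z * bumpS n c z) := by
  simp only [integral_mul_bumpS]
  exact HasCompactSupport.continuous_convolution_left _ (shrinkBump n).hasCompactSupport_normed
    (shrinkBump n).continuous_normed hv

/-- Pairings with bumps are mollifications: continuous in the centre, so a dense sequence of centres
suffices, and convergent almost everywhere to v as the bumps shrink. -/
theorem eLpNorm_top_le_of_bump {v : Plane → ℂ} (hv : LocallyIntegrable v volume) {M : ℝ≥0∞}
    (h : ∀ j, ‖∫ z, v z * bumpFamily j z‖ₑ ≤ M) : eLpNorm v ⊤ volume ≤ M := by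
  have h1 : ∀ n c, ‖∫ z, v z * bumpS n c z‖ₑ ≤ M := by
    intro n c
    have hcl : IsClosed {c | ‖∫ z, v z * bumpS n c z‖ₑ ≤ M} :=
      isClosed_le (continuous_integral_mul_bumpS hv n).enorm continuous_const
    have hd := TopologicalSpace.denseRange_denseSeq Plane
    refine hd.induction_on (p := fun c => ‖∫ z, v z * bumpS n c z‖ₑ ≤ M) c hcl fun i => ?_
    have := h (Nat.pair n i)
    simpa only [bumpFamily, Nat.unpair_pair] using this
  rw [eLpNorm_exponent_top]
  refine essSup_le_of_ae_le _ ?_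
  filter_upwards [tendsto_integral_mul_bumpS hv] with c hc
  exact le_of_tendsto hc.enorm (Filter.Eventually.of_forall fun n => h1 n c)

theorem locallyIntegrable_of_memLp {v : Plane → ℂ} (hv : MemLp v 2 volume) : LocallyIntegrable v volume :=
  hv.locallyIntegrable (by norm_num)

theorem pair_fourierInv (v : Plane → ℂ) (Ψ : 𝓢(Plane, ℂ)) :
    pair v (𝓕⁻ (Ψ : Plane → ℂ)) = ∫ z, v z * Ψ z := by
  rw [pair, ← SchwartzMap.fourierInv_coe, ← SchwartzMap.fourier_coe, fourier_fourierInv_eq]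

/-! ### Fourier multipliers in the first variable on square integrable functions. -/

/-- Symbols of polynomial growth. -/
structure GoodSymbol (m : ℝ → ℂ) : Prop where
  meas : Measurable m
  growth : ∃ a C : ℝ, ∀ p, ‖m p‖ ≤ C * bes a p

theorem GoodSymbol.mem12 {m : ℝ → ℂ} (hm : GoodSymbol m) (χ : 𝓢(Plane, ℂ)) :
    Mem12 (fun ζ => m (ζ 0) * χ ζ) := by
  obtain ⟨a, C, h⟩ := hm.growth
  refine (mem12_schwartz (besselMul a χ)).mono (c := C)
    ((hm.meas.comp (measurable_coord 0)).aestronglyMeasurable.mul χ.continuous.aestronglyMeasurable)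
    (ae_of_all _ fun ζ => ?_)
  rw [besselMul_apply, norm_mul, norm_mul, Complex.norm_real, besselSymbol_eq,
    Real.norm_of_nonneg (bes_pos _ _).le, ← mul_assoc]
  exact mul_le_mul_of_nonneg_right (h _) (norm_nonneg _)

theorem GoodSymbol.mem12_fourierInv {m : ℝ → ℂ} (hm : GoodSymbol m) (Ψ : 𝓢(Plane, ℂ)) :
    Mem12 (fun ζ => m (ζ 0) * 𝓕⁻ (Ψ : Plane → ℂ) ζ) := by
  rw [← SchwartzMap.fourierInv_coe]; exact hm.mem12 _

theorem stronglyMeasurable_pair_bump {u : ℝ → Plane → ℂ} (hu : StronglyMeasurable (Function.uncurry u))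
    {m : ℝ → ℂ} (hm : Measurable m) (n : ℕ) :
    StronglyMeasurable (fun p : ℝ × Plane => pair (u p.1)
      (fun ζ => m (ζ 0) * 𝓕⁻ (bumpS n p.2 : Plane → ℂ) ζ)) := by
  have h1 : StronglyMeasurable (fun q : Plane × Plane => 𝓕⁻ (bumpS n q.1 : Plane → ℂ) q.2) := by
    simp only [Real.fourierInv_eq', bumpS_apply, smul_eq_mul]
    have h := continuous_bumpFun n
    refine StronglyMeasurable.integral_prod_right' (f := fun r : (Plane × Plane) × Plane =>
      Complex.exp (((2 * Real.pi * inner ℝ r.2 r.1.2 : ℝ) : ℂ) * Complex.I) * (bumpFun n r.1.1 r.2 : ℂ)) ?_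
    have h' : Continuous (fun r : (Plane × Plane) × Plane => bumpFun n r.1.1 r.2) :=
      h.comp (g := fun p : Plane × Plane => bumpFun n p.1 p.2)
        (f := fun r : (Plane × Plane) × Plane => (r.1.1, r.2)) (by fun_prop)
    exact Continuous.stronglyMeasurable (by fun_prop)
  have h2 : StronglyMeasurable (fun q : Plane × Plane =>
      𝓕 (fun ζ => m (ζ 0) * 𝓕⁻ (bumpS n q.1 : Plane → ℂ) ζ) q.2) := by
    simp only [Real.fourier_eq', smul_eq_mul]
    refine StronglyMeasurable.integral_prod_right' (f := fun r : (Plane × Plane) × Plane =>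
      Complex.exp (((-2 * Real.pi * inner ℝ r.2 r.1.2 : ℝ) : ℂ) * Complex.I) *
        (m (r.2 0) * 𝓕⁻ (bumpS n r.1.1 : Plane → ℂ) r.2)) ?_
    refine StronglyMeasurable.mul (Continuous.stronglyMeasurable (by fun_prop)) (StronglyMeasurable.mul
      ((hm.comp (measurable_coord 0)).comp measurable_snd).stronglyMeasurable ?_)
    exact h1.comp_measurable (g := fun r : (Plane × Plane) × Plane => (r.1.1, r.2)) (by fun_prop)
  refine StronglyMeasurable.integral_prod_right' (f := fun r : (ℝ × Plane) × Plane =>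
    u r.1.1 r.2 * 𝓕 (fun ζ => m (ζ 0) * 𝓕⁻ (bumpS n r.1.2 : Plane → ℂ) ζ) r.2) ?_
  exact (hu.comp_measurable (g := fun r : (ℝ × Plane) × Plane => (r.1.1, r.2)) (by fun_prop)).mul
    (h2.comp_measurable (g := fun r : (ℝ × Plane) × Plane => (r.1.2, r.2)) (by fun_prop))

theorem fourierL2_congr {v w : Plane → ℂ} (hv : MemLp v 2 volume) (hw : MemLp w 2 volume)
    (h : v =ᵐ[volume] w) : fourierL2 hv = fourierL2 hw := by
  rw [fourierL2, fourierL2, MemLp.toLp_eq_toLp_iff hv hw |>.2 h]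

/-- `V = m(D_x) u` in `L²`. -/
def IsMultiplier (m : ℝ → ℂ) (u V : Plane → ℂ) : Prop :=
  ∃ (h : MemLp u 2 volume) (hV : MemLp V 2 volume), fourierL2 hV =ᵐ[volume] fun ζ => m (ζ 0) * fourierL2 h ζ

/-- Fourier multipliers of jointly measurable functions are jointly measurable. -/
theorem exists_multiplier {u : ℝ → Plane → ℂ} (hu : StronglyMeasurable (Function.uncurry u))
    {m : ℝ → ℂ} (hm : GoodSymbol m) : ∃ V : ℝ → Plane → ℂ, StronglyMeasurable (Function.uncurry V) ∧
      ∀ t (h : MemLp (u t) 2 volume), MemLp (fun ζ => m (ζ 0) * fourierL2 h ζ) 2 volume →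
        IsMultiplier m (u t) (V t) := by
  -- Joint measurability is built in: V is the limit of mollified pairings that are jointly
  -- measurable in time and space. For fixed t this limit agrees almost everywhere with the L²
  -- function whose transform is m times that of u(t).
  refine ⟨fun t z => Filter.limUnder Filter.atTop (fun n => pair (u t)
    (fun ζ => m (ζ 0) * 𝓕⁻ (bumpS n z : Plane → ℂ) ζ)),
    StronglyMeasurable.limUnder fun n => stronglyMeasurable_pair_bump hu hm.meas n, fun t h hG => ?_⟩
  set v₀ : Lp ℂ 2 (volume : Measure Plane) := 𝓕⁻ (hG.toLp _) with hv₀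
  have hv : MemLp v₀ 2 volume := Lp.memLp v₀
  have hF : fourierL2 hv =ᵐ[volume] fun ζ => m (ζ 0) * fourierL2 h ζ := by
    rw [fourierL2, Lp.toLp_coeFn, hv₀, fourier_fourierInv_eq]
    exact hG.coeFn_toLp
  have hlim : (fun z => Filter.limUnder Filter.atTop (fun n => pair (u t)
      (fun ζ => m (ζ 0) * 𝓕⁻ (bumpS n z : Plane → ℂ) ζ))) =ᵐ[volume] v₀ := by
    filter_upwards [tendsto_integral_mul_bumpS (locallyIntegrable_of_memLp hv)] with z hz
    refine Filter.Tendsto.limUnder_eq (hz.congr fun n => ?_)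
    rw [← pair_fourierInv, pair_eq_fourierL2 hv (mem12_fourierInv _),
      pair_eq_fourierL2 h (hm.mem12_fourierInv _)]
    refine integral_congr_ae ?_
    filter_upwards [hF] with ζ hζ
    rw [hζ]; ring
  have hV := (memLp_congr_ae hlim).2 hv
  exact ⟨h, hV, by rw [fourierL2_congr hV hv hlim]; exact hF⟩

theorem IsMultiplier.pair_eq {m : ℝ → ℂ} {u V : Plane → ℂ} (h : IsMultiplier m u V) {χ : Plane → ℂ}
    (hχ : Mem12 χ) (hmχ : Mem12 (fun ζ => m (ζ 0) * χ ζ)) :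
    pair V χ = pair u (fun ζ => m (ζ 0) * χ ζ) := by
  obtain ⟨hu, hV, he⟩ := h
  rw [pair_eq_fourierL2 hV hχ, pair_eq_fourierL2 hu hmχ]
  refine integral_congr_ae ?_
  filter_upwards [he] with ζ hζ
  rw [hζ]; ring

theorem goodSymbol_bes (θ : ℝ) : GoodSymbol (fun p => (bes θ p : ℂ)) where
  meas := (continuous_ofReal_bes θ).measurable
  growth := ⟨θ, 1, fun p => by rw [Complex.norm_real, Real.norm_of_nonneg (bes_pos _ _).le, one_mul]⟩

theorem GoodSymbol.indicator {m : ℝ → ℂ} (hm : GoodSymbol m) {B : Set ℝ} (hB : MeasurableSet B) :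
    GoodSymbol (B.indicator m) where
  meas := hm.meas.indicator hB
  growth := by
    obtain ⟨a, C, h⟩ := hm.growth
    refine ⟨a, C, fun p => (norm_indicator_le_norm_self _ _).trans (h p)⟩

theorem IsMultiplier.represents {θ : ℝ} {u V : Plane → ℂ} (h : IsMultiplier (fun p => (bes θ p : ℂ)) u V) :
    ∃ S : 𝓢'(Plane, ℂ), Represents S u ∧ Represents (Jx θ S) V := by
  obtain ⟨hu, hV, he⟩ := id h
  have hInt : ∀ {v : Plane → ℂ}, MemLp v 2 volume → ∀ φ : 𝓢(Plane, ℂ), Integrable (fun z => v z * φ z) :=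
    fun hv φ => hv.integrable_mul (φ.memLp 2)
  have hS : Represents (Lp.toTemperedDistribution (hu.toLp u)) u := by
    refine fun φ => ⟨hInt hu φ, ?_⟩
    rw [Lp.toTemperedDistribution_apply]
    refine integral_congr_ae ?_
    filter_upwards [hu.coeFn_toLp] with z hz
    rw [hz, smul_eq_mul, mul_comm]
  refine ⟨_, hS, fun φ => ⟨hInt hV φ, ?_⟩⟩
  obtain ⟨χ, rfl⟩ : ∃ χ : 𝓢(Plane, ℂ), φ = 𝓕 χ := ⟨𝓕⁻ φ, by rw [fourier_fourierInv_eq]⟩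
  rw [Jx_apply_fourier, hS.fourier_eq_pair]
  have := h.pair_eq (mem12_schwartz χ) ((goodSymbol_bes θ).mem12 χ)
  have e : ((besselMul θ χ : 𝓢(Plane, ℂ)) : Plane → ℂ) = fun ζ => (bes θ (ζ 0) : ℂ) * χ ζ := by
    funext ζ; rw [besselMul_apply, besselSymbol_eq]
  rw [e, ← this, pair]
  rfl

/-! ### Dyadic decomposition -/

theorem fourierL2_add {v w : Plane → ℂ} (hv : MemLp v 2 volume) (hw : MemLp w 2 volume)
    (h : MemLp (fun z => v z + w z) 2 volume) :
    fourierL2 h =ᵐ[volume] fun ζ => fourierL2 hv ζ + fourierL2 hw ζ := by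
  have e : h.toLp _ = hv.toLp v + hw.toLp w := rfl
  rw [fourierL2, e, FourierAdd.fourier_add]
  exact Lp.coeFn_add _ _

theorem fourierL2_sub {v w : Plane → ℂ} (hv : MemLp v 2 volume) (hw : MemLp w 2 volume)
    (h : MemLp (fun z => v z - w z) 2 volume) :
    fourierL2 h =ᵐ[volume] fun ζ => fourierL2 hv ζ - fourierL2 hw ζ := by
  have e : (hv.toLp v : Lp ℂ 2 (volume : Measure Plane)) = h.toLp _ + hw.toLp w := by
    rw [← sub_eq_iff_eq_add]; rfl
  have e2 : (𝓕 (h.toLp _) : Lp ℂ 2 (volume : Measure Plane)) = 𝓕 (hv.toLp v) - 𝓕 (hw.toLp w) := by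
    rw [e, FourierAdd.fourier_add, add_sub_cancel_right]
  rw [fourierL2, e2]
  exact Lp.coeFn_sub _ _

theorem IsMultiplier.add {m m' : ℝ → ℂ} {u V V' : Plane → ℂ} (h : IsMultiplier m u V)
    (h' : IsMultiplier m' u V') : IsMultiplier (fun p => m p + m' p) u (fun z => V z + V' z) := by
  obtain ⟨hu, hV, he⟩ := h
  obtain ⟨_, hV', he'⟩ := h'
  refine ⟨hu, hV.add hV', ?_⟩
  filter_upwards [fourierL2_add hV hV' (hV.add hV'), he, he'] with ζ h1 h2 h3
  rw [add_mul, ← h2, ← h3]; exact h1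

theorem IsMultiplier.sub {m m' : ℝ → ℂ} {u V V' : Plane → ℂ} (h : IsMultiplier m u V)
    (h' : IsMultiplier m' u V') : IsMultiplier (fun p => m p - m' p) u (fun z => V z - V' z) := by
  obtain ⟨hu, hV, he⟩ := h
  obtain ⟨_, hV', he'⟩ := h'
  refine ⟨hu, hV.sub hV', ?_⟩
  filter_upwards [fourierL2_sub hV hV' (hV.sub hV'), he, he'] with ζ h1 h2 h3
  rw [sub_mul, ← h2, ← h3]; exact h1

theorem isMultiplier_one {u : Plane → ℂ} (h : MemLp u 2 volume) : IsMultiplier (fun _ => 1) u u :=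
  ⟨h, h, ae_of_all _ fun ζ => by simp⟩

/-- The Sobolev norm as a condition on a given function. -/
def SobolevLE (s : ℝ) (u : Plane → ℂ) (U : ℝ≥0∞) : Prop :=
  ∃ h : MemLp u 2 volume, eLpNorm (fun ζ => (besselSymbol s ζ : ℂ) * fourierL2 h ζ) 2 volume ≤ U

theorem IsMultiplier.eLpNorm_two_le {m : ℝ → ℂ} {u V : Plane → ℂ} (h : IsMultiplier m u V) {s K : ℝ}
    {U : ℝ≥0∞} (hU : SobolevLE s u U) (hm : ∀ p, ‖m p‖ ≤ K * bes s p) :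
    eLpNorm V 2 volume ≤ ENNReal.ofReal K * U := by
  obtain ⟨hu, hV, he⟩ := h
  obtain ⟨_, hU⟩ := hU
  rw [← eLpNorm_fourierL2 hV, eLpNorm_congr_ae he]
  refine (eLpNorm_le_mul_eLpNorm_of_ae_le_mul (ae_of_all _ fun ζ => ?_) 2).trans (mul_le_mul_right hU _)
  rw [norm_mul, norm_mul, ← mul_assoc, Complex.norm_real, besselSymbol_eq,
    Real.norm_of_nonneg (bes_pos _ _).le]
  exact mul_le_mul_of_nonneg_right (hm _) (norm_nonneg _)

theorem memLp_symbol_mul {m : ℝ → ℂ} (hmm : Measurable m) {u : Plane → ℂ} {s K : ℝ} {U : ℝ≥0∞}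
    (hU : SobolevLE s u U) (hUt : U ≠ ⊤) (hm : ∀ p, ‖m p‖ ≤ K * bes s p) (h : MemLp u 2 volume) :
    MemLp (fun ζ => m (ζ 0) * fourierL2 h ζ) 2 volume := by
  obtain ⟨_, hU⟩ := hU
  refine ⟨(hmm.comp (measurable_coord 0)).aestronglyMeasurable.mul (memLp_fourierL2 h).1, ?_⟩
  refine lt_of_le_of_lt ((eLpNorm_le_mul_eLpNorm_of_ae_le_mul (c := K) (ae_of_all _ fun ζ => ?_) 2).trans
    (mul_le_mul_right hU _)) (ENNReal.mul_lt_top ENNReal.ofReal_lt_top hUt.lt_top)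
  rw [norm_mul, norm_mul, ← mul_assoc, Complex.norm_real, besselSymbol_eq,
    Real.norm_of_nonneg (bes_pos _ _).le]
  exact mul_le_mul_of_nonneg_right (hm _) (norm_nonneg _)

/-- Frequencies below `2^N`. -/
def lowSet (N : ℕ) : Set ℝ := {p | |p| < 2 ^ N}

theorem lowSet_zero : lowSet 0 = band 0 := by simp [lowSet, band]

theorem lowSet_succ (N : ℕ) : lowSet (N + 1) = lowSet N ∪ band (N + 1) := by
  ext p
  have h : (2 : ℝ) ^ N ≤ 2 ^ (N + 1) := pow_le_pow_right₀ (by norm_num) (by omega)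
  constructor
  · intro (hp : |p| < 2 ^ (N + 1))
    rcases lt_or_ge |p| (2 ^ N) with h' | h'
    · exact Or.inl h'
    · exact Or.inr ⟨h', hp⟩
  · rintro (hp | hp)
    · exact lt_of_lt_of_le hp h
    · exact hp.2

theorem disjoint_lowSet_band (N : ℕ) : Disjoint (lowSet N) (band (N + 1)) :=
  disjoint_left.2 fun _ h1 h2 => absurd h2.1 (not_le.2 h1)

theorem band_subset_lowSet (k : ℕ) : band k ⊆ lowSet k := fun _ hp => abs_lt_of_mem_band hp

theorem lowSet_mono : Monotone lowSet := fun _ _ h p (hp : |p| < _) =>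
  show |p| < _ from lt_of_lt_of_le hp (pow_le_pow_right₀ one_le_two h)

theorem disjoint_band : Pairwise (Function.onFun Disjoint band) := by
  have key : ∀ i j, i < j → Disjoint (band i) (band j) := by
    intro i j h
    obtain ⟨N, rfl⟩ := Nat.exists_eq_succ_of_ne_zero (Nat.ne_of_gt (Nat.zero_lt_of_lt h))
    exact (disjoint_lowSet_band N).mono_left
      ((band_subset_lowSet i).trans (lowSet_mono (Nat.lt_succ_iff.1 h)))
  intro i j h
  rcases lt_or_gt_of_ne h with h | h
  · exact key i j h
  · exact (key j i h).symm

theorem lowSet_subset_iUnion (N : ℕ) : lowSet N ⊆ ⋃ k, band k := by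
  induction N with
  | zero => rw [lowSet_zero]; exact subset_iUnion _ 0
  | succ N ih => rw [lowSet_succ]; exact union_subset ih (subset_iUnion _ _)

theorem iUnion_band : ⋃ k, band k = univ := by
  refine eq_univ_of_forall fun p => ?_
  obtain ⟨N, hN⟩ := pow_unbounded_of_one_lt |p| (one_lt_two (α := ℝ))
  exact lowSet_subset_iUnion N hN

theorem bes_neg_le_of_notMem {σ p : ℝ} (hσ : 0 ≤ σ) {N : ℕ} (hp : p ∉ lowSet N) :
    bes (-σ) p ≤ (2 ^ N : ℝ) ^ (-σ) := by
  have h1 : (2 : ℝ) ^ N ≤ |p| := not_lt.1 hp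
  have h0 : (0 : ℝ) < 2 ^ N := by positivity
  have h2 : (2 ^ N : ℝ) ^ (-σ) = ((2 ^ N : ℝ) ^ 2) ^ (-σ / 2) := by
    rw [← Real.rpow_natCast (2 ^ N : ℝ) 2, ← Real.rpow_mul h0.le]; congr 1; push_cast; ring
  rw [h2, bes]
  refine Real.rpow_le_rpow_of_nonpos (by positivity) ?_ (by linarith)
  have h3 : (2 ^ N : ℝ) ^ 2 ≤ p ^ 2 := by rw [← sq_abs p]; gcongr
  have h4 : 1 ≤ (2 * Real.pi) ^ 2 := by
    have := Real.pi_gt_three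
    nlinarith
  rw [mul_pow]
  nlinarith [sq_nonneg p]

theorem bes_neg_le_one {σ : ℝ} (hσ : 0 ≤ σ) (p : ℝ) : bes (-σ) p ≤ 1 :=
  Real.rpow_le_one_of_one_le_of_nonpos (by nlinarith [sq_nonneg (2 * Real.pi * p)]) (by linarith)

theorem bes_le_bes {θ s : ℝ} (h : θ ≤ s) (p : ℝ) : bes θ p ≤ 1 * bes s p := by
  have e : bes θ p = bes (-(s - θ)) p * bes s p := by rw [← bes_add]; congr 1; ring
  rw [e]
  exact mul_le_mul_of_nonneg_right (bes_neg_le_one (by linarith) p) (bes_pos _ _).le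

theorem norm_indicator_bes_le {θ s : ℝ} (h : θ ≤ s) (B : Set ℝ) (p : ℝ) :
    ‖B.indicator (fun p => (bes θ p : ℂ)) p‖ ≤ 1 * bes s p := by
  refine (norm_indicator_le_norm_self _ _).trans ?_
  rw [Complex.norm_real, Real.norm_of_nonneg (bes_pos _ _).le]
  exact bes_le_bes h p

theorem norm_compl_low_bes_le {θ s : ℝ} (h : θ ≤ s) (N : ℕ) (p : ℝ) :
    ‖(bes θ p : ℂ) - (lowSet N).indicator (fun p => (bes θ p : ℂ)) p‖ ≤ (2 ^ N : ℝ) ^ (θ - s) * bes s p := by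
  by_cases hp : p ∈ lowSet N
  · rw [indicator_of_mem hp, sub_self, norm_zero]
    exact mul_nonneg (by positivity) (bes_pos _ _).le
  · rw [indicator_of_notMem hp, sub_zero, Complex.norm_real, Real.norm_of_nonneg (bes_pos _ _).le]
    have e : bes θ p = bes (-(s - θ)) p * bes s p := by rw [← bes_add]; congr 1; ring
    rw [e]
    have := bes_neg_le_of_notMem (σ := s - θ) (by linarith) hp
    rw [neg_sub] at this ⊢
    exact mul_le_mul_of_nonneg_right this (bes_pos _ _).le

/-- Against each bump, V is an absolutely convergent integral on the Fourier side, which splits over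
the disjoint bands. No convergence of the dyadic series in the sup norm is needed. -/
theorem eLpNorm_top_multiplier_le {θ : ℝ} {u V : Plane → ℂ}
    (h : IsMultiplier (fun p => (bes θ p : ℂ)) u V) :
    eLpNorm V ⊤ volume ≤ ∑' k, bandMax k (fun p => (bes θ p : ℂ)) bumpFamily (fun _ => u) 0 0 := by
  obtain ⟨hu, hV, he⟩ := h
  refine eLpNorm_top_le_of_bump (locallyIntegrable_of_memLp hV) fun j => ?_
  set F : Plane → ℂ := fun ζ => fourierL2 hV ζ * 𝓕⁻ (bumpFamily j : Plane → ℂ) ζ with hF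
  have hFi : Integrable F := (memLp_fourierL2 hV).integrable_mul (mem12_fourierInv (bumpFamily j)).l2
  set B : ℕ → Set Plane := fun k => {ζ | ζ 0 ∈ band k} with hB
  have hBm : ∀ k, MeasurableSet (B k) := fun k => measurable_coord 0 (measurableSet_band k)
  have hBd : Pairwise (Function.onFun Disjoint B) := fun i j hij =>
    disjoint_left.2 fun ζ h1 h2 => disjoint_left.1 (disjoint_band hij) h1 h2
  have hBu : ⋃ k, B k = univ := by
    refine eq_univ_of_forall fun ζ => ?_
    have : ζ 0 ∈ ⋃ k, band k := by rw [iUnion_band]; trivial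
    obtain ⟨k, hk⟩ := mem_iUnion.1 this
    exact mem_iUnion.2 ⟨k, hk⟩
  have hs := hasSum_integral_iUnion hBm hBd (hFi.integrableOn (s := ⋃ k, B k))
  rw [hBu, setIntegral_univ] at hs
  have e1 : ∫ z, V z * bumpFamily j z = ∫ ζ, F ζ := by
    rw [← pair_fourierInv, pair_eq_fourierL2 hV (mem12_fourierInv _)]
  have e2 : ∀ k, ∫ ζ in B k, F ζ = pair u (bandTest k (fun p => (bes θ p : ℂ)) (0 - 0) (bumpFamily j)) := by
    intro k
    rw [pair_eq_fourierL2 hu (mem12_bandTest (continuous_ofReal_bes θ) k _ _), ← integral_indicator (hBm k)]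
    refine integral_congr_ae ?_
    filter_upwards [he] with ζ hζ
    by_cases hb : ζ 0 ∈ band k
    · rw [indicator_of_mem (show ζ ∈ B k from hb), bandTest, indicator_of_mem hb, sub_zero, prop_zero]
      simp only [hF, hζ]; ring
    · rw [indicator_of_notMem (show ζ ∉ B k from hb), bandTest, indicator_of_notMem hb]; ring
  rw [e1, ← hs.tsum_eq]
  refine enorm_tsum_le_tsum_enorm.trans (ENNReal.tsum_le_tsum fun k => ?_)
  rw [e2]
  exact le_iSup (fun j => ‖pair u (bandTest k (fun p => (bes θ p : ℂ)) (0 - 0) (bumpFamily j))‖ₑ) j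

theorem eLpNorm_top_band_le {θ : ℝ} {k : ℕ} {u V : Plane → ℂ}
    (h : IsMultiplier ((band k).indicator (fun p => (bes θ p : ℂ))) u V) :
    eLpNorm V ⊤ volume ≤ bandMax k (fun p => (bes θ p : ℂ)) bumpFamily (fun _ => u) 0 0 := by
  obtain ⟨hu, hV, he⟩ := id h
  refine eLpNorm_top_le_of_bump (locallyIntegrable_of_memLp hV) fun j => ?_
  rw [← pair_fourierInv, h.pair_eq (mem12_fourierInv _)
    (((goodSymbol_bes θ).indicator (measurableSet_band k)).mem12_fourierInv _)]
  have e : (fun ζ : Plane => (band k).indicator (fun p => (bes θ p : ℂ)) (ζ 0) *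
      𝓕⁻ (bumpFamily j : Plane → ℂ) ζ) = bandTest k (fun p => (bes θ p : ℂ)) (0 - 0) (bumpFamily j) := by
    funext ζ
    rw [bandTest, sub_zero, prop_zero, mul_one]
  rw [e]
  exact le_iSup (fun j => ‖pair u (bandTest k (fun p => (bes θ p : ℂ)) (0 - 0) (bumpFamily j))‖ₑ) j

theorem eLpNorm_two_band_le {θ s : ℝ} {k : ℕ} {u V : Plane → ℂ} {U : ℝ≥0∞}
    (h : IsMultiplier ((band k).indicator (fun p => (bes θ p : ℂ))) u V) (hU : SobolevLE s u U) :
    eLpNorm V 2 volume ≤ ENNReal.ofReal (besConst (θ - s)) * dyad k ^ (θ - s) * U := by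
  obtain ⟨hu, hV, he⟩ := id h
  obtain ⟨_, hU⟩ := hU
  rw [← eLpNorm_fourierL2 hV, eLpNorm_congr_ae he]
  exact (eLpNorm_band_bes_le hu k θ s).trans (mul_le_mul_right hU _)

theorem eLpNorm_four_rpow_le {v : Plane → ℂ} (hv : AEStronglyMeasurable v volume) :
    eLpNorm v 4 volume ^ (4 : ℝ) ≤ eLpNorm v 2 volume ^ (2 : ℝ) * eLpNorm v ⊤ volume ^ (2 : ℝ) := by
  have e4 : eLpNorm v 4 volume ^ (4 : ℝ) = ∫⁻ z, ‖v z‖ₑ ^ (4 : ℝ) := by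
    rw [eLpNorm_eq_lintegral_rpow_enorm_toReal (by norm_num) (by norm_num), ← ENNReal.rpow_mul]; simp
  have e2 : eLpNorm v 2 volume ^ (2 : ℝ) = ∫⁻ z, ‖v z‖ₑ ^ (2 : ℝ) := by
    rw [eLpNorm_eq_lintegral_rpow_enorm_toReal (by norm_num) (by norm_num), ← ENNReal.rpow_mul]; simp
  rw [e4, e2, ← lintegral_mul_const'' _ (hv.enorm.pow_const _)]
  refine lintegral_mono_ae ?_
  filter_upwards [ae_le_eLpNormEssSup (f := v) (μ := volume)] with z hz
  rw [show (4 : ℝ) = 2 + 2 by norm_num, ENNReal.rpow_add_of_nonneg _ _ (by norm_num) (by norm_num), eLpNorm_exponent_top]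
  gcongr

theorem isMultiplier_low {m : ℝ → ℂ} {u : Plane → ℂ} {V : ℕ → Plane → ℂ}
    (h : ∀ k, IsMultiplier ((band k).indicator m) u (V k)) (N : ℕ) :
    IsMultiplier ((lowSet N).indicator m) u (fun z => ∑ k ∈ Finset.range (N + 1), V k z) := by
  induction N with
  | zero => simpa [lowSet_zero] using h 0
  | succ N ih =>
    have h1 := ih.add (h (N + 1))
    rw [lowSet_succ, indicator_union_of_disjoint (disjoint_lowSet_band N)]
    simpa [Finset.sum_range_succ _ (N + 1)] using h1

theorem tendsto_dyad_rpow {x : ℝ} (hx : x < 0) :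
    Filter.Tendsto (fun N => ENNReal.ofReal ((2 ^ N : ℝ) ^ x)) Filter.atTop (nhds 0) := by
  have e : ∀ N : ℕ, (2 ^ N : ℝ) ^ x = ((2 : ℝ) ^ x) ^ N := fun N => by
    rw [← Real.rpow_natCast, ← Real.rpow_natCast, ← Real.rpow_mul (by norm_num),
      ← Real.rpow_mul (by norm_num), mul_comm]
  simp only [e]
  have h := tendsto_pow_atTop_nhds_zero_of_lt_one (r := (2 : ℝ) ^ x) (by positivity)
    (Real.rpow_lt_one_of_one_lt_of_neg (by norm_num) hx)
  simpa using ENNReal.tendsto_ofReal h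

/-- The partial sums converge to W in L², since the remainder is at most 2^{N(θ-s)}U with θ < s,
hence almost everywhere along a subsequence; Fatou and the triangle inequality in L^p conclude. -/
theorem eLpNorm_le_tsum_band {θ s : ℝ} (hθ : θ < s) {u W : Plane → ℂ} {U : ℝ≥0∞} (hU : SobolevLE s u U)
    (hUt : U ≠ ⊤) (h : IsMultiplier (fun p => (bes θ p : ℂ)) u W) {V : ℕ → Plane → ℂ}
    (hV : ∀ k, IsMultiplier ((band k).indicator (fun p => (bes θ p : ℂ))) u (V k)) {p : ℝ≥0∞} (hp : 1 ≤ p) :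
    eLpNorm W p volume ≤ ∑' k, eLpNorm (V k) p volume := by
  have hVm : ∀ k, AEStronglyMeasurable (V k) volume := fun k => (hV k).2.choose.1
  set S : ℕ → Plane → ℂ := fun N z => ∑ k ∈ Finset.range (N + 1), V k z with hS
  have hSm : ∀ N, AEStronglyMeasurable (S N) volume := fun N =>
    Finset.aestronglyMeasurable_fun_sum _ fun k _ => hVm k
  have h1 : ∀ N, eLpNorm (S N - W) 2 volume ≤ ENNReal.ofReal ((2 ^ N : ℝ) ^ (θ - s)) * U := by
    intro N
    rw [eLpNorm_sub_comm]
    exact (h.sub (isMultiplier_low hV N)).eLpNorm_two_le hU (norm_compl_low_bes_le hθ.le N)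
  have h2 : Filter.Tendsto (fun N => eLpNorm (S N - W) 2 volume) Filter.atTop (nhds 0) := by
    have h3 := ENNReal.Tendsto.mul_const (b := U) (tendsto_dyad_rpow (x := θ - s) (by linarith))
      (Or.inr hUt)
    rw [zero_mul] at h3
    exact tendsto_of_tendsto_of_tendsto_of_le_of_le tendsto_const_nhds h3 (fun _ => zero_le) h1
  obtain ⟨ns, _, hns⟩ := (tendstoInMeasure_of_tendsto_eLpNorm (by norm_num) hSm h.2.choose.1
    h2).exists_seq_tendsto_ae
  refine (Lp.eLpNorm_lim_le_liminf_eLpNorm (fun n => hSm (ns n)) W hns).trans ?_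
  refine Filter.liminf_le_of_le (by isBoundedDefault) fun b hb => ?_
  obtain ⟨n, hn⟩ := hb.exists
  refine hn.trans ?_
  have e : S (ns n) = ∑ k ∈ Finset.range (ns n + 1), V k := by funext z; simp [hS]
  rw [e]
  exact (eLpNorm_sum_le (fun k _ => hVm k) hp).trans (ENNReal.sum_le_tsum _)

/-! ### Summation over bands and splitting of the forcing -/

/-- The geometric series of the negative powers of `2^k`. -/
noncomputable def geoConst (κ : ℝ) : ℝ≥0∞ := ∑' k, dyad k ^ (-κ)

theorem dyad_rpow_eq (k : ℕ) (x : ℝ) : dyad k ^ x = ((2 : ℝ≥0∞) ^ x) ^ k := by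
  rw [dyad, ← ENNReal.rpow_natCast, ← ENNReal.rpow_natCast, ← ENNReal.rpow_mul, ← ENNReal.rpow_mul, mul_comm]

theorem geoConst_ne_top {κ : ℝ} (hκ : 0 < κ) : geoConst κ ≠ ⊤ := by
  simp only [geoConst, dyad_rpow_eq]
  rw [ENNReal.tsum_geometric, ne_eq, ENNReal.inv_eq_top, tsub_eq_zero_iff_le, not_le]
  exact ENNReal.rpow_lt_one_of_one_lt_of_neg (by norm_num) (by linarith)

theorem dyad_rpow_add (k : ℕ) (x y : ℝ) : dyad k ^ (x + y) = dyad k ^ x * dyad k ^ y :=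
  ENNReal.rpow_add _ _ (dyad_ne_zero k) (dyad_ne_top k)

theorem dyad_rpow_mono (k : ℕ) {x y : ℝ} (h : x ≤ y) : dyad k ^ x ≤ dyad k ^ y :=
  ENNReal.rpow_le_rpow_of_exponent_le (one_le_dyad k) h

theorem dyad_rpow_le_one (k : ℕ) {x : ℝ} (h : x ≤ 0) : dyad k ^ x ≤ 1 := by
  simpa using dyad_rpow_mono k h

/-- Hölder on the counting measure with weights 2^{-kκ}, whose sum is the geometric constant. -/
theorem rpow_tsum_le {q κ : ℝ} (hq : 1 < q) (hκ : 0 ≤ κ) (a : ℕ → ℝ≥0∞) :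
    (∑' k, a k) ^ q ≤ geoConst κ ^ (q - 1) * ∑' k, (dyad k ^ κ * a k) ^ q := by
  have h := rpow_lintegral_mul_le (μ := Measure.count) hq (w := fun k : ℕ => dyad k ^ (-κ))
    (f := fun k => dyad k ^ κ * a k) (measurable_from_nat.aemeasurable) measurable_from_nat.aemeasurable
  simp only [lintegral_count, ← mul_assoc, ← dyad_rpow_add, neg_add_cancel, ENNReal.rpow_zero,
    one_mul] at h
  refine h.trans (mul_le_mul_right (ENNReal.tsum_le_tsum fun k => ?_) _)
  exact mul_le_of_le_one_left' (dyad_rpow_le_one k (by linarith))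

/-- Of the decay 2^{-2kκ} on each band, one half pays for the Hölder weight and the other half sums
over k. -/
theorem lintegral_tsum_rpow_le {q κ : ℝ} (hq : 1 < q) (hκ : 0 ≤ κ) {μ : Measure ℝ} {a : ℕ → ℝ → ℝ≥0∞}
    (ha : ∀ k, Measurable (a k)) {X : ℝ≥0∞} (h : ∀ k, ∫⁻ t, a k t ^ q ∂μ ≤ (dyad k ^ (-(2 * κ))) ^ q * X) :
    ∫⁻ t, (∑' k, a k t) ^ q ∂μ ≤ geoConst κ ^ (q - 1) * geoConst κ * X := by
  have hq0 : 0 ≤ q := by linarith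
  have hm : ∀ k, Measurable (fun t => (dyad k ^ κ * a k t) ^ q) := fun k =>
    ((ha k).const_mul _).pow_const q
  calc ∫⁻ t, (∑' k, a k t) ^ q ∂μ
      ≤ ∫⁻ t, geoConst κ ^ (q - 1) * ∑' k, (dyad k ^ κ * a k t) ^ q ∂μ :=
        lintegral_mono fun t => rpow_tsum_le hq hκ _
    _ = geoConst κ ^ (q - 1) * ∑' k, ∫⁻ t, (dyad k ^ κ * a k t) ^ q ∂μ := by
        rw [lintegral_const_mul _ (Measurable.tsum hm), lintegral_tsum fun k => (hm k).aemeasurable]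
    _ ≤ geoConst κ ^ (q - 1) * ∑' k, dyad k ^ (-κ) * X := by
        gcongr with k
        simp only [ENNReal.mul_rpow_of_nonneg _ _ hq0]
        rw [lintegral_const_mul _ ((ha k).pow_const q)]
        refine (mul_le_mul_right (h k) _).trans ?_
        rw [← mul_assoc, ← ENNReal.mul_rpow_of_nonneg _ _ hq0, ← dyad_rpow_add,
          show κ + -(2 * κ) = -κ by ring, ← ENNReal.rpow_mul]
        exact mul_le_mul_left (dyad_rpow_mono k (by nlinarith)) _
    _ = geoConst κ ^ (q - 1) * geoConst κ * X := by
        rw [ENNReal.tsum_mul_right, mul_assoc, geoConst]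

theorem eLpNorm_rpow_eq {v : Plane → ℂ} {p : ℝ≥0∞} (hp0 : p ≠ 0) (hpt : p ≠ ⊤) :
    eLpNorm v p volume ^ p.toReal = ∫⁻ z, ‖v z‖ₑ ^ p.toReal := by
  rw [eLpNorm_eq_lintegral_rpow_enorm_toReal hp0 hpt, ← ENNReal.rpow_mul, one_div,
    inv_mul_cancel₀ (ENNReal.toReal_pos hp0 hpt).ne', ENNReal.rpow_one]

theorem measurable_eLpNorm {v : ℝ → Plane → ℂ} (hv : StronglyMeasurable (Function.uncurry v)) {p : ℝ≥0∞}
    (hp0 : p ≠ 0) (hpt : p ≠ ⊤) : Measurable (fun t => eLpNorm (v t) p volume) := by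
  simp only [eLpNorm_eq_lintegral_rpow_enorm_toReal hp0 hpt]
  exact ((hv.measurable.enorm.pow_const _).lintegral_prod_right').pow_const _

theorem toReal_four_thirds : (4 / 3 : ℝ≥0∞).toReal = 4 / 3 := by
  rw [ENNReal.toReal_div]; norm_num

theorem four_thirds_ne_top : (4 / 3 : ℝ≥0∞) ≠ ⊤ :=
  ENNReal.div_ne_top (by norm_num) (by norm_num)

theorem four_thirds_ne_zero : (4 / 3 : ℝ≥0∞) ≠ 0 := by
  intro h
  have := toReal_four_thirds
  rw [h] at this
  norm_num at this

/-! ### Splitting of the forcing and the resulting estimates on one band. -/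

/-- The large part of a function. -/
noncomputable def bigPart (c : ℝ≥0∞) (g : Plane → ℂ) (z : Plane) : ℂ := {z | c < ‖g z‖ₑ}.indicator g z

/-- The small part of a function. -/
noncomputable def smallPart (c : ℝ≥0∞) (g : Plane → ℂ) (z : Plane) : ℂ := {z | c < ‖g z‖ₑ}ᶜ.indicator g z

theorem bigPart_add_smallPart (c : ℝ≥0∞) (g : Plane → ℂ) (z : Plane) :
    bigPart c g z + smallPart c g z = g z := indicator_self_add_compl_apply _ _ _

theorem stronglyMeasurable_parts {g : ℝ → Plane → ℂ} (hg : StronglyMeasurable (Function.uncurry g))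
    {c : ℝ → ℝ≥0∞} (hc : Measurable c) :
    StronglyMeasurable (Function.uncurry fun t => bigPart (c t) (g t)) ∧
    StronglyMeasurable (Function.uncurry fun t => smallPart (c t) (g t)) := by
  have hS : MeasurableSet {p : ℝ × Plane | c p.1 < ‖g p.1 p.2‖ₑ} :=
    measurableSet_lt (hc.comp measurable_fst) hg.measurable.enorm
  exact ⟨hg.indicator hS, hg.indicator hS.compl⟩

/-- Where |g| exceeds the level c = r³a one has |g| ≤ c^{-1/3}|g|^{4/3}, and c^{-1/3}a^{4/3} = a/r.
The level scales with a so that the result is homogeneous. -/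
theorem eLpNorm_bigPart_le {g : Plane → ℂ} (hg : AEStronglyMeasurable g volume) {a r : ℝ≥0∞}
    (ha : a ≠ ⊤) (hr0 : r ≠ 0) (hrt : r ≠ ⊤) (h : eLpNorm g (4 / 3) volume ≤ a) :
    eLpNorm (bigPart (r ^ (3 : ℝ) * a) g) 1 volume ≤ r⁻¹ * a := by
  by_cases ha0 : a = 0
  · rw [ha0, nonpos_iff_eq_zero, eLpNorm_eq_zero_iff hg four_thirds_ne_zero] at h
    have : bigPart (r ^ (3 : ℝ) * a) g =ᵐ[volume] 0 := by
      filter_upwards [h] with z hz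
      have hz' : g z = 0 := hz
      simp [bigPart, hz']
    rw [eLpNorm_congr_ae this, eLpNorm_zero]
    exact zero_le
  set c : ℝ≥0∞ := r ^ (3 : ℝ) * a with hc
  have hr3 : r ^ (3 : ℝ) ≠ 0 := by simp [hr0]
  have hr3t : r ^ (3 : ℝ) ≠ ⊤ := ENNReal.rpow_ne_top_of_nonneg (by norm_num) hrt
  have hc0 : c ≠ 0 := mul_ne_zero hr3 ha0
  have hct : c ≠ ⊤ := ENNReal.mul_ne_top hr3t ha
  have h1 : ∫⁻ z, ‖g z‖ₑ ^ (4 / 3 : ℝ) ≤ a ^ (4 / 3 : ℝ) := by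
    have := eLpNorm_rpow_eq (v := g) four_thirds_ne_zero four_thirds_ne_top
    rw [toReal_four_thirds] at this
    rw [← this]
    exact ENNReal.rpow_le_rpow h (by norm_num)
  rw [eLpNorm_one_eq_lintegral_enorm]
  calc ∫⁻ z, ‖bigPart c g z‖ₑ ≤ ∫⁻ z, c ^ (-1 / 3 : ℝ) * ‖g z‖ₑ ^ (4 / 3 : ℝ) := by
        refine lintegral_mono fun z => ?_
        by_cases hz : c < ‖g z‖ₑ
        · rw [bigPart, indicator_of_mem (show z ∈ {z | c < ‖g z‖ₑ} from hz)]
          have hz0 : ‖g z‖ₑ ≠ 0 := ((zero_le).trans_lt hz).ne'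
          calc ‖g z‖ₑ = ‖g z‖ₑ ^ (-1 / 3 : ℝ) * ‖g z‖ₑ ^ (4 / 3 : ℝ) := by
                rw [← ENNReal.rpow_add _ _ hz0 enorm_ne_top]; norm_num
            _ ≤ _ := by
                refine mul_le_mul_left ?_ _
                rw [show (-1 / 3 : ℝ) = -(1 / 3) by norm_num, ENNReal.rpow_neg, ENNReal.rpow_neg]
                exact ENNReal.inv_le_inv.2 (ENNReal.rpow_le_rpow hz.le (by norm_num))
        · rw [bigPart, indicator_of_notMem (show z ∉ {z | c < ‖g z‖ₑ} from hz), enorm_zero]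
          exact zero_le
    _ = c ^ (-1 / 3 : ℝ) * ∫⁻ z, ‖g z‖ₑ ^ (4 / 3 : ℝ) :=
        lintegral_const_mul' _ _ (ENNReal.rpow_ne_top_of_ne_zero hc0 hct)
    _ ≤ c ^ (-1 / 3 : ℝ) * a ^ (4 / 3 : ℝ) := by gcongr
    _ = r⁻¹ * a := by
        rw [hc, ENNReal.mul_rpow_of_ne_top hr3t ha, ← ENNReal.rpow_mul, mul_assoc,
          ← ENNReal.rpow_add _ _ ha0 ha]
        norm_num [ENNReal.rpow_neg_one]

/-- Where |g| ≤ c one has |g|² ≤ c^{2/3}|g|^{4/3}, and c^{2/3}a^{4/3} = (ra)². -/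
theorem eLpNorm_smallPart_le {g : Plane → ℂ} {a r : ℝ≥0∞} (h : eLpNorm g (4 / 3) volume ≤ a) (ha : a ≠ ⊤) :
    eLpNorm (smallPart (r ^ (3 : ℝ) * a) g) 2 volume ≤ r * a := by
  set c : ℝ≥0∞ := r ^ (3 : ℝ) * a with hc
  have h1 : ∫⁻ z, ‖g z‖ₑ ^ (4 / 3 : ℝ) ≤ a ^ (4 / 3 : ℝ) := by
    have := eLpNorm_rpow_eq (v := g) four_thirds_ne_zero four_thirds_ne_top
    rw [toReal_four_thirds] at this
    rw [← this]
    exact ENNReal.rpow_le_rpow h (by norm_num)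
  have e2 : eLpNorm (smallPart c g) 2 volume ^ (2 : ℝ) = ∫⁻ z, ‖smallPart c g z‖ₑ ^ (2 : ℝ) := by
    have := eLpNorm_rpow_eq (v := smallPart c g) (p := 2) (by norm_num) (by norm_num)
    simpa using this
  rw [← ENNReal.rpow_le_rpow_iff (z := 2) (by norm_num), e2]
  by_cases ha0 : a = 0
  · have hz : ∫⁻ z, ‖smallPart c g z‖ₑ ^ (2 : ℝ) = 0 := by
      have : ∀ z, ‖smallPart c g z‖ₑ ^ (2 : ℝ) = 0 := by
        intro z
        rw [hc, ha0, mul_zero]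
        by_cases hz : g z = 0 <;> simp [smallPart, hz]
      simp [this]
    rw [hz]; exact zero_le
  by_cases hrt : r = ⊤
  · rw [hrt, ENNReal.top_mul ha0]; simp
  calc ∫⁻ z, ‖smallPart c g z‖ₑ ^ (2 : ℝ) ≤ ∫⁻ z, c ^ (2 / 3 : ℝ) * ‖g z‖ₑ ^ (4 / 3 : ℝ) := by
        refine lintegral_mono fun z => ?_
        by_cases hz : c < ‖g z‖ₑ
        · rw [smallPart, indicator_of_notMem (show z ∉ {z | c < ‖g z‖ₑ}ᶜ from fun h' => h' hz), enorm_zero]; simp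
        · rw [smallPart, indicator_of_mem (show z ∈ {z | c < ‖g z‖ₑ}ᶜ from hz)]
          calc ‖g z‖ₑ ^ (2 : ℝ) = ‖g z‖ₑ ^ (2 / 3 : ℝ) * ‖g z‖ₑ ^ (4 / 3 : ℝ) := by
                rw [← ENNReal.rpow_add_of_nonneg _ _ (by norm_num) (by norm_num)]; norm_num
            _ ≤ _ := by
                gcongr
                exact not_lt.1 hz
    _ = c ^ (2 / 3 : ℝ) * ∫⁻ z, ‖g z‖ₑ ^ (4 / 3 : ℝ) := by
        refine lintegral_const_mul' _ _ (ENNReal.rpow_ne_top_of_nonneg (by norm_num) ?_)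
        exact ENNReal.mul_ne_top (ENNReal.rpow_ne_top_of_nonneg (by norm_num) hrt) ha
    _ ≤ c ^ (2 / 3 : ℝ) * a ^ (4 / 3 : ℝ) := by gcongr
    _ = (r * a) ^ (2 : ℝ) := by
        rw [hc, ENNReal.mul_rpow_of_nonneg _ _ (by norm_num), ENNReal.mul_rpow_of_nonneg _ _ (by norm_num),
          ← ENNReal.rpow_mul, mul_assoc, ← ENNReal.rpow_add_of_nonneg _ _ (by norm_num) (by norm_num)]
        norm_num

/-- Common data on a band for a single forcing term. -/
structure ForcedProblem (T : ℝ) (k : ℕ) (θ β s : ℝ) (u g : ℝ → Plane → ℂ) (U : ℝ≥0∞) (p : ℝ≥0∞)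
    (a : ℝ → ℝ≥0∞) : Prop where
  meas_u : StronglyMeasurable (Function.uncurry u)
  meas_g : StronglyMeasurable (Function.uncurry g)
  meas_a : Measurable a
  bound_u : ∀ᵐ t ∂volume.restrict (Ioo 0 T), SobolevLE s (u t) U
  bound_g : ∀ᵐ t ∂volume.restrict (Ioo 0 T), eLpNorm (g t) p volume ≤ a t
  finite : ∀ᵐ t ∂volume.restrict (Ioo 0 T), a t ≠ ⊤
  duhamel : ∀ j, BandDuhamel T u g k θ β (bumpFamily j)

/-- The maximal function of `J^θ u` on the band `k`. -/
noncomputable def bandSup (k : ℕ) (θ : ℝ) (u : Plane → ℂ) : ℝ≥0∞ :=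
  bandMax k (fun p => (bes θ p : ℂ)) bumpFamily (fun _ => u) 0 0

theorem measurable_bandSup {u : ℝ → Plane → ℂ} (hu : StronglyMeasurable (Function.uncurry u)) (k : ℕ) (θ : ℝ) :
    Measurable (fun t => bandSup k θ (u t)) := by
  have h := (measurable_bandMax hu (continuous_ofReal_bes θ) k bumpFamily).comp
    (measurable_id.prodMk measurable_id)
  have e : (fun t => bandSup k θ (u t)) = fun t : ℝ =>
      Function.uncurry (bandMax k (fun p => (bes θ p : ℂ)) bumpFamily u) (id t, id t) := by
    funext t
    simp only [bandSup, bandMax, Function.uncurry, id, sub_self]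
  rw [e]; exact h

/-- With L¹ forcing alone there is nothing to gain from short windows: δ = 1 and the L² part is
zero. -/
theorem exists_band_estimate_one (θ β s : ℝ) {ν : ℝ} (hν : 0 < ν) (hν' : ν ≤ 1 / 2) :
    ∃ C : ℝ≥0∞, C ≠ ⊤ ∧ ∀ (k : ℕ) (T : ℝ), 0 < T → T < 2 → ∀ (u g : ℝ → Plane → ℂ) (U : ℝ≥0∞)
        (a : ℝ → ℝ≥0∞), ForcedProblem T k θ β s u g U 1 a →
      ∫⁻ t in Ioo 0 T, bandSup k θ (u t) ^ (2 : ℝ) ≤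
        C * (dyad k ^ (3 * ν)) ^ (2 : ℝ) * ((dyad k ^ (θ - s) * U) ^ (2 : ℝ) +
          (dyad k ^ (β + 1)) ^ (2 : ℝ) * ∫⁻ t in Ioo 0 T, a t ^ (2 : ℝ)) := by
  obtain ⟨C, hC, h⟩ := exists_band_estimate θ β s (q := 2) hν hν' le_rfl (by linarith)
  refine ⟨C, hC, fun k T hT0 hT u g U a hp => ?_⟩
  have := h bumpFamily testFamily_bumpFamily k 1 T one_pos le_rfl hT0 hT u g (fun _ _ => 0) U a (fun _ => 0)
    ⟨hp.meas_u, hp.meas_g, stronglyMeasurable_const, hp.meas_a, measurable_const, hp.bound_u, ?_,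
      ae_of_all _ fun t => ⟨MemLp.zero', by simp⟩, by simpa using hp.duhamel⟩
  · simpa [bandSup] using this
  · filter_upwards [hp.bound_g, hp.finite] with t h1 h2
    exact ⟨memLp_one_iff_integrable.1
      ⟨(hp.meas_g.comp_measurable measurable_prodMk_left).aestronglyMeasurable, h1.trans_lt h2.lt_top⟩, h1⟩

/-- The choice r = 2^{k/3}, δ = 2^{-4k/3} balances everything at q = 2: the free part pays δ^{-1/2}
= 2^{2k/3}, the large part gains 1/r on the derivative 2^k, and the small part pays r and gains
δ^{1/2}, so each ends at 2^{2k/3}. For q > 2 the powers of δ are only more favourable. -/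
theorem exists_band_estimate_fourThirds (θ β s : ℝ) {ν q : ℝ} (hν : 0 < ν) (hν' : ν ≤ 1 / 2) (hq2 : 2 ≤ q)
    (hq : (1 - ν) * (q / 2) < 1) :
    ∃ C : ℝ≥0∞, C ≠ ⊤ ∧ ∀ (k : ℕ) (T : ℝ), 0 < T → T < 2 → ∀ (u g : ℝ → Plane → ℂ) (U : ℝ≥0∞)
        (a : ℝ → ℝ≥0∞), ForcedProblem T k θ β s u g U (4 / 3) a →
      ∫⁻ t in Ioo 0 T, bandSup k θ (u t) ^ q ≤
        C * (dyad k ^ (3 * ν)) ^ q * ((dyad k ^ (θ - s + 2 / 3) * U) ^ q +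
          (dyad k ^ (β + 2 / 3)) ^ q * ∫⁻ t in Ioo 0 T, a t ^ q) := by
  obtain ⟨C, hC, h⟩ := exists_band_estimate θ β s hν hν' hq2 hq
  have hq0 : 0 ≤ q := by linarith
  refine ⟨2 * C, ENNReal.mul_ne_top (by norm_num) hC, fun k T hT0 hT u g U a hp => ?_⟩
  set r : ℝ≥0∞ := dyad k ^ (1 / 3 : ℝ) with hr
  have hr0 : r ≠ 0 := by
    have := dyad_rpow_mono k (show (0:ℝ) ≤ 1 / 3 by norm_num)
    rw [ENNReal.rpow_zero] at this
    exact (zero_lt_one.trans_le this).ne'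
  have hrt : r ≠ ⊤ := dyad_rpow_ne_top _ _
  have hri : r⁻¹ = dyad k ^ (-(1 / 3) : ℝ) := by rw [ENNReal.rpow_neg]
  have hcm : Measurable (fun t => r ^ (3 : ℝ) * a t) := hp.meas_a.const_mul _
  obtain ⟨hm₁, hm₂⟩ := stronglyMeasurable_parts hp.meas_g hcm
  set δ : ℝ := (2 ^ k : ℝ) ^ (-(4 / 3) : ℝ) with hδ
  have hδ1 : δ ≤ 1 := Real.rpow_le_one_of_one_le_of_nonpos (one_le_pow₀ one_le_two) (by norm_num)
  have hδe : ENNReal.ofReal δ = dyad k ^ (-(4 / 3) : ℝ) := ofReal_two_pow_rpow _ _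
  have hgm : ∀ t, AEStronglyMeasurable (g t) volume := fun t =>
    (hp.meas_g.comp_measurable measurable_prodMk_left).aestronglyMeasurable
  have key := h bumpFamily testFamily_bumpFamily k δ T (by positivity) hδ1 hT0 hT u
    (fun t => bigPart (r ^ (3 : ℝ) * a t) (g t)) (fun t => smallPart (r ^ (3 : ℝ) * a t) (g t)) U
    (fun t => r⁻¹ * a t) (fun t => r * a t)
    ⟨hp.meas_u, hm₁, hm₂, hp.meas_a.const_mul _, hp.meas_a.const_mul _, hp.bound_u, ?_, ?_, ?_⟩
  · refine key.trans ?_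
    simp only [ENNReal.mul_rpow_of_nonneg _ _ hq0]
    rw [lintegral_const_mul _ (hp.meas_a.pow_const q), lintegral_const_mul _ (hp.meas_a.pow_const q), hδe, hri, hr]
    set A := ∫⁻ t in Ioo 0 T, a t ^ q
    have e1 : (dyad k ^ (-(4 / 3) : ℝ))⁻¹ * ((dyad k ^ (θ - s)) ^ q * U ^ q) ≤
        (dyad k ^ (θ - s + 2 / 3)) ^ q * U ^ q := by
      rw [← ENNReal.rpow_neg, ← mul_assoc, ← ENNReal.rpow_mul, ← ENNReal.rpow_mul, ← dyad_rpow_add]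
      exact mul_le_mul_left (dyad_rpow_mono k (by nlinarith)) _
    have e2 : (dyad k ^ (β + 1)) ^ q * ((dyad k ^ (-(1 / 3) : ℝ)) ^ q * A) =
        (dyad k ^ (β + 2 / 3)) ^ q * A := by
      rw [← mul_assoc, ← ENNReal.mul_rpow_of_nonneg _ _ hq0, ← dyad_rpow_add,
        show β + 1 + -(1 / 3) = β + 2 / 3 by ring]
    have e3 : (dyad k ^ (-(4 / 3) : ℝ)) ^ (q - 1) * ((dyad k ^ (β + 1)) ^ q *
        ((dyad k ^ (1 / 3 : ℝ)) ^ q * A)) ≤ (dyad k ^ (β + 2 / 3)) ^ q * A := by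
      simp only [← ENNReal.rpow_mul, ← mul_assoc, ← dyad_rpow_add]
      exact mul_le_mul_left (dyad_rpow_mono k (by nlinarith)) _
    rw [e2]
    calc _ ≤ C * (dyad k ^ (3 * ν)) ^ q * ((dyad k ^ (θ - s + 2 / 3)) ^ q * U ^ q +
          (dyad k ^ (β + 2 / 3)) ^ q * A + (dyad k ^ (β + 2 / 3)) ^ q * A) := by gcongr
      _ ≤ C * (dyad k ^ (3 * ν)) ^ q * (2 * ((dyad k ^ (θ - s + 2 / 3)) ^ q * U ^ q +
          (dyad k ^ (β + 2 / 3)) ^ q * A)) := by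
          refine mul_le_mul_right ?_ _
          rw [two_mul, ← add_assoc]
          exact add_le_add (le_self_add : _ ≤ _ + (dyad k ^ (θ - s + 2 / 3)) ^ q * U ^ q) le_rfl
      _ = _ := by ring
  · filter_upwards [hp.bound_g, hp.finite] with t h1 h2
    have h3 := eLpNorm_bigPart_le (hgm t) h2 hr0 hrt h1
    exact ⟨memLp_one_iff_integrable.1 ⟨(hm₁.comp_measurable measurable_prodMk_left).aestronglyMeasurable,
      h3.trans_lt (ENNReal.mul_lt_top (ENNReal.inv_lt_top.2 hr0.bot_lt) h2.lt_top)⟩, h3⟩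
  · filter_upwards [hp.bound_g, hp.finite] with t h1 h2
    have h3 := eLpNorm_smallPart_le (r := r) h1 h2
    exact ⟨⟨(hm₂.comp_measurable measurable_prodMk_left).aestronglyMeasurable,
      h3.trans_lt (ENNReal.mul_lt_top hrt.lt_top h2.lt_top)⟩, h3⟩
  · simpa only [bigPart_add_smallPart] using hp.duhamel

/-! ### From solutions to band problems -/

theorem pair_congr {v w : Plane → ℂ} (h : v =ᵐ[volume] w) (χ : Plane → ℂ) : pair v χ = pair w χ := by
  refine integral_congr_ae ?_
  filter_upwards [h] with z hz
  rw [hz]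

theorem Represents.congr {S : 𝓢'(Plane, ℂ)} {v w : Plane → ℂ} (h : Represents S v) (hvw : v =ᵐ[volume] w) :
    Represents S w := by
  intro φ
  have e : (fun z => v z * φ z) =ᵐ[volume] fun z => w z * φ z := by
    filter_upwards [hvw] with z hz
    rw [hz]
  exact ⟨(h φ).1.congr e, (h φ).2.trans (integral_congr_ae e)⟩

theorem SobolevLE.congr {s : ℝ} {u v : Plane → ℂ} {U : ℝ≥0∞} (h : SobolevLE s u U) (huv : u =ᵐ[volume] v) :
    SobolevLE s v U := by
  obtain ⟨hu, hU⟩ := h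
  have hv := (memLp_congr_ae huv).1 hu
  exact ⟨hv, by rwa [← fourierL2_congr hu hv huv]⟩

theorem sobolevLE_of_sobolevNorm_le {s : ℝ} {u : Plane → ℂ} {U : ℝ≥0∞} (h : sobolevNorm s u ≤ U)
    (hU : U ≠ ⊤) : SobolevLE s u U := by
  by_cases hu : MemLp u 2 volume
  · refine ⟨hu, ?_⟩
    rw [sobolevNorm, iInf_pos hu] at h
    exact h
  · rw [sobolevNorm, iInf_neg hu] at h
    exact absurd (top_le_iff.1 h) hU

theorem SobolevLE.memLp {s : ℝ} {u : Plane → ℂ} {U : ℝ≥0∞} (h : SobolevLE s u U) : MemLp u 2 volume :=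
  h.choose

theorem SobolevLE.eLpNorm_le {s : ℝ} (hs : 0 ≤ s) {u : Plane → ℂ} {U : ℝ≥0∞} (h : SobolevLE s u U) :
    eLpNorm u 2 volume ≤ U := by
  have := (isMultiplier_one h.memLp).eLpNorm_two_le (s := s) (K := 1) h fun p => by
    have := bes_le_bes hs p
    rw [bes_zero] at this
    rwa [norm_one]
  simpa using this

/-- A jointly measurable representative. -/
theorem exists_regular {T : ℝ} {u : ℝ → Plane → ℂ}
    (hu : AEStronglyMeasurable (Function.uncurry u) (slabMeasure T)) :
    ∃ v : ℝ → Plane → ℂ, StronglyMeasurable (Function.uncurry v) ∧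
      ∀ᵐ t ∂volume.restrict (Ioo 0 T), u t =ᵐ[volume] v t :=
  ⟨fun t z => hu.mk _ (t, z), hu.stronglyMeasurable_mk, Measure.ae_ae_of_ae_prod hu.ae_eq_mk⟩

theorem MemLinftySobolev.ae_sobolevLE {s T : ℝ} {u : ℝ → Plane → ℂ} (h : MemLinftySobolev s T u) :
    ∀ᵐ t ∂volume.restrict (Ioo 0 T), SobolevLE s (u t) (linftySobolevNorm s T u) := by
  have h1 : ∀ᵐ t ∂volume.restrict (Ioo 0 T), ‖sobolevNorm s (u t)‖ₑ ≤ linftySobolevNorm s T u := by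
    rw [linftySobolevNorm, eLpNorm_exponent_top]
    exact ae_le_eLpNormEssSup
  filter_upwards [h1] with t ht
  exact sobolevLE_of_sobolevNorm_le (by simpa using ht) h.2.ne

theorem BandDuhamel.congr {T : ℝ} {u v g g' : ℝ → Plane → ℂ} {k : ℕ} {θ β : ℝ} {Ψ : 𝓢(Plane, ℂ)}
    (h : BandDuhamel T u g k θ β Ψ) (huv : ∀ᵐ t ∂volume.restrict (Ioo 0 T), u t =ᵐ[volume] v t)
    (hg : ∀ᵐ τ ∂volume.restrict (Ioo 0 T), ∀ t, pair (g τ) (bandTest k (forceSymbol β) t Ψ) =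
      pair (g' τ) (bandTest k (forceSymbol β) t Ψ)) : BandDuhamel T v g' k θ β Ψ := by
  obtain ⟨S, hS, hST, hD⟩ := h
  refine ⟨S ∩ {t | u t =ᵐ[volume] v t}, hS.and huv, fun t ht => hST ht.1, fun t₀ ht₀ t ht => ?_⟩
  rw [← pair_congr ht.2, ← pair_congr ht₀.2, hD t₀ ht₀.1 t ht.1]
  congr 1
  have hsub : uIoc t₀ t ⊆ Ioo 0 T := by
    have ha := hST ht₀.1
    have hb := hST ht.1
    intro τ hτ
    rcases mem_uIoc.1 hτ with h | h
    · exact ⟨ha.1.trans h.1, h.2.trans_lt hb.2⟩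
    · exact ⟨hb.1.trans h.1, h.2.trans_lt ha.2⟩
  refine intervalIntegral.integral_congr_ae ?_
  filter_upwards [(ae_restrict_iff' measurableSet_Ioo).1 hg] with τ h1 h2 using h1 (hsub h2) _

theorem timePairable_of_sobolevLE {s T : ℝ} (hs : 0 ≤ s) {u : ℝ → Plane → ℂ}
    (hm : AEStronglyMeasurable (Function.uncurry u) (slabMeasure T)) {U : ℝ≥0∞} (hU : U ≠ ⊤)
    (h : ∀ᵐ t ∂volume.restrict (Ioo 0 T), SobolevLE s (u t) U) : TimePairable T u (fun _ => U.toReal) where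
  meas := hm
  int := integrableOn_const (by simp)
  pairable := by
    filter_upwards [h] with t ht
    exact (pairable_of_memLp ht.memLp).mono (ENNReal.toReal_mono hU (ht.eLpNorm_le hs))

/-- Functions in `L^r` pair with Fourier transforms of functions in `L¹ ∩ L²`. -/
def PairExponent (r : ℝ≥0∞) : Prop :=
  ∀ w : Plane → ℂ, AEStronglyMeasurable w volume → eLpNorm w r volume ≠ ⊤ →
    Pairable w (2 * (eLpNorm w r volume).toReal)

theorem pairExponent_one : PairExponent 1 := by
  intro w hw ht
  have hi : Integrable w := memLp_one_iff_integrable.1 ⟨hw, ht.lt_top⟩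
  refine (pairable_of_integrable hi).mono ?_
  rw [integral_norm_eq_lintegral_enorm hw, ← eLpNorm_one_eq_lintegral_enorm]
  have := ENNReal.toReal_nonneg (a := eLpNorm w 1 volume)
  linarith

/-- L^{4/3} lies in L¹ + L²: cutting w at the height of its own norm bounds either part by that
norm, hence the factor 2. -/
theorem pairExponent_four_thirds : PairExponent (4 / 3) := by
  intro w hw ht
  set a := eLpNorm w (4 / 3) volume with ha
  have h1 := eLpNorm_bigPart_le (r := 1) hw ht one_ne_zero ENNReal.one_ne_top le_rfl
  have h2 := eLpNorm_smallPart_le (r := 1) (g := w) le_rfl ht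
  simp only [ENNReal.one_rpow, one_mul, inv_one, ← ha] at h1 h2
  have hS : NullMeasurableSet {z | a < ‖w z‖ₑ} volume := nullMeasurableSet_lt aemeasurable_const hw.enorm
  have hm1 : AEStronglyMeasurable (bigPart a w) volume := hw.indicator₀ hS
  have hm2 : AEStronglyMeasurable (smallPart a w) volume := hw.indicator₀ hS.compl
  have i1 : Integrable (bigPart a w) := memLp_one_iff_integrable.1 ⟨hm1, h1.trans_lt ht.lt_top⟩
  have i2 : MemLp (smallPart a w) 2 volume := ⟨hm2, h2.trans_lt ht.lt_top⟩
  have p1 : Pairable (bigPart a w) a.toReal := by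
    refine (pairable_of_integrable i1).mono ?_
    rw [integral_norm_eq_lintegral_enorm hm1, ← eLpNorm_one_eq_lintegral_enorm]
    exact ENNReal.toReal_mono ht h1
  have p2 : Pairable (smallPart a w) a.toReal := (pairable_of_memLp i2).mono (ENNReal.toReal_mono ht h2)
  have := p1.add p2
  simp only [bigPart_add_smallPart] at this
  rwa [two_mul]

theorem mixedNorm_rpow {q r : ℝ≥0∞} (hq0 : q ≠ 0) (hqt : q ≠ ⊤) (T : ℝ) (g : ℝ → Plane → ℂ) :
    mixedNorm q r T g ^ q.toReal = ∫⁻ t in Ioo 0 T, eLpNorm (g t) r volume ^ q.toReal := by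
  rw [mixedNorm, eLpNorm_eq_lintegral_rpow_enorm_toReal hq0 hqt, ← ENNReal.rpow_mul, one_div,
    inv_mul_cancel₀ (ENNReal.toReal_pos hq0 hqt).ne', ENNReal.rpow_one]
  simp

theorem integrableOn_toReal {T q : ℝ} (hq : 1 ≤ q) {a : ℝ → ℝ≥0∞} (ha : Measurable a)
    (h : ∫⁻ t in Ioo 0 T, a t ^ q ≠ ⊤) : IntegrableOn (fun t => (a t).toReal) (Ioo 0 T) := by
  refine integrable_toReal_of_lintegral_ne_top ha.aemeasurable (ne_top_of_le_ne_top (b := ∫⁻ t in Ioo 0 T, (1 + a t ^ q)) ?_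
    (lintegral_mono fun t => ?_))
  · rw [lintegral_add_left measurable_const]
    exact ENNReal.add_ne_top.2 ⟨by simp, h⟩
  · rcases le_total (a t) 1 with h1 | h1
    · exact h1.trans le_self_add
    · refine le_trans ?_ le_add_self
      simpa using ENNReal.rpow_le_rpow_of_exponent_le h1 hq

theorem ae_ne_top_of_lintegral_rpow {T q : ℝ} (hq : 0 < q) {a : ℝ → ℝ≥0∞} (ha : Measurable a)
    (h : ∫⁻ t in Ioo 0 T, a t ^ q ≠ ⊤) : ∀ᵐ t ∂volume.restrict (Ioo 0 T), a t ≠ ⊤ := by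
  filter_upwards [ae_lt_top (ha.pow_const q) h] with t ht hc
  rw [hc, ENNReal.top_rpow_of_pos hq] at ht
  exact lt_irrefl _ ht

/-- Jointly measurable representatives replace u and J_x^{θ'}f, and the spatial norm of the latter
becomes a measurable function a of time. Finiteness of the mixed norm makes a finite almost
everywhere and integrable, as the derivation of Duhamel's formula requires. -/
theorem exists_forcedProblem {s T : ℝ} (hs : 0 ≤ s) (hT : 0 < T) {u f g : ℝ → Plane → ℂ}
    (hu : MemLinftySobolev s T u) (hsol : IsSolution T u f) {θ' : ℝ} {q r : ℝ≥0∞} (hr0 : r ≠ 0)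
    (hrt : r ≠ ⊤) (hr : PairExponent r) (hq1 : 1 ≤ q) (hqt : q ≠ ⊤) (hg : IsJx θ' T f g)
    (hfin : mixedNorm q r T g ≠ ⊤) {v : ℝ → Plane → ℂ} (hv : StronglyMeasurable (Function.uncurry v))
    (huv : ∀ᵐ t ∂volume.restrict (Ioo 0 T), u t =ᵐ[volume] v t) :
    ∃ (g' : ℝ → Plane → ℂ) (a : ℝ → ℝ≥0∞), Measurable a ∧
      (∫⁻ t in Ioo 0 T, a t ^ q.toReal) = mixedNorm q r T g ^ q.toReal ∧
      ∀ k θ, ForcedProblem T k θ (θ - θ') s v g' (linftySobolevNorm s T u) r a := by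
  have hq0 : q ≠ 0 := (zero_lt_one.trans_le hq1).ne'
  have hq1' : 1 ≤ q.toReal := by simpa using ENNReal.toReal_mono hqt hq1
  obtain ⟨g', hg'm, hgg'⟩ := exists_regular hg.1
  have hU := hu.ae_sobolevLE
  set U := linftySobolevNorm s T u with hUdef
  set a : ℝ → ℝ≥0∞ := fun t => eLpNorm (g' t) r volume with ha
  have ham : Measurable a := measurable_eLpNorm hg'm hr0 hrt
  have hInt : (∫⁻ t in Ioo 0 T, a t ^ q.toReal) = mixedNorm q r T g ^ q.toReal := by
    rw [mixedNorm_rpow hq0 hqt]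
    refine lintegral_congr_ae ?_
    filter_upwards [hgg'] with t ht
    rw [ha, eLpNorm_congr_ae ht]
  have hfin' : ∫⁻ t in Ioo 0 T, a t ^ q.toReal ≠ ⊤ := by
    rw [hInt]; exact ENNReal.rpow_ne_top_of_nonneg (by linarith) hfin
  have hat := ae_ne_top_of_lintegral_rpow (by linarith) ham hfin'
  have hgp : TimePairable T g' (fun t => 2 * (a t).toReal) :=
    ⟨hg'm.aestronglyMeasurable, (integrableOn_toReal hq1' ham hfin').const_mul 2, by
      filter_upwards [hat] with t ht
      exact hr _ (hg'm.comp_measurable measurable_prodMk_left).aestronglyMeasurable ht⟩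
  have hfg : ∀ᵐ t ∂volume.restrict (Ioo 0 T),
      ∃ S : 𝓢'(Plane, ℂ), Represents S (f t) ∧ Represents (Jx θ' S) (g' t) := by
    filter_upwards [hg.2, hgg'] with t ⟨S, h1, h2⟩ h3
    exact ⟨S, h1, h2.congr h3⟩
  refine ⟨g', a, ham, hInt, fun k θ => ⟨hv, hg'm, ham, ?_, ae_of_all _ fun t => le_rfl, hat, fun j => ?_⟩⟩
  · filter_upwards [hU, huv] with t h1 h2 using h1.congr h2
  · exact (hsol.bandDuhamel hT (timePairable_of_sobolevLE hs hu.1 hu.2.ne hU) hgp hg'm hfg k θ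
      (bumpFamily j)).congr huv (ae_of_all _ fun _ _ => rfl)

/-- Hölder's inequality in time on intervals of length at most `2`. -/
theorem lintegral_rpow_le_rpow {T p q : ℝ} (hT : T < 2) (hp : 0 < p) (hpq : p < q) {a : ℝ → ℝ≥0∞}
    (ha : Measurable a) : ∫⁻ t in Ioo 0 T, a t ^ p ≤ 2 * (∫⁻ t in Ioo 0 T, a t ^ q) ^ (p / q) := by
  have hq : 0 < q := hp.trans hpq
  have h1 : 1 < q / p := (one_lt_div hp).2 hpq
  have h := rpow_lintegral_mul_le (μ := volume.restrict (Ioo 0 T)) h1 (w := fun _ => 1)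
    (f := fun t => a t ^ p) aemeasurable_const (ha.pow_const p).aemeasurable
  simp only [one_mul, lintegral_one, Measure.restrict_apply_univ, ← ENNReal.rpow_mul,
    mul_div_cancel₀ q hp.ne', Real.volume_Ioo, sub_zero] at h
  have h2 := ENNReal.rpow_le_rpow h (show 0 ≤ p / q by positivity)
  rw [← ENNReal.rpow_mul, div_mul_div_cancel₀ hp.ne', div_self hq.ne', ENNReal.rpow_one,
    ENNReal.mul_rpow_of_nonneg _ _ (by positivity), ← ENNReal.rpow_mul] at h2
  refine h2.trans (mul_le_mul_left ?_ _)
  have hT2 : ENNReal.ofReal T ≤ 2 := (ENNReal.ofReal_le_ofReal hT.le).trans (by simp)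
  have hexp : (q / p - 1) * (p / q) ≤ 1 := by
    have : (q / p - 1) * (p / q) = 1 - p / q := by field_simp
    rw [this]
    have : 0 ≤ p / q := by positivity
    linarith
  calc ENNReal.ofReal T ^ ((q / p - 1) * (p / q)) ≤ 2 ^ ((q / p - 1) * (p / q)) :=
        ENNReal.rpow_le_rpow hT2 (mul_nonneg (by linarith) (by positivity))
    _ ≤ 2 ^ (1 : ℝ) := ENNReal.rpow_le_rpow_of_exponent_le (by norm_num) hexp
    _ = 2 := by simp

/-- The norm of the forcing is an infimum over representatives. Dividing by the nonzero finite C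
isolates it, so the bound for each representative passes to the infimum; those of infinite norm are
trivial. -/
theorem le_mul_add_JxNorm {X U : ℝ≥0∞} {C : ℝ≥0} (hC : C ≠ 0) {θ : ℝ} {q r : ℝ≥0∞} {T : ℝ}
    {f : ℝ → Plane → ℂ} (h : ∀ g, IsJx θ T f g → mixedNorm q r T g ≠ ⊤ → X ≤ C * (U + mixedNorm q r T g)) :
    X ≤ C * (U + JxNorm θ q r T f) := by
  have hC0 : (C : ℝ≥0∞) ≠ 0 := by simpa using hC
  have key : X / C - U ≤ JxNorm θ q r T f := by
    refine le_iInf₂ fun g hg => ?_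
    by_cases hm : mixedNorm q r T g = ⊤
    · rw [hm]; exact le_top
    · rw [tsub_le_iff_left]
      exact ENNReal.div_le_of_le_mul' (h g hg hm)
  rw [tsub_le_iff_left] at key
  exact (ENNReal.div_le_iff_le_mul (Or.inl hC0) (Or.inl ENNReal.coe_ne_top)).1 key |>.trans (mul_comm _ _).le

theorem mixedNorm_le {q : ℝ} (hq : 0 < q) {r : ℝ≥0∞} {T : ℝ} {W : ℝ → Plane → ℂ} {b : ℝ → ℝ≥0∞}
    (h : ∀ᵐ t ∂volume.restrict (Ioo 0 T), eLpNorm (W t) r volume ≤ b t) :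
    mixedNorm (ENNReal.ofReal q) r T W ≤ (∫⁻ t in Ioo 0 T, b t ^ q) ^ (1 / q) := by
  have hq0 : ENNReal.ofReal q ≠ 0 := by simpa using hq
  have h1 := mixedNorm_rpow (r := r) hq0 ENNReal.ofReal_ne_top T W
  rw [ENNReal.toReal_ofReal hq.le] at h1
  have h2 : mixedNorm (ENNReal.ofReal q) r T W = (mixedNorm (ENNReal.ofReal q) r T W ^ q) ^ (1 / q) := by
    rw [← ENNReal.rpow_mul, mul_one_div_cancel hq.ne', ENNReal.rpow_one]
  rw [h2, h1]
  refine ENNReal.rpow_le_rpow (lintegral_mono_ae ?_) (by positivity)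
  filter_upwards [h] with t ht
  exact ENNReal.rpow_le_rpow ht hq.le

theorem ae_isMultiplier {s T : ℝ} {v V : ℝ → Plane → ℂ} {U : ℝ≥0∞} (hU : U ≠ ⊤)
    (hv : ∀ᵐ t ∂volume.restrict (Ioo 0 T), SobolevLE s (v t) U) {m : ℝ → ℂ} (hm : Measurable m)
    (hms : ∀ p, ‖m p‖ ≤ 1 * bes s p)
    (hV : ∀ t (h : MemLp (v t) 2 volume), MemLp (fun ζ => m (ζ 0) * fourierL2 h ζ) 2 volume →
        IsMultiplier m (v t) (V t)) :
    ∀ᵐ t ∂volume.restrict (Ioo 0 T), IsMultiplier m (v t) (V t) := by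
  filter_upwards [hv] with t ht
  exact hV t ht.memLp (memLp_symbol_mul hm ht hU hms ht.memLp)

/-- The function `J_x^θ u` and its `L^∞` bound by the maximal functions on the bands. -/
theorem exists_isJx_top {s T θ : ℝ} (hθ : θ ≤ s) {u v : ℝ → Plane → ℂ} {U : ℝ≥0∞} (hU : U ≠ ⊤)
    (hv : StronglyMeasurable (Function.uncurry v))
    (huv : ∀ᵐ t ∂volume.restrict (Ioo 0 T), u t =ᵐ[volume] v t)
    (hvU : ∀ᵐ t ∂volume.restrict (Ioo 0 T), SobolevLE s (v t) U) :
    ∃ W, IsJx θ T u W ∧ ∀ᵐ t ∂volume.restrict (Ioo 0 T), IsMultiplier (fun p => (bes θ p : ℂ)) (v t) (W t) ∧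
      eLpNorm (W t) ⊤ volume ≤ ∑' k, bandSup k θ (v t) := by
  obtain ⟨W, hWm, hW⟩ := exists_multiplier hv (goodSymbol_bes θ)
  have hM := ae_isMultiplier hU hvU (goodSymbol_bes θ).meas (fun p => by
    simpa using norm_indicator_bes_le hθ univ p) hW
  refine ⟨W, ⟨hWm.aestronglyMeasurable, ?_⟩, hM.mono fun t ht => ⟨ht, eLpNorm_top_multiplier_le ht⟩⟩
  filter_upwards [hM, huv] with t h1 h2
  obtain ⟨S, hS1, hS2⟩ := h1.represents
  exact ⟨S, hS1.congr h2.symm, hS2⟩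

/-! ### The linear estimates -/

theorem exists_band_pieces {s T θ : ℝ} (hθ : θ ≤ s) {v : ℝ → Plane → ℂ} {U : ℝ≥0∞} (hU : U ≠ ⊤)
    (hv : StronglyMeasurable (Function.uncurry v))
    (hvU : ∀ᵐ t ∂volume.restrict (Ioo 0 T), SobolevLE s (v t) U) :
    ∃ V : ℕ → ℝ → Plane → ℂ, (∀ k, StronglyMeasurable (Function.uncurry (V k))) ∧
      ∀ᵐ t ∂volume.restrict (Ioo 0 T), ∀ k,
        IsMultiplier ((band k).indicator (fun p => (bes θ p : ℂ))) (v t) (V k t) := by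
  have hg := fun k => (goodSymbol_bes θ).indicator (measurableSet_band k)
  choose V hVm hV using fun k => exists_multiplier hv (hg k)
  exact ⟨V, hVm, ae_all_iff.2 fun k => ae_isMultiplier hU hvU (hg k).meas (norm_indicator_bes_le hθ _) (hV k)⟩

/-- From |V|⁴ ≤ |V|² sup|V|²: the L² norm is bounded uniformly in time by the Sobolev norm, and the
squared sup norm is integrated by the band estimate with q = 2. -/
theorem exists_four_estimate (θ β s : ℝ) {ν : ℝ} (hν : 0 < ν) (hν' : ν ≤ 1 / 2) :
    ∃ C : ℝ≥0∞, C ≠ ⊤ ∧ ∀ (k : ℕ) (T : ℝ), 0 < T → T < 2 → ∀ (v g V : ℝ → Plane → ℂ) (U : ℝ≥0∞)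
        (a : ℝ → ℝ≥0∞), ForcedProblem T k θ β s v g U 1 a →
      (∀ᵐ t ∂volume.restrict (Ioo 0 T),
        IsMultiplier ((band k).indicator (fun p => (bes θ p : ℂ))) (v t) (V t)) →
      ∫⁻ t in Ioo 0 T, eLpNorm (V t) 4 volume ^ (4 : ℝ) ≤
        C * ((dyad k ^ (θ - s + 3 * ν) * U) ^ (2 : ℝ) * ((dyad k ^ (θ - s) * U) ^ (2 : ℝ) +
          (dyad k ^ (β + 1)) ^ (2 : ℝ) * ∫⁻ t in Ioo 0 T, a t ^ (2 : ℝ))) := by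
  obtain ⟨C, hC, h⟩ := exists_band_estimate_one θ β s hν hν'
  set K : ℝ≥0∞ := ENNReal.ofReal (besConst (θ - s)) with hK
  refine ⟨K ^ (2 : ℝ) * C, ENNReal.mul_ne_top (ENNReal.rpow_ne_top_of_nonneg (by norm_num)
    ENNReal.ofReal_ne_top) hC, fun k T hT0 hT v g V U a hp hV => ?_⟩
  calc ∫⁻ t in Ioo 0 T, eLpNorm (V t) 4 volume ^ (4 : ℝ)
      ≤ ∫⁻ t in Ioo 0 T, (K * dyad k ^ (θ - s) * U) ^ (2 : ℝ) * bandSup k θ (v t) ^ (2 : ℝ) := by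
        refine lintegral_mono_ae ?_
        filter_upwards [hV, hp.bound_u] with t h1 h2
        refine (eLpNorm_four_rpow_le h1.2.choose.1).trans ?_
        gcongr
        · exact eLpNorm_two_band_le h1 h2
        · exact eLpNorm_top_band_le h1
    _ = (K * dyad k ^ (θ - s) * U) ^ (2 : ℝ) * ∫⁻ t in Ioo 0 T, bandSup k θ (v t) ^ (2 : ℝ) :=
        lintegral_const_mul _ ((measurable_bandSup hp.meas_u k θ).pow_const _)
    _ ≤ _ := mul_le_mul_right (h k T hT0 hT v g U a hp) _
    _ = _ := by
        rw [dyad_rpow_add k (θ - s) (3 * ν)]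
        simp only [ENNReal.mul_rpow_of_nonneg _ _ (show (0:ℝ) ≤ 2 by norm_num)]
        ring

theorem exists_nnreal_rpow {K : ℝ≥0∞} (hK : K ≠ ⊤) {q : ℝ} (hq : 0 < q) :
    ∃ C : ℝ≥0, C ≠ 0 ∧ ∀ x y : ℝ≥0∞, x ≤ K * y ^ q → x ^ (1 / q) ≤ C * y := by
  have hKt : K ^ (1 / q) ≠ ⊤ := ENNReal.rpow_ne_top_of_nonneg (by positivity) hK
  refine ⟨(K ^ (1 / q)).toNNReal + 1, by positivity, fun x y h => ?_⟩
  have h1 := ENNReal.rpow_le_rpow h (show 0 ≤ 1 / q by positivity)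
  rw [ENNReal.mul_rpow_of_nonneg _ _ (by positivity), ← ENNReal.rpow_mul, mul_one_div_cancel hq.ne',
    ENNReal.rpow_one] at h1
  refine h1.trans (mul_le_mul_left ?_ _)
  rw [ENNReal.coe_add, ENNReal.coe_toNNReal hKt]
  exact le_self_add

theorem linear_estimate_four {s : ℝ} (hs : 0 ≤ s) {ε ε' : ℝ} (hε' : 0 < ε') (hεε : ε' < ε) :
    ∃ C : ℝ≥0, ∀ T : ℝ, 0 < T → T < 2 → ∀ u f : ℝ → Plane → ℂ,
      MemLinftySobolev s T u → IsSolution T u f →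
      JxNorm (s - (1 / 2 + ε)) 4 4 T u ≤ C * (linftySobolevNorm s T u + JxNorm (s - ε') 4 1 T f) := by
  have hε : 0 < ε := hε'.trans hεε
  set ν : ℝ := min (ε / 6) (1 / 2) with hν
  have hν0 : 0 < ν := lt_min (by positivity) (by norm_num)
  have hν1 : ν ≤ ε / 6 := min_le_left _ _
  set θ : ℝ := s - (1 / 2 + ε) with hθ
  -- The fourth power of the forced term has dyadic exponent 2(-1/2 - ε + 3ν) + 2(1/2 - ε + ε').
  -- With 6ν ≤ ε and ε' < ε this is at most -ε = -8κ, which is the decay that the summation needs;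
  -- the free term decays faster.
  set κ : ℝ := ε / 8 with hκ
  obtain ⟨C, hC, hmain⟩ := exists_four_estimate θ (θ - (s - ε')) s hν0 (min_le_right _ _)
  set G : ℝ≥0∞ := geoConst κ ^ ((4 : ℝ) - 1) * geoConst κ with hG
  have hGt : G ≠ ⊤ := ENNReal.mul_ne_top (ENNReal.rpow_ne_top_of_nonneg (by norm_num)
    (geoConst_ne_top (by positivity))) (geoConst_ne_top (by positivity))
  obtain ⟨C', hC', hfin⟩ := exists_nnreal_rpow (K := G * (C * 3))
    (ENNReal.mul_ne_top hGt (ENNReal.mul_ne_top hC (by norm_num))) (q := 4) (by norm_num)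
  refine ⟨C', fun T hT0 hT u f hu hsol => le_mul_add_JxNorm hC' fun g hg hgt => ?_⟩
  set U := linftySobolevNorm s T u with hU
  set F := mixedNorm 4 1 T g with hF
  have hUt : U ≠ ⊤ := hu.2.ne
  obtain ⟨v, hvm, huv⟩ := exists_regular hu.1
  obtain ⟨g', a, ham, haF, hprob⟩ := exists_forcedProblem hs hT0 hu hsol one_ne_zero ENNReal.one_ne_top
    pairExponent_one (q := 4) Nat.one_le_ofNat (by norm_num) hg hgt hvm huv
  have hvU := (hprob 0 0).bound_u
  have hθs : θ < s := by rw [hθ]; linarith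
  obtain ⟨W, hW, hWM⟩ := exists_isJx_top hθs.le hUt hvm huv hvU
  obtain ⟨V, hVm, hV⟩ := exists_band_pieces hθs.le hUt hvm hvU
  have hbound : ∀ᵐ t ∂volume.restrict (Ioo 0 T), eLpNorm (W t) 4 volume ≤ ∑' k, eLpNorm (V k t) 4 volume := by
    filter_upwards [hWM, hV, hvU] with t h1 h2 h3
    exact eLpNorm_le_tsum_band hθs h3 hUt h1.1 h2 Nat.one_le_ofNat
  have ha2 : ∫⁻ t in Ioo 0 T, a t ^ (2 : ℝ) ≤ 2 * F ^ (2 : ℝ) := by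
    refine (lintegral_rpow_le_rpow hT (by norm_num) (show (2 : ℝ) < 4 by norm_num) ham).trans (le_of_eq ?_)
    simp only [ENNReal.toReal_ofNat] at haF
    rw [haF, ← ENNReal.rpow_mul, show (4 : ℝ) * (2 / 4) = 2 by norm_num]
  have hk : ∀ k, ∫⁻ t in Ioo 0 T, eLpNorm (V k t) 4 volume ^ (4 : ℝ) ≤
      (dyad k ^ (-(2 * κ))) ^ (4 : ℝ) * (C * 3 * (U + F) ^ (4 : ℝ)) := by
    intro k
    refine (hmain k T hT0 hT v g' (V k) U a (hprob k θ) (hV.mono fun t ht => ht k)).trans ?_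
    have two0 : (0 : ℝ) ≤ 2 := by norm_num
    have e1 : (dyad k ^ (θ - s + 3 * ν)) ^ (2 : ℝ) * (dyad k ^ (θ - s)) ^ (2 : ℝ) ≤
        (dyad k ^ (-(2 * κ))) ^ (4 : ℝ) := by
      simp only [← ENNReal.rpow_mul, ← dyad_rpow_add]
      refine dyad_rpow_mono k ?_
      rw [hθ, hκ]; linarith
    have e2 : (dyad k ^ (θ - s + 3 * ν)) ^ (2 : ℝ) * (dyad k ^ (θ - (s - ε') + 1)) ^ (2 : ℝ) ≤
        (dyad k ^ (-(2 * κ))) ^ (4 : ℝ) := by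
      simp only [← ENNReal.rpow_mul, ← dyad_rpow_add]
      refine dyad_rpow_mono k ?_
      rw [hθ, hκ]; linarith
    have u1 : U ^ (2 : ℝ) ≤ (U + F) ^ (2 : ℝ) := ENNReal.rpow_le_rpow le_self_add two0
    have u2 : F ^ (2 : ℝ) ≤ (U + F) ^ (2 : ℝ) := ENNReal.rpow_le_rpow le_add_self two0
    have u4 : (U + F) ^ (4 : ℝ) = (U + F) ^ (2 : ℝ) * (U + F) ^ (2 : ℝ) := by
      rw [← ENNReal.rpow_add_of_nonneg _ _ two0 two0]; norm_num
    set D : ℝ≥0∞ := (dyad k ^ (-(2 * κ))) ^ (4 : ℝ)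
    simp only [ENNReal.mul_rpow_of_nonneg _ _ two0]
    calc _ = C * (U ^ (2 : ℝ) * (((dyad k ^ (θ - s + 3 * ν)) ^ (2 : ℝ) * (dyad k ^ (θ - s)) ^ (2 : ℝ)) *
          U ^ (2 : ℝ) + ((dyad k ^ (θ - s + 3 * ν)) ^ (2 : ℝ) * (dyad k ^ (θ - (s - ε') + 1)) ^ (2 : ℝ)) *
          ∫⁻ t in Ioo 0 T, a t ^ (2 : ℝ))) := by ring
      _ ≤ C * ((U + F) ^ (2 : ℝ) * (D * (U + F) ^ (2 : ℝ) + D * (2 * (U + F) ^ (2 : ℝ)))) := by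
          gcongr
          exact ha2.trans (by gcongr)
      _ = D * (C * 3 * (U + F) ^ (4 : ℝ)) := by rw [u4]; ring
  have hsum := lintegral_tsum_rpow_le (q := 4) (κ := κ) (by norm_num) (by positivity)
    (fun k => measurable_eLpNorm (hVm k) (p := 4) (by norm_num) (by norm_num)) hk
  refine (iInf₂_le W hW).trans ?_
  have h4 : (4 : ℝ≥0∞) = ENNReal.ofReal 4 := by simp
  have hmix := mixedNorm_le (q := 4) (by norm_num) hbound
  rw [← h4] at hmix
  exact hmix.trans (hfin _ _ (hsum.trans (le_of_eq (by rw [hG]; ring))))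

theorem linear_estimate_top {s : ℝ} (hs : 0 ≤ s) {ε : ℝ} (hε : 0 < ε) :
    ∃ q₀ : ℝ, 2 < q₀ ∧ ∀ q : ℝ, 2 < q → q < q₀ →
      ∃ C : ℝ≥0, ∀ T : ℝ, 0 < T → T < 2 → ∀ u f : ℝ → Plane → ℂ,
        MemLinftySobolev s T u → IsSolution T u f →
        JxNorm (s - (2 / 3 + ε)) (ENNReal.ofReal q) ⊤ T u ≤
          C * (linftySobolevNorm s T u + JxNorm s (ENNReal.ofReal q) (4 / 3) T f) := by
  set ν : ℝ := min (ε / 6) (1 / 2) with hν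
  have hν0 : 0 < ν := lt_min (by positivity) (by norm_num)
  have hν1 : ν ≤ ε / 6 := min_le_left _ _
  have hν2 : ν ≤ 1 / 2 := min_le_right _ _
  -- The condition q < 2/(1-ν) says that |t|^{-(1-ν)q/2} is integrable at 0, which TT* requires.
  refine ⟨2 / (1 - ν), by rw [lt_div_iff₀ (by linarith)]; linarith, fun q hq2 hq => ?_⟩
  rw [lt_div_iff₀ (by linarith)] at hq
  have hq0 : 0 ≤ q := by linarith
  set θ : ℝ := s - (2 / 3 + ε) with hθ
  -- Both terms of the band estimate carry 2^{k(3ν-ε)}, and 3ν ≤ ε/2 leaves 2^{-kε/2} = 2^{-2kκ}.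
  set κ : ℝ := ε / 4 with hκ
  obtain ⟨C, hC, hmain⟩ := exists_band_estimate_fourThirds θ (θ - s) s hν0 hν2 hq2.le (by linarith)
  set G : ℝ≥0∞ := geoConst κ ^ (q - 1) * geoConst κ with hG
  have hGt : G ≠ ⊤ := ENNReal.mul_ne_top (ENNReal.rpow_ne_top_of_nonneg (by linarith)
    (geoConst_ne_top (by positivity))) (geoConst_ne_top (by positivity))
  obtain ⟨C', hC', hfin⟩ := exists_nnreal_rpow (K := G * C) (ENNReal.mul_ne_top hGt hC) (q := q) (by linarith)
  refine ⟨C', fun T hT0 hT u f hu hsol => le_mul_add_JxNorm hC' fun g hg hgt => ?_⟩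
  set U := linftySobolevNorm s T u with hU
  set F := mixedNorm (ENNReal.ofReal q) (4 / 3) T g with hF
  have hUt : U ≠ ⊤ := hu.2.ne
  obtain ⟨v, hvm, huv⟩ := exists_regular hu.1
  obtain ⟨g', a, ham, haF, hprob⟩ := exists_forcedProblem hs hT0 hu hsol four_thirds_ne_zero
    four_thirds_ne_top pairExponent_four_thirds (q := ENNReal.ofReal q)
    (by rw [← ENNReal.ofReal_one]; exact ENNReal.ofReal_le_ofReal (by linarith)) ENNReal.ofReal_ne_top hg hgt
    hvm huv
  rw [ENNReal.toReal_ofReal hq0] at haF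
  have hθs : θ < s := by rw [hθ]; linarith
  obtain ⟨W, hW, hWM⟩ := exists_isJx_top hθs.le hUt hvm huv (hprob 0 0).bound_u
  have hk : ∀ k, ∫⁻ t in Ioo 0 T, bandSup k θ (v t) ^ q ≤
      (dyad k ^ (-(2 * κ))) ^ q * (C * (U + F) ^ q) := by
    intro k
    refine (hmain k T hT0 hT v g' U a (hprob k θ)).trans ?_
    rw [haF, show θ - s + 2 / 3 = -ε by rw [hθ]; ring]
    have e : (dyad k ^ (3 * ν)) ^ q * (dyad k ^ (-ε)) ^ q ≤ (dyad k ^ (-(2 * κ))) ^ q := by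
      rw [← ENNReal.mul_rpow_of_nonneg _ _ hq0, ← dyad_rpow_add]
      exact ENNReal.rpow_le_rpow (dyad_rpow_mono k (by rw [hκ]; linarith)) hq0
    rw [ENNReal.mul_rpow_of_nonneg _ U hq0]
    calc _ = ((dyad k ^ (3 * ν)) ^ q * (dyad k ^ (-ε)) ^ q) * (C * (U ^ q + F ^ q)) := by ring
      _ ≤ _ := by
          gcongr
          exact ENNReal.add_rpow_le_rpow_add _ _ (by linarith)
  have hsum := lintegral_tsum_rpow_le (q := q) (κ := κ) (by linarith) (by positivity)
    (fun k => measurable_bandSup hvm k θ) hk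
  refine (iInf₂_le W hW).trans ((mixedNorm_le (by linarith) (hWM.mono fun t ht => ht.2)).trans ?_)
  exact hfin _ _ (hsum.trans (le_of_eq (by rw [hG]; ring)))

/-! ### The quadratic nonlinearity -/

theorem fourier_comp_add (χ : Plane → ℂ) (η z : Plane) :
    𝓕 (fun ζ => χ (ζ + η)) z = Complex.exp (((2 * Real.pi * inner ℝ z η : ℝ) : ℂ) * Complex.I) * 𝓕 χ z := by
  simp only [Real.fourier_eq', smul_eq_mul]
  rw [← integral_const_mul, ← integral_add_right_eq_self _ η]
  have h := integral_add_right_eq_self (μ := (volume : Measure Plane)) (fun ζ : Plane =>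
    Complex.exp (((2 * Real.pi * inner ℝ z η : ℝ) : ℂ) * Complex.I) *
      (Complex.exp (((-2 * Real.pi * inner ℝ ζ z : ℝ) : ℂ) * Complex.I) * χ ζ)) η
  rw [integral_add_right_eq_self (μ := (volume : Measure Plane)) (fun ζ : Plane =>
    Complex.exp (((-2 * Real.pi * inner ℝ ζ z : ℝ) : ℂ) * Complex.I) * χ (ζ + η)) η, ← h]
  refine integral_congr_ae (ae_of_all _ fun ζ => ?_)
  simp only
  rw [← mul_assoc, ← Complex.exp_add, inner_add_left, real_inner_comm η z]
  congr 2
  push_cast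
  ring

theorem Mem12.comp_add {χ : Plane → ℂ} (h : Mem12 χ) (η : Plane) : Mem12 (fun ζ => χ (ζ + η)) :=
  ⟨h.int.comp_add_right η, h.l2.comp_measurePreserving (measurePreserving_add_right volume η)⟩

/-- Plancherel for v and the conjugate of φ. -/
theorem integral_mul_eq_fourierL2 {v φ : Plane → ℂ} (hv : MemLp v 2 volume) (hφ : Mem12 φ) :
    ∫ z, v z * φ z = ∫ η, fourierL2 hv η *
      ∫ z, Complex.exp (((2 * Real.pi * inner ℝ z η : ℝ) : ℂ) * Complex.I) * φ z := by
  set ψ : Plane → ℂ := fun z => (starRingEnd ℂ) (φ z) with hψ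
  have hψ2 : MemLp ψ 2 volume := hφ.l2.star
  have hψ1 : Integrable ψ := memLp_one_iff_integrable.1 (memLp_one_iff_integrable.2 hφ.int).star
  have e1 : ∫ z, v z * φ z = inner ℂ (hψ2.toLp ψ) (hv.toLp v) := by
    rw [L2.inner_def]
    refine integral_congr_ae ?_
    filter_upwards [hψ2.coeFn_toLp, hv.coeFn_toLp] with z h1 h2
    rw [h1, h2, RCLike.inner_apply, hψ, starRingEnd_self_apply]
  rw [e1, ← Lp.inner_fourier_eq, L2.inner_def]
  refine integral_congr_ae ?_
  filter_upwards [fourier_toLp_ae hψ1 hψ2] with η h1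
  rw [h1, RCLike.inner_apply, fourierL2, Real.fourier_eq', ← integral_conj]
  congr 1
  refine integral_congr_ae (ae_of_all _ fun z => ?_)
  simp only [smul_eq_mul, map_mul, hψ, starRingEnd_self_apply, ← Complex.exp_conj, Complex.conj_ofReal,
    Complex.conj_I]
  congr 2
  push_cast
  ring

/-- The convolution theorem in weak form: each frequency η of v translates the test function seen by
w. This makes the Fourier support of a product visible without defining the transform of the
product. -/
theorem integral_mul_mul_fourier {v w χ : Plane → ℂ} (hv : MemLp v 2 volume) (hw : MemLp w 2 volume)
    (hχ : Mem12 χ) : ∫ z, v z * (w z * 𝓕 χ z) =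
      ∫ η, fourierL2 hv η * pair w (fun ζ => χ (ζ + η)) := by
  have hφ : Mem12 (fun z => w z * 𝓕 χ z) := by
    refine ⟨(pairable_of_memLp hw).int χ hχ, ?_⟩
    refine hw.of_le_mul (c := ∫ ζ, ‖χ ζ‖)
      (hw.1.mul (continuous_fourier hχ.int).aestronglyMeasurable) (ae_of_all _ fun z => ?_)
    rw [norm_mul, mul_comm]
    exact mul_le_mul_of_nonneg_right (norm_fourier_le χ z) (norm_nonneg _)
  rw [integral_mul_eq_fourierL2 hv hφ]
  refine integral_congr_ae (ae_of_all _ fun η => ?_)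
  simp only [pair, fourier_comp_add]
  congr 1
  refine integral_congr_ae (ae_of_all _ fun z => ?_)
  simp only
  ring

/-- Products of low frequencies do not reach a higher band. -/
theorem integral_low_mul_low {N : ℕ} {m : ℝ → ℂ} {u w χ : Plane → ℂ}
    (h : IsMultiplier ((lowSet N).indicator m) u w) (hχ : Mem12 χ)
    (hs : ∀ ζ : Plane, ζ 0 ∉ band (N + 2) → χ ζ = 0) : ∫ z, w z * (w z * 𝓕 χ z) = 0 := by
  obtain ⟨hu, hw, he⟩ := h
  rw [integral_mul_mul_fourier hw hw hχ]
  refine integral_eq_zero_of_ae ?_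
  filter_upwards [he] with η hη
  by_cases hη0 : η 0 ∈ lowSet N
  · rw [pair_eq_fourierL2 hw (hχ.comp_add η), integral_eq_zero_of_ae, mul_zero, Pi.zero_apply]
    filter_upwards [he] with ζ hζ
    by_cases hζ0 : ζ 0 ∈ lowSet N
    · rw [hs (ζ + η), mul_zero, Pi.zero_apply]
      intro hb
      have h1 : (2 : ℝ) ^ (N + 1) ≤ |ζ 0 + η 0| := hb.1
      have h2 := abs_add_le (ζ 0) (η 0)
      have h3 : |ζ 0| < 2 ^ N := hζ0
      have h4 : |η 0| < 2 ^ N := hη0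
      rw [pow_succ] at h1
      linarith
    · rw [hζ, indicator_of_notMem hζ0, zero_mul, zero_mul, Pi.zero_apply]
  · rw [hη, indicator_of_notMem hη0, zero_mul, zero_mul, Pi.zero_apply]

theorem represents_integrable {w : Plane → ℂ} (hw : Integrable w) :
    ∃ S : 𝓢'(Plane, ℂ), Represents S w ∧ Represents (Jx 0 S) w := by
  have hw1 : MemLp w 1 volume := memLp_one_iff_integrable.2 hw
  have hS : Represents (Lp.toTemperedDistribution (hw1.toLp w)) w := by
    refine fun φ => ⟨?_, ?_⟩
    · obtain ⟨C, _, hC⟩ := φ.decay 0 0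
      refine hw.mul_bdd (c := C) φ.continuous.aestronglyMeasurable (ae_of_all _ fun z => ?_)
      simpa using hC z
    · rw [Lp.toTemperedDistribution_apply]
      refine integral_congr_ae ?_
      filter_upwards [hw1.coeFn_toLp] with z hz
      rw [hz, smul_eq_mul, mul_comm]
  refine ⟨_, hS, ?_⟩
  have e : ∀ S : 𝓢'(Plane, ℂ), Jx 0 S = S := by
    intro S
    ext φ
    obtain ⟨χ, rfl⟩ : ∃ χ : 𝓢(Plane, ℂ), φ = 𝓕 χ := ⟨𝓕⁻ φ, by rw [fourier_fourierInv_eq]⟩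
    rw [Jx_apply_fourier]
    congr 2
    ext ζ
    rw [besselMul_apply, besselSymbol_eq, bes_zero]
    simp
  rwa [e]

theorem eLpNorm_mul_one_le {f g : Plane → ℂ} (hf : AEStronglyMeasurable f volume)
    (hg : AEStronglyMeasurable g volume) :
    eLpNorm (fun z => f z * g z) 1 volume ≤ eLpNorm f 2 volume * eLpNorm g 2 volume := by
  have e : (fun z => f z * g z) = f • g := rfl
  rw [e]
  exact eLpNorm_smul_le_mul_eLpNorm (p := 2) (q := 2) (r := 1) hg hf

theorem eLpNorm_mul_four_thirds_le {f g : Plane → ℂ} (hf : AEStronglyMeasurable f volume)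
    (hg : AEStronglyMeasurable g volume) :
    eLpNorm (fun z => f z * g z) (4 / 3) volume ≤ eLpNorm f 2 volume * eLpNorm g 4 volume := by
  have : ENNReal.HolderTriple 2 4 (4 / 3) := ⟨by
    rw [← ENNReal.toReal_eq_toReal_iff' (by simp) (by simp), ENNReal.toReal_add (by simp) (by simp)]
    simp only [ENNReal.toReal_inv, toReal_four_thirds]
    norm_num⟩
  have e : (fun z => f z * g z) = f • g := rfl
  rw [e]
  exact eLpNorm_smul_le_mul_eLpNorm (p := 2) (q := 4) (r := 4 / 3) hg hf

/-! ### High-low decomposition of the quadratic term. -/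

/-- The interaction of the band `k` with the part of the square of `v = ∑ Vᵢ` which reaches it. -/
noncomputable def lowPart (V : ℕ → ℝ → Plane → ℂ) (k : ℕ) (t : ℝ) (z : Plane) : ℂ :=
  ∑ i ∈ Finset.range (k - 1), V i t z

/-- The part of `v² / 2` which reaches the band `k`. -/
noncomputable def highForce (v : ℝ → Plane → ℂ) (V : ℕ → ℝ → Plane → ℂ) (k : ℕ) (t : ℝ) (z : Plane) : ℂ :=
  (v t z - lowPart V k t z) * ((v t z + lowPart V k t z) / 2)

theorem stronglyMeasurable_lowPart {V : ℕ → ℝ → Plane → ℂ}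
    (hV : ∀ k, StronglyMeasurable (Function.uncurry (V k))) (k : ℕ) :
    StronglyMeasurable (Function.uncurry (lowPart V k)) := by
  have h := Finset.stronglyMeasurable_fun_sum (Finset.range (k - 1)) fun i _ => hV i
  exact h

theorem bes_zero_fun : (fun p => (bes 0 p : ℂ)) = fun _ => 1 := by
  funext p; rw [bes_zero, Complex.ofReal_one]

theorem dyad_add (j k : ℕ) : dyad (j + k) = dyad j * dyad k := pow_add _ _ _

section

variable {s : ℝ} {U : ℝ≥0∞} {t : ℝ} {v : ℝ → Plane → ℂ} {V : ℕ → ℝ → Plane → ℂ}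

/-- For k = N + 2 the low part consists of the bands 0, …, N, so what is left has |p| ≥ 2^{k-2} and
gains (2^{k-2})^{-s}; this is the origin of `dyad 2 ^ s`. For k ≤ 1 the truncated subtraction makes
the low part empty and the same constant absorbs the absence of a gain. -/
theorem eLpNorm_sub_lowPart_le (hs : 0 ≤ s) (hv : SobolevLE s (v t) U)
    (hV : ∀ k, IsMultiplier ((band k).indicator (fun p => (bes 0 p : ℂ))) (v t) (V k t)) (k : ℕ) :
    eLpNorm (fun z => v t z - lowPart V k t z) 2 volume ≤ dyad 2 ^ s * dyad k ^ (-s) * U := by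
  have hsmall : k ≤ 2 → 1 ≤ dyad 2 ^ s * dyad k ^ (-s) := fun hk => by
    rw [show dyad 2 = dyad (2 - k) * dyad k by rw [← dyad_add, Nat.sub_add_cancel hk],
      ENNReal.mul_rpow_of_nonneg _ _ hs, mul_assoc, ← dyad_rpow_add, add_neg_cancel, ENNReal.rpow_zero, mul_one]
    simpa using dyad_rpow_mono (2 - k) hs
  match k with
  | 0 => simpa [lowPart] using (hv.eLpNorm_le hs).trans (le_mul_of_one_le_left' (hsmall (by norm_num)))
  | 1 => simpa [lowPart] using (hv.eLpNorm_le hs).trans (le_mul_of_one_le_left' (hsmall (by norm_num)))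
  | N + 2 =>
    have h1 : IsMultiplier (fun p => (bes 0 p : ℂ)) (v t) (v t) := by
      rw [bes_zero_fun]; exact isMultiplier_one hv.memLp
    have h2 := (h1.sub (isMultiplier_low hV N)).eLpNorm_two_le hv (norm_compl_low_bes_le hs N)
    refine h2.trans (le_of_eq ?_)
    rw [ofReal_two_pow_rpow, zero_sub, add_comm N 2, dyad_add,
      ENNReal.mul_rpow_of_ne_top (dyad_ne_top _) (dyad_ne_top _), ← mul_assoc, ← dyad_rpow_add,
      add_neg_cancel, ENNReal.rpow_zero, one_mul]

theorem memLp_lowPart (hV : ∀ k, IsMultiplier ((band k).indicator (fun p => (bes 0 p : ℂ))) (v t) (V k t))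
    (k : ℕ) : MemLp (lowPart V k t) 2 volume :=
  memLp_finsetSum _ fun i _ => (hV i).2.choose

/-- Since v² - L² = (v - L)(v + L), the two forcings differ by L²/2. Two frequencies below 2^{k-2}
add up to less than 2^{k-1}, the lower edge of the band k, so this difference is invisible to χ. -/
theorem pair_sq_eq (hv : MemLp (v t) 2 volume)
    (hV : ∀ k, IsMultiplier ((band k).indicator (fun p => (bes 0 p : ℂ))) (v t) (V k t)) (k : ℕ)
    {χ : Plane → ℂ} (hχ : Mem12 χ) (hs : ∀ ζ : Plane, ζ 0 ∉ band k → χ ζ = 0) :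
    pair (fun z => v t z ^ 2 / 2) χ = pair (highForce v V k t) χ := by
  have hl := memLp_lowPart hV k
  have hlow : ∫ z, lowPart V k t z * (lowPart V k t z * 𝓕 χ z) = 0 := by
    match k with
    | 0 => simp [lowPart]
    | 1 => simp [lowPart]
    | N + 2 => exact integral_low_mul_low (isMultiplier_low hV N) hχ hs
  have hi : ∀ {f g : Plane → ℂ}, MemLp f 2 volume → MemLp g 2 volume →
      Integrable (fun z => f z * g z * 𝓕 χ z) := fun hf hg =>
    (pairable_of_integrable (hf.integrable_mul hg)).int χ hχ
  have e : ∀ z, v t z ^ 2 / 2 * 𝓕 χ z = highForce v V k t z * 𝓕 χ z +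
      (1 / 2 : ℂ) * (lowPart V k t z * (lowPart V k t z * 𝓕 χ z)) := fun z => by
    rw [highForce]; ring
  have i1 : Integrable (fun z => highForce v V k t z * 𝓕 χ z) := by
    have h2 : MemLp (fun z => (v t z + lowPart V k t z) / 2) 2 volume := by
      have h : MemLp (fun z => (v t z + lowPart V k t z) * (2 : ℂ)⁻¹) 2 volume := (hv.add hl).mul_const _
      simpa only [div_eq_mul_inv] using h
    exact hi (hv.sub hl) h2
  have i2 : Integrable (fun z => (1 / 2 : ℂ) * (lowPart V k t z * (lowPart V k t z * 𝓕 χ z))) := by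
    refine Integrable.const_mul ?_ _
    simpa only [mul_assoc] using hi hl hl
  rw [pair, pair]
  simp only [e]
  rw [integral_add i1 i2, integral_const_mul, hlow, mul_zero, add_zero]

theorem eLpNorm_half (f : Plane → ℂ) (p : ℝ≥0∞) :
    eLpNorm (fun z => f z / 2) p volume ≤ eLpNorm f p volume := by
  refine eLpNorm_mono fun z => ?_
  rw [norm_div, Complex.norm_ofNat]
  linarith [norm_nonneg (f z)]

/-- Cauchy-Schwarz: v - L carries the whole decay 2^{-ks}, and v + L = 2v - (v - L) is bounded in L²
by a multiple of U. -/
theorem eLpNorm_highForce_one_le (hs : 0 ≤ s) (hv : SobolevLE s (v t) U)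
    (hV : ∀ k, IsMultiplier ((band k).indicator (fun p => (bes 0 p : ℂ))) (v t) (V k t)) (k : ℕ) :
    eLpNorm (highForce v V k t) 1 volume ≤ dyad 2 ^ s * (2 + dyad 2 ^ s) * dyad k ^ (-s) * U ^ 2 := by
  have hl := memLp_lowPart hV k
  have h1 := eLpNorm_sub_lowPart_le hs hv hV k
  set c : ℝ≥0∞ := dyad 2 ^ s
  have h2 : eLpNorm (fun z => v t z + lowPart V k t z) 2 volume ≤ (2 + c) * U := by
    have e : (fun z => v t z + lowPart V k t z) = fun z => (v t z + v t z) - (v t z - lowPart V k t z) := by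
      funext z; ring
    rw [e]
    refine (eLpNorm_sub_le (hv.memLp.1.add hv.memLp.1) (hv.memLp.1.sub hl.1) (by norm_num)).trans ?_
    rw [add_mul, two_mul]
    refine add_le_add ((eLpNorm_add_le hv.memLp.1 hv.memLp.1 (by norm_num)).trans
      (add_le_add (hv.eLpNorm_le hs) (hv.eLpNorm_le hs))) (h1.trans ?_)
    refine mul_le_mul_left (mul_le_of_le_one_right' (dyad_rpow_le_one k (by linarith))) _
  refine (eLpNorm_mul_one_le (hv.memLp.1.sub hl.1) ?_).trans ?_
  · have h : AEStronglyMeasurable (fun z => (v t z + lowPart V k t z) * (2 : ℂ)⁻¹) volume :=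
      (hv.memLp.1.add hl.1).mul_const _
    simpa only [div_eq_mul_inv] using h
  · calc _ ≤ c * dyad k ^ (-s) * U * ((2 + c) * U) :=
          mul_le_mul' h1 ((eLpNorm_half _ 2).trans h2)
      _ = _ := by ring

/-- Hölder with exponents 2 and 4: the decay 2^{-ks} comes from v - L in L², while v and L are both
bounded in L⁴ by the sum of the L⁴ norms of the pieces. The bound is linear in U, which yields the
single factor U in the final estimate. -/
theorem eLpNorm_highForce_four_thirds_le (hs : 0 < s) (hU : U ≠ ⊤) (hv : SobolevLE s (v t) U)
    (hV : ∀ k, IsMultiplier ((band k).indicator (fun p => (bes 0 p : ℂ))) (v t) (V k t)) (k : ℕ) :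
    eLpNorm (highForce v V k t) (4 / 3) volume ≤
      2 * dyad 2 ^ s * dyad k ^ (-s) * U * ∑' i, eLpNorm (V i t) 4 volume := by
  have hl := memLp_lowPart hV k
  have h1 := eLpNorm_sub_lowPart_le hs.le hv hV k
  have hv1 : IsMultiplier (fun p => (bes 0 p : ℂ)) (v t) (v t) := by
    rw [bes_zero_fun]; exact isMultiplier_one hv.memLp
  have h2 := eLpNorm_le_tsum_band hs hv hU hv1 hV (p := 4) Nat.one_le_ofNat
  have h3 : eLpNorm (lowPart V k t) 4 volume ≤ ∑' i, eLpNorm (V i t) 4 volume := by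
    have e : lowPart V k t = ∑ i ∈ Finset.range (k - 1), V i t := by funext z; simp [lowPart]
    rw [e]
    exact (eLpNorm_sum_le (fun i _ => (hV i).2.choose.1) Nat.one_le_ofNat).trans (ENNReal.sum_le_tsum _)
  refine (eLpNorm_mul_four_thirds_le (hv.memLp.1.sub hl.1) ?_).trans ?_
  · have h : AEStronglyMeasurable (fun z => (v t z + lowPart V k t z) * (2 : ℂ)⁻¹) volume :=
      (hv.memLp.1.add hl.1).mul_const _
    simpa only [div_eq_mul_inv] using h
  · calc _ ≤ dyad 2 ^ s * dyad k ^ (-s) * U *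
          ((∑' i, eLpNorm (V i t) 4 volume) + ∑' i, eLpNorm (V i t) 4 volume) :=
          mul_le_mul' h1 ((eLpNorm_half _ 4).trans
            ((eLpNorm_add_le hv.memLp.1 hl.1 Nat.one_le_ofNat).trans (add_le_add h2 h3)))
      _ = _ := by ring

end

/-! ### The nonlinear estimate -/

theorem stronglyMeasurable_highForce {v : ℝ → Plane → ℂ} {V : ℕ → ℝ → Plane → ℂ}
    (hv : StronglyMeasurable (Function.uncurry v))
    (hV : ∀ k, StronglyMeasurable (Function.uncurry (V k))) (k : ℕ) :
    StronglyMeasurable (Function.uncurry (highForce v V k)) := by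
  have hl := stronglyMeasurable_lowPart hV k
  have e : Function.uncurry (highForce v V k) = fun p =>
      (Function.uncurry v p - Function.uncurry (lowPart V k) p) *
        ((Function.uncurry v p + Function.uncurry (lowPart V k) p) * (2 : ℂ)⁻¹) := by
    funext p
    simp only [Function.uncurry, highForce, div_eq_mul_inv]
  rw [e]
  exact (hv.sub hl).mul ((hv.add hl).mul_const _)

/-- Tested with transforms of smooth compactly supported functions, the distributional definition of
J_x^s determines the transform of g. -/
theorem fourierL2_ae_eq_of_represents {s : ℝ} {u g : Plane → ℂ} (hu : MemLp u 2 volume)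
    (hg : MemLp g 2 volume) {S : 𝓢'(Plane, ℂ)} (h₁ : Represents S u) (h₂ : Represents (Jx s S) g) :
    fourierL2 hg =ᵐ[volume] fun ζ => (besselSymbol s ζ : ℂ) * fourierL2 hu ζ := by
  have hbc : Continuous (fun ζ : Plane => (besselSymbol s ζ : ℂ)) :=
    (continuous_ofReal_bes s).comp (continuous_coord 0)
  refine ae_eq_of_integral_contDiff_smul_eq ((memLp_fourierL2 hg).locallyIntegrable (by norm_num))
    (((memLp_fourierL2 hu).locallyIntegrable (by norm_num)).continuous_mul hbc) fun φ hφ hφc => ?_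
  set χ : 𝓢(Plane, ℂ) := HasCompactSupport.toSchwartzMap (f := fun z => (φ z : ℂ))
    (hφc.comp_left (g := fun r : ℝ => (r : ℂ)) rfl) (Complex.ofRealCLM.contDiff.comp hφ) with hχ
  have e0 : ∀ z, χ z = (φ z : ℂ) := fun z => rfl
  have key : pair g χ = pair u (besselMul s χ) := by
    rw [← h₂.fourier_eq_pair, Jx_apply_fourier, h₁.fourier_eq_pair]
  rw [pair_eq_fourierL2 hg (mem12_schwartz _), pair_eq_fourierL2 hu (mem12_schwartz _)] at key
  calc ∫ ζ, φ ζ • fourierL2 hg ζ = ∫ ζ, fourierL2 hg ζ * χ ζ :=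
        integral_congr_ae (ae_of_all _ fun ζ => by simp only [e0, Complex.real_smul, mul_comm])
    _ = _ := key
    _ = _ := integral_congr_ae (ae_of_all _ fun ζ => by
        simp only [besselMul_apply, e0, Complex.real_smul]; ring)

/-- The final estimate is stated with J_x^s u in L^∞L², the proof works with the Sobolev norm; by
Plancherel they agree at each time where J_x^s u is square integrable. -/
theorem linftySobolevNorm_le_JxNorm {s T : ℝ} {u : ℝ → Plane → ℂ} (hu : MemLinftySobolev s T u) :
    linftySobolevNorm s T u ≤ JxNorm s ⊤ 2 T u := by
  refine le_iInf₂ fun g hg => ?_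
  obtain ⟨g', hg'm, hgg'⟩ := exists_regular hg.1
  refine eLpNorm_mono_enorm_ae ?_
  filter_upwards [hu.ae_sobolevLE, hg.2, hgg'] with t h1 ⟨S, h2, h3⟩ h4
  simp only [enorm_eq_self]
  by_cases ht : eLpNorm (g t) 2 volume = ⊤
  · rw [ht]; exact le_top
  · have hgt : MemLp (g t) 2 volume :=
      ⟨((hg'm.comp_measurable measurable_prodMk_left).aestronglyMeasurable).congr h4.symm, lt_top_iff_ne_top.2 ht⟩
    have he := fourierL2_ae_eq_of_represents h1.memLp hgt h2 h3
    rw [sobolevNorm, iInf_pos h1.memLp, ← eLpNorm_fourierL2 hgt, eLpNorm_congr_ae he]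
    exact le_rfl

/-- Duhamel's formula is first obtained with the full forcing v²/2, which lies in L¹ uniformly in
time, so that no derivative has to be put on it. The forcing enters only through pairings with
functions supported on the band k, where it may be replaced by its high part. -/
theorem bandDuhamel_highForce {s T : ℝ} (hs : 0 ≤ s) (hT : 0 < T) {u v : ℝ → Plane → ℂ}
    (hu : MemLinftySobolev s T u) (hsol : IsKPISolution T u) (hv : StronglyMeasurable (Function.uncurry v))
    (huv : ∀ᵐ t ∂volume.restrict (Ioo 0 T), u t =ᵐ[volume] v t) {V : ℕ → ℝ → Plane → ℂ}
    (hV : ∀ᵐ t ∂volume.restrict (Ioo 0 T), ∀ k,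
        IsMultiplier ((band k).indicator (fun p => (bes 0 p : ℂ))) (v t) (V k t))
    (k : ℕ) (θ : ℝ) (Ψ : 𝓢(Plane, ℂ)) : BandDuhamel T v (highForce v V k) k θ θ Ψ := by
  have hU := hu.ae_sobolevLE
  have hvU : ∀ᵐ t ∂volume.restrict (Ioo 0 T), SobolevLE s (v t) (linftySobolevNorm s T u) := by
    filter_upwards [hU, huv] with t h1 h2 using h1.congr h2
  set U := linftySobolevNorm s T u with hUd
  have hUt : U ≠ ⊤ := hu.2.ne
  set w : ℝ → Plane → ℂ := fun t z => v t z ^ 2 / 2 with hw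
  have hwm : StronglyMeasurable (Function.uncurry w) := by
    have h : StronglyMeasurable (fun p : ℝ × Plane => Function.uncurry v p ^ 2 * (2 : ℂ)⁻¹) :=
      (hv.pow 2).mul_const _
    have e : Function.uncurry w = fun p => Function.uncurry v p ^ 2 * (2 : ℂ)⁻¹ := by
      funext p
      simp only [hw, Function.uncurry, div_eq_mul_inv]
    rw [e]
    exact h
  have hwi : ∀ᵐ t ∂volume.restrict (Ioo 0 T), Integrable (w t) ∧ ∫ z, ‖w t z‖ ≤ (U * U).toReal := by
    filter_upwards [hvU] with t ht
    have hm : AEStronglyMeasurable (w t) volume :=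
      (hwm.comp_measurable (measurable_prodMk_left (x := t))).aestronglyMeasurable
    have h1 : eLpNorm (w t) 1 volume ≤ U * U := by
      have e : w t = fun z => (v t z * v t z) / 2 := by funext z; simp only [hw, sq]
      rw [e]
      exact (eLpNorm_half _ 1).trans ((eLpNorm_mul_one_le ht.memLp.1 ht.memLp.1).trans
        (mul_le_mul' (ht.eLpNorm_le hs) (ht.eLpNorm_le hs)))
    have hUU : U * U ≠ ⊤ := ENNReal.mul_ne_top hUt hUt
    refine ⟨memLp_one_iff_integrable.1 ⟨hm, h1.trans_lt hUU.lt_top⟩, ?_⟩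
    rw [integral_norm_eq_lintegral_enorm hm, ← eLpNorm_one_eq_lintegral_enorm]
    exact ENNReal.toReal_mono hUU h1
  have hwp : TimePairable T w (fun _ => (U * U).toReal) :=
    ⟨hwm.aestronglyMeasurable, integrableOn_const (by simp),
      hwi.mono fun t ht => (pairable_of_integrable ht.1).mono ht.2⟩
  have hfg : ∀ᵐ t ∂volume.restrict (Ioo 0 T), ∃ S : 𝓢'(Plane, ℂ),
      Represents S (fun z => u t z ^ 2 / 2) ∧ Represents (Jx 0 S) (w t) := by
    filter_upwards [hwi, huv] with t h1 h2
    obtain ⟨S, hS1, hS2⟩ := represents_integrable h1.1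
    refine ⟨S, hS1.congr ?_, hS2⟩
    filter_upwards [h2] with z hz
    simp only [hw, hz]
  have hD := IsSolution.bandDuhamel hT hsol (timePairable_of_sobolevLE hs hu.1 hUt hU) hwp hwm hfg k θ Ψ
  rw [sub_zero] at hD
  refine hD.congr huv ?_
  filter_upwards [hV, hvU] with τ h1 h2 t
  refine pair_sq_eq h2.memLp h1 k (mem12_bandTest (continuous_forceSymbol θ) k t Ψ) fun ζ hζ => ?_
  rw [bandTest, indicator_of_notMem hζ, zero_mul, zero_mul]

/-- The `L⁴` bound for solutions of the nonlinear equation. -/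
theorem exists_nonlinear_four {s : ℝ} (hs : 2 / 3 < s) : ∃ K : ℝ≥0∞, K ≠ ⊤ ∧ ∀ T : ℝ, 0 < T → T < 2 →
    ∀ u v : ℝ → Plane → ℂ, MemLinftySobolev s T u → IsKPISolution T u →
    StronglyMeasurable (Function.uncurry v) → (∀ᵐ t ∂volume.restrict (Ioo 0 T), u t =ᵐ[volume] v t) →
    ∀ V : ℕ → ℝ → Plane → ℂ, (∀ k, StronglyMeasurable (Function.uncurry (V k))) →
    (∀ᵐ t ∂volume.restrict (Ioo 0 T), ∀ k,
        IsMultiplier ((band k).indicator (fun p => (bes 0 p : ℂ))) (v t) (V k t)) →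
    ∫⁻ t in Ioo 0 T, (∑' k, eLpNorm (V k t) 4 volume) ^ (4 : ℝ) ≤
      K * (1 + linftySobolevNorm s T u ^ 2) ^ (4 : ℝ) := by
  have hs0 : 0 ≤ s := by linarith
  set ν : ℝ := 1 / 18 with hν
  -- The forced term has dyadic exponent 2(-s + 3ν) + 2 - 2s = 7/3 - 4s, which for s > 2/3 is below
  -- -1/3 = -8κ; ν = 1/18 and κ = 1/24 fit together exactly at s = 2/3.
  set κ : ℝ := 1 / 24 with hκ
  obtain ⟨C, hC, hmain⟩ := exists_four_estimate 0 0 s (ν := ν) (by norm_num) (by norm_num)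
  set c : ℝ≥0∞ := dyad 2 ^ s * (2 + dyad 2 ^ s) with hc
  have hct : c ≠ ⊤ := ENNReal.mul_ne_top (dyad_rpow_ne_top _ _)
    (ENNReal.add_ne_top.2 ⟨by norm_num, dyad_rpow_ne_top _ _⟩)
  have hc2 : c ^ (2 : ℝ) ≠ ⊤ := ENNReal.rpow_ne_top_of_nonneg (by norm_num) hct
  set G : ℝ≥0∞ := geoConst κ ^ ((4 : ℝ) - 1) * geoConst κ with hG
  have hGt : G ≠ ⊤ := ENNReal.mul_ne_top (ENNReal.rpow_ne_top_of_nonneg (by norm_num)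
    (geoConst_ne_top (by norm_num))) (geoConst_ne_top (by norm_num))
  refine ⟨G * (C * (1 + c ^ (2 : ℝ) * 2)), ENNReal.mul_ne_top hGt (ENNReal.mul_ne_top hC
    (ENNReal.add_ne_top.2 ⟨by norm_num, ENNReal.mul_ne_top hc2 (by norm_num)⟩)),
    fun T hT0 hT u v hu hsol hvm huv V hVm hV => ?_⟩
  have hvU : ∀ᵐ t ∂volume.restrict (Ioo 0 T), SobolevLE s (v t) (linftySobolevNorm s T u) := by
    filter_upwards [hu.ae_sobolevLE, huv] with t h1 h2 using h1.congr h2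
  set U := linftySobolevNorm s T u with hUd
  have hUt : U ≠ ⊤ := hu.2.ne
  have hprob : ∀ k, ForcedProblem T k 0 0 s v (highForce v V k) U 1 (fun _ => c * dyad k ^ (-s) * U ^ 2) := by
    intro k
    refine ⟨hvm, stronglyMeasurable_highForce hvm hVm k, measurable_const, hvU, ?_, ae_of_all _ fun t => ?_, fun j =>
      bandDuhamel_highForce hs0 hT0 hu hsol hvm huv hV k 0 _⟩
    · filter_upwards [hV, hvU] with t h1 h2 using eLpNorm_highForce_one_le hs0 h2 h1 k
    · exact ENNReal.mul_ne_top (ENNReal.mul_ne_top hct (dyad_rpow_ne_top _ _)) (ENNReal.pow_ne_top hUt)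
  have two0 : (0 : ℝ) ≤ 2 := by norm_num
  set Y : ℝ≥0∞ := 1 + U ^ 2 with hY
  have hY1 : 1 ≤ Y := le_self_add
  have hUY : U ^ (2 : ℝ) ≤ Y := by rw [ENNReal.rpow_two]; exact le_add_self
  have hY4 : Y ^ (4 : ℝ) = Y * Y * (Y * Y) := by
    rw [show (4 : ℝ) = ((4 : ℕ) : ℝ) by norm_num, ENNReal.rpow_natCast]; ring
  have hk : ∀ k, ∫⁻ t in Ioo 0 T, eLpNorm (V k t) 4 volume ^ (4 : ℝ) ≤
      (dyad k ^ (-(2 * κ))) ^ (4 : ℝ) * (C * (1 + c ^ (2 : ℝ) * 2) * Y ^ (4 : ℝ)) := by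
    intro k
    refine (hmain k T hT0 hT v _ (V k) U _ (hprob k) (hV.mono fun t ht => ht k)).trans ?_
    rw [setLIntegral_const, Real.volume_Ioo, sub_zero]
    have hT2 : ENNReal.ofReal T ≤ 2 := (ENNReal.ofReal_le_ofReal hT.le).trans (by simp)
    have e1 : (dyad k ^ (0 - s + 3 * ν)) ^ (2 : ℝ) * (dyad k ^ (0 - s)) ^ (2 : ℝ) ≤
        (dyad k ^ (-(2 * κ))) ^ (4 : ℝ) := by
      simp only [← ENNReal.rpow_mul, ← dyad_rpow_add]
      refine dyad_rpow_mono k ?_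
      rw [hκ, hν]; linarith
    have e2 : (dyad k ^ (0 - s + 3 * ν)) ^ (2 : ℝ) * ((dyad k ^ ((0 : ℝ) + 1)) ^ (2 : ℝ) *
        (dyad k ^ (-s)) ^ (2 : ℝ)) ≤ (dyad k ^ (-(2 * κ))) ^ (4 : ℝ) := by
      simp only [← ENNReal.rpow_mul, ← dyad_rpow_add]
      refine dyad_rpow_mono k ?_
      rw [hκ, hν]; linarith
    set D : ℝ≥0∞ := (dyad k ^ (-(2 * κ))) ^ (4 : ℝ)
    simp only [ENNReal.mul_rpow_of_nonneg _ _ two0, ← ENNReal.rpow_two U]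
    calc _ = C * (U ^ (2 : ℝ) * (((dyad k ^ (0 - s + 3 * ν)) ^ (2 : ℝ) * (dyad k ^ (0 - s)) ^ (2 : ℝ)) *
          U ^ (2 : ℝ) + ((dyad k ^ (0 - s + 3 * ν)) ^ (2 : ℝ) * ((dyad k ^ ((0 : ℝ) + 1)) ^ (2 : ℝ) *
          (dyad k ^ (-s)) ^ (2 : ℝ))) * (c ^ (2 : ℝ) * (U ^ (2 : ℝ)) ^ (2 : ℝ) * ENNReal.ofReal T))) := by ring
      _ ≤ C * (Y * (D * (Y * Y * Y) + D * (c ^ (2 : ℝ) * (Y * Y * Y) * 2))) := by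
          have l1 : U ^ (2 : ℝ) ≤ Y * Y * Y := hUY.trans
            (le_mul_of_one_le_left' (one_le_mul hY1 hY1))
          have l2 : (U ^ (2 : ℝ)) ^ (2 : ℝ) ≤ Y * Y * Y := by
            refine (ENNReal.rpow_le_rpow hUY two0).trans ?_
            rw [ENNReal.rpow_two, sq]
            exact le_mul_of_one_le_right' hY1
          gcongr
      _ = _ := by rw [hY4]; ring
  have hsum := lintegral_tsum_rpow_le (q := 4) (κ := κ) (by norm_num) (by norm_num)
    (fun k => measurable_eLpNorm (hVm k) (p := 4) (by norm_num) (by norm_num)) hk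
  exact hsum.trans (le_of_eq (by rw [hG]; ring))

/-- The `L^q L^∞` bound for solutions of the nonlinear equation. -/
theorem nonlinear_estimate {s ε ν q : ℝ} (hs : 2 / 3 < s) (hε : 0 ≤ ε) (hν : 0 < ν) (hν' : ν ≤ 1 / 2)
    (hνs : 6 * ν ≤ s - 2 / 3 - ε) (hq2 : 2 < q) (hq4 : q < 4) (hq : (1 - ν) * (q / 2) < 1) :
    ∃ C : ℝ≥0, ∀ T : ℝ, 0 < T → T < 2 → ∀ u : ℝ → Plane → ℂ, MemLinftySobolev s T u → IsKPISolution T u →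
      ∃ v W : ℝ → Plane → ℂ, IsJx ε T u W ∧ (∀ᵐ t ∂volume.restrict (Ioo 0 T), u t =ᵐ[volume] v t ∧
          IsMultiplier (fun p => (bes ε p : ℂ)) (v t) (W t)) ∧
        mixedNorm (ENNReal.ofReal q) ⊤ T W ≤
          C * ((1 + linftySobolevNorm s T u ^ 2) * linftySobolevNorm s T u) := by
  have hs0 : 0 < s := by linarith
  have hq0 : 0 ≤ q := by linarith
  obtain ⟨K, hK, hfour⟩ := exists_nonlinear_four hs
  obtain ⟨C, hC, hmain⟩ := exists_band_estimate_fourThirds ε ε s hν hν' hq2.le hq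
  -- The exponent 3ν + ε - s + 2/3 is at most 3ν - 6ν = -3ν = -2κ by the assumption on ν.
  set κ : ℝ := 3 / 2 * ν with hκ
  set c : ℝ≥0∞ := 2 * dyad 2 ^ s with hc
  have hct : c ≠ ⊤ := ENNReal.mul_ne_top (by norm_num) (dyad_rpow_ne_top _ _)
  set R : ℝ≥0∞ := c ^ q * (2 * K ^ (q / 4)) with hR
  have hRt : R ≠ ⊤ := ENNReal.mul_ne_top (ENNReal.rpow_ne_top_of_nonneg hq0 hct)
    (ENNReal.mul_ne_top (by norm_num) (ENNReal.rpow_ne_top_of_nonneg (by positivity) hK))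
  set G : ℝ≥0∞ := geoConst κ ^ (q - 1) * geoConst κ with hG
  have hGt : G ≠ ⊤ := ENNReal.mul_ne_top (ENNReal.rpow_ne_top_of_nonneg (by linarith)
    (geoConst_ne_top (by positivity))) (geoConst_ne_top (by positivity))
  obtain ⟨C', hC', hfin⟩ := exists_nnreal_rpow (K := G * (C * (1 + R))) (ENNReal.mul_ne_top hGt
    (ENNReal.mul_ne_top hC (ENNReal.add_ne_top.2 ⟨by norm_num, hRt⟩))) (q := q) (by linarith)
  refine ⟨C', fun T hT0 hT u hu hsol => ?_⟩
  obtain ⟨v, hvm, huv⟩ := exists_regular hu.1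
  have hvU : ∀ᵐ t ∂volume.restrict (Ioo 0 T), SobolevLE s (v t) (linftySobolevNorm s T u) := by
    filter_upwards [hu.ae_sobolevLE, huv] with t h1 h2 using h1.congr h2
  have hUt : linftySobolevNorm s T u ≠ ⊤ := hu.2.ne
  obtain ⟨V, hVm, hV⟩ := exists_band_pieces hs0.le hUt hvm hvU
  have hD4 := hfour T hT0 hT u v hu hsol hvm huv V hVm hV
  obtain ⟨W, hW, hWM⟩ := exists_isJx_top (θ := ε) (by linarith) hUt hvm huv hvU
  refine ⟨v, W, hW, ?_, ?_⟩
  · filter_upwards [huv, hWM] with t h1 h2 using ⟨h1, h2.1⟩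
  set U := linftySobolevNorm s T u with hUd
  set Y : ℝ≥0∞ := 1 + U ^ 2 with hY
  have hY1 : 1 ≤ Y := le_self_add
  have hYt : Y ≠ ⊤ := ENNReal.add_ne_top.2 ⟨by norm_num, ENNReal.pow_ne_top hUt⟩
  set D : ℝ → ℝ≥0∞ := fun t => ∑' k, eLpNorm (V k t) 4 volume with hD
  have hDm : Measurable D := Measurable.tsum fun k => measurable_eLpNorm (hVm k) (by norm_num) (by norm_num)
  have hDt : ∀ᵐ t ∂volume.restrict (Ioo 0 T), D t ≠ ⊤ :=
    ae_ne_top_of_lintegral_rpow (q := 4) (by norm_num) hDm (ne_top_of_le_ne_top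
      (ENNReal.mul_ne_top hK (ENNReal.rpow_ne_top_of_nonneg (by norm_num) hYt)) hD4)
  -- Hölder in time from L⁴ to L^q; this is where q < 4 is used.
  have hDq : ∫⁻ t in Ioo 0 T, D t ^ q ≤ 2 * K ^ (q / 4) * Y ^ q := by
    refine (lintegral_rpow_le_rpow hT (by linarith) hq4 hDm).trans ?_
    rw [mul_assoc]
    refine mul_le_mul_right ((ENNReal.rpow_le_rpow hD4 (by positivity)).trans (le_of_eq ?_)) _
    rw [ENNReal.mul_rpow_of_nonneg _ _ (by positivity), ← ENNReal.rpow_mul, mul_div_cancel₀ q (by norm_num)]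
  have hprob : ∀ k, ForcedProblem T k ε ε s v (highForce v V k) U (4 / 3)
      (fun t => c * dyad k ^ (-s) * U * D t) := by
    intro k
    refine ⟨hvm, stronglyMeasurable_highForce hvm hVm k, hDm.const_mul _, hvU, ?_, ?_, fun j =>
      bandDuhamel_highForce hs0.le hT0 hu hsol hvm huv hV k ε _⟩
    · filter_upwards [hV, hvU] with t h1 h2 using eLpNorm_highForce_four_thirds_le hs0 hUt h2 h1 k
    · filter_upwards [hDt] with t ht
      exact ENNReal.mul_ne_top (ENNReal.mul_ne_top (ENNReal.mul_ne_top hct (dyad_rpow_ne_top _ _)) hUt) ht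
  have hk : ∀ k, ∫⁻ t in Ioo 0 T, bandSup k ε (v t) ^ q ≤
      (dyad k ^ (-(2 * κ))) ^ q * (C * (1 + R) * (Y * U) ^ q) := by
    intro k
    refine (hmain k T hT0 hT v _ U _ (hprob k)).trans ?_
    simp only [ENNReal.mul_rpow_of_nonneg _ _ hq0]
    rw [lintegral_const_mul _ (hDm.pow_const q)]
    have e1 : (dyad k ^ (3 * ν)) ^ q * (dyad k ^ (ε - s + 2 / 3)) ^ q ≤ (dyad k ^ (-(2 * κ))) ^ q := by
      rw [← ENNReal.mul_rpow_of_nonneg _ _ hq0, ← dyad_rpow_add]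
      exact ENNReal.rpow_le_rpow (dyad_rpow_mono k (by rw [hκ]; linarith)) hq0
    have e2 : (dyad k ^ (3 * ν)) ^ q * ((dyad k ^ (ε + 2 / 3)) ^ q * (dyad k ^ (-s)) ^ q) ≤
        (dyad k ^ (-(2 * κ))) ^ q := by
      rw [← ENNReal.mul_rpow_of_nonneg _ _ hq0, ← ENNReal.mul_rpow_of_nonneg _ _ hq0, ← dyad_rpow_add,
        ← dyad_rpow_add]
      exact ENNReal.rpow_le_rpow (dyad_rpow_mono k (by rw [hκ]; linarith)) hq0
    have hYq : 1 ≤ Y ^ q := ENNReal.one_le_rpow hY1 (by linarith)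
    set E : ℝ≥0∞ := (dyad k ^ (-(2 * κ))) ^ q
    calc _ = C * ((((dyad k ^ (3 * ν)) ^ q * (dyad k ^ (ε - s + 2 / 3)) ^ q) * U ^ q) +
          ((dyad k ^ (3 * ν)) ^ q * ((dyad k ^ (ε + 2 / 3)) ^ q * (dyad k ^ (-s)) ^ q)) * (c ^ q * U ^ q *
          ∫⁻ t in Ioo 0 T, D t ^ q)) := by ring
      _ ≤ C * (E * (Y ^ q * U ^ q) + E * (c ^ q * U ^ q * (2 * K ^ (q / 4) * Y ^ q))) := by
          gcongr
          exact le_mul_of_one_le_left' hYq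
      _ = _ := by rw [hR]; ring
  have hsum := lintegral_tsum_rpow_le (q := q) (κ := κ) (by linarith) (by positivity)
    (fun k => measurable_bandSup hvm k ε) hk
  refine (mixedNorm_le (by linarith) (hWM.mono fun t ht => ht.2)).trans ?_
  exact hfin _ _ (hsum.trans (le_of_eq (by rw [hG]; ring)))

/-- The estimate is applied twice with the same ν and q: with ε for the bound, and with exponent 0
for membership of u itself. The requirement on ν for exponent 0 is weaker, so one q₀ serves both. -/
theorem memMixed_and_JxNorm_le {s : ℝ} (hs : 2 / 3 < s) {ε : ℝ} (hε : 0 < ε) (hεs : ε < s - 2 / 3) :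
    ∃ q₀ : ℝ, 2 < q₀ ∧ ∀ q : ℝ, 2 < q → q < q₀ →
      ∃ C : ℝ≥0, ∀ T : ℝ, 0 < T → T < 2 → ∀ u : ℝ → Plane → ℂ,
        MemLinftySobolev s T u → IsKPISolution T u →
        MemMixed (ENNReal.ofReal q) ⊤ T u ∧
        JxNorm ε (ENNReal.ofReal q) ⊤ T u ≤ C * ((1 + JxNorm s ⊤ 2 T u ^ 2) * JxNorm s ⊤ 2 T u) := by
  set ν : ℝ := min ((s - 2 / 3 - ε) / 6) (1 / 2) with hν
  have hν0 : 0 < ν := lt_min (by linarith) (by norm_num)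
  have hν1 : ν ≤ (s - 2 / 3 - ε) / 6 := min_le_left _ _
  have hν2 : ν ≤ 1 / 2 := min_le_right _ _
  refine ⟨min (2 / (1 - ν)) 4, lt_min (by rw [lt_div_iff₀ (by linarith)]; linarith) (by norm_num),
    fun q hq2 hq => ?_⟩
  have hq1 := hq.trans_le (min_le_left _ _)
  have hq4 := hq.trans_le (min_le_right _ _)
  rw [lt_div_iff₀ (by linarith)] at hq1
  obtain ⟨C, hC⟩ := nonlinear_estimate hs hε.le hν0 hν2 (by linarith) hq2 hq4 (by linarith)
  obtain ⟨C₀, hC₀⟩ := nonlinear_estimate hs le_rfl hν0 hν2 (by linarith) hq2 hq4 (by linarith)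
  refine ⟨C, fun T hT0 hT u hu hsol => ⟨⟨hu.1, ?_⟩, ?_⟩⟩
  · obtain ⟨v, W, _, hM, hb⟩ := hC₀ T hT0 hT u hu hsol
    have e : mixedNorm (ENNReal.ofReal q) ⊤ T u = mixedNorm (ENNReal.ofReal q) ⊤ T W := by
      refine eLpNorm_congr_ae ?_
      filter_upwards [hM] with t ⟨h1, hm, hWm, he⟩
      rw [eLpNorm_congr_ae h1]
      refine eLpNorm_congr_ae ?_
      -- The symbol of order 0 is 1, so W and v have the same L² transform and coincide almost
      -- everywhere.
      simp only [bes_zero, Complex.ofReal_one, one_mul] at he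
      have h2 : (𝓕 (hWm.toLp (W t)) : Lp ℂ 2 (volume : Measure Plane)) = 𝓕 (hm.toLp (v t)) :=
        Lp.ext he
      have h3 := congrArg (fun x => (𝓕⁻ x : Lp ℂ 2 (volume : Measure Plane))) h2
      simp only [fourierInv_fourier_eq] at h3
      exact ((MemLp.toLp_eq_toLp_iff _ _).1 h3).symm
    rw [e]
    refine hb.trans_lt (ENNReal.mul_lt_top ENNReal.coe_lt_top (ENNReal.mul_lt_top ?_ hu.2))
    exact ENNReal.add_lt_top.2 ⟨ENNReal.one_lt_top, ENNReal.pow_lt_top hu.2⟩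
  · obtain ⟨v, W, hW, _, hb⟩ := hC T hT0 hT u hu hsol
    refine (iInf₂_le W hW).trans (hb.trans ?_)
    have := linftySobolevNorm_le_JxNorm hu
    gcongr

end KP

theorem proposition3p1 (s : ℝ) (hs : 2 / 3 < s) :
    (∀ ε ε' : ℝ, 0 < ε' → ε' < ε →
      ∃ C : ℝ≥0, ∀ T : ℝ, 0 < T → T < 2 → ∀ u f : ℝ → KP.Plane → ℂ,
        KP.MemLinftySobolev s T u → KP.IsSolution T u f →
        KP.JxNorm (s - (1 / 2 + ε)) 4 4 T u ≤
          C * (KP.linftySobolevNorm s T u + KP.JxNorm (s - ε') 4 1 T f)) ∧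
    (∀ ε : ℝ, 0 < ε → ∃ q₀ : ℝ, 2 < q₀ ∧ ∀ q : ℝ, 2 < q → q < q₀ →
      ∃ C : ℝ≥0, ∀ T : ℝ, 0 < T → T < 2 → ∀ u f : ℝ → KP.Plane → ℂ,
        KP.MemLinftySobolev s T u → KP.IsSolution T u f →
        KP.JxNorm (s - (2 / 3 + ε)) (ENNReal.ofReal q) ⊤ T u ≤
          C * (KP.linftySobolevNorm s T u + KP.JxNorm s (ENNReal.ofReal q) (4 / 3) T f)) ∧
    (∀ ε : ℝ, 0 < ε → ε < s - 2 / 3 → ∃ q₀ : ℝ, 2 < q₀ ∧ ∀ q : ℝ, 2 < q → q < q₀ →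
      ∃ C : ℝ≥0, ∀ T : ℝ, 0 < T → T < 2 → ∀ u : ℝ → KP.Plane → ℂ,
        KP.MemLinftySobolev s T u → KP.IsKPISolution T u →
        KP.MemMixed (ENNReal.ofReal q) ⊤ T u ∧
        KP.JxNorm ε (ENNReal.ofReal q) ⊤ T u ≤
          C * ((1 + KP.JxNorm s ⊤ 2 T u ^ 2) * KP.JxNorm s ⊤ 2 T u)) := by
  exact ⟨fun ε ε' h₁ h₂ => KP.linear_estimate_four (by linarith) h₁ h₂,
    fun ε hε => KP.linear_estimate_top (by linarith) hε,
    fun ε h₁ h₂ => KP.memMixed_and_JxNorm_le hs h₁ h₂⟩
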